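/- Let $n\ge 1$, $m\ge 1$, $0<\beta<1$, and let $\Omega_1,\dots,\Omega_m:\mathbb{R}^n\to\mathbb{C}$ be functions such that for every $j$: (i) $\Omega_j(\lambda y)=\Omega_j(y)$ for all $\lambda>0$ and $y\in\mathbb{R}^n$; (ii) there is $L_j>0$ with $|\Omega_j(\xi)-\Omega_j(\eta)|\le L_j\bigl|\frac{\xi}{|\xi|}-\frac{\eta}{|\eta|}\bigr|^{\beta}$ for all $\xi,\eta\neq 0$; (iii) $\int_{S^{n-1}}\Omega_j\,d\sigma=0$, where $\sigma$ is surface measure. For $\vec f=(f_1,\dots,f_m)$, $f_j:\mathbb{R}^n\to\mathbb{C}$, and $t>0$ put $$F_t(\vec f)(x)=\frac1{t^m}\prod_{j=1}^m\int_{|y|\le t}\frac{\Omega_j(y)}{|y|^{n-1}}f_j(x-y)\,dy,\qquad \tilde\mu(\vec f)(x)=\Bigl(\int_0^\infty|F_t(\vec f)(x)|^2\,\frac{dt}{t}\Bigr)^{1/2}\in[0,\infty]$$ (an integral over $|y|\le t$ that does not converge absolutely is read as $0$; for the $f_j$ below this happens, for some $t$, only for $x$ in a null set). For a locally integrable $g$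 write $g_B=\frac1{|B|}\int_B g$ and let $\|g\|_{\mathcal E^{\alpha,p}}=\sup_B|B|^{-\alpha/n}\bigl(\frac1{|B|}\int_B|g-g_B|^p\bigr)^{1/p}$ and $\|g\|_{BMO}=\sup_B\frac1{|B|}\int_B|g-g_B|$, the suprema being over all balls $B\subset\mathbb{R}^n$; $\mathcal E^{\alpha,p}$ and $BMO$ consist of the locally integrable functions for which these are finite. Let $\|g\|_{Lip_\alpha}=\sup_{x\ne y}|g(x)-g(y)|/|x-y|^\alpha$, and let $Lip_\alpha$ consist of the functions for which this is finite. Then the following hold. Each constant $C>0$ is independent of $\vec f$. 1. (Lebesgue spaces) If $1<q_1,\dots,q_m<\infty$ and $\frac1q=\sum_j\frac1{q_j}$, there is $C>0$ with $\|\tilde\mu(\vec f)\|_{L^q}\le C\prod_{j}\|f_j\|_{L^{q_j}}$ for all $f_j\in L^{q_j}(\mathbb{R}^n)$. 2. (BMO) There is $C>0$ such that, whenever $f_1,\dots,f_m\in BMO(\mathbb{R}^n)$ and $\tilde\mu(\vec f)(x_0)<\infty$ for some point $x_0$, then $\tilde\mu(\vec f)<\infty$ almost everywhere, $\tilde\mu(\vec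 f)\in BMO(\mathbb{R}^n)$ and $\|\tilde\mu(\vec f)\|_{BMO}\le C\prod_j\|f_j\|_{BMO}$. 3. (Campanato spaces) Let $\alpha_1,\dots,\alpha_m<0$, $\alpha=\alpha_1+\dots+\alpha_m$, $1<p_1,\dots,p_m<\infty$, $\frac1p=\sum_j\frac1{p_j}$, and suppose that either $n<p<\infty$, or $-m<\alpha$ and $1<p<\infty$. There is $C>0$ such that for all $f_j\in\mathcal E^{\alpha_j,p_j}(\mathbb{R}^n)$, $j=1,\dots,m$, $\tilde\mu(\vec f)$ is either infinite everywhere or finite almost everywhere, and in the latter case $\tilde\mu(\vec f)\in\mathcal E^{\alpha,p}(\mathbb{R}^n)$ and $\|\tilde\mu(\vec f)\|_{\mathcal E^{\alpha,p}}\le C\prod_j\|f_j\|_{\mathcal E^{\alpha_j,p_j}}$. 4. (Lipschitz spaces) Let $0<\alpha_j<\frac1m$ for $j=1,\dots,m$ and $\alpha=\alpha_1+\dots+\alpha_m<\frac\beta2$. There is $C>0$ such that for all $f_j\in Lip_{\alpha_j}$, $j=1,\dots,m$, $\tilde\mu(\vec f)$ is either infinite everywhere or finite everywhere (in particular almost everywhere),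 and in the latter case $\|\tilde\mu(\vec f)\|_{Lip_\alpha}\le C\prod_j\|f_j\|_{Lip_{\alpha_j}}$. -/

import Mathlib

open MeasureTheory Metric
open scoped ENNReal NNReal

noncomputable section

namespace Marcinkiewicz

/-- The Euclidean space `ℝⁿ`. -/
abbrev Rn (n : ℕ) : Type := EuclideanSpace ℝ (Fin n)

/-- `Om : ℝⁿ → ℂ` is homogeneous of degree `0`, Hölder continuous of order `β` on the unit sphere
(extended to nonzero vectors through `y ↦ y / |y|`), and has integral `0` over the unit sphere with
respect to surface measure. -/
structure IsKernel {n : ℕ} (β : ℝ) (Om : Rn n → ℂ) : Prop where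
  homogeneous : ∀ (l : ℝ) (y : Rn n), 0 < l → Om (l • y) = Om y
  lipschitz : ∃ C : ℝ, 0 < C ∧ ∀ ξ η : Rn n, ξ ≠ 0 → η ≠ 0 →
    ‖Om ξ - Om η‖ ≤ C * ‖‖ξ‖⁻¹ • ξ - ‖η‖⁻¹ • η‖ ^ β
  vanishing : ∫ y : sphere (0 : Rn n) 1, Om y ∂((volume : Measure (Rn n)).toSphere) = 0

/-- `F_t(f₁,…,f_m)(x) = t⁻ᵐ ∏ⱼ ∫_{|y| ≤ t} Ωⱼ(y) |y|^{-(n-1)} fⱼ(x - y) dy`. -/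
def truncated {n m : ℕ} (Om f : Fin m → Rn n → ℂ) (t : ℝ) (x : Rn n) : ℂ :=
  ((t : ℂ) ^ m)⁻¹ *
    ∏ j, ∫ y in closedBall (0 : Rn n) t, Om j y / ((‖y‖ ^ (n - 1) : ℝ) : ℂ) * f j (x - y)

/-- By Fubini's theorem, `F_t` is the `m`-fold integral of the product kernel. -/
theorem truncated_eq_integral {n m : ℕ} (Om f : Fin m → Rn n → ℂ) (t : ℝ) (x : Rn n) :
    truncated Om f t x = ((t : ℂ) ^ m)⁻¹ *
      ∫ y in Set.univ.pi (fun _ : Fin m => closedBall (0 : Rn n) t),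
        (∏ j, Om j (y j) / ((‖y j‖ ^ (n - 1) : ℝ) : ℂ)) * ∏ j, f j (x - y j) := by
  rw [truncated, volume_pi, Measure.restrict_pi_pi]
  simp_rw [← Finset.prod_mul_distrib]
  rw [← integral_fintype_prod_eq_prod]

/-- The multilinear Marcinkiewicz integral with separated kernel,
`(∫₀^∞ |F_t(f₁,…,f_m)(x)|² dt/t)^{1/2}`, with values in `[0,∞]`. -/
def mu {n m : ℕ} (Om f : Fin m → Rn n → ℂ) (x : Rn n) : ℝ≥0∞ :=
  (∫⁻ t in Set.Ioi (0 : ℝ), ‖truncated Om f t x‖ₑ ^ 2 / ENNReal.ofReal t) ^ (1 / 2 : ℝ)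

variable {V : Type*} [NormedAddCommGroup V] [NormedSpace ℝ V]

/-- The Campanato seminorm
`sup_B |B|^{-α/n} (|B|⁻¹ ∫_B |g - g_B|^p)^{1/p}`, the supremum being over all balls `B`. -/
def campanatoSeminorm {n : ℕ} (α p : ℝ) (g : Rn n → V) : ℝ≥0∞ :=
  ⨆ (z : Rn n) (r : ℝ) (_ : 0 < r),
    volume (closedBall z r) ^ (-(α / n)) *
      ((volume (closedBall z r))⁻¹ *
        ∫⁻ x in closedBall z r, ‖g x - ⨍ y in closedBall z r, g y‖ₑ ^ p) ^ (1 / p)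

/-- Membership in the Campanato space `𝓔^{α,p}(ℝⁿ)`: locally integrable, finite seminorm. -/
def MemCampanato {n : ℕ} (α p : ℝ) (g : Rn n → V) : Prop :=
  LocallyIntegrable g ∧ campanatoSeminorm α p g < ∞

/-- The seminorm `sup_B |B|⁻¹ ∫_B |g - g_B|` of `BMO(ℝⁿ)`. -/
def bmoSeminorm {n : ℕ} (g : Rn n → V) : ℝ≥0∞ :=
  ⨆ (z : Rn n) (r : ℝ) (_ : 0 < r),
    (volume (closedBall z r))⁻¹ *
      ∫⁻ x in closedBall z r, ‖g x - ⨍ y in closedBall z r, g y‖ₑ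

/-- Membership in `BMO(ℝⁿ)`. -/
def MemBMO {n : ℕ} (g : Rn n → V) : Prop :=
  LocallyIntegrable g ∧ bmoSeminorm g < ∞

/-- The seminorm `sup_{x ≠ y} |g(x) - g(y)| / |x - y|^α` of `Lip_α(ℝⁿ)`. -/
def lipSeminorm {n : ℕ} (α : ℝ) (g : Rn n → V) : ℝ≥0∞ :=
  ⨆ (x : Rn n) (y : Rn n) (_ : x ≠ y), ‖g x - g y‖ₑ / ‖x - y‖ₑ ^ α

end Marcinkiewicz

end

/-! The truncated integral F_t is a product of linear averages A_t f_j(x) (`avgOp`), so the operator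
is the L²(dt/t) norm in t of that product (`mu_eq_multSqFn`). Everything rests on three properties
of k(y) = Ω(y)/|y|^{n-1}, collected in `RoughKernel`: size |y|^{1-n}, Hölder regularity away from
the origin, and zero integral over balls centred at 0. Regularity survives the sharp cutoff |y| ≤ t
in two forms: an L¹ modulus of order (|h|/t)^β at fixed t (`lintegral_ker_sub_le`), and an
L²(dt/t)-valued estimate of order β/2 (`l2_ker_sub_le`), where the jump at |y| = t costs only a
short interval of t. Zero integral means that the averages do not see constants (`avgOp_sub_const`).

Lebesgue spaces. For one function, Plancherel reduces the L² bound to |𝓕(ker_t)(ξ)| ≤ C min(t|ξ|,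
(t|ξ|)^{-β}), which is square integrable for dt/t uniformly in ξ (`lintegral_fourier_ker_sq_le`). A
Calderón–Zygmund decomposition gives weak type (1,1) (`sqFn_weak_type`). All exponents 1 < p < ∞ are
then reached at once by a good-λ inequality against the Hardy–Littlewood maximal function
(`WeakOscillation.lintegral_rpow_le`, `weakOscillation_sqFn`), without interpolation or duality. For
a product, one factor keeps its square function, the others are dominated pointwise in t by maximal
functions, and Hölder's inequality finishes (`lintegral_multSqFn_rpow_le`).

The other spaces. On a ball B of radius r, the scales are split at t = r. For t ≤ r the averages on
B only see the functions on 2B, and constants may be subtracted, so the Lebesgue bound applies to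
(f_j - c_j)1_{2B} (`lintegral_multSqFnSmall_le`). For t > r the averages at two points of B differ
by a factor (r/t)^γ, which makes the difference of the products square integrable for dt/t as long
as γ exceeds the total order of growth (`multSqFnLarge_le_add`). In BMO the small scales use
John–Nirenberg, and γ = β/2 comes from a Cauchy–Schwarz argument (`enorm_avgOp_bmo`). In the
Lipschitz case both halves are pointwise, with γ = β (`multSqFn_le_add_lip`). Finiteness at one
point bounds the large scales at every other point, which is the source of the dichotomies.

For negative Campanato order a function is, up to a constant, of Morrey type
(`exists_const_morrey`). No oscillation argument is then needed: the large scales are themselves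
small (`multSqFnLarge_morrey_le`), and the operator maps Morrey functions to a Morrey function,
finite almost everywhere. -/

noncomputable section

namespace Marcinkiewicz

open Set Filter Topology

/-! ### Balls and radial weights -/

/-- The volume of the unit ball of `ℝⁿ`. -/
def unitVol (n : ℕ) : ℝ≥0∞ := volume (closedBall (0 : Rn n) 1)

lemma unitVol_ne_zero (n : ℕ) : unitVol n ≠ 0 :=
  (measure_closedBall_pos volume _ one_pos).ne'

lemma unitVol_ne_top (n : ℕ) : unitVol n ≠ ∞ := measure_closedBall_lt_top.ne

lemma volume_closedBall_eq {n : ℕ} (x : Rn n) {r : ℝ} (hr : 0 ≤ r) :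
    volume (closedBall x r) = ENNReal.ofReal (r ^ n) * unitVol n := by
  rw [Measure.addHaar_closedBall' volume x hr]; simp [unitVol]

lemma volume_closedBall_ne_zero {n : ℕ} (x : Rn n) {r : ℝ} (hr : 0 < r) :
    volume (closedBall x r) ≠ 0 := (measure_closedBall_pos volume _ hr).ne'

lemma volume_closedBall_ne_top {n : ℕ} (x : Rn n) (r : ℝ) :
    volume (closedBall x r) ≠ ∞ := measure_closedBall_lt_top.ne

lemma volume_closedBall_mul {n : ℕ} (x y : Rn n) {r c : ℝ} (hr : 0 ≤ r) (hc : 0 ≤ c) :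
    volume (closedBall y (c * r)) = ENNReal.ofReal (c ^ n) * volume (closedBall x r) := by
  rw [volume_closedBall_eq _ hr, volume_closedBall_eq _ (mul_nonneg hc hr), mul_pow,
    ENNReal.ofReal_mul (by positivity), mul_assoc]

lemma ofReal_geometric_sum {ρ : ℝ} (h0 : 0 ≤ ρ) (h1 : ρ < 1) :
    ∑' k : ℕ, ENNReal.ofReal (ρ ^ k) = ENNReal.ofReal (1 - ρ)⁻¹ := by
  rw [← ENNReal.ofReal_tsum_of_nonneg (fun k => by positivity)
    (summable_geometric_of_lt_one h0 h1), tsum_geometric_of_lt_one h0 h1]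

lemma two_pow_cover_near {d R : ℝ} (hd : 0 < d) (hR : d ≤ R) :
    ∃ k : ℕ, (1 / 2 : ℝ) ^ (k + 1) * R < d ∧ d ≤ (1 / 2 : ℝ) ^ k * R := by
  have hR0 : 0 < R := hd.trans_le hR
  obtain ⟨k, h1, h2⟩ := exists_nat_pow_near_of_lt_one (x := d / R) (y := (1 / 2 : ℝ))
    (by positivity) ((div_le_one hR0).2 hR) (by norm_num) (by norm_num)
  exact ⟨k, (lt_div_iff₀ hR0).1 h1, (div_le_iff₀ hR0).1 h2⟩

lemma two_pow_cover_far {d R : ℝ} (hR0 : 0 < R) (hR : R ≤ d) :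
    ∃ k : ℕ, (2 : ℝ) ^ k * R ≤ d ∧ d ≤ (2 : ℝ) ^ (k + 1) * R := by
  obtain ⟨k, h1, h2⟩ := exists_nat_pow_near (x := d / R) (y := (2 : ℝ))
    ((one_le_div hR0).2 hR) (by norm_num)
  exact ⟨k, (le_div_iff₀ hR0).1 h1, ((div_lt_iff₀ hR0).1 h2).le⟩

/-- Integration of a negative power of the distance against a weight whose mass in small balls
around the centre is controlled. -/
lemma lintegral_rpow_near {n : ℕ} [NeZero n] {a σ : ℝ} (ha : 0 ≤ a) (haσ : a < σ) :
    ∃ C : ℝ≥0, 0 < C ∧ ∀ (w : Rn n → ℝ≥0∞) (x : Rn n) (A : ℝ≥0∞) (R : ℝ), 0 < R →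
      (∀ s, 0 < s → s ≤ R → ∫⁻ y in closedBall x s, w y ≤ A * ENNReal.ofReal (s ^ σ)) →
      ∫⁻ y in closedBall x R, ENNReal.ofReal (‖x - y‖ ^ (-a)) * w y ≤
        C * A * ENNReal.ofReal (R ^ (σ - a)) := by
  -- On the k-th dyadic annulus the power is at most 2^a (2^{-k}R)^{-a} and the mass at most
  -- A(2^{-k}R)^σ, so the pieces decay with ratio 2^{-(σ-a)}.
  set ρ : ℝ := (1 / 2 : ℝ) ^ (σ - a) with hρ
  have hρ0 : 0 < ρ := by positivity
  have hρ1 : ρ < 1 := Real.rpow_lt_one (by norm_num) (by norm_num) (by linarith)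
  have hCpos : 0 < 2 ^ a * (1 - ρ)⁻¹ := by
    have : 0 < 1 - ρ := by linarith
    positivity
  refine ⟨(2 ^ a * (1 - ρ)⁻¹).toNNReal, Real.toNNReal_pos.2 hCpos, fun w x A R hR h => ?_⟩
  set S : ℕ → Set (Rn n) := fun k =>
    {y | (1 / 2 : ℝ) ^ (k + 1) * R < ‖x - y‖ ∧ ‖x - y‖ ≤ (1 / 2 : ℝ) ^ k * R} with hS
  have hsub : (closedBall x R : Set (Rn n)) \ {x} ⊆ ⋃ k, S k := by
    rintro y ⟨hy, hyx⟩
    have h1 : 0 < ‖x - y‖ := norm_pos_iff.2 (sub_ne_zero.2 fun h => hyx h.symm)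
    obtain ⟨k, hk⟩ := two_pow_cover_near (R := R) h1 (by rwa [← dist_eq_norm, dist_comm])
    exact mem_iUnion.2 ⟨k, hk⟩
  have hmeasS : ∀ k, MeasurableSet (S k) := fun k =>
    (by fun_prop : Measurable fun y : Rn n => ‖x - y‖) measurableSet_Ioc
  -- The annuli miss only the centre, a null point since n ≥ 1.
  have hnull : (closedBall x R : Set (Rn n)) =ᵐ[volume] (closedBall x R \ {x} : Set (Rn n)) :=
    (sdiff_null_ae_eq_self (measure_singleton x)).symm
  rw [setLIntegral_congr hnull]
  calc ∫⁻ y in closedBall x R \ {x}, ENNReal.ofReal (‖x - y‖ ^ (-a)) * w y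
      ≤ ∫⁻ y in ⋃ k, S k, ENNReal.ofReal (‖x - y‖ ^ (-a)) * w y := lintegral_mono_set hsub
    _ ≤ ∑' k, ∫⁻ y in S k, ENNReal.ofReal (‖x - y‖ ^ (-a)) * w y := lintegral_iUnion_le _ _
    _ ≤ ∑' k : ℕ, ENNReal.ofReal (ρ ^ k) * (ENNReal.ofReal (2 ^ a) * A *
          ENNReal.ofReal (R ^ (σ - a))) := by
        refine ENNReal.tsum_le_tsum fun k => ?_
        have hk : (0 : ℝ) < (1 / 2 : ℝ) ^ k * R := by positivity
        have hk1 : (0 : ℝ) < (1 / 2 : ℝ) ^ (k + 1) * R := by positivity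
        calc ∫⁻ y in S k, ENNReal.ofReal (‖x - y‖ ^ (-a)) * w y
            ≤ ∫⁻ y in S k, ENNReal.ofReal (((1 / 2 : ℝ) ^ (k + 1) * R) ^ (-a)) * w y := by
              refine setLIntegral_mono' (hmeasS k) fun y hy => ?_
              gcongr ENNReal.ofReal ?_ * _
              exact Real.rpow_le_rpow_of_nonpos hk1 hy.1.le (by linarith)
          _ = ENNReal.ofReal (((1 / 2 : ℝ) ^ (k + 1) * R) ^ (-a)) * ∫⁻ y in S k, w y :=
              lintegral_const_mul' _ _ ENNReal.ofReal_ne_top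
          _ ≤ ENNReal.ofReal (((1 / 2 : ℝ) ^ (k + 1) * R) ^ (-a)) *
                (A * ENNReal.ofReal (((1 / 2 : ℝ) ^ k * R) ^ σ)) := by
              gcongr
              refine (lintegral_mono_set ?_).trans (h _ hk ?_)
              · intro y hy
                rw [mem_closedBall, dist_comm, dist_eq_norm]; exact hy.2
              · exact mul_le_of_le_one_left hR.le (pow_le_one₀ (by norm_num) (by norm_num))
          _ = ENNReal.ofReal (((1 / 2 : ℝ) ^ (k + 1) * R) ^ (-a) * ((1 / 2 : ℝ) ^ k * R) ^ σ) *
                A := by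
              rw [ENNReal.ofReal_mul (by positivity)]; ring
          _ = ENNReal.ofReal (ρ ^ k) * (ENNReal.ofReal (2 ^ a) * A *
                ENNReal.ofReal (R ^ (σ - a))) := by
              have : ((1 / 2 : ℝ) ^ (k + 1) * R) ^ (-a) * ((1 / 2 : ℝ) ^ k * R) ^ σ
                  = ρ ^ k * (2 ^ a * R ^ (σ - a)) := by
                have e1 : (1 / 2 : ℝ) ^ (k + 1) * R = ((1 / 2 : ℝ) ^ k * R) * 2⁻¹ := by ring
                rw [e1, Real.mul_rpow hk.le (by norm_num), Real.inv_rpow (by norm_num),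
                  Real.rpow_neg (by norm_num : (0 : ℝ) ≤ 2), inv_inv]
                rw [mul_right_comm, ← Real.rpow_add hk, neg_add_eq_sub,
                  Real.mul_rpow (by positivity) hR.le, ← Real.rpow_natCast (1 / 2 : ℝ) k,
                  ← Real.rpow_natCast ρ k, hρ, ← Real.rpow_mul (by norm_num),
                  ← Real.rpow_mul (by norm_num), mul_comm (k : ℝ)]
                ring
              rw [this, ENNReal.ofReal_mul (by positivity), ENNReal.ofReal_mul (by positivity)]
              ring
    _ = (2 ^ a * (1 - ρ)⁻¹).toNNReal * A * ENNReal.ofReal (R ^ (σ - a)) := by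
        rw [ENNReal.tsum_mul_right, ofReal_geometric_sum hρ0.le hρ1]
        change _ = ENNReal.ofReal _ * _ * _
        rw [ENNReal.ofReal_mul (by positivity)]
        ring

/-- Integration of a negative power of the distance, away from the centre, against a weight whose
mass in large balls around the centre is controlled. -/
lemma lintegral_rpow_far {n : ℕ} {a σ : ℝ} (ha : 0 ≤ a) (haσ : σ < a) :
    ∃ C : ℝ≥0, 0 < C ∧ ∀ (w : Rn n → ℝ≥0∞) (x : Rn n) (A : ℝ≥0∞) (R : ℝ), 0 < R →
      (∀ s, R ≤ s → ∫⁻ y in closedBall x s, w y ≤ A * ENNReal.ofReal (s ^ σ)) →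
      ∫⁻ y in {y | R ≤ ‖x - y‖}, ENNReal.ofReal (‖x - y‖ ^ (-a)) * w y ≤
        C * A * ENNReal.ofReal (R ^ (σ - a)) := by
  set ρ : ℝ := (2 : ℝ) ^ (σ - a) with hρ
  have hρ0 : 0 < ρ := by positivity
  have hρ1 : ρ < 1 := Real.rpow_lt_one_of_one_lt_of_neg (by norm_num) (by linarith)
  have hCpos : 0 < 2 ^ σ * (1 - ρ)⁻¹ := by
    have : 0 < 1 - ρ := by linarith
    positivity
  refine ⟨(2 ^ σ * (1 - ρ)⁻¹).toNNReal, Real.toNNReal_pos.2 hCpos, fun w x A R hR h => ?_⟩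
  set S : ℕ → Set (Rn n) := fun k =>
    {y | (2 : ℝ) ^ k * R ≤ ‖x - y‖ ∧ ‖x - y‖ ≤ (2 : ℝ) ^ (k + 1) * R} with hS
  have hsub : {y : Rn n | R ≤ ‖x - y‖} ⊆ ⋃ k, S k := by
    intro y hy
    obtain ⟨k, hk⟩ := two_pow_cover_far hR hy
    exact mem_iUnion.2 ⟨k, hk⟩
  have hmeasS : ∀ k, MeasurableSet (S k) := fun k =>
    (by fun_prop : Measurable fun y : Rn n => ‖x - y‖) measurableSet_Icc
  calc ∫⁻ y in {y | R ≤ ‖x - y‖}, ENNReal.ofReal (‖x - y‖ ^ (-a)) * w y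
      ≤ ∫⁻ y in ⋃ k, S k, ENNReal.ofReal (‖x - y‖ ^ (-a)) * w y := lintegral_mono_set hsub
    _ ≤ ∑' k, ∫⁻ y in S k, ENNReal.ofReal (‖x - y‖ ^ (-a)) * w y := lintegral_iUnion_le _ _
    _ ≤ ∑' k : ℕ, ENNReal.ofReal (ρ ^ k) * (ENNReal.ofReal (2 ^ σ) * A *
          ENNReal.ofReal (R ^ (σ - a))) := by
        refine ENNReal.tsum_le_tsum fun k => ?_
        have hk : (0 : ℝ) < (2 : ℝ) ^ k * R := by positivity
        calc ∫⁻ y in S k, ENNReal.ofReal (‖x - y‖ ^ (-a)) * w y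
            ≤ ∫⁻ y in S k, ENNReal.ofReal (((2 : ℝ) ^ k * R) ^ (-a)) * w y := by
              refine setLIntegral_mono' (hmeasS k) fun y hy => ?_
              gcongr ENNReal.ofReal ?_ * _
              exact Real.rpow_le_rpow_of_nonpos hk hy.1 (by linarith)
          _ = ENNReal.ofReal (((2 : ℝ) ^ k * R) ^ (-a)) * ∫⁻ y in S k, w y :=
              lintegral_const_mul' _ _ ENNReal.ofReal_ne_top
          _ ≤ ENNReal.ofReal (((2 : ℝ) ^ k * R) ^ (-a)) *
                (A * ENNReal.ofReal (((2 : ℝ) ^ (k + 1) * R) ^ σ)) := by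
              gcongr
              refine (lintegral_mono_set ?_).trans (h _ ?_)
              · intro y hy
                rw [mem_closedBall, dist_comm, dist_eq_norm]; exact hy.2
              · exact le_mul_of_one_le_left hR.le (one_le_pow₀ (by norm_num))
          _ = ENNReal.ofReal (((2 : ℝ) ^ k * R) ^ (-a) * ((2 : ℝ) ^ (k + 1) * R) ^ σ) * A := by
              rw [ENNReal.ofReal_mul (by positivity)]; ring
          _ = ENNReal.ofReal (ρ ^ k) * (ENNReal.ofReal (2 ^ σ) * A *
                ENNReal.ofReal (R ^ (σ - a))) := by
              have : ((2 : ℝ) ^ k * R) ^ (-a) * ((2 : ℝ) ^ (k + 1) * R) ^ σ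
                  = ρ ^ k * (2 ^ σ * R ^ (σ - a)) := by
                have e1 : (2 : ℝ) ^ (k + 1) * R = ((2 : ℝ) ^ k * R) * 2 := by ring
                rw [e1, Real.mul_rpow hk.le (by norm_num), ← mul_assoc, ← Real.rpow_add hk,
                  neg_add_eq_sub, Real.mul_rpow (by positivity) hR.le,
                  ← Real.rpow_natCast (2 : ℝ) k,
                  ← Real.rpow_natCast ρ k, hρ, ← Real.rpow_mul (by norm_num),
                  ← Real.rpow_mul (by norm_num), mul_comm (k : ℝ)]
                ring
              rw [this, ENNReal.ofReal_mul (by positivity), ENNReal.ofReal_mul (by positivity)]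
              ring
    _ = (2 ^ σ * (1 - ρ)⁻¹).toNNReal * A * ENNReal.ofReal (R ^ (σ - a)) := by
        rw [ENNReal.tsum_mul_right, ofReal_geometric_sum hρ0.le hρ1]
        change _ = ENNReal.ofReal _ * _ * _
        rw [ENNReal.ofReal_mul (by positivity)]
        ring

/-! ### Differentiation and a stopping-time covering lemma -/

/-- Besicovitch differentiation of the finite measure w dx: ball averages converge almost everywhere
to w, so a small enough ball already has average above l. This stands in for Lebesgue points
wherever a level set has to be covered by balls of large density. -/
lemma ae_exists_closedBall_of_lt {n : ℕ} {w : Rn n → ℝ≥0∞} (hw : Measurable w)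
    (hfin : ∫⁻ y, w y ≠ ∞) (l : ℝ≥0∞) :
    ∀ᵐ x, l < w x → ∃ r, 0 < r ∧ l * volume (closedBall x r) < ∫⁻ y in closedBall x r, w y := by
  have : IsFiniteMeasure (volume.withDensity w) := isFiniteMeasure_withDensity hfin
  filter_upwards [Besicovitch.ae_tendsto_rnDeriv (volume.withDensity w) (volume : Measure (Rn n)),
    Measure.rnDeriv_withDensity volume hw] with x hx h'x hlt
  rw [h'x] at hx
  have h1 := (hx.eventually (lt_mem_nhds hlt)).and self_mem_nhdsWithin
  obtain ⟨r, hr, hr0⟩ := h1.exists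
  refine ⟨r, hr0, ?_⟩
  rw [withDensity_apply _ measurableSet_closedBall] at hr
  exact (ENNReal.lt_div_iff_mul_lt (Or.inl (volume_closedBall_ne_zero x hr0))
    (Or.inl (volume_closedBall_ne_top x r))).1 hr

/-- Stopping balls for a finite measure `ν` at height `l`: disjoint balls of density larger than
`l` whose fivefold dilates cover, and all of whose proper dilates have density at most `l`. -/
lemma exists_stopping_balls {n : ℕ} [NeZero n] (ν : Measure (Rn n)) (hν : ν univ ≠ ∞)
    {l : ℝ≥0∞} (hl0 : l ≠ 0) (hltop : l ≠ ∞) (U : Set (Rn n))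
    (hU : ∀ x ∈ U, ∃ r, 0 < r ∧ l * volume (closedBall x r) < ν (closedBall x r)) :
    ∃ u : Set (Rn n × ℝ), u.Countable ∧ (∀ p ∈ u, p.1 ∈ U ∧ 0 < p.2 ∧
        l * volume (closedBall p.1 p.2) < ν (closedBall p.1 p.2) ∧
        ∀ R, 2 * p.2 ≤ R → ν (closedBall p.1 R) ≤ l * volume (closedBall p.1 R)) ∧
      u.PairwiseDisjoint (fun p => closedBall p.1 p.2) ∧
      U ⊆ ⋃ p ∈ u, closedBall p.1 (5 * p.2) := by
  have hn : n ≠ 0 := NeZero.ne n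
  have hω0 := unitVol_ne_zero n
  have hωt := unitVol_ne_top n
  -- an upper bound for the radii
  obtain ⟨R0, hR0⟩ : ∃ R0 : ℝ, ∀ (x : Rn n) (r : ℝ), 0 < r →
      l * volume (closedBall x r) < ν (closedBall x r) → r ≤ R0 := by
    -- A ball of density above l satisfies l ω rⁿ < ν(ℝⁿ), ω being the volume of the unit ball. The
    -- maximum with 1 allows r ≤ rⁿ, so no n-th root is needed.
    refine ⟨max 1 (ν univ / (l * unitVol n)).toReal, fun x r hr h => ?_⟩
    by_contra! hcon
    obtain ⟨h1, h2⟩ := max_lt_iff.1 hcon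
    have hfin : ν univ / (l * unitVol n) ≠ ∞ :=
      ENNReal.div_ne_top hν (mul_ne_zero hl0 hω0)
    have h3 : ν univ / (l * unitVol n) ≤ ENNReal.ofReal (r ^ n) := by
      rw [← ENNReal.ofReal_toReal hfin]
      exact ENNReal.ofReal_le_ofReal (h2.le.trans (le_self_pow₀ h1.le hn))
    have h4 := (ENNReal.div_le_iff (mul_ne_zero hl0 hω0) (ENNReal.mul_ne_top hltop hωt)).1 h3
    have h5 : ν univ ≤ l * volume (closedBall x r) := by
      rw [volume_closedBall_eq x hr.le]; convert! h4 using 1; ring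
    exact absurd (h.trans_le (measure_mono (subset_univ _))) (not_lt.2 h5)
  set t : Set (Rn n × ℝ) := {p | p.1 ∈ U ∧ 0 < p.2 ∧
        l * volume (closedBall p.1 p.2) < ν (closedBall p.1 p.2) ∧
        ∀ R, 2 * p.2 ≤ R → ν (closedBall p.1 R) ≤ l * volume (closedBall p.1 R)} with ht
  have hUt : ∀ x ∈ U, ∃ r, (x, r) ∈ t := by
    intro x hx
    set A : Set ℝ := {r | 0 < r ∧ l * volume (closedBall x r) < ν (closedBall x r)} with hA
    have hne : A.Nonempty := hU x hx
    have hbdd : BddAbove A := ⟨R0, fun r hr => hR0 x r hr.1 hr.2⟩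
    have hpos : 0 < sSup A := by
      obtain ⟨r, hr⟩ := hne
      exact hr.1.trans_le (le_csSup hbdd hr)
    -- A radius above half the supremum of the admissible ones: any R ≥ 2r then exceeds the
    -- supremum, hence has density at most l.
    obtain ⟨r, hr, hlt⟩ := exists_lt_of_lt_csSup hne (half_lt_self hpos)
    refine ⟨r, hx, hr.1, hr.2, fun R hR => ?_⟩
    by_contra! hcon
    have hRA : R ∈ A := ⟨by linarith [hr.1], hcon⟩
    have := le_csSup hbdd hRA
    linarith
  -- Vitali covering; any dilation factor above 3 would do.
  obtain ⟨u, hut, hdisj, hcov⟩ :=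
    Vitali.exists_disjoint_subfamily_covering_enlargement_closedBall t (fun p => p.1)
      (fun p => p.2) R0 (fun p hp => hR0 p.1 p.2 hp.2.1 hp.2.2.1) 5 (by norm_num)
  refine ⟨u, ?_, fun p hp => hut hp, hdisj, ?_⟩
  · refine hdisj.countable_of_nonempty_interior fun p hp => ?_
    exact ⟨p.1, ball_subset_interior_closedBall (mem_ball_self (hut hp).2.1)⟩
  · intro x hx
    obtain ⟨r, hr⟩ := hUt x hx
    obtain ⟨p, hp, hsub⟩ := hcov _ hr
    exact mem_iUnion₂.2 ⟨p, hp, hsub (mem_closedBall_self hr.2.1.le)⟩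

/-- The total volume of the stopping balls. -/
lemma tsum_volume_stopping_le {n : ℕ} {ν : Measure (Rn n)} {l : ℝ≥0∞} {u : Set (Rn n × ℝ)}
    (hu : u.Countable)
    (h : ∀ p ∈ u, l * volume (closedBall p.1 p.2) < ν (closedBall p.1 p.2))
    (hdisj : u.PairwiseDisjoint (fun p => closedBall p.1 p.2)) :
    l * ∑' p : u, volume (closedBall p.1.1 p.1.2) ≤ ν univ := by
  have := hu.to_subtype
  rw [← ENNReal.tsum_mul_left]
  calc ∑' p : u, l * volume (closedBall p.1.1 p.1.2)
      ≤ ∑' p : u, ν (closedBall p.1.1 p.1.2) := ENNReal.tsum_le_tsum fun p => (h p.1 p.2).le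
    _ = ν (⋃ p : u, closedBall p.1.1 p.1.2) := by
        rw [measure_iUnion _ fun p => measurableSet_closedBall]
        intro p q hpq
        exact hdisj p.2 q.2 (fun h => hpq (Subtype.ext h))
    _ ≤ ν univ := measure_mono (subset_univ _)

/-! ### Layer-cake formula for extended nonnegative functions -/

/-- The scalar identity p ∫₀^c t^{p-1} dt = c^p, including c = ∞, which is reached by comparison
with all finite levels. -/
lemma lintegral_Ioi_layer {p : ℝ} (hp : 0 < p) (c : ℝ≥0∞) :
    ENNReal.ofReal p * ∫⁻ t in Ioi (0 : ℝ),
      {t : ℝ | ENNReal.ofReal t < c}.indicator (fun t => ENNReal.ofReal (t ^ (p - 1))) t = c ^ p := by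
  have key : ∀ a : ℝ, 0 ≤ a → ENNReal.ofReal p * ∫⁻ t in Ioi (0 : ℝ),
      {t : ℝ | ENNReal.ofReal t < ENNReal.ofReal a}.indicator
        (fun t => ENNReal.ofReal (t ^ (p - 1))) t = ENNReal.ofReal a ^ p := by
    intro a ha
    -- For a finite level, this is the layer-cake formula for a constant function under a Dirac
    -- mass.
    have h := lintegral_rpow_eq_lintegral_meas_lt_mul (Measure.dirac ()) (f := fun _ => a)
      (Eventually.of_forall fun _ => ha) (measurable_const.aemeasurable) hp
    simp only [lintegral_const, measure_univ, mul_one] at h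
    rw [ENNReal.ofReal_rpow_of_nonneg ha hp.le, h]
    congr 1
    refine setLIntegral_congr_fun measurableSet_Ioi fun t ht => ?_
    by_cases hta : t < a
    · have : ENNReal.ofReal t < ENNReal.ofReal a :=
        (ENNReal.ofReal_lt_ofReal_iff_of_nonneg (le_of_lt ht)).2 hta
      simp [indicator, this, hta]
    · have : ¬ ENNReal.ofReal t < ENNReal.ofReal a := fun h =>
        hta ((ENNReal.ofReal_lt_ofReal_iff_of_nonneg (le_of_lt ht)).1 h)
      simp [indicator, this, hta]
  rcases eq_or_ne c ∞ with rfl | hc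
  · rw [ENNReal.top_rpow_of_pos hp]
    refine ENNReal.eq_top_of_forall_nnreal_le fun r => ?_
    have h1 : (r : ℝ≥0∞) = ENNReal.ofReal ((r : ℝ) ^ (1 / p)) ^ p := by
      rw [ENNReal.ofReal_rpow_of_nonneg (by positivity) hp.le, ← Real.rpow_mul r.coe_nonneg,
        one_div_mul_cancel hp.ne', Real.rpow_one, ENNReal.ofReal_coe_nnreal]
    rw [h1, ← key _ (by positivity)]
    gcongr
    exact le_top
  · have := key c.toReal ENNReal.toReal_nonneg
    rwa [ENNReal.ofReal_toReal hc] at this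

lemma lintegral_rpow_eq_layer {α : Type*} [MeasurableSpace α] {μ : Measure α} [SFinite μ]
    {g : α → ℝ≥0∞} (hg : Measurable g) {p : ℝ} (hp : 0 < p) :
    ∫⁻ x, g x ^ p ∂μ = ENNReal.ofReal p * ∫⁻ t in Ioi (0 : ℝ),
      ENNReal.ofReal (t ^ (p - 1)) * μ {x | ENNReal.ofReal t < g x} := by
  have hm : MeasurableSet {q : α × ℝ | ENNReal.ofReal q.2 < g q.1} :=
    measurableSet_lt (by fun_prop) (by fun_prop)
  have hF : Measurable (fun q : α × ℝ => {q : α × ℝ | ENNReal.ofReal q.2 < g q.1}.indicator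
      (fun q => ENNReal.ofReal (q.2 ^ (p - 1))) q) :=
    Measurable.indicator (by fun_prop) hm
  calc ∫⁻ x, g x ^ p ∂μ
      = ∫⁻ x, ENNReal.ofReal p * (∫⁻ t in Ioi (0 : ℝ), {t : ℝ | ENNReal.ofReal t < g x}.indicator
          (fun t => ENNReal.ofReal (t ^ (p - 1))) t) ∂μ := by
        simp_rw [lintegral_Ioi_layer hp]
    _ = ENNReal.ofReal p * ∫⁻ x, (∫⁻ t in Ioi (0 : ℝ), {t : ℝ | ENNReal.ofReal t < g x}.indicator
          (fun t => ENNReal.ofReal (t ^ (p - 1))) t) ∂μ :=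
        lintegral_const_mul' _ _ ENNReal.ofReal_ne_top
    _ = ENNReal.ofReal p * ∫⁻ t in Ioi (0 : ℝ), (∫⁻ x, {t : ℝ | ENNReal.ofReal t < g x}.indicator
          (fun t => ENNReal.ofReal (t ^ (p - 1))) t ∂μ) := by
        rw [lintegral_lintegral_swap]
        exact hF.aemeasurable
    _ = _ := by
        congr 1
        refine lintegral_congr fun t => ?_
        have : ∀ x, {t : ℝ | ENNReal.ofReal t < g x}.indicator
            (fun t => ENNReal.ofReal (t ^ (p - 1))) t =
            {x | ENNReal.ofReal t < g x}.indicator (fun _ => ENNReal.ofReal (t ^ (p - 1))) x := by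
          intro x; simp [indicator]
        simp_rw [this]
        rw [lintegral_indicator_const (measurableSet_lt measurable_const hg)]

/-! ### The Hardy–Littlewood maximal function over balls of dyadic radius -/

/-- The centred maximal function over balls whose radius is a power of `2`. -/
def maxFn {n : ℕ} (w : Rn n → ℝ≥0∞) (x : Rn n) : ℝ≥0∞ :=
  ⨆ k : ℤ, (volume (closedBall x ((2 : ℝ) ^ k)))⁻¹ * ∫⁻ y in closedBall x ((2 : ℝ) ^ k), w y

/-- The next dyadic radius above r is at most 2r, so restricting the supremum to countably many
radii costs only 2ⁿ, while measurability becomes immediate. -/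
lemma setLIntegral_closedBall_le_maxFn {n : ℕ} (w : Rn n → ℝ≥0∞) (x : Rn n) {r : ℝ} (hr : 0 < r) :
    ∫⁻ y in closedBall x r, w y ≤ ENNReal.ofReal (2 ^ n) * volume (closedBall x r) * maxFn w x := by
  obtain ⟨k, hk1, hk2⟩ := exists_mem_Ioc_zpow hr (by norm_num : (1 : ℝ) < 2)
  have h0 : (0 : ℝ) < 2 ^ (k + 1) := by positivity
  have h2 : (2 : ℝ) ^ (k + 1) ≤ 2 * r := by
    rw [zpow_add_one₀ (by norm_num)]; linarith
  calc ∫⁻ y in closedBall x r, w y ≤ ∫⁻ y in closedBall x ((2 : ℝ) ^ (k + 1)), w y :=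
        lintegral_mono_set (closedBall_subset_closedBall hk2)
    _ = volume (closedBall x ((2 : ℝ) ^ (k + 1))) * ((volume (closedBall x ((2 : ℝ) ^ (k + 1))))⁻¹ *
          ∫⁻ y in closedBall x ((2 : ℝ) ^ (k + 1)), w y) := by
        rw [← mul_assoc, ENNReal.mul_inv_cancel (volume_closedBall_ne_zero x h0)
          (volume_closedBall_ne_top x _), one_mul]
    _ ≤ ENNReal.ofReal (2 ^ n) * volume (closedBall x r) * maxFn w x := by
        refine mul_le_mul' ?_ (le_iSup (fun k : ℤ => (volume (closedBall x ((2 : ℝ) ^ k)))⁻¹ *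
          ∫⁻ y in closedBall x ((2 : ℝ) ^ k), w y) (k + 1))
        rw [← volume_closedBall_mul x x hr.le (by norm_num)]
        exact measure_mono (closedBall_subset_closedBall h2)

lemma measurable_setLIntegral_closedBall {n : ℕ} {w : Rn n → ℝ≥0∞} (hw : Measurable w) (r : ℝ) :
    Measurable fun x => ∫⁻ y in closedBall x r, w y := by
  have h : ∀ x, ∫⁻ y in closedBall x r, w y =
      ∫⁻ y, {q : Rn n × Rn n | dist q.2 q.1 ≤ r}.indicator (fun q => w q.2) (x, y) := by
    intro x
    rw [← lintegral_indicator measurableSet_closedBall]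
    rfl
  simp_rw [h]
  refine Measurable.lintegral_prod_right' (Measurable.indicator (by fun_prop) ?_)
  exact measurableSet_le (by fun_prop) measurable_const

lemma measurable_maxFn {n : ℕ} {w : Rn n → ℝ≥0∞} (hw : Measurable w) : Measurable (maxFn w) := by
  refine Measurable.iSup fun k => ?_
  have : ∀ x : Rn n, volume (closedBall x ((2 : ℝ) ^ k)) = ENNReal.ofReal (((2 : ℝ) ^ k) ^ n) *
      unitVol n := fun x => volume_closedBall_eq x (by positivity)
  simp_rw [this]
  exact (measurable_setLIntegral_closedBall hw _).const_mul _

/-- Averages of a constant are that constant. This lets the part of w below t/2 be discarded when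
the level t of its maximal function is studied. -/
lemma maxFn_add_const_le {n : ℕ} {w v : Rn n → ℝ≥0∞} {c : ℝ≥0∞}
    (h : ∀ y, w y ≤ v y + c) (x : Rn n) : maxFn w x ≤ maxFn v x + c := by
  refine iSup_le fun k => ?_
  have h0 : (0 : ℝ) < 2 ^ k := by positivity
  calc (volume (closedBall x ((2 : ℝ) ^ k)))⁻¹ * ∫⁻ y in closedBall x ((2 : ℝ) ^ k), w y
      ≤ (volume (closedBall x ((2 : ℝ) ^ k)))⁻¹ *
          (∫⁻ y in closedBall x ((2 : ℝ) ^ k), (v y + c)) :=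
        mul_le_mul' le_rfl (lintegral_mono h)
    _ = (volume (closedBall x ((2 : ℝ) ^ k)))⁻¹ *
          (∫⁻ y in closedBall x ((2 : ℝ) ^ k), v y) + c := by
        rw [lintegral_add_right _ measurable_const, mul_add, lintegral_const,
          Measure.restrict_apply_univ, mul_comm c, ← mul_assoc,
          ENNReal.inv_mul_cancel (volume_closedBall_ne_zero x h0) (volume_closedBall_ne_top x _),
          one_mul]
    _ ≤ maxFn v x + c := by
        gcongr
        exact le_iSup (fun k : ℤ => (volume (closedBall x ((2 : ℝ) ^ k)))⁻¹ *
          ∫⁻ y in closedBall x ((2 : ℝ) ^ k), v y) k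

/-- Weak type `(1,1)` of the maximal function. -/
lemma maxFn_weak_type {n : ℕ} [NeZero n] (w : Rn n → ℝ≥0∞) {l : ℝ≥0∞} (hl0 : l ≠ 0)
    (hltop : l ≠ ∞) :
    l * volume {x | l < maxFn w x} ≤ ENNReal.ofReal (5 ^ n) * ∫⁻ y, w y := by
  rcases eq_or_ne (∫⁻ y, w y) ∞ with htop | hfin
  · rw [htop, ENNReal.mul_top (by simp)]; exact le_top
  have hνE : (volume.withDensity w) univ = ∫⁻ y, w y := by
    rw [withDensity_apply _ MeasurableSet.univ, Measure.restrict_univ]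
  obtain ⟨u, hc, hu, hdisj, hcov⟩ := exists_stopping_balls (volume.withDensity w)
    (by rw [hνE]; exact hfin) hl0 hltop {x | l < maxFn w x} (by
      intro x hx
      rw [mem_ofPred_eq, maxFn, lt_iSup_iff] at hx
      obtain ⟨k, hk⟩ := hx
      have h0 : (0 : ℝ) < 2 ^ k := by positivity
      refine ⟨2 ^ k, h0, ?_⟩
      rw [withDensity_apply _ measurableSet_closedBall]
      rw [mul_comm, ← div_eq_mul_inv] at hk
      exact (ENNReal.lt_div_iff_mul_lt (Or.inl (volume_closedBall_ne_zero x h0))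
        (Or.inl (volume_closedBall_ne_top x _))).1 hk)
  have hsum := tsum_volume_stopping_le hc (fun p hp => (hu p hp).2.2.1) hdisj
  have := hc.to_subtype
  calc l * volume {x | l < maxFn w x}
      ≤ l * volume (⋃ p ∈ u, closedBall p.1 (5 * p.2)) := by gcongr
    _ ≤ l * ∑' p : u, volume (closedBall p.1.1 (5 * p.1.2)) := by
        gcongr; rw [biUnion_eq_iUnion]; exact measure_iUnion_le _
    _ = ENNReal.ofReal (5 ^ n) * (l * ∑' p : u, volume (closedBall p.1.1 p.1.2)) := by
        rw [mul_left_comm, ← ENNReal.tsum_mul_left (a := ENNReal.ofReal (5 ^ n))]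
        congr 1
        refine tsum_congr fun p => ?_
        exact volume_closedBall_mul _ _ (hu p.1 p.2).2.1.le (by norm_num)
    _ ≤ ENNReal.ofReal (5 ^ n) * ∫⁻ y, w y := by
        rw [← hνE]; gcongr

/-- The Hardy–Littlewood maximal theorem. -/
lemma maxFn_strong_type {n : ℕ} [NeZero n] {p : ℝ} (hp : 1 < p) :
    ∃ C : ℝ≥0, 0 < C ∧ ∀ w : Rn n → ℝ≥0∞, Measurable w →
      ∫⁻ x, maxFn w x ^ p ≤ C * ∫⁻ x, w x ^ p := by
  have hp0 : 0 < p := by linarith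
  have hp1 : 0 < p - 1 := by linarith
  refine ⟨(p * (5 ^ n * 2) * (p - 1)⁻¹ * 2 ^ (p - 1)).toNNReal, Real.toNNReal_pos.2 (by positivity),
    fun w hw => ?_⟩
  change _ ≤ ENNReal.ofReal _ * _
  rw [lintegral_rpow_eq_layer (measurable_maxFn hw) hp0]
  have hdist : ∀ t ∈ Ioi (0 : ℝ), ENNReal.ofReal (t ^ (p - 1)) *
      volume {x | ENNReal.ofReal t < maxFn w x} ≤
      ENNReal.ofReal (5 ^ n * 2) * (ENNReal.ofReal (t ^ (p - 1 - 1)) *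
        ∫⁻ x, {x | ENNReal.ofReal t < 2 * w x}.indicator w x) := by
    intro t ht
    have ht0 : (0 : ℝ) < t := ht
    -- Only the part of w above t/2 matters at level t: the rest contributes at most t/2 to the
    -- maximal function. The weak type bound is applied to this part at height t/2.
    set v : Rn n → ℝ≥0∞ := {x | ENNReal.ofReal t < 2 * w x}.indicator w
    have h1 : ∀ x, maxFn w x ≤ maxFn v x + ENNReal.ofReal (t / 2) := by
      refine maxFn_add_const_le fun y => ?_
      by_cases hy : ENNReal.ofReal t < 2 * w y
      · simp [v, hy]
      · refine le_add_left ?_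
        rw [ENNReal.ofReal_div_of_pos (by norm_num), ENNReal.le_div_iff_mul_le (by simp) (by simp)]
        simpa [mul_comm] using hy
    have h2 : {x | ENNReal.ofReal t < maxFn w x} ⊆ {x | ENNReal.ofReal (t / 2) < maxFn v x} := by
      intro x hx
      by_contra hcon
      have h3 := (hx.trans_le (h1 x)).trans_le (add_le_add_left (not_lt.1 hcon) _)
      rw [← ENNReal.ofReal_add (by positivity) (by positivity), add_halves] at h3
      exact lt_irrefl _ h3
    have h3 := maxFn_weak_type v (l := ENNReal.ofReal (t / 2))
      (by simpa using ht0) ENNReal.ofReal_ne_top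
    have e : t ^ (p - 1) = 2 * t ^ (p - 1 - 1) * (t / 2) := by
      rw [Real.rpow_sub_one ht0.ne' (p - 1)]; field_simp
    calc ENNReal.ofReal (t ^ (p - 1)) * volume {x | ENNReal.ofReal t < maxFn w x}
        ≤ ENNReal.ofReal (t ^ (p - 1)) * volume {x | ENNReal.ofReal (t / 2) < maxFn v x} := by
          gcongr
      _ = ENNReal.ofReal (2 * t ^ (p - 1 - 1)) * (ENNReal.ofReal (t / 2) *
            volume {x | ENNReal.ofReal (t / 2) < maxFn v x}) := by
          rw [e, ENNReal.ofReal_mul (by positivity), mul_assoc]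
      _ ≤ ENNReal.ofReal (2 * t ^ (p - 1 - 1)) * (ENNReal.ofReal (5 ^ n) * ∫⁻ y, v y) := by gcongr
      _ = _ := by
          rw [ENNReal.ofReal_mul (by norm_num), ENNReal.ofReal_mul (by positivity)]; ring
  have hm : MeasurableSet {q : Rn n × ℝ | ENNReal.ofReal q.2 < 2 * w q.1} :=
    measurableSet_lt (by fun_prop) (by fun_prop)
  have hF : Measurable (fun q : Rn n × ℝ => {q : Rn n × ℝ | ENNReal.ofReal q.2 < 2 * w q.1}.indicator
      (fun q => ENNReal.ofReal (q.2 ^ (p - 1 - 1)) * w q.1) q) :=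
    Measurable.indicator (by fun_prop) hm
  -- Tonelli: for fixed x, the variable t runs over (0, 2w(x)), which later produces
  -- (2w(x))^{p-1}/(p-1).
  have hswap : ∫⁻ t in Ioi (0 : ℝ), ENNReal.ofReal (t ^ (p - 1 - 1)) *
        ∫⁻ x, {x | ENNReal.ofReal t < 2 * w x}.indicator w x =
      ∫⁻ x, w x * ∫⁻ t in Ioi (0 : ℝ), {t : ℝ | ENNReal.ofReal t < 2 * w x}.indicator
        (fun t => ENNReal.ofReal (t ^ (p - 1 - 1))) t := by
    have e1 : ∀ t : ℝ, ENNReal.ofReal (t ^ (p - 1 - 1)) *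
        ∫⁻ x, {x | ENNReal.ofReal t < 2 * w x}.indicator w x =
        ∫⁻ x, {q : Rn n × ℝ | ENNReal.ofReal q.2 < 2 * w q.1}.indicator
          (fun q => ENNReal.ofReal (q.2 ^ (p - 1 - 1)) * w q.1) (x, t) := by
      intro t
      rw [← lintegral_const_mul' _ _ ENNReal.ofReal_ne_top]
      refine lintegral_congr fun x => ?_
      simp only [indicator, mem_ofPred_eq, mul_ite, mul_zero]
    have e2 : ∀ x, w x * ∫⁻ t in Ioi (0 : ℝ), {t : ℝ | ENNReal.ofReal t < 2 * w x}.indicator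
        (fun t => ENNReal.ofReal (t ^ (p - 1 - 1))) t =
        ∫⁻ t in Ioi (0 : ℝ), {q : Rn n × ℝ | ENNReal.ofReal q.2 < 2 * w q.1}.indicator
          (fun q => ENNReal.ofReal (q.2 ^ (p - 1 - 1)) * w q.1) (x, t) := by
      intro x
      rw [← lintegral_const_mul _ (Measurable.indicator (by fun_prop)
        (measurableSet_lt (by fun_prop) measurable_const))]
      refine lintegral_congr fun t => ?_
      simp only [indicator, mem_ofPred_eq]
      split_ifs
      · exact mul_comm _ _
      · simp
    simp_rw [e1, e2]
    exact lintegral_lintegral_swap (f := fun t x => {q : Rn n × ℝ | ENNReal.ofReal q.2 <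
      2 * w q.1}.indicator (fun q => ENNReal.ofReal (q.2 ^ (p - 1 - 1)) * w q.1) (x, t))
      (hF.comp measurable_swap).aemeasurable
  calc ENNReal.ofReal p * ∫⁻ t in Ioi (0 : ℝ), ENNReal.ofReal (t ^ (p - 1)) *
        volume {x | ENNReal.ofReal t < maxFn w x}
      ≤ ENNReal.ofReal p * ∫⁻ t in Ioi (0 : ℝ), ENNReal.ofReal (5 ^ n * 2) *
          (ENNReal.ofReal (t ^ (p - 1 - 1)) *
            ∫⁻ x, {x | ENNReal.ofReal t < 2 * w x}.indicator w x) := by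
        gcongr ENNReal.ofReal p * ?_
        exact setLIntegral_mono' measurableSet_Ioi hdist
    _ = ENNReal.ofReal p * (ENNReal.ofReal (5 ^ n * 2) * ∫⁻ x, w x *
          ∫⁻ t in Ioi (0 : ℝ), {t : ℝ | ENNReal.ofReal t < 2 * w x}.indicator
        (fun t => ENNReal.ofReal (t ^ (p - 1 - 1))) t) := by
        rw [lintegral_const_mul' _ _ ENNReal.ofReal_ne_top, hswap]
    _ = ENNReal.ofReal p * (ENNReal.ofReal (5 ^ n * 2) * ∫⁻ x,
          ENNReal.ofReal ((p - 1)⁻¹ * 2 ^ (p - 1)) * w x ^ p) := by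
        congr 3
        refine funext fun x => ?_
        have h1 := lintegral_Ioi_layer hp1 (2 * w x)
        have h2 : ∫⁻ t in Ioi (0 : ℝ), {t : ℝ | ENNReal.ofReal t < 2 * w x}.indicator
            (fun t => ENNReal.ofReal (t ^ (p - 1 - 1))) t =
            ENNReal.ofReal (p - 1)⁻¹ * (2 * w x) ^ (p - 1) := by
          rw [← h1, ← mul_assoc, ← ENNReal.ofReal_mul (by positivity), inv_mul_cancel₀ hp1.ne',
            ENNReal.ofReal_one, one_mul]
        rw [h2, ENNReal.mul_rpow_of_nonneg _ _ hp1.le, ENNReal.ofReal_mul (by positivity),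
          ← ENNReal.ofReal_rpow_of_pos (by norm_num : (0 : ℝ) < 2), ENNReal.ofReal_ofNat]
        have h3 : w x ^ p = w x * w x ^ (p - 1) := by
          conv_lhs => rw [show p = 1 + (p - 1) by ring,
            ENNReal.rpow_add_of_nonneg _ _ zero_le_one hp1.le, ENNReal.rpow_one]
        rw [h3]; ring
    _ = _ := by
        rw [lintegral_const_mul' _ _ ENNReal.ofReal_ne_top, ← mul_assoc, ← mul_assoc,
          ← ENNReal.ofReal_mul (by positivity), ← ENNReal.ofReal_mul (by positivity)]
        congr 2; ring

/-! ### A good-`λ` inequality for functions with controlled local oscillation -/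

/-- On every ball, `g` differs from some constant by an error whose weak `L¹` size is controlled
by `A` times the infimum of `G` over the ball. -/
def WeakOscillation {n : ℕ} (A : ℝ≥0) (g G : Rn n → ℝ≥0∞) : Prop :=
  ∀ (z : Rn n) (r : ℝ), 0 < r → ∃ (c : ℝ≥0∞) (e : Rn n → ℝ≥0∞),
    (∀ᵐ x, x ∈ closedBall z r → g x ≤ c + e x ∧ c ≤ g x + e x) ∧
    ∀ l : ℝ≥0∞, l ≠ 0 → l ≠ ∞ → ∀ y ∈ closedBall z r,
      l * volume {x ∈ closedBall z r | l < e x} ≤ A * volume (closedBall z r) * G y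

/-- Cover the set on the left by fivefold dilates B of balls in which {g > l} has density above 1/2,
stopped so that its density in B is at most 1/2. The centre of B satisfies G ≤ γl, so the error e is
small on most of B. Hence some point of B has both g and e small, the constant c is at most 3l/2,
and g > 3l then forces e > l, which happens only on a fraction Aγ of B. -/
lemma WeakOscillation.good_lambda {n : ℕ} [NeZero n] {A : ℝ≥0} {g G : Rn n → ℝ≥0∞}
    (hW : WeakOscillation A g G) (hg : Measurable g) {γ : ℝ≥0}
    (hAγ : 8 * A * γ ≤ 1) {l : ℝ≥0∞} (hl0 : l ≠ 0) (hltop : l ≠ ∞)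
    (hfin : volume {x | l < g x} ≠ ∞) :
    volume {x | 3 * l < g x ∧ G x ≤ γ * l} ≤
      (2 * 5 ^ n * A * γ : ℝ≥0) * volume {x | l < g x} := by
  set E : Set (Rn n) := {x | l < g x} with hE
  have hEm : MeasurableSet E := measurableSet_lt measurable_const hg
  set ν : Measure (Rn n) := volume.restrict E with hν
  have hνE : ν univ = volume E := Measure.restrict_apply_univ _
  have hle : ∀ x, 3 * l < g x → x ∈ E := fun x hx => by
    refine lt_of_le_of_lt ?_ hx
    calc l = 1 * l := (one_mul l).symm
      _ ≤ 3 * l := by gcongr; norm_num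
  -- points of density
  have hdens : ∀ᵐ x, x ∈ E → ∃ r, 0 < r ∧ (2⁻¹ : ℝ≥0∞) * volume (closedBall x r) <
      ν (closedBall x r) := by
    have h1 : ∫⁻ y, E.indicator 1 y ≠ ∞ := by
      rw [lintegral_indicator_one hEm]; exact hfin
    filter_upwards [ae_exists_closedBall_of_lt (w := E.indicator 1)
      (measurable_one.indicator hEm) h1 2⁻¹] with x hx hxE
    obtain ⟨r, hr, h⟩ := hx (by rw [indicator_of_mem hxE]; simp)
    refine ⟨r, hr, ?_⟩
    rwa [lintegral_indicator_one hEm, Measure.restrict_apply hEm, inter_comm,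
      ← Measure.restrict_apply measurableSet_closedBall] at h
  set N : Set (Rn n) := {x | ¬ (x ∈ E → ∃ r, 0 < r ∧ (2⁻¹ : ℝ≥0∞) * volume (closedBall x r) <
      ν (closedBall x r))} with hN
  have hN0 : volume N = 0 := hdens
  set U : Set (Rn n) := {x | 3 * l < g x ∧ G x ≤ γ * l} \ N with hU
  obtain ⟨u, hc, hu, hdisj, hcov⟩ := exists_stopping_balls ν (by rw [hνE]; exact hfin)
    (l := 2⁻¹) (by simp) (by simp) U (by
      rintro x ⟨hx, hxN⟩
      simp only [hN, mem_ofPred_eq, not_not] at hxN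
      exact hxN (hle x hx.1))
  have hsum := tsum_volume_stopping_le hc (fun p hp => (hu p hp).2.2.1) hdisj
  have := hc.to_subtype
  have hloc : ∀ p ∈ u, volume ({x | 3 * l < g x} ∩ closedBall p.1 (5 * p.2)) ≤
      (A * γ : ℝ≥0) * volume (closedBall p.1 (5 * p.2)) := by
    intro p hp
    obtain ⟨⟨⟨-, hG⟩, -⟩, hr, -, hR⟩ := hu p hp
    have hr5 : 0 < 5 * p.2 := by positivity
    set B := closedBall p.1 (5 * p.2) with hB
    have hB0 : volume B ≠ 0 := volume_closedBall_ne_zero _ hr5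
    have hBt : volume B ≠ ∞ := volume_closedBall_ne_top _ _
    obtain ⟨c, e, hae, hweak⟩ := hW p.1 (5 * p.2) hr5
    have hpB : p.1 ∈ closedBall p.1 (5 * p.2) := mem_closedBall_self hr5.le
    have hw1 : volume {x ∈ B | l < e x} ≤ (A * γ : ℝ≥0) * volume B := by
      have h := hweak l hl0 hltop p.1 hpB
      rw [← ENNReal.mul_le_mul_iff_right hl0 hltop]
      calc l * volume {x ∈ B | l < e x} ≤ A * volume B * G p.1 := h
        _ ≤ A * volume B * (γ * l) := by gcongr
        _ = l * ((A * γ : ℝ≥0) * volume B) := by push_cast; ring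
    -- At height l/2 the bad fraction is 2Aγ ≤ 1/4, by the assumption 8Aγ ≤ 1.
    have hw2 : volume {x ∈ B | l / 2 < e x} ≤ 4⁻¹ * volume B := by
      have h := hweak (l / 2) (by simp [hl0]) (ENNReal.div_ne_top hltop (by simp)) p.1 hpB
      have h3 : (2 * (A * γ : ℝ≥0) : ℝ≥0∞) ≤ 4⁻¹ := by
        have : 2 * (A * γ) ≤ (4⁻¹ : ℝ≥0) := by
          rw [← mul_le_mul_iff_right₀ (by norm_num : (0 : ℝ≥0) < 4)]
          calc 4 * (2 * (A * γ)) = 8 * A * γ := by ring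
            _ ≤ 1 := hAγ
            _ = 4 * 4⁻¹ := by norm_num
        have h4 := ENNReal.coe_le_coe.2 this
        rw [ENNReal.coe_inv (by norm_num)] at h4
        simpa using h4
      have hl2 : l / 2 * 2 = l := ENNReal.div_mul_cancel (by simp) (by simp)
      have : volume {x ∈ B | l / 2 < e x} ≤ 2 * (A * γ : ℝ≥0) * volume B := by
        rw [← ENNReal.mul_le_mul_iff_right (a := l / 2) (by simp [hl0])
          (ENNReal.div_ne_top hltop (by simp))]
        calc l / 2 * volume {x ∈ B | l / 2 < e x} ≤ A * volume B * G p.1 := h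
          _ ≤ A * volume B * (γ * l) := by gcongr
          _ = A * volume B * (γ * (l / 2 * 2)) := by rw [hl2]
          _ = l / 2 * (2 * (A * γ : ℝ≥0) * volume B) := by push_cast; ring
      exact this.trans (by gcongr)
    have hν2 : volume (E ∩ B) ≤ 2⁻¹ * volume B := by
      have := hR (5 * p.2) (by linarith)
      rwa [hν, Measure.restrict_apply measurableSet_closedBall, inter_comm] at this
    -- The sets {g > l} and {e > l/2} fill at most 1/2 + 1/4 of the ball, so a point outside both
    -- exists and bounds c.
    have hc' : c ≤ l + l / 2 := by
      by_contra! hcon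
      set M : Set (Rn n) := {x | ¬ (x ∈ closedBall p.1 (5 * p.2) → g x ≤ c + e x ∧ c ≤ g x + e x)}
      have hM0 : volume M = 0 := hae
      have hsubB : B ⊆ (E ∩ B) ∪ {x ∈ B | l / 2 < e x} ∪ M := by
        intro x hxB
        by_contra hx
        simp only [mem_union, not_or, M, mem_ofPred_eq, not_not] at hx
        obtain ⟨⟨h1, h2⟩, h3⟩ := hx
        have hgl : g x ≤ l := not_lt.1 fun h => h1 ⟨h, hxB⟩
        have hel : e x ≤ l / 2 := not_lt.1 fun h => h2 ⟨hxB, h⟩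
        exact absurd ((h3 hxB).2.trans (add_le_add hgl hel)) (not_le.2 hcon)
      have h1 : volume B ≤ (2⁻¹ + 4⁻¹ : ℝ≥0∞) * volume B := by
        calc volume B ≤ volume ((E ∩ B) ∪ {x ∈ B | l / 2 < e x} ∪ M) := measure_mono hsubB
          _ ≤ volume (E ∩ B) + volume {x ∈ B | l / 2 < e x} + volume M :=
              (measure_union_le _ _).trans (add_le_add_left (measure_union_le _ _) _)
          _ ≤ 2⁻¹ * volume B + 4⁻¹ * volume B + 0 := by rw [hM0]; gcongr
          _ = _ := by rw [add_zero, add_mul]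
      have h2 : (2⁻¹ + 4⁻¹ : ℝ≥0∞) * volume B < 1 * volume B := by
        refine ENNReal.mul_lt_mul_left hB0 hBt ?_
        have : (2⁻¹ + 4⁻¹ : ℝ≥0∞) = ENNReal.ofReal (3 / 4) := by
          rw [show (3 / 4 : ℝ) = 2⁻¹ + 4⁻¹ by norm_num,
            ENNReal.ofReal_add (by norm_num) (by norm_num),
            ENNReal.ofReal_inv_of_pos (by norm_num), ENNReal.ofReal_inv_of_pos (by norm_num)]
          simp
        rw [this, ← ENNReal.ofReal_one]
        exact (ENNReal.ofReal_lt_ofReal_iff (by norm_num)).2 (by norm_num)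
      rw [one_mul] at h2
      exact absurd h1 (not_le.2 h2)
    have hsub : ({x | 3 * l < g x} ∩ B : Set (Rn n)) ≤ᵐ[volume] {x ∈ B | l < e x} := by
      filter_upwards [hae] with x hx hx3
      refine ⟨hx3.2, ?_⟩
      by_contra! hel
      have h1 := (hx hx3.2).1.trans (add_le_add hc' hel)
      have h2 : l + l / 2 + l ≤ 3 * l := by
        calc l + l / 2 + l ≤ l + l + l := by gcongr; exact ENNReal.half_le_self
          _ = 3 * l := by ring
      exact absurd (h1.trans h2) (not_le.2 hx3.1)
    exact (measure_mono_ae hsub).trans hw1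
  calc volume {x | 3 * l < g x ∧ G x ≤ γ * l}
      ≤ volume (⋃ p : u, {x | 3 * l < g x} ∩ closedBall p.1.1 (5 * p.1.2)) + volume N := by
        refine (measure_mono ?_).trans (measure_union_le _ _)
        intro x hx
        by_cases hxN : x ∈ N
        · exact Or.inr hxN
        · obtain ⟨p, hp, hxp⟩ := mem_iUnion₂.1 (hcov ⟨hx, hxN⟩)
          exact Or.inl (mem_iUnion.2 ⟨⟨p, hp⟩, hx.1, hxp⟩)
    _ ≤ ∑' p : u, (A * γ : ℝ≥0) * volume (closedBall p.1.1 (5 * p.1.2)) := by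
        rw [hN0, add_zero]
        exact (measure_iUnion_le _).trans (ENNReal.tsum_le_tsum fun p => hloc p.1 p.2)
    _ = (2 * 5 ^ n * A * γ : ℝ≥0) * (2⁻¹ * ∑' p : u, volume (closedBall p.1.1 p.1.2)) := by
        have h1 : ∀ p : u, volume (closedBall p.1.1 (5 * p.1.2)) =
            5 ^ n * volume (closedBall p.1.1 p.1.2) := fun p => by
          rw [volume_closedBall_mul p.1.1 _ (hu p.1 p.2).2.1.le (by norm_num)]
          congr 1
          rw [ENNReal.ofReal_pow (by norm_num), ENNReal.ofReal_ofNat]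
        simp_rw [h1, ENNReal.tsum_mul_left]
        push_cast
        have : (2 : ℝ≥0∞) * 2⁻¹ = 1 := ENNReal.mul_inv_cancel (by simp) (by simp)
        calc _ = (2 * 2⁻¹) * (A * γ * (5 ^ n * ∑' p : u, volume (closedBall p.1.1 p.1.2))) := by
              rw [this, one_mul]
          _ = _ := by ring
    _ ≤ (2 * 5 ^ n * A * γ : ℝ≥0) * volume E := by rw [← hνE]; gcongr

/-- A function with controlled weak oscillation which is in weak `L¹` is bounded in `Lᵖ` by its
controlling function. -/
lemma WeakOscillation.lintegral_rpow_le {n : ℕ} [NeZero n] (A : ℝ≥0) {p : ℝ} (hp : 1 < p) :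
    ∃ C : ℝ≥0, 0 < C ∧ ∀ g G : Rn n → ℝ≥0∞, Measurable g → Measurable G →
      WeakOscillation A g G →
      (∃ D : ℝ≥0∞, D ≠ ∞ ∧ ∀ t : ℝ, 0 < t →
        ENNReal.ofReal t * volume {x | ENNReal.ofReal t < g x} ≤ D) →
      ∫⁻ x, g x ^ p ≤ C * ∫⁻ x, G x ^ p := by
  have hp0 : 0 < p := by linarith
  have hp1 : 0 < p - 1 := by linarith
  obtain ⟨γ, hγ0, hγ1, hγ2⟩ : ∃ γ : ℝ≥0, 0 < γ ∧ 8 * A * γ ≤ 1 ∧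
      3 ^ p * (2 * 5 ^ n * A * γ) ≤ 2⁻¹ := by
    -- The three summands serve, in turn, 8Aγ ≤ 1, the absorption condition 3^p ε ≤ 1/2 with ε =
    -- 2·5ⁿAγ, and positivity of M.
    set M : ℝ≥0 := 8 * A + 2 * (3 ^ p * (2 * 5 ^ n * A)) + 1 with hM
    have hM0 : 0 < M := by positivity
    refine ⟨M⁻¹, by positivity, ?_, ?_⟩
    · rw [← div_eq_mul_inv, div_le_one hM0, hM, add_assoc]
      exact le_self_add
    · rw [← mul_assoc, ← div_eq_mul_inv, div_le_iff₀ hM0,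
        ← mul_le_mul_iff_right₀ (by norm_num : (0 : ℝ≥0) < 2), ← mul_assoc (2 : ℝ≥0) 2⁻¹,
        mul_inv_cancel₀ (by norm_num), one_mul, hM]
      exact (le_add_self).trans le_self_add
  refine ⟨2 * (3 * γ⁻¹) ^ p, by positivity, fun g G hg hG hW ⟨D, hD, hweak⟩ => ?_⟩
  have hfin : ∀ t : ℝ, 0 < t → volume {x | ENNReal.ofReal t < g x} ≠ ∞ := by
    intro t ht h
    have := hweak t ht
    rw [h, ENNReal.mul_top (by simpa using ht)] at this
    exact hD (top_le_iff.1 this)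
  set ε : ℝ≥0 := 2 * 5 ^ n * A * γ with hε
  -- the truncated functions
  have key : ∀ K : ℕ, ∫⁻ x, (min (g x) (ENNReal.ofReal K)) ^ p ≤
      (2 * (3 * γ⁻¹) ^ p : ℝ≥0) * ∫⁻ x, G x ^ p := by
    intro K
    set gK : Rn n → ℝ≥0∞ := fun x => min (g x) (ENNReal.ofReal K) with hgK
    have hgKm : Measurable gK := hg.min measurable_const
    -- Weak L¹ bounds the layer-cake integrand by D t^{p-2} on (0, K), which is integrable since p >
    -- 1. Finiteness is what permits absorbing the term on the left below; it is the reason for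
    -- truncating at K.
    have hfinK : ∫⁻ x, gK x ^ p ≠ ∞ := by
      rw [lintegral_rpow_eq_layer hgKm hp0]
      refine ENNReal.mul_ne_top ENNReal.ofReal_ne_top (ne_top_of_le_ne_top ?_ (b := D *
        ∫⁻ t in Ioi (0 : ℝ), {t : ℝ | ENNReal.ofReal t < ENNReal.ofReal K}.indicator
          (fun t => ENNReal.ofReal (t ^ (p - 1 - 1))) t) ?_)
      · refine ENNReal.mul_ne_top hD fun h => ?_
        have h2 := lintegral_Ioi_layer hp1 (ENNReal.ofReal K)
        rw [h, ENNReal.mul_top (by simpa using hp1)] at h2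
        exact ENNReal.rpow_ne_top_of_nonneg hp1.le ENNReal.ofReal_ne_top h2.symm
      · rw [← lintegral_const_mul' _ _ hD]
        refine setLIntegral_mono' measurableSet_Ioi fun t ht => ?_
        have ht0 : (0 : ℝ) < t := ht
        by_cases htK : ENNReal.ofReal t < ENNReal.ofReal K
        · rw [indicator_of_mem (by exact htK)]
          have e : t ^ (p - 1) = t ^ (p - 1 - 1) * t := by
            rw [Real.rpow_sub_one ht0.ne' (p - 1)]; field_simp
          rw [e, ENNReal.ofReal_mul (by positivity), mul_assoc, mul_comm D]
          gcongr
          refine le_trans ?_ (hweak t ht0)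
          gcongr with x
          exact min_le_left _ _
        · have : {x | ENNReal.ofReal t < gK x} = ∅ := by
            ext x; simp only [mem_ofPred_eq, mem_empty_iff_false, iff_false, not_lt]
            exact (min_le_right _ _).trans (not_lt.1 htK)
          rw [this]; simp
    have hdist : ∀ t ∈ Ioi (0 : ℝ), ENNReal.ofReal (t ^ (p - 1)) *
        volume {x | ENNReal.ofReal t < 3⁻¹ * gK x} ≤
        ε * (ENNReal.ofReal (t ^ (p - 1)) * volume {x | ENNReal.ofReal t < gK x}) +
        ENNReal.ofReal (t ^ (p - 1)) * volume {x | ENNReal.ofReal t < γ⁻¹ * G x} := by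
      intro t ht
      have ht0 : (0 : ℝ) < t := ht
      rw [mul_left_comm, ← mul_add]
      gcongr
      have h3 : ∀ x, ENNReal.ofReal t < 3⁻¹ * gK x ↔ 3 * ENNReal.ofReal t < gK x := by
        intro x
        rw [mul_comm, ← div_eq_mul_inv, ENNReal.lt_div_iff_mul_lt (by simp) (by simp), mul_comm]
      have hγG : ∀ x, ¬ ENNReal.ofReal t < γ⁻¹ * G x → G x ≤ γ * ENNReal.ofReal t := by
        intro x hx
        rw [not_lt, ENNReal.coe_inv hγ0.ne', mul_comm, ← div_eq_mul_inv,
          ENNReal.div_le_iff_le_mul (by simp [hγ0.ne']) (by simp)] at hx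
        rwa [mul_comm]
      -- Below the truncation the level sets of g and of its truncation agree; once 3t ≥ K the
      -- left-hand set is empty.
      by_cases htK : 3 * ENNReal.ofReal t < ENNReal.ofReal K
      · have hgood := hW.good_lambda hg hγ1 (l := ENNReal.ofReal t) (by simpa using ht0)
          ENNReal.ofReal_ne_top (hfin t ht0)
        have htK' : ENNReal.ofReal t < ENNReal.ofReal K := by
          refine lt_of_le_of_lt ?_ htK
          calc ENNReal.ofReal t = 1 * ENNReal.ofReal t := (one_mul _).symm
            _ ≤ _ := by gcongr; norm_num
        have e1 : {x | ENNReal.ofReal t < g x} = {x | ENNReal.ofReal t < gK x} := by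
          ext x; simp only [hgK, mem_ofPred_eq, lt_min_iff, and_iff_left htK']
        rw [e1] at hgood
        calc volume {x | ENNReal.ofReal t < 3⁻¹ * gK x}
            ≤ volume ({x | 3 * ENNReal.ofReal t < g x ∧ G x ≤ γ * ENNReal.ofReal t} ∪
                {x | ENNReal.ofReal t < γ⁻¹ * G x}) := by
              refine measure_mono fun x hx => ?_
              by_cases hx2 : ENNReal.ofReal t < γ⁻¹ * G x
              · exact Or.inr hx2
              · exact Or.inl ⟨((h3 x).1 hx).trans_le (min_le_left _ _), hγG x hx2⟩
          _ ≤ _ := (measure_union_le _ _).trans (add_le_add_left hgood _)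
      · have : {x | ENNReal.ofReal t < 3⁻¹ * gK x} = ∅ := by
          ext x; simp only [mem_ofPred_eq, mem_empty_iff_false, iff_false, h3 x, not_lt]
          exact (min_le_right _ _).trans (not_lt.1 htK)
        rw [this, measure_empty]; exact zero_le
    have h1 : ∫⁻ x, (3⁻¹ * gK x) ^ p ≤ ε * (∫⁻ x, gK x ^ p) + ∫⁻ x, (γ⁻¹ * G x) ^ p := by
      have L1 := lintegral_rpow_eq_layer (μ := (volume : Measure (Rn n)))
        (hgKm.const_mul 3⁻¹) hp0
      have L2 := lintegral_rpow_eq_layer (μ := (volume : Measure (Rn n))) hgKm hp0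
      have L3 := lintegral_rpow_eq_layer (μ := (volume : Measure (Rn n)))
        (hG.const_mul (γ⁻¹ : ℝ≥0)) hp0
      rw [L1, L2, L3, mul_left_comm, ← mul_add]
      gcongr ENNReal.ofReal p * ?_
      rw [← lintegral_const_mul' _ _ ENNReal.coe_ne_top]
      calc _ ≤ _ := setLIntegral_mono' measurableSet_Ioi hdist
        _ = _ := by
          refine lintegral_add_right' _ (AEMeasurable.mul (by fun_prop) ?_)
          -- A distribution function is antitone in t, hence measurable.
          have hanti : Antitone fun t : ℝ => volume {x | ENNReal.ofReal t < γ⁻¹ * G x} := by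
            intro s t hst
            refine measure_mono fun x hx => ?_
            exact (ENNReal.ofReal_le_ofReal hst).trans_lt hx
          exact hanti.measurable.aemeasurable
    have h3p : (3 : ℝ≥0∞) ^ p = ((3 ^ p : ℝ≥0) : ℝ≥0∞) := by
      rw [ENNReal.coe_rpow_of_nonneg _ hp0.le]; norm_num
    have h2 : ∫⁻ x, gK x ^ p = (3 ^ p : ℝ≥0) * ∫⁻ x, (3⁻¹ * gK x) ^ p := by
      rw [← h3p, ← lintegral_const_mul' _ _ (ENNReal.rpow_ne_top_of_nonneg hp0.le (by simp))]
      refine lintegral_congr fun x => ?_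
      rw [← ENNReal.mul_rpow_of_nonneg _ _ hp0.le, ← mul_assoc,
        ENNReal.mul_inv_cancel (by simp) (by simp), one_mul]
    have h4 : ∫⁻ x, (γ⁻¹ * G x) ^ p = (γ⁻¹ ^ p : ℝ≥0) * ∫⁻ x, G x ^ p := by
      rw [← lintegral_const_mul' _ _ ENNReal.coe_ne_top]
      refine lintegral_congr fun x => ?_
      rw [ENNReal.mul_rpow_of_nonneg _ _ hp0.le, ENNReal.coe_rpow_of_nonneg _ hp0.le,
        ENNReal.coe_inv hγ0.ne']
    set I := ∫⁻ x, gK x ^ p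
    set J := ∫⁻ x, G x ^ p
    have h5 : I ≤ 2⁻¹ * I + ((3 ^ p * γ⁻¹ ^ p : ℝ≥0) : ℝ≥0∞) * J := by
      calc I = (3 ^ p : ℝ≥0) * ∫⁻ x, (3⁻¹ * gK x) ^ p := h2
        _ ≤ (3 ^ p : ℝ≥0) * (ε * I + (γ⁻¹ ^ p : ℝ≥0) * J) := by rw [← h4]; gcongr
        _ = ((3 ^ p * ε : ℝ≥0) : ℝ≥0∞) * I + ((3 ^ p * γ⁻¹ ^ p : ℝ≥0) : ℝ≥0∞) * J := by
            push_cast; ring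
        _ ≤ ((2⁻¹ : ℝ≥0) : ℝ≥0∞) * I + ((3 ^ p * γ⁻¹ ^ p : ℝ≥0) : ℝ≥0∞) * J := by
            gcongr
        _ = _ := by simp
    -- Half of the finite integral I is absorbed.
    have h6 : 2⁻¹ * I ≤ ((3 ^ p * γ⁻¹ ^ p : ℝ≥0) : ℝ≥0∞) * J := by
      have hI2 : I = 2⁻¹ * I + 2⁻¹ * I := by rw [← add_mul, ENNReal.inv_two_add_inv_two, one_mul]
      have hne : 2⁻¹ * I ≠ ∞ := ENNReal.mul_ne_top (by simp) hfinK
      rw [← ENNReal.add_le_add_iff_left hne]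
      calc _ = I := hI2.symm
        _ ≤ _ := h5
    calc I = 2 * (2⁻¹ * I) := by
          rw [← mul_assoc, ENNReal.mul_inv_cancel (by simp) (by simp), one_mul]
      _ ≤ 2 * (((3 ^ p * γ⁻¹ ^ p : ℝ≥0) : ℝ≥0∞) * J) := by gcongr
      _ = _ := by rw [NNReal.mul_rpow]; push_cast; ring
  -- remove the truncation
  have hlim : ∫⁻ x, g x ^ p = ⨆ K : ℕ, ∫⁻ x, (min (g x) (ENNReal.ofReal K)) ^ p := by
    rw [← lintegral_iSup]
    · refine lintegral_congr fun x => ?_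
      refine le_antisymm ?_ (iSup_le fun K => by gcongr; exact min_le_left _ _)
      have ht : Tendsto (fun K : ℕ => (min (g x) (ENNReal.ofReal K)) ^ p) atTop (𝓝 (g x ^ p)) := by
        refine (ENNReal.continuous_rpow_const.tendsto _).comp ?_
        have h1 : Tendsto (fun K : ℕ => ENNReal.ofReal K) atTop (𝓝 ∞) :=
          ENNReal.tendsto_ofReal_atTop.comp tendsto_natCast_atTop_atTop
        simpa using (tendsto_const_nhds (x := g x)).min h1
      exact le_of_tendsto' ht fun K => le_iSup (fun K : ℕ => (min (g x) (ENNReal.ofReal K)) ^ p) K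
    · intro K; exact (hg.min measurable_const).pow_const _
    · intro K L hKL x
      dsimp only
      gcongr
  rw [hlim]
  exact iSup_le key

/-! ### Kernels homogeneous of degree `1 - n` -/

/-- Size, smoothness and cancellation conditions satisfied by `k(y) = Ω(y) / |y|^{n-1}`. -/
structure RoughKernel {n : ℕ} (β D : ℝ) (k : Rn n → ℂ) : Prop where
  beta_pos : 0 < β
  beta_lt_one : β < 1
  pos : 0 < D
  measurable : Measurable k
  size : ∀ y, ‖k y‖ ≤ D * ‖y‖ ^ (-((n : ℝ) - 1))
  regular : ∀ u h, u ≠ 0 → 2 * ‖h‖ ≤ ‖u‖ →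
    ‖k (u + h) - k u‖ ≤ D * ((‖h‖ / ‖u‖) ^ β * ‖u‖ ^ (-((n : ℝ) - 1)))
  integral_zero : ∀ t, ∫ y in closedBall 0 t, k y = 0

/-- Split the change into a change of the normalizing factor applied to u + h, and h divided by |u|;
each is at most |h|/|u|. This turns the spherical Hölder condition on Ω into one on ℝⁿ. -/
lemma norm_normalize_sub_le {E : Type*} [NormedAddCommGroup E] [NormedSpace ℝ E] {u h : E}
    (hu : u ≠ 0) (huh : u + h ≠ 0) :
    ‖‖u + h‖⁻¹ • (u + h) - ‖u‖⁻¹ • u‖ ≤ 2 * (‖h‖ / ‖u‖) := by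
  have hu0 : 0 < ‖u‖ := norm_pos_iff.2 hu
  have hv0 : 0 < ‖u + h‖ := norm_pos_iff.2 huh
  have e : ‖u + h‖⁻¹ • (u + h) - ‖u‖⁻¹ • u =
      (‖u + h‖⁻¹ - ‖u‖⁻¹) • (u + h) + ‖u‖⁻¹ • h := by
    rw [sub_smul, smul_add ‖u‖⁻¹]; abel
  have h1 : |‖u + h‖⁻¹ - ‖u‖⁻¹| * ‖u + h‖ ≤ ‖h‖ / ‖u‖ := by
    have : (‖u + h‖⁻¹ - ‖u‖⁻¹) * ‖u + h‖ = (‖u‖ - ‖u + h‖) / ‖u‖ := by field_simp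
    rw [← abs_of_pos hv0, ← abs_mul, abs_of_pos hv0, this, abs_div, abs_of_pos hu0]
    gcongr
    calc |‖u‖ - ‖u + h‖| ≤ ‖u - (u + h)‖ := abs_norm_sub_norm_le _ _
      _ = ‖h‖ := by rw [sub_add_cancel_left, norm_neg]
  calc _ ≤ ‖(‖u + h‖⁻¹ - ‖u‖⁻¹) • (u + h)‖ + ‖‖u‖⁻¹ • h‖ := by rw [e]; exact norm_add_le _ _
    _ ≤ ‖h‖ / ‖u‖ + ‖h‖ / ‖u‖ := by
        rw [norm_smul, norm_smul, Real.norm_eq_abs, norm_inv, norm_norm]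
        gcongr
        rw [inv_mul_eq_div]
    _ = _ := by ring

/-- Since d ≤ b/2, the number a is at least b/2, so both reciprocals are at most 2/b and the
difference of N-th powers factors. -/
lemma abs_inv_pow_sub_le {a b d : ℝ} (N : ℕ) (hb : 0 < b) (hd : 2 * d ≤ b)
    (hab : |a - b| ≤ d) : |(a ^ N)⁻¹ - (b ^ N)⁻¹| ≤ N * 2 ^ N * (d / b) * (b ^ N)⁻¹ := by
  have ha : b / 2 ≤ a := by have := abs_le.1 hab; linarith
  have ha0 : 0 < a := by linarith
  have hd0 : 0 ≤ d := (abs_nonneg _).trans hab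
  rcases Nat.eq_zero_or_pos N with rfl | hN
  · simp
  have h1 := abs_pow_sub_pow_le a⁻¹ b⁻¹ N
  rw [inv_pow, inv_pow] at h1
  have ha' : a⁻¹ ≤ 2 / b := by
    rw [inv_eq_one_div, div_le_div_iff₀ ha0 hb]; linarith
  have hb' : b⁻¹ ≤ 2 / b := by
    rw [inv_eq_one_div]; gcongr; norm_num
  have h2 : |a⁻¹ - b⁻¹| ≤ 2 * (d / b) * b⁻¹ := by
    have : a⁻¹ - b⁻¹ = (b - a) * (a⁻¹ * b⁻¹) := by field_simp
    rw [this, abs_mul, abs_sub_comm, abs_of_pos (by positivity : 0 < a⁻¹ * b⁻¹)]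
    calc |a - b| * (a⁻¹ * b⁻¹) ≤ d * (2 / b * b⁻¹) := by gcongr
      _ = _ := by ring
  calc |(a ^ N)⁻¹ - (b ^ N)⁻¹| ≤ |a⁻¹ - b⁻¹| * N * max |a⁻¹| |b⁻¹| ^ (N - 1) := h1
    _ ≤ (2 * (d / b) * b⁻¹) * N * (2 / b) ^ (N - 1) := by
        gcongr
        rw [abs_of_pos (by positivity), abs_of_pos (by positivity)]
        exact max_le ha' hb'
    _ = N * 2 ^ N * (d / b) * (b ^ N)⁻¹ := by
        obtain ⟨M, rfl⟩ := Nat.exists_eq_succ_of_ne_zero hN.ne'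
        rw [Nat.succ_sub_one, div_pow, pow_succ (2 : ℝ) M, pow_succ b M, mul_inv]
        field_simp

lemma inv_pow_eq_rpow {n : ℕ} (hn : 1 ≤ n) {r : ℝ} (hr : 0 ≤ r) :
    (r ^ (n - 1))⁻¹ = r ^ (-((n : ℝ) - 1)) := by
  rw [Real.rpow_neg hr, ← Real.rpow_natCast, Nat.cast_sub hn, Nat.cast_one]

/-- In polar coordinates the integral factors into the spherical mean of `Om`, which vanishes, and a
radial integral. The product formula needs no integrability, so φ is arbitrary. -/
lemma integral_closedBall_homogeneous {n : ℕ} [NeZero n] {Om : Rn n → ℂ}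
    (hhom : ∀ (l : ℝ) (y : Rn n), 0 < l → Om (l • y) = Om y)
    (hv : ∫ y : sphere (0 : Rn n) 1, Om y ∂((volume : Measure (Rn n)).toSphere) = 0)
    (φ : ℝ → ℂ) (t : ℝ) :
    ∫ y in closedBall (0 : Rn n) t, Om y * φ ‖y‖ = 0 := by
  set F : Rn n → ℂ := (closedBall (0 : Rn n) t).indicator fun y => Om y * φ ‖y‖ with hF
  rw [← integral_indicator measurableSet_closedBall]
  have h1 : ∫ x, F x = ∫ x : ({(0)}ᶜ : Set (Rn n)), F x ∂((volume : Measure (Rn n)).comap (↑)) := by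
    rw [integral_subtype_comap (measurableSet_singleton _).compl F, restrict_compl_singleton]
  have h2 := (volume : Measure (Rn n)).measurePreserving_homeomorphUnitSphereProd.integral_comp
    (Homeomorph.measurableEmbedding _)
    (fun q : sphere (0 : Rn n) 1 × Ioi (0 : ℝ) => Om q.1 * ((Iic t).indicator φ q.2))
  have h3 : ∀ x : ({(0)}ᶜ : Set (Rn n)), F x =
      (fun q : sphere (0 : Rn n) 1 × Ioi (0 : ℝ) => Om q.1 * ((Iic t).indicator φ q.2))
        (homeomorphUnitSphereProd (Rn n) x) := by
    intro x
    have hx : (0 : ℝ) < ‖(x : Rn n)‖ := norm_pos_iff.2 x.2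
    have hOm : Om (((homeomorphUnitSphereProd (Rn n) x).1 : sphere (0 : Rn n) 1) : Rn n) =
        Om x := by
      rw [homeomorphUnitSphereProd_apply_fst_coe, hhom _ _ (inv_pos.2 hx)]
    simp only [hOm, homeomorphUnitSphereProd_apply_snd_coe]
    by_cases hxt : ‖(x : Rn n)‖ ≤ t
    · rw [hF, indicator_of_mem (by simpa using hxt), indicator_of_mem (by simpa using hxt)]
    · rw [hF, indicator_of_notMem (by simpa using hxt), indicator_of_notMem (by simpa using hxt),
        mul_zero]
  change ∫ x, F x = 0
  rw [h1]
  simp_rw [h3]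
  rw [h2, integral_prod_mul (fun x : sphere (0 : Rn n) 1 => Om x)
    (fun r : Ioi (0 : ℝ) => (Iic t).indicator φ r), hv, zero_mul]

/-- Comparison with one fixed direction bounds Ω, and the Hölder condition gives continuity off the
origin, hence measurability. The increment of the kernel is an increment of Ω plus an increment of
|y|^{1-n}; the latter is Lipschitz in |h|/|u| ≤ 1 and therefore also of order β. -/
lemma IsKernel.exists_roughKernel {n : ℕ} [NeZero n] {β : ℝ} (hβ0 : 0 < β) (hβ1 : β < 1)
    {Om : Rn n → ℂ} (h : IsKernel β Om) :
    ∃ D, RoughKernel β D (fun y => Om y / ((‖y‖ ^ (n - 1) : ℝ) : ℂ)) := by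
  have hn : 1 ≤ n := Nat.one_le_iff_ne_zero.2 (NeZero.ne n)
  obtain ⟨C, hC, hLip⟩ := h.lipschitz
  obtain ⟨e, he⟩ : ∃ e : Rn n, e ≠ 0 := exists_ne 0
  -- The Hölder condition says nothing at the origin, and for n = 1 the kernel takes the value Ω(0)
  -- there, so that value enters the bound separately.
  set M : ℝ := max ‖Om 0‖ (‖Om e‖ + C * 2 ^ β) with hM
  have hM0 : 0 < M := lt_max_of_lt_right (by positivity)
  have hbd : ∀ y, ‖Om y‖ ≤ M := by
    intro y
    by_cases hy : y = 0
    · rw [hy]; exact le_max_left _ _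
    · refine le_trans ?_ (le_max_right _ _)
      have hs : ‖‖y‖⁻¹ • y - ‖e‖⁻¹ • e‖ ≤ 2 := by
        refine (norm_sub_le _ _).trans ?_
        rw [norm_smul, norm_smul, norm_inv, norm_inv, norm_norm, norm_norm,
          inv_mul_cancel₀ (norm_ne_zero_iff.2 hy), inv_mul_cancel₀ (norm_ne_zero_iff.2 he)]
        norm_num
      calc ‖Om y‖ = ‖Om e + (Om y - Om e)‖ := by congr 1; ring
        _ ≤ ‖Om e‖ + ‖Om y - Om e‖ := norm_add_le _ _
        _ ≤ ‖Om e‖ + C * ‖‖y‖⁻¹ • y - ‖e‖⁻¹ • e‖ ^ β := by gcongr; exact hLip y e hy he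
        _ ≤ ‖Om e‖ + C * 2 ^ β := by gcongr
  have hOmm : Measurable Om := by
    refine measurable_of_continuousOn_compl_singleton 0 fun ξ hξ => ?_
    have hξ0 : ξ ≠ 0 := hξ
    have hc : ContinuousAt (fun η : Rn n => C * ‖‖η‖⁻¹ • η - ‖ξ‖⁻¹ • ξ‖ ^ β) ξ := by
      refine continuousAt_const.mul (ContinuousAt.rpow_const ?_ (Or.inr hβ0.le))
      refine ContinuousAt.norm (ContinuousAt.sub ?_ continuousAt_const)
      exact (continuousAt_id.norm.inv₀ (norm_ne_zero_iff.2 hξ0)).smul continuousAt_id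
    have hc0 : Tendsto (fun η : Rn n => C * ‖‖η‖⁻¹ • η - ‖ξ‖⁻¹ • ξ‖ ^ β) (𝓝[{0}ᶜ] ξ) (𝓝 0) := by
      have := hc.tendsto.mono_left (nhdsWithin_le_nhds (s := {0}ᶜ))
      simpa [Real.zero_rpow hβ0.ne'] using this
    refine tendsto_iff_norm_sub_tendsto_zero.2 (squeeze_zero' (Eventually.of_forall fun _ =>
      norm_nonneg _) ?_ hc0)
    filter_upwards [self_mem_nhdsWithin] with η hη using hLip η ξ hη hξ0
  -- The first two terms give the regularity constant, the last one the size constant.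
  refine ⟨C * 2 ^ β * 2 ^ (n - 1) + M * ((n - 1 : ℕ) * 2 ^ (n - 1)) + M, ⟨hβ0, hβ1, by positivity,
    ?_, ?_, ?_, ?_⟩⟩
  · exact hOmm.div (by fun_prop)
  · intro y
    rw [← inv_pow_eq_rpow hn (norm_nonneg y), norm_div, div_eq_mul_inv, Complex.norm_real,
      Real.norm_of_nonneg (by positivity)]
    gcongr
    refine (hbd y).trans ?_
    have : 0 ≤ C * 2 ^ β * 2 ^ (n - 1) + M * ((n - 1 : ℕ) * 2 ^ (n - 1)) := by positivity
    linarith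
  · intro u h hu hh
    have hu0 : 0 < ‖u‖ := norm_pos_iff.2 hu
    have hle : ‖u‖ / 2 ≤ ‖u + h‖ := by
      have : ‖u‖ ≤ ‖u + h‖ + ‖h‖ := by
        calc ‖u‖ = ‖(u + h) - h‖ := by rw [add_sub_cancel_right]
          _ ≤ _ := norm_sub_le _ _
      linarith
    have huh : u + h ≠ 0 := norm_pos_iff.1 (by linarith)
    have hv0 : 0 < ‖u + h‖ := norm_pos_iff.2 huh
    set q := ‖h‖ / ‖u‖ with hq
    have hq0 : 0 ≤ q := by positivity
    have hq1 : q ≤ 1 := by rw [hq, div_le_one hu0]; linarith [norm_nonneg h]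
    have hqβ : q ≤ q ^ β := by
      calc q = q ^ (1 : ℝ) := (Real.rpow_one q).symm
        _ ≤ q ^ β := Real.rpow_le_rpow_of_exponent_ge_of_imp hq0 hq1 hβ1.le (by
            intro _ h1; exact absurd h1 one_ne_zero)
    have hinv : (‖u + h‖ ^ (n - 1))⁻¹ ≤ 2 ^ (n - 1) * (‖u‖ ^ (n - 1))⁻¹ := by
      rw [← inv_pow, ← inv_pow, ← mul_pow]
      gcongr
      rw [← inv_inv (2 : ℝ), ← mul_inv]
      apply inv_anti₀ (by positivity); linarith
    have hOmd : ‖Om (u + h) - Om u‖ ≤ C * 2 ^ β * q ^ β := by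
      refine (hLip _ _ huh hu).trans ?_
      rw [mul_assoc, ← Real.mul_rpow (by norm_num) hq0]
      gcongr
      exact norm_normalize_sub_le hu huh
    have hdiff : |(‖u + h‖ ^ (n - 1))⁻¹ - (‖u‖ ^ (n - 1))⁻¹| ≤
        (n - 1 : ℕ) * 2 ^ (n - 1) * q * (‖u‖ ^ (n - 1))⁻¹ := by
      refine abs_inv_pow_sub_le (n - 1) hu0 hh ?_
      calc |‖u + h‖ - ‖u‖| ≤ ‖(u + h) - u‖ := abs_norm_sub_norm_le _ _
        _ = ‖h‖ := by rw [add_sub_cancel_left]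
    have e : Om (u + h) / ((‖u + h‖ ^ (n - 1) : ℝ) : ℂ) - Om u / ((‖u‖ ^ (n - 1) : ℝ) : ℂ) =
        (Om (u + h) - Om u) * (((‖u + h‖ ^ (n - 1))⁻¹ : ℝ) : ℂ) +
        Om u * (((‖u + h‖ ^ (n - 1))⁻¹ - (‖u‖ ^ (n - 1))⁻¹ : ℝ) : ℂ) := by
      push_cast; ring
    rw [← inv_pow_eq_rpow hn (norm_nonneg u)]
    calc _ ≤ ‖Om (u + h) - Om u‖ * (‖u + h‖ ^ (n - 1))⁻¹ +
          ‖Om u‖ * |(‖u + h‖ ^ (n - 1))⁻¹ - (‖u‖ ^ (n - 1))⁻¹| := by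
          rw [e]
          refine (norm_add_le _ _).trans ?_
          rw [norm_mul, norm_mul, Complex.norm_real, Complex.norm_real,
            Real.norm_of_nonneg (by positivity), Real.norm_eq_abs]
      _ ≤ C * 2 ^ β * q ^ β * (2 ^ (n - 1) * (‖u‖ ^ (n - 1))⁻¹) +
          M * ((n - 1 : ℕ) * 2 ^ (n - 1) * q ^ β * (‖u‖ ^ (n - 1))⁻¹) := by
          gcongr
          · exact hbd u
          · exact hdiff.trans (by gcongr)
      _ = (C * 2 ^ β * 2 ^ (n - 1) + M * ((n - 1 : ℕ) * 2 ^ (n - 1))) *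
          (q ^ β * (‖u‖ ^ (n - 1))⁻¹) := by ring
      _ ≤ _ := mul_le_mul_of_nonneg_right (by linarith) (by positivity)
  · intro t
    have := integral_closedBall_homogeneous h.homogeneous h.vanishing
      (fun r => (((r ^ (n - 1))⁻¹ : ℝ) : ℂ)) t
    rw [← this]
    refine integral_congr_ae (Eventually.of_forall fun y => ?_)
    simp only
    push_cast
    rw [div_eq_mul_inv]

/-! ### The measure `dt/t` and the `L²` size with respect to it -/

/-- The measure `dt / t` on `(0, ∞)`. -/
def dtt : Measure ℝ := (volume.restrict (Ioi (0 : ℝ))).withDensity fun t => (ENNReal.ofReal t)⁻¹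

instance : SFinite dtt := by unfold dtt; infer_instance

lemma lintegral_dtt {φ : ℝ → ℝ≥0∞} (hφ : Measurable φ) :
    ∫⁻ t, φ t ∂dtt = ∫⁻ t in Ioi (0 : ℝ), (ENNReal.ofReal t)⁻¹ * φ t := by
  rw [dtt, lintegral_withDensity_eq_lintegral_mul _ (by fun_prop) hφ]
  rfl

lemma ae_dtt_pos : ∀ᵐ t ∂dtt, 0 < t := by
  have h : ∀ᵐ t ∂(volume.restrict (Ioi (0 : ℝ))), 0 < t := ae_restrict_mem measurableSet_Ioi
  exact (withDensity_absolutelyContinuous _ _).ae_le h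

lemma setLIntegral_dtt {φ : ℝ → ℝ≥0∞} (hφ : Measurable φ) {S : Set ℝ} (hS : MeasurableSet S)
    (hpos : S ⊆ Ioi 0) :
    ∫⁻ t in S, φ t ∂dtt = ∫⁻ t in S, (ENNReal.ofReal t)⁻¹ * φ t := by
  rw [dtt, restrict_withDensity hS, Measure.restrict_restrict hS, inter_eq_self_of_subset_left hpos,
    lintegral_withDensity_eq_lintegral_mul _ (by fun_prop) hφ]
  rfl

lemma setLIntegral_Ici_rpow_dtt {a r : ℝ} (ha : 0 < a) (hr : 0 < r) :
    ∫⁻ t in Ici r, ENNReal.ofReal (t ^ (-a)) ∂dtt = ENNReal.ofReal (r ^ (-a) / a) := by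
  have hsub : Ici r ⊆ Ioi 0 := fun t ht => hr.trans_le ht
  rw [setLIntegral_dtt (by fun_prop) measurableSet_Ici hsub]
  have h1 : ∫⁻ t in Ici r, (ENNReal.ofReal t)⁻¹ * ENNReal.ofReal (t ^ (-a)) =
      ∫⁻ t in Ioi r, ENNReal.ofReal (t ^ (-a - 1)) := by
    rw [setLIntegral_congr Ioi_ae_eq_Ici.symm]
    refine setLIntegral_congr_fun measurableSet_Ioi fun t ht => ?_
    have ht0 : 0 < t := hr.trans ht
    rw [← ENNReal.ofReal_inv_of_pos ht0, ← ENNReal.ofReal_mul (by positivity),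
      Real.rpow_sub_one ht0.ne', mul_comm, div_eq_mul_inv]
  rw [h1, ← ofReal_integral_eq_lintegral_ofReal
    ((integrableOn_Ioi_rpow_iff hr).2 (by linarith))
    ((ae_restrict_mem measurableSet_Ioi).mono fun t ht => Real.rpow_nonneg (hr.trans ht).le _),
    integral_Ioi_rpow_of_lt (by linarith) hr]
  congr 1
  rw [sub_add_cancel, neg_div_neg_eq]

lemma setLIntegral_Ioc_rpow_dtt {a r : ℝ} (ha : 0 < a) (hr : 0 < r) :
    ∫⁻ t in Ioc 0 r, ENNReal.ofReal (t ^ a) ∂dtt = ENNReal.ofReal (r ^ a / a) := by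
  rw [setLIntegral_dtt (by fun_prop) measurableSet_Ioc Ioc_subset_Ioi_self]
  have h1 : ∫⁻ t in Ioc 0 r, (ENNReal.ofReal t)⁻¹ * ENNReal.ofReal (t ^ a) =
      ∫⁻ t in Ioc 0 r, ENNReal.ofReal (t ^ (a - 1)) := by
    refine setLIntegral_congr_fun measurableSet_Ioc fun t ht => ?_
    have ht0 : 0 < t := ht.1
    rw [← ENNReal.ofReal_inv_of_pos ht0, ← ENNReal.ofReal_mul (by positivity),
      Real.rpow_sub_one ht0.ne', mul_comm, div_eq_mul_inv]
  have hint : IntervalIntegrable (fun t : ℝ => t ^ (a - 1)) volume 0 r :=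
    intervalIntegral.intervalIntegrable_rpow' (by linarith)
  rw [h1, ← ofReal_integral_eq_lintegral_ofReal
    ((intervalIntegrable_iff_integrableOn_Ioc_of_le hr.le).1 hint)
    ((ae_restrict_mem measurableSet_Ioc).mono fun t ht => Real.rpow_nonneg ht.1.le _),
    ← intervalIntegral.integral_of_le hr.le, integral_rpow (Or.inl (by linarith))]
  congr 1
  rw [sub_add_cancel, Real.zero_rpow ha.ne', sub_zero]

/-- The `L²` size of an extended nonnegative function. -/
def l2 {α : Type*} [MeasurableSpace α] (ν : Measure α) (φ : α → ℝ≥0∞) : ℝ≥0∞ :=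
  (∫⁻ t, φ t ^ 2 ∂ν) ^ (1 / 2 : ℝ)

section l2
variable {α γ : Type*} [MeasurableSpace α] [MeasurableSpace γ] {ν : Measure α} {φ ψ : α → ℝ≥0∞}

lemma sq_rpow_half (c : ℝ≥0∞) : (c ^ 2) ^ (1 / 2 : ℝ) = c := by
  rw [← ENNReal.rpow_natCast, ← ENNReal.rpow_mul]; norm_num

lemma rpow_half_sq (c : ℝ≥0∞) : (c ^ (1 / 2 : ℝ)) ^ 2 = c := by
  rw [← ENNReal.rpow_natCast, ← ENNReal.rpow_mul]; norm_num

lemma l2_sq : l2 ν φ ^ 2 = ∫⁻ t, φ t ^ 2 ∂ν := rpow_half_sq _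

lemma l2_le_iff {c : ℝ≥0∞} : l2 ν φ ≤ c ↔ ∫⁻ t, φ t ^ 2 ∂ν ≤ c ^ 2 := by
  constructor
  · intro h; rw [← l2_sq]; gcongr
  · intro h
    rw [← sq_rpow_half c]
    exact ENNReal.rpow_le_rpow h (by norm_num)

lemma l2_mono_ae (h : ∀ᵐ t ∂ν, φ t ≤ ψ t) : l2 ν φ ≤ l2 ν ψ := by
  refine ENNReal.rpow_le_rpow (lintegral_mono_ae ?_) (by norm_num)
  filter_upwards [h] with t ht
  gcongr

lemma l2_congr_ae (h : ∀ᵐ t ∂ν, φ t = ψ t) : l2 ν φ = l2 ν ψ :=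
  le_antisymm (l2_mono_ae (h.mono fun _ h => h.le)) (l2_mono_ae (h.mono fun _ h => h.ge))

lemma l2_mono_measure {ν' : Measure α} (h : ν ≤ ν') : l2 ν φ ≤ l2 ν' φ :=
  ENNReal.rpow_le_rpow (lintegral_mono' h le_rfl) (by norm_num)

lemma l2_add_le (hφ : AEMeasurable φ ν) (hψ : AEMeasurable ψ ν) :
    l2 ν (fun t => φ t + ψ t) ≤ l2 ν φ + l2 ν ψ := by
  have := ENNReal.lintegral_Lp_add_le hφ hψ (p := 2) (by norm_num)
  simpa [l2, ENNReal.rpow_ofNat] using this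

lemma l2_const_mul {c : ℝ≥0∞} (hc : c ≠ ∞) : l2 ν (fun t => c * φ t) = c * l2 ν φ := by
  simp only [l2, mul_pow]
  rw [lintegral_const_mul' _ _ (by simp [hc]), ENNReal.mul_rpow_of_nonneg _ _ (by norm_num),
    sq_rpow_half]

lemma lintegral_mul_le_l2 (hφ : AEMeasurable φ ν) (hψ : AEMeasurable ψ ν) :
    ∫⁻ t, φ t * ψ t ∂ν ≤ l2 ν φ * l2 ν ψ := by
  have := ENNReal.lintegral_mul_le_Lp_mul_Lq ν Real.HolderConjugate.two_two hφ hψ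
  simpa [l2, ENNReal.rpow_ofNat] using this

/-- Minkowski's integral inequality for the exponent `2`. -/
lemma l2_lintegral_le [SFinite ν] {m : Measure γ} [SFinite m] {Φ : α → γ → ℝ≥0∞}
    (hΦ : Measurable (Function.uncurry Φ)) :
    l2 ν (fun t => ∫⁻ y, Φ t y ∂m) ≤ ∫⁻ y, l2 ν (fun t => Φ t y) ∂m := by
  rw [l2_le_iff]
  have hm1 : ∀ t, Measurable (Φ t) := fun t => hΦ.comp measurable_prodMk_left
  have hm2 : ∀ y, Measurable fun t => Φ t y := fun y => hΦ.comp measurable_prodMk_right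
  have hl2 : Measurable fun y => l2 ν (fun t => Φ t y) := by
    unfold l2
    refine Measurable.pow_const ?_ _
    exact Measurable.lintegral_prod_left' (f := fun q : α × γ => Φ q.1 q.2 ^ 2)
      ((hΦ.pow_const 2))
  -- The square is a double integral in y and y'; after moving the t-integral inside, Cauchy–Schwarz
  -- applies for each pair.
  calc ∫⁻ t, (∫⁻ y, Φ t y ∂m) ^ 2 ∂ν
      = ∫⁻ t, ∫⁻ y, ∫⁻ y', Φ t y * Φ t y' ∂m ∂m ∂ν := by
        refine lintegral_congr fun t => ?_
        simp_rw [lintegral_const_mul _ (hm1 t)]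
        rw [lintegral_mul_const _ (hm1 t), sq]
    _ = ∫⁻ y, ∫⁻ t, ∫⁻ y', Φ t y * Φ t y' ∂m ∂ν ∂m := by
        refine lintegral_lintegral_swap (Measurable.aemeasurable ?_)
        refine Measurable.lintegral_prod_right'
          (f := fun q : (α × γ) × γ => Φ q.1.1 q.1.2 * Φ q.1.1 q.2) ?_
        exact (hΦ.comp (by fun_prop : Measurable fun q : (α × γ) × γ => (q.1.1, q.1.2))).mul
          (hΦ.comp (by fun_prop : Measurable fun q : (α × γ) × γ => (q.1.1, q.2)))
    _ = ∫⁻ y, ∫⁻ y', ∫⁻ t, Φ t y * Φ t y' ∂ν ∂m ∂m := by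
        refine lintegral_congr fun y => ?_
        refine lintegral_lintegral_swap (Measurable.aemeasurable ?_)
        exact (hΦ.comp (by fun_prop : Measurable fun q : α × γ => (q.1, y))).mul hΦ
    _ ≤ ∫⁻ y, ∫⁻ y', l2 ν (fun t => Φ t y) * l2 ν (fun t => Φ t y') ∂m ∂m := by
        gcongr with y y'
        exact lintegral_mul_le_l2 (hm2 y).aemeasurable (hm2 y').aemeasurable
    _ = (∫⁻ y, l2 ν (fun t => Φ t y) ∂m) ^ 2 := by
        simp_rw [lintegral_const_mul _ hl2]
        rw [lintegral_mul_const _ hl2, sq]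

/-- Minkowski's integral inequality for the counting measure. It is used to sum the bad pieces of a
Calderón–Zygmund decomposition. -/
lemma l2_tsum_le [SFinite ν] {ι : Type*} [Countable ι] {Φ : ι → α → ℝ≥0∞}
    (hΦ : ∀ i, Measurable (Φ i)) :
    l2 ν (fun t => ∑' i, Φ i t) ≤ ∑' i, l2 ν (Φ i) := by
  let _ : MeasurableSpace ι := ⊤
  have := l2_lintegral_le (ν := ν) (m := (Measure.count : Measure ι)) (Φ := fun t i => Φ i t)
    (measurable_from_prod_countable_left fun i => hΦ i)
  simpa [lintegral_count] using this

end l2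

/-! ### The truncated kernels -/

/-- The truncated and rescaled kernel `t⁻¹ k(u) 1_{|u| ≤ t}`. -/
def ker {n : ℕ} (k : Rn n → ℂ) (t : ℝ) (u : Rn n) : ℂ :=
  (t : ℂ)⁻¹ * (closedBall (0 : Rn n) t).indicator k u

lemma ker_of_le {n : ℕ} {k : Rn n → ℂ} {t : ℝ} {u : Rn n} (h : ‖u‖ ≤ t) :
    ker k t u = (t : ℂ)⁻¹ * k u := by
  rw [ker, indicator_of_mem (by simpa using h)]

lemma ker_of_lt {n : ℕ} {k : Rn n → ℂ} {t : ℝ} {u : Rn n} (h : t < ‖u‖) : ker k t u = 0 := by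
  rw [ker, indicator_of_notMem (by simpa using h), mul_zero]

lemma lintegral_closedBall_rpow_norm {n : ℕ} [NeZero n] {a : ℝ} (ha : 0 ≤ a) (han : a < n) :
    ∃ C : ℝ≥0, 0 < C ∧ ∀ (x : Rn n) (R : ℝ), 0 < R →
      ∫⁻ y in closedBall x R, ENNReal.ofReal (‖x - y‖ ^ (-a)) ≤
        C * ENNReal.ofReal (R ^ ((n : ℝ) - a)) := by
  obtain ⟨C, hC, h⟩ := lintegral_rpow_near (n := n) ha han
  refine ⟨C * (unitVol n).toNNReal, mul_pos hC (ENNReal.toNNReal_pos (unitVol_ne_zero n)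
    (unitVol_ne_top n)), fun x R hR => ?_⟩
  have := h (fun _ => 1) x (unitVol n) R hR fun s hs _ => by
    rw [setLIntegral_one, volume_closedBall_eq x hs.le, Real.rpow_natCast, mul_comm]
  simpa [ENNReal.coe_toNNReal (unitVol_ne_top n)] using this

/-- A shell of radius t and thickness 2h has volume of order h t^{n-1}. This measures where the
sharp cutoff |u| ≤ t can change under a translation by h. -/
lemma volume_annulus_le (n : ℕ) [NeZero n] : ∃ C : ℝ≥0, 0 < C ∧ ∀ h t : ℝ, 0 ≤ h → 0 < t → 2 * h ≤ t →
    volume {u : Rn n | |‖u‖ - t| ≤ h} ≤ C * ENNReal.ofReal (h / t * t ^ n) := by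
  refine ⟨(2 * n * 2 ^ n + 1) * (unitVol n).toNNReal, mul_pos (by positivity)
    (ENNReal.toNNReal_pos (unitVol_ne_zero n) (unitVol_ne_top n)), fun h t hh ht hht => ?_⟩
  have hsub : {u : Rn n | |‖u‖ - t| ≤ h} ⊆ closedBall 0 (t + h) \ ball 0 (t - h) := by
    intro u hu
    have := abs_le.1 (show |‖u‖ - t| ≤ h from hu)
    simp only [Set.mem_sdiff, mem_closedBall, mem_ball, dist_zero_right, not_lt]
    constructor <;> linarith
  have hpow : (t + h) ^ n - (t - h) ^ n ≤ 2 * n * 2 ^ n * (h / t * t ^ n) := by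
    have h1 := abs_pow_sub_pow_le (t + h) (t - h) n
    rcases Nat.eq_zero_or_pos n with rfl | hn
    · simp
    have h2 : max |t + h| |t - h| ≤ 2 * t := by
      rw [abs_of_nonneg (by linarith), abs_of_nonneg (by linarith)]
      exact max_le (by linarith) (by linarith)
    calc (t + h) ^ n - (t - h) ^ n ≤ |(t + h) ^ n - (t - h) ^ n| := le_abs_self _
      _ ≤ _ := h1
      _ ≤ 2 * h * n * (2 * t) ^ (n - 1) := by
          gcongr
          rw [abs_of_nonneg (by linarith)]; linarith
      _ ≤ 2 * h * n * (2 ^ n * (t ^ n / t)) := by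
          gcongr
          rw [mul_pow]
          gcongr
          · norm_num
          · omega
          · rw [le_div_iff₀ ht, ← pow_succ, Nat.sub_add_cancel hn]
      _ = _ := by ring
  calc volume {u : Rn n | |‖u‖ - t| ≤ h}
      ≤ volume (closedBall (0 : Rn n) (t + h) \ ball 0 (t - h)) := measure_mono hsub
    _ = volume (closedBall (0 : Rn n) (t + h)) - volume (ball (0 : Rn n) (t - h)) :=
        measure_sdiff (ball_subset_closedBall.trans (closedBall_subset_closedBall (by linarith)))
          measurableSet_ball.nullMeasurableSet measure_ball_lt_top.ne
    _ = ENNReal.ofReal ((t + h) ^ n - (t - h) ^ n) * unitVol n := by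
        rw [volume_closedBall_eq _ (by linarith), Measure.addHaar_ball _ _ (by linarith),
          ← Measure.addHaar_unitClosedBall_eq_addHaar_unitBall, finrank_euclideanSpace_fin,
          ← unitVol, ENNReal.ofReal_sub _ (pow_nonneg (by linarith) n), ENNReal.sub_mul]
        intro _ _; exact unitVol_ne_top n
    _ ≤ ENNReal.ofReal ((2 * n * 2 ^ n + 1) * (h / t * t ^ n)) * unitVol n := by
        gcongr
        refine hpow.trans ?_
        rw [add_mul]
        have : 0 ≤ h / t * t ^ n := by positivity
        linarith
    _ = _ := by
        rw [ENNReal.ofReal_mul (by positivity)]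
        push_cast
        rw [ENNReal.coe_toNNReal (unitVol_ne_top n), ENNReal.ofReal_add (by positivity) one_pos.le,
          ENNReal.ofReal_mul (by positivity), ENNReal.ofReal_mul (by positivity),
          ENNReal.ofReal_pow (by norm_num)]
        simp only [ENNReal.ofReal_ofNat, ENNReal.ofReal_natCast, ENNReal.ofReal_one]
        ring

namespace RoughKernel

variable {n : ℕ} {β D : ℝ} {k : Rn n → ℂ}

lemma measurable_ker (hk : RoughKernel β D k) :
    Measurable fun q : ℝ × Rn n => ker k q.1 q.2 := by
  have h1 : Measurable fun q : ℝ × Rn n =>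
      {q : ℝ × Rn n | ‖q.2‖ ≤ q.1}.indicator (fun q => k q.2) q :=
    Measurable.indicator (hk.measurable.comp measurable_snd)
      (measurableSet_le (by fun_prop) (by fun_prop))
  have h2 : ∀ q : ℝ × Rn n, ker k q.1 q.2 = (q.1 : ℂ)⁻¹ *
      {q : ℝ × Rn n | ‖q.2‖ ≤ q.1}.indicator (fun q => k q.2) q := by
    intro q
    simp only [ker, indicator, mem_closedBall, dist_zero_right, mem_ofPred_eq]
  simp_rw [h2]
  exact Measurable.mul (by fun_prop) h1

lemma measurable_ker_right (hk : RoughKernel β D k) (t : ℝ) : Measurable (ker k t) :=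
  hk.measurable_ker.comp measurable_prodMk_left

lemma norm_ker_le (hk : RoughKernel β D k) {t : ℝ} (ht : 0 < t) (u : Rn n) :
    ‖ker k t u‖ ≤ D * (t⁻¹ * ‖u‖ ^ (-((n : ℝ) - 1))) := by
  have := hk.pos
  rcases le_or_gt ‖u‖ t with h | h
  · rw [ker_of_le h, norm_mul, norm_inv, Complex.norm_real, Real.norm_of_nonneg ht.le]
    calc t⁻¹ * ‖k u‖ ≤ t⁻¹ * (D * ‖u‖ ^ (-((n : ℝ) - 1))) := by gcongr; exact hk.size u
      _ = _ := by ring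
  · rw [ker_of_lt h, norm_zero]; positivity

/-- Two effects are separated: the regularity of k when both points lie inside the cutoff, and the
jump of the cutoff, which requires u to lie within |h| of the sphere of radius t and for which the
size bound is all that is used. -/
lemma norm_ker_sub_le [NeZero n] (hk : RoughKernel β D k) {t : ℝ} (ht : 0 < t) {u h : Rn n}
    (hu : u ≠ 0) (hh : 2 * ‖h‖ ≤ ‖u‖) :
    ‖ker k t (u + h) - ker k t u‖ ≤ 2 ^ n * D * (t⁻¹ * ‖u‖ ^ (-((n : ℝ) - 1)) *
      ((if ‖u‖ ≤ 2 * t then (‖h‖ / ‖u‖) ^ β else 0) + if |‖u‖ - t| ≤ ‖h‖ then 1 else 0)) := by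
  have hD := hk.pos
  have hn : 1 ≤ n := Nat.one_le_iff_ne_zero.2 (NeZero.ne n)
  have hn' : (1 : ℝ) ≤ n := by exact_mod_cast hn
  have hu0 : 0 < ‖u‖ := norm_pos_iff.2 hu
  have hup : ‖u + h‖ ≤ ‖u‖ + ‖h‖ := norm_add_le _ _
  have hlow : ‖u‖ ≤ ‖u + h‖ + ‖h‖ := by
    calc ‖u‖ = ‖(u + h) - h‖ := by rw [add_sub_cancel_right]
      _ ≤ _ := norm_sub_le _ _
  have h2n : (1 : ℝ) ≤ 2 ^ n := one_le_pow₀ (by norm_num)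
  set P := t⁻¹ * ‖u‖ ^ (-((n : ℝ) - 1)) with hP
  have hP0 : 0 ≤ P := by positivity
  have hle0 : (0 : ℝ) ≤ if ‖u‖ ≤ 2 * t then (‖h‖ / ‖u‖) ^ β else 0 := by split_ifs <;> positivity
  have hle1 : (0 : ℝ) ≤ if |‖u‖ - t| ≤ ‖h‖ then 1 else 0 := by split_ifs <;> norm_num
  have hone : |‖u‖ - t| ≤ ‖h‖ → 2 ^ n * D * P ≤ 2 ^ n * D * (P *
      ((if ‖u‖ ≤ 2 * t then (‖h‖ / ‖u‖) ^ β else 0) + if |‖u‖ - t| ≤ ‖h‖ then 1 else 0)) := by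
    intro hc
    rw [if_pos hc]
    gcongr
    exact le_mul_of_one_le_right hP0 (by linarith)
  -- In the two mixed cases only one point is inside, so ||u| - t| ≤ |h|. When only u + h survives,
  -- |u + h| ≥ |u|/2 costs a power of 2, absorbed in 2ⁿ.
  rcases le_or_gt ‖u‖ t with h1 | h1 <;> rcases le_or_gt ‖u + h‖ t with h2 | h2
  · rw [ker_of_le h1, ker_of_le h2, ← mul_sub, norm_mul, norm_inv, Complex.norm_real,
      Real.norm_of_nonneg ht.le, if_pos (by linarith)]
    calc t⁻¹ * ‖k (u + h) - k u‖
        ≤ t⁻¹ * (D * ((‖h‖ / ‖u‖) ^ β * ‖u‖ ^ (-((n : ℝ) - 1)))) := by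
          gcongr; exact hk.regular u h hu hh
      _ = 1 * D * (P * ((‖h‖ / ‖u‖) ^ β + 0)) := by rw [hP]; ring
      _ ≤ _ := by gcongr
  · rw [ker_of_lt h2, zero_sub, norm_neg]
    refine le_trans ?_ (hone (abs_le.2 ⟨by linarith, by linarith⟩))
    calc ‖ker k t u‖ ≤ 1 * D * P := by rw [one_mul]; exact hk.norm_ker_le ht u
      _ ≤ _ := by gcongr
  · rw [ker_of_lt h1, sub_zero]
    refine le_trans ?_ (hone (abs_le.2 ⟨by linarith, by linarith⟩))
    calc ‖ker k t (u + h)‖ ≤ D * (t⁻¹ * ‖u + h‖ ^ (-((n : ℝ) - 1))) := hk.norm_ker_le ht _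
      _ ≤ D * (t⁻¹ * (‖u‖ / 2) ^ (-((n : ℝ) - 1))) := by
          gcongr ?_ * (_ * ?_)
          exact Real.rpow_le_rpow_of_nonpos (by positivity) (by linarith) (by linarith)
      _ = 2 ^ ((n : ℝ) - 1) * D * P := by
          rw [Real.div_rpow hu0.le (by norm_num), Real.rpow_neg (by norm_num : (0 : ℝ) ≤ 2),
            div_inv_eq_mul, hP]
          ring
      _ ≤ 2 ^ n * D * P := by
          gcongr
          rw [← Real.rpow_natCast]
          exact Real.rpow_le_rpow_of_exponent_le (by norm_num) (by linarith)
  · rw [ker_of_lt h1, ker_of_lt h2, sub_zero, norm_zero]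
    positivity

end RoughKernel

lemma enorm_le_ofReal {E : Type*} [SeminormedAddCommGroup E] {x : E} {c : ℝ} (h : ‖x‖ ≤ c) :
    ‖x‖ₑ ≤ ENNReal.ofReal c := by
  rw [← ofReal_norm]; exact ENNReal.ofReal_le_ofReal h

namespace RoughKernel

variable {n : ℕ} {β D : ℝ} {k : Rn n → ℂ}

/-- The singularity |u|^{1-n} has mass of order R on a ball of radius R. The case R = t is the
uniform L¹ bound on the truncated kernels. -/
lemma lintegral_closedBall_ker_le [NeZero n] (hk : RoughKernel β D k) :
    ∃ C : ℝ≥0, 0 < C ∧ ∀ (t R : ℝ) (x : Rn n), 0 < t → 0 < R →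
      ∫⁻ u in closedBall x R, ‖ker k t (x - u)‖ₑ ≤ C * ENNReal.ofReal (R / t) := by
  have hn : (1 : ℝ) ≤ n := by exact_mod_cast Nat.one_le_iff_ne_zero.2 (NeZero.ne n)
  have hD := hk.pos
  obtain ⟨C, hC, h⟩ := lintegral_closedBall_rpow_norm (n := n) (a := (n : ℝ) - 1)
    (by linarith) (by linarith)
  refine ⟨D.toNNReal * C, mul_pos (Real.toNNReal_pos.2 hD) hC, fun t R x ht hR => ?_⟩
  calc ∫⁻ u in closedBall x R, ‖ker k t (x - u)‖ₑ
      ≤ ∫⁻ u in closedBall x R, ENNReal.ofReal (D * t⁻¹) *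
          ENNReal.ofReal (‖x - u‖ ^ (-((n : ℝ) - 1))) := by
        refine lintegral_mono fun u => ?_
        rw [← ENNReal.ofReal_mul (by positivity), mul_assoc]
        exact enorm_le_ofReal (hk.norm_ker_le ht _)
    _ ≤ ENNReal.ofReal (D * t⁻¹) * (C * ENNReal.ofReal (R ^ ((n : ℝ) - ((n : ℝ) - 1)))) := by
        rw [lintegral_const_mul' _ _ ENNReal.ofReal_ne_top]
        gcongr
        exact h x R hR
    _ = _ := by
        rw [sub_sub_cancel, Real.rpow_one, ENNReal.ofReal_mul hD.le, div_eq_mul_inv,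
          ENNReal.ofReal_mul hR.le]
        push_cast
        rw [ENNReal.ofReal]
        ring

lemma lintegral_ker_le [NeZero n] (hk : RoughKernel β D k) :
    ∃ C : ℝ≥0, 0 < C ∧ ∀ t : ℝ, 0 < t → ∫⁻ u, ‖ker k t u‖ₑ ≤ C := by
  obtain ⟨C, hC, h⟩ := hk.lintegral_closedBall_ker_le
  refine ⟨C, hC, fun t ht => ?_⟩
  have h1 := h t t 0 ht ht
  simp only [zero_sub] at h1
  have h2 : ∫⁻ u in closedBall (0 : Rn n) t, ‖ker k t (-u)‖ₑ = ∫⁻ u, ‖ker k t (-u)‖ₑ := by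
    rw [← lintegral_indicator measurableSet_closedBall]
    refine lintegral_congr fun u => ?_
    by_cases hu : ‖u‖ ≤ t
    · rw [indicator_of_mem (by simpa using hu)]
    · rw [indicator_of_notMem (by simpa using hu), ker_of_lt (by simpa using hu), enorm_zero]
  rw [h2, lintegral_neg_eq_self (fun u => ‖ker k t u‖ₑ), div_self ht.ne'] at h1
  simpa using h1

lemma integrable_ker [NeZero n] (hk : RoughKernel β D k) (t : ℝ) (ht : 0 < t) :
    Integrable (ker k t) := by
  obtain ⟨C, hC, h⟩ := hk.lintegral_ker_le
  exact ⟨(hk.measurable_ker_right t).aestronglyMeasurable,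
    (h t ht).trans_lt ENNReal.coe_lt_top⟩

lemma integral_ker (hk : RoughKernel β D k) (t : ℝ) : ∫ u, ker k t u = 0 := by
  simp_rw [ker]
  rw [integral_const_mul, integral_indicator measurableSet_closedBall, hk.integral_zero, mul_zero]

/-- `L¹`-modulus of continuity of the truncated kernels. -/
lemma lintegral_ker_sub_le [NeZero n] (hk : RoughKernel β D k) :
    ∃ C : ℝ≥0, 0 < C ∧ ∀ (t : ℝ) (h : Rn n), 0 < t →
      ∫⁻ u, ‖ker k t (u + h) - ker k t u‖ₑ ≤ C * ENNReal.ofReal ((‖h‖ / t) ^ β) := by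
  have hn : (1 : ℝ) ≤ n := by exact_mod_cast Nat.one_le_iff_ne_zero.2 (NeZero.ne n)
  have hD := hk.pos
  have hβ0 := hk.beta_pos
  have hβ1 := hk.beta_lt_one
  obtain ⟨C1, hC1, h1⟩ := hk.lintegral_closedBall_ker_le
  obtain ⟨C2, hC2, h2⟩ := hk.lintegral_ker_le
  obtain ⟨C3, hC3, h3⟩ := lintegral_closedBall_rpow_norm (n := n) (a := (n : ℝ) - 1 + β)
    (by linarith) (by linarith)
  obtain ⟨C4, hC4, h4⟩ := volume_annulus_le n
  set Q : ℝ≥0 := (2 ^ n * D).toNNReal with hQ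
  have hQ0 : 0 < Q := Real.toNNReal_pos.2 (by positivity)
  refine ⟨2 * C2 * (2 ^ β : ℝ).toNNReal + (6 * C1 + (Q * C3 * (2 ^ (1 - β) : ℝ).toNNReal +
    Q * (2 ^ ((n : ℝ) - 1) : ℝ).toNNReal * C4)), by positivity, fun t h ht => ?_⟩
  have hmeas : ∀ h, Measurable fun u => ker k t (u + h) := fun h =>
    (hk.measurable_ker_right t).comp (measurable_add_const h)
  have htriv : ∫⁻ u, ‖ker k t (u + h) - ker k t u‖ₑ ≤ 2 * C2 := by
    calc ∫⁻ u, ‖ker k t (u + h) - ker k t u‖ₑ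
        ≤ ∫⁻ u, (‖ker k t (u + h)‖ₑ + ‖ker k t u‖ₑ) := lintegral_mono fun u => enorm_sub_le
      _ = (∫⁻ u, ‖ker k t u‖ₑ) + ∫⁻ u, ‖ker k t u‖ₑ := by
          rw [lintegral_add_left (hmeas h).enorm,
            lintegral_add_right_eq_self (fun u => ‖ker k t u‖ₑ) h]
      _ ≤ C2 + C2 := add_le_add (h2 t ht) (h2 t ht)
      _ = _ := by ring
  -- If |h| ≥ t/2, the right-hand side is bounded below and the trivial bound suffices.
  rcases le_or_gt t (2 * ‖h‖) with hth | hth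
  · have h5 : (1 : ℝ≥0∞) ≤ ((2 ^ β : ℝ).toNNReal : ℝ≥0∞) * ENNReal.ofReal ((‖h‖ / t) ^ β) := by
      rw [← ENNReal.ofReal, ← ENNReal.ofReal_mul (by positivity), ← Real.mul_rpow (by norm_num)
        (by positivity), ← ENNReal.ofReal_one]
      refine ENNReal.ofReal_le_ofReal (Real.one_le_rpow ?_ hβ0.le)
      rw [← mul_div_assoc, le_div_iff₀ ht]; linarith
    calc ∫⁻ u, ‖ker k t (u + h) - ker k t u‖ₑ ≤ 2 * C2 * 1 := by rw [mul_one]; exact htriv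
      _ ≤ 2 * C2 * (((2 ^ β : ℝ).toNNReal : ℝ≥0∞) * ENNReal.ofReal ((‖h‖ / t) ^ β)) := by
          gcongr
      _ = ((2 * C2 * (2 ^ β : ℝ).toNNReal : ℝ≥0) : ℝ≥0∞) * ENNReal.ofReal ((‖h‖ / t) ^ β) := by
          push_cast; ring
      _ ≤ _ := mul_le_mul' (ENNReal.coe_le_coe.2 le_self_add) le_rfl
  · rcases eq_or_ne h 0 with rfl | hh0
    · simp
    have hhp : 0 < ‖h‖ := norm_pos_iff.2 hh0
    set q : ℝ := ‖h‖ / t with hq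
    have hq0 : 0 < q := by positivity
    have hq1 : q ≤ 1 := by rw [hq, div_le_one ht]; linarith
    have hqβ : q ≤ q ^ β := by
      calc q = q ^ (1 : ℝ) := (Real.rpow_one q).symm
        _ ≤ q ^ β := Real.rpow_le_rpow_of_exponent_ge hq0 hq1 hβ1.le
    -- Regularity is not available for |u| < 2|h|. There each term is integrated over a ball of
    -- radius 3|h| about its own singularity, which yields |h|/t ≤ (|h|/t)^β.
    set A : Set (Rn n) := {u | ‖u‖ < 2 * ‖h‖} with hA
    have hAm : MeasurableSet A := measurableSet_lt (by fun_prop) measurable_const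
    -- near part
    have hnear : ∫⁻ u in A, ‖ker k t (u + h) - ker k t u‖ₑ ≤
        (6 * C1 : ℝ≥0) * ENNReal.ofReal (q ^ β) := by
      have hball : ∀ v : Rn n, A ⊆ closedBall (-v) (3 * ‖h‖) → ∫⁻ u in A, ‖ker k t (u + v)‖ₑ ≤
          C1 * ENNReal.ofReal (3 * q) := by
        intro v hv
        have h6 := h1 t (3 * ‖h‖) v ht (by positivity)
        rw [mul_div_assoc] at h6
        refine le_trans ?_ h6
        rw [← lintegral_indicator hAm, ← lintegral_indicator measurableSet_closedBall,
          ← lintegral_neg_eq_self (A.indicator fun u => ‖ker k t (u + v)‖ₑ)]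
        refine lintegral_mono fun u => ?_
        by_cases hu : -u ∈ A
        · rw [indicator_of_mem hu, indicator_of_mem, neg_add_eq_sub]
          have := hv hu
          rw [mem_closedBall, dist_eq_norm] at this ⊢
          rwa [← norm_neg, show -(u - v) = -u - -v by abel]
        · rw [indicator_of_notMem hu]; exact zero_le
      have hb1 := hball h (fun u hu => by
        have hu' : ‖u‖ < 2 * ‖h‖ := hu
        rw [mem_closedBall, dist_eq_norm, sub_neg_eq_add]
        linarith [norm_add_le u h])
      have hb0 := hball 0 (fun u hu => by
        have hu' : ‖u‖ < 2 * ‖h‖ := hu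
        rw [mem_closedBall, dist_eq_norm, neg_zero, sub_zero]
        linarith)
      simp only [add_zero] at hb0
      calc ∫⁻ u in A, ‖ker k t (u + h) - ker k t u‖ₑ
          ≤ ∫⁻ u in A, (‖ker k t (u + h)‖ₑ + ‖ker k t u‖ₑ) := lintegral_mono fun u => enorm_sub_le
        _ = (∫⁻ u in A, ‖ker k t (u + h)‖ₑ) + ∫⁻ u in A, ‖ker k t u‖ₑ := by
            rw [lintegral_add_left (hmeas h).enorm]
        _ ≤ C1 * ENNReal.ofReal (3 * q) + C1 * ENNReal.ofReal (3 * q) := add_le_add hb1 hb0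
        _ = (6 * C1 : ℝ≥0) * ENNReal.ofReal q := by
            rw [ENNReal.ofReal_mul (by norm_num)]; push_cast
            rw [ENNReal.ofReal_ofNat]; ring
        _ ≤ _ := by gcongr
    -- smooth part
    set w1 : Rn n → ℝ≥0∞ := (closedBall (0 : Rn n) (2 * t)).indicator fun u =>
      ENNReal.ofReal (t⁻¹ * ‖h‖ ^ β) * ENNReal.ofReal (‖u‖ ^ (-((n : ℝ) - 1 + β))) with hw1
    -- The jump of the cutoff: size of order t^{-n} on a shell of volume of order |h|t^{n-1}, in
    -- total |h|/t.
    set w2 : Rn n → ℝ≥0∞ := {u : Rn n | |‖u‖ - t| ≤ ‖h‖}.indicator fun _ =>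
      ENNReal.ofReal (t⁻¹ * (t / 2) ^ (-((n : ℝ) - 1))) with hw2
    have hann : MeasurableSet {u : Rn n | |‖u‖ - t| ≤ ‖h‖} :=
      measurableSet_le (by fun_prop) measurable_const
    have hpt : ∀ u ∈ Aᶜ, ‖ker k t (u + h) - ker k t u‖ₑ ≤ Q * (w1 u + w2 u) := by
      intro u hu
      have hu2 : 2 * ‖h‖ ≤ ‖u‖ := not_lt.1 hu
      have hup : 0 < ‖u‖ := by linarith
      have e1 : ENNReal.ofReal (t⁻¹ * ‖u‖ ^ (-((n : ℝ) - 1)) *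
          (if ‖u‖ ≤ 2 * t then (‖h‖ / ‖u‖) ^ β else 0)) = w1 u := by
        by_cases hc : ‖u‖ ≤ 2 * t
        · rw [if_pos hc, hw1, indicator_of_mem (by simpa using hc),
            ← ENNReal.ofReal_mul (by positivity), neg_add, Real.rpow_add hup,
            Real.div_rpow hhp.le hup.le, Real.rpow_neg hup.le β]
          congr 1; ring
        · rw [if_neg hc, hw1, indicator_of_notMem (by simpa using hc), mul_zero,
            ENNReal.ofReal_zero]
      have e2 : ENNReal.ofReal (t⁻¹ * ‖u‖ ^ (-((n : ℝ) - 1)) *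
          (if |‖u‖ - t| ≤ ‖h‖ then 1 else 0)) ≤ w2 u := by
        by_cases hc : |‖u‖ - t| ≤ ‖h‖
        · rw [if_pos hc, hw2, indicator_of_mem (by exact hc), mul_one]
          have := (abs_le.1 hc).1
          refine ENNReal.ofReal_le_ofReal (mul_le_mul_of_nonneg_left ?_ (by positivity))
          exact Real.rpow_le_rpow_of_nonpos (by positivity) (by linarith) (by linarith)
        · rw [if_neg hc, mul_zero, ENNReal.ofReal_zero]; exact zero_le
      calc _ ≤ _ := enorm_le_ofReal (hk.norm_ker_sub_le ht (norm_pos_iff.1 hup) hu2)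
        _ = Q * (ENNReal.ofReal (t⁻¹ * ‖u‖ ^ (-((n : ℝ) - 1)) *
              (if ‖u‖ ≤ 2 * t then (‖h‖ / ‖u‖) ^ β else 0)) +
            ENNReal.ofReal (t⁻¹ * ‖u‖ ^ (-((n : ℝ) - 1)) *
              (if |‖u‖ - t| ≤ ‖h‖ then 1 else 0))) := by
            rw [mul_add (t⁻¹ * _), ENNReal.ofReal_mul (by positivity), ENNReal.ofReal_add]
            · rfl
            · split_ifs <;> positivity
            · split_ifs <;> positivity
        _ ≤ _ := by rw [e1]; gcongr
    have hI1 : ∫⁻ u, w1 u ≤ (C3 * (2 ^ (1 - β) : ℝ).toNNReal : ℝ≥0) * ENNReal.ofReal (q ^ β) := by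
      rw [hw1, lintegral_indicator measurableSet_closedBall,
        lintegral_const_mul' _ _ ENNReal.ofReal_ne_top]
      have h6 := h3 0 (2 * t) (by positivity)
      simp only [zero_sub, norm_neg] at h6
      calc _ ≤ ENNReal.ofReal (t⁻¹ * ‖h‖ ^ β) *
            (C3 * ENNReal.ofReal ((2 * t) ^ ((n : ℝ) - ((n : ℝ) - 1 + β)))) := by gcongr
        _ = C3 * ENNReal.ofReal ((2 ^ (1 - β)) * q ^ β) := by
            rw [mul_left_comm, ← ENNReal.ofReal_mul (by positivity)]
            congr 2
            rw [show (n : ℝ) - ((n : ℝ) - 1 + β) = 1 - β by ring, Real.mul_rpow (by norm_num) ht.le,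
              Real.rpow_sub ht, Real.rpow_one, hq, Real.div_rpow hhp.le ht.le]
            field_simp
        _ = _ := by
            rw [ENNReal.ofReal_mul (by positivity)]; push_cast
            rw [ENNReal.ofReal]; ring
    have hI2 : ∫⁻ u, w2 u ≤ ((2 ^ ((n : ℝ) - 1) : ℝ).toNNReal * C4 : ℝ≥0) *
        ENNReal.ofReal (q ^ β) := by
      rw [hw2, lintegral_indicator_const hann]
      calc _ ≤ ENNReal.ofReal (t⁻¹ * (t / 2) ^ (-((n : ℝ) - 1))) *
            (C4 * ENNReal.ofReal (q * t ^ n)) := by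
              gcongr; exact h4 ‖h‖ t hhp.le ht hth.le
        _ = C4 * ENNReal.ofReal (2 ^ ((n : ℝ) - 1) * q) := by
            rw [mul_left_comm, ← ENNReal.ofReal_mul (by positivity)]
            congr 2
            rw [Real.div_rpow ht.le (by norm_num), Real.rpow_neg (by norm_num : (0 : ℝ) ≤ 2),
              div_inv_eq_mul, neg_sub, Real.rpow_sub ht, Real.rpow_one, Real.rpow_natCast]
            field_simp
        _ ≤ C4 * ENNReal.ofReal (2 ^ ((n : ℝ) - 1) * q ^ β) := by gcongr
        _ = _ := by
            rw [ENNReal.ofReal_mul (by positivity)]; push_cast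
            rw [ENNReal.ofReal]; ring
    have hw1m : Measurable w1 := Measurable.indicator (by fun_prop) measurableSet_closedBall
    calc ∫⁻ u, ‖ker k t (u + h) - ker k t u‖ₑ
        = (∫⁻ u in A, ‖ker k t (u + h) - ker k t u‖ₑ) +
            ∫⁻ u in Aᶜ, ‖ker k t (u + h) - ker k t u‖ₑ := (lintegral_add_compl _ hAm).symm
      _ ≤ (6 * C1 : ℝ≥0) * ENNReal.ofReal (q ^ β) + Q * ((∫⁻ u, w1 u) + ∫⁻ u, w2 u) := by
          refine add_le_add hnear ?_
          rw [← lintegral_add_left hw1m, ← lintegral_const_mul' _ _ ENNReal.coe_ne_top]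
          exact (setLIntegral_mono' hAm.compl hpt).trans (setLIntegral_le_lintegral _ _)
      _ ≤ (6 * C1 : ℝ≥0) * ENNReal.ofReal (q ^ β) + Q *
            ((C3 * (2 ^ (1 - β) : ℝ).toNNReal : ℝ≥0) * ENNReal.ofReal (q ^ β) +
              ((2 ^ ((n : ℝ) - 1) : ℝ).toNNReal * C4 : ℝ≥0) * ENNReal.ofReal (q ^ β)) := by
          gcongr
      _ = ((6 * C1 + (Q * C3 * (2 ^ (1 - β) : ℝ).toNNReal +
            Q * (2 ^ ((n : ℝ) - 1) : ℝ).toNNReal * C4) : ℝ≥0) : ℝ≥0∞) * ENNReal.ofReal (q ^ β) := by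
          push_cast; ring
      _ ≤ _ := mul_le_mul' (ENNReal.coe_le_coe.2 le_add_self) le_rfl

/-- Smoothness of the kernel as an `L²(dt/t)`-valued function. -/
lemma l2_ker_sub_le [NeZero n] (hk : RoughKernel β D k) :
    ∃ C : ℝ, 0 < C ∧ ∀ u h : Rn n, u ≠ 0 → 2 * ‖h‖ ≤ ‖u‖ →
      l2 dtt (fun t => ‖ker k t (u + h) - ker k t u‖ₑ) ≤
        ENNReal.ofReal (C * ((‖h‖ / ‖u‖) ^ (β / 2) * ‖u‖ ^ (-(n : ℝ)))) := by
  have hD := hk.pos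
  have hβ0 := hk.beta_pos
  have hβ1 := hk.beta_lt_one
  refine ⟨6 * (2 ^ n * D), by positivity, fun u h hu hh => ?_⟩
  have hup : 0 < ‖u‖ := norm_pos_iff.2 hu
  set q := ‖h‖ / ‖u‖ with hq
  have hq0 : 0 ≤ q := by positivity
  have hq1 : q ≤ 1 := by rw [hq, div_le_one hup]; linarith [norm_nonneg h]
  set P := ‖u‖ ^ (-((n : ℝ) - 1)) with hP
  have hP0 : 0 < P := by positivity
  set Q := 2 ^ n * D with hQ
  have hQ0 : 0 < Q := by positivity
  -- The regular part lives on t ≥ |u|/2; the jump occurs only for t in an interval of length 2|h|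
  -- around |u|, whose dt/t measure is of order |h|/|u|.
  set S1 : Set ℝ := Ici (‖u‖ / 2) with hS1
  set S2 : Set ℝ := Icc (‖u‖ - ‖h‖) (‖u‖ + ‖h‖) with hS2
  have hS2sub : S2 ⊆ Ioi 0 := fun t ht => by
    have := ht.1; rw [mem_Ioi]; linarith [norm_nonneg h]
  rw [l2_le_iff]
  have hpt : ∀ᵐ t ∂dtt, ‖ker k t (u + h) - ker k t u‖ₑ ^ 2 ≤
      ENNReal.ofReal (2 * (Q * P) ^ 2) * (ENNReal.ofReal (q ^ β) *
        S1.indicator (fun t => ENNReal.ofReal (t ^ (-(2 : ℝ)))) t +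
        S2.indicator (fun t => ENNReal.ofReal (t ^ (-(2 : ℝ)))) t) := by
    filter_upwards [ae_dtt_pos] with t ht
    have h1 := enorm_le_ofReal (hk.norm_ker_sub_le ht hu hh)
    set a : ℝ := if ‖u‖ ≤ 2 * t then q ^ β else 0 with ha
    set b : ℝ := if |‖u‖ - t| ≤ ‖h‖ then 1 else 0 with hb
    have ha0 : 0 ≤ a := by rw [ha]; split_ifs <;> positivity
    have hb0 : 0 ≤ b := by rw [hb]; split_ifs <;> norm_num
    -- Squaring would give q^{2β}, but only q^β is kept; the jump contributes q ≤ q^β to the squared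
    -- norm. Taking the root leaves β/2.
    have ha2 : a ^ 2 ≤ if ‖u‖ ≤ 2 * t then q ^ β else 0 := by
      rw [ha]; split_ifs with hc
      · have h2 : q ^ β ≤ 1 := Real.rpow_le_one hq0 hq1 hβ0.le
        have h3 : 0 ≤ q ^ β := by positivity
        nlinarith
      · simp
    have hb2 : b ^ 2 = b := by rw [hb]; split_ifs <;> norm_num
    have e1 : ENNReal.ofReal (q ^ β) * S1.indicator (fun t => ENNReal.ofReal (t ^ (-(2 : ℝ)))) t =
        ENNReal.ofReal ((if ‖u‖ ≤ 2 * t then q ^ β else 0) * t ^ (-(2 : ℝ))) := by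
      by_cases hc : ‖u‖ ≤ 2 * t
      · rw [if_pos hc, indicator_of_mem (by rw [hS1, mem_Ici]; linarith),
          ENNReal.ofReal_mul (by positivity)]
      · rw [if_neg hc, indicator_of_notMem (by rw [hS1, mem_Ici]; intro h; apply hc; linarith)]
        simp
    have e2 : S2.indicator (fun t => ENNReal.ofReal (t ^ (-(2 : ℝ)))) t =
        ENNReal.ofReal (b * t ^ (-(2 : ℝ))) := by
      by_cases hc : |‖u‖ - t| ≤ ‖h‖
      · have := abs_le.1 hc
        rw [hb, if_pos hc, indicator_of_mem (by rw [hS2, mem_Icc]; constructor <;> linarith),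
          one_mul]
      · rw [hb, if_neg hc, indicator_of_notMem]
        · simp
        · intro h; apply hc; rw [abs_le]; constructor <;> linarith [h.1, h.2]
    have ht2 : t⁻¹ ^ 2 = t ^ (-(2 : ℝ)) := by
      rw [Real.rpow_neg ht.le, inv_pow]; norm_num
    have hx0 : (0 : ℝ) ≤ if ‖u‖ ≤ 2 * t then q ^ β else 0 := by split_ifs <;> positivity
    rw [e1, e2, ← ENNReal.ofReal_add (by positivity) (by positivity),
      ← ENNReal.ofReal_mul (by positivity)]
    refine (pow_le_pow_left' h1 2).trans ?_
    rw [← ENNReal.ofReal_pow (by positivity)]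
    refine ENNReal.ofReal_le_ofReal ?_
    calc (Q * (t⁻¹ * P * (a + b))) ^ 2 = (Q * P) ^ 2 * (a + b) ^ 2 * t⁻¹ ^ 2 := by ring
      _ ≤ (Q * P) ^ 2 * (2 * (a ^ 2 + b ^ 2)) * t⁻¹ ^ 2 := by
          gcongr; nlinarith [sq_nonneg (a - b)]
      _ ≤ (Q * P) ^ 2 * (2 * ((if ‖u‖ ≤ 2 * t then q ^ β else 0) + b)) * t⁻¹ ^ 2 := by
          rw [hb2]; gcongr
      _ = _ := by rw [ht2]; ring
  have hI1 : ∫⁻ t, S1.indicator (fun t => ENNReal.ofReal (t ^ (-(2 : ℝ)))) t ∂dtt ≤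
      ENNReal.ofReal (2 * ‖u‖ ^ (-(2 : ℝ))) := by
    rw [lintegral_indicator measurableSet_Ici, setLIntegral_Ici_rpow_dtt (by norm_num)
      (by positivity)]
    refine ENNReal.ofReal_le_ofReal (le_of_eq ?_)
    rw [Real.div_rpow hup.le (by norm_num), Real.rpow_neg (by norm_num : (0 : ℝ) ≤ 2)]
    norm_num
    ring
  have hI2 : ∫⁻ t, S2.indicator (fun t => ENNReal.ofReal (t ^ (-(2 : ℝ)))) t ∂dtt ≤
      ENNReal.ofReal (16 * q ^ β * ‖u‖ ^ (-(2 : ℝ))) := by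
    rw [lintegral_indicator measurableSet_Icc, setLIntegral_dtt (by fun_prop) measurableSet_Icc
      hS2sub]
    calc ∫⁻ t in S2, (ENNReal.ofReal t)⁻¹ * ENNReal.ofReal (t ^ (-(2 : ℝ)))
        ≤ ∫⁻ t in S2, ENNReal.ofReal (8 * ‖u‖⁻¹ * ‖u‖ ^ (-(2 : ℝ))) := by
          refine setLIntegral_mono' measurableSet_Icc fun t ht => ?_
          have ht0 : 0 < t := hS2sub ht
          have ht1 : ‖u‖ / 2 ≤ t := by linarith [ht.1]
          rw [← ENNReal.ofReal_inv_of_pos ht0, ← ENNReal.ofReal_mul (by positivity)]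
          refine ENNReal.ofReal_le_ofReal ?_
          calc t⁻¹ * t ^ (-(2 : ℝ)) ≤ (‖u‖ / 2)⁻¹ * (‖u‖ / 2) ^ (-(2 : ℝ)) := by
                gcongr ?_ * ?_
                · exact inv_anti₀ (by positivity) ht1
                · exact Real.rpow_le_rpow_of_nonpos (by positivity) ht1 (by norm_num)
            _ = _ := by
                rw [Real.div_rpow hup.le (by norm_num), Real.rpow_neg (by norm_num : (0 : ℝ) ≤ 2)]
                norm_num
                ring
      _ = ENNReal.ofReal (16 * q * ‖u‖ ^ (-(2 : ℝ))) := by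
          rw [setLIntegral_const, Real.volume_Icc, ← ENNReal.ofReal_mul (by positivity)]
          congr 1
          rw [hq]; field_simp; ring
      _ ≤ _ := by
          refine ENNReal.ofReal_le_ofReal ?_
          gcongr
          calc q = q ^ (1 : ℝ) := (Real.rpow_one q).symm
            _ ≤ q ^ β := Real.rpow_le_rpow_of_exponent_ge_of_imp hq0 hq1 hβ1.le (by
              intro _ h1; exact absurd h1 one_ne_zero)
  have hm1 : Measurable fun t => ENNReal.ofReal (q ^ β) *
      S1.indicator (fun t => ENNReal.ofReal (t ^ (-(2 : ℝ)))) t :=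
    (Measurable.indicator (by fun_prop) measurableSet_Ici).const_mul _
  calc ∫⁻ t, ‖ker k t (u + h) - ker k t u‖ₑ ^ 2 ∂dtt
      ≤ ∫⁻ t, ENNReal.ofReal (2 * (Q * P) ^ 2) * (ENNReal.ofReal (q ^ β) *
        S1.indicator (fun t => ENNReal.ofReal (t ^ (-(2 : ℝ)))) t +
        S2.indicator (fun t => ENNReal.ofReal (t ^ (-(2 : ℝ)))) t) ∂dtt := lintegral_mono_ae hpt
    _ ≤ ENNReal.ofReal (2 * (Q * P) ^ 2) * (ENNReal.ofReal (q ^ β) *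
          ENNReal.ofReal (2 * ‖u‖ ^ (-(2 : ℝ))) +
          ENNReal.ofReal (16 * q ^ β * ‖u‖ ^ (-(2 : ℝ)))) := by
        rw [lintegral_const_mul' _ _ ENNReal.ofReal_ne_top, lintegral_add_left hm1,
          lintegral_const_mul' _ _ ENNReal.ofReal_ne_top]
        gcongr
    _ = ENNReal.ofReal (36 * Q ^ 2 * (q ^ β * (P ^ 2 * ‖u‖ ^ (-(2 : ℝ))))) := by
        rw [← ENNReal.ofReal_mul (by positivity), ← ENNReal.ofReal_add (by positivity)
          (by positivity), ← ENNReal.ofReal_mul (by positivity)]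
        congr 1; ring
    _ = (ENNReal.ofReal (6 * Q * (q ^ (β / 2) * ‖u‖ ^ (-(n : ℝ))))) ^ 2 := by
        rw [← ENNReal.ofReal_pow (by positivity)]
        congr 1
        have e1 : (q ^ (β / 2)) ^ 2 = q ^ β := by
          rw [← Real.rpow_natCast, ← Real.rpow_mul hq0]; congr 1; push_cast; ring
        have e2 : P ^ 2 * ‖u‖ ^ (-(2 : ℝ)) = (‖u‖ ^ (-(n : ℝ))) ^ 2 := by
          rw [hP, ← Real.rpow_natCast, ← Real.rpow_natCast, ← Real.rpow_mul hup.le,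
            ← Real.rpow_mul hup.le, ← Real.rpow_add hup]
          congr 1; push_cast; ring
        rw [show (6 * Q * (q ^ (β / 2) * ‖u‖ ^ (-(n : ℝ)))) ^ 2 =
          36 * Q ^ 2 * ((q ^ (β / 2)) ^ 2 * (‖u‖ ^ (-(n : ℝ))) ^ 2) by ring, e1, e2]

end RoughKernel

/-! ### Plancherel's theorem for integrable square-integrable functions -/

open scoped FourierTransform SchwartzMap RealInnerProductSpace in
-- Both transforms satisfy ⟨𝓕f, φ⟩ = ⟨f, 𝓕φ⟩: the L² one through tempered distributions, the
-- integral one by Fubini. Testing against smooth compactly supported functions identifies them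
-- almost everywhere.
lemma fourier_toLp_ae_eq {n : ℕ} {f : Rn n → ℂ} (h1 : Integrable f) (h2 : MemLp f 2 volume) :
    ((𝓕 (h2.toLp f) : Lp ℂ 2 (volume : Measure (Rn n))) : Rn n → ℂ) =ᵐ[volume] 𝓕 f := by
  have hcont : Continuous (𝓕 f) :=
    VectorFourier.fourierIntegral_continuous Real.continuous_fourierChar
      (by exact continuous_inner) h1
  refine ae_eq_of_integral_contDiff_smul_eq ?_ hcont.locallyIntegrable fun g hg hgs => ?_
  · exact (Lp.memLp (𝓕 (h2.toLp f) : Lp ℂ 2 (volume : Measure (Rn n)))).locallyIntegrable (by norm_num)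
  · have hs : HasCompactSupport (fun x => (g x : ℂ)) := hgs.comp_left Complex.ofReal_zero
    have hd : ContDiff ℝ ((⊤ : ℕ∞) : WithTop ℕ∞) (fun x => (g x : ℂ)) := Complex.ofRealCLM.contDiff.comp hg
    set φ : 𝓢(Rn n, ℂ) := hs.toSchwartzMap hd with hφ
    have hφg : ∀ x, φ x = (g x : ℂ) := fun x => rfl
    have e1 := congrArg (fun T : 𝓢'(Rn n, ℂ) => T φ)
      (Lp.fourier_toTemperedDistribution_eq (h2.toLp f))
    simp only [TemperedDistribution.fourier_apply, Lp.toTemperedDistribution_apply] at e1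
    have e2 : ∫ x, (𝓕 φ) x • (h2.toLp f) x = ∫ x, (𝓕 φ) x • f x :=
      integral_congr_ae (by filter_upwards [h2.coeFn_toLp] with x hx; rw [hx])
    have e3 : ∫ ξ, 𝓕 (φ : Rn n → ℂ) ξ • f ξ = ∫ x, φ x • 𝓕 f x := by
      simpa using! (VectorFourier.integral_fourierIntegral_smul_eq_flip (L := innerₗ (Rn n))
        Real.continuous_fourierChar continuous_inner φ.integrable h1)
    rw [e2, SchwartzMap.fourier_coe, e3] at e1
    simp_rw [hφg] at e1
    simpa using e1.symm

open scoped FourierTransform in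
lemma lintegral_enorm_fourier_sq {n : ℕ} {f : Rn n → ℂ} (h1 : Integrable f)
    (h2 : MemLp f 2 volume) : ∫⁻ ξ, ‖𝓕 f ξ‖ₑ ^ 2 = ∫⁻ x, ‖f x‖ₑ ^ 2 := by
  have key : eLpNorm (𝓕 f) 2 volume = eLpNorm f 2 volume := by
    rw [← eLpNorm_congr_ae (fourier_toLp_ae_eq h1 h2), ← eLpNorm_congr_ae h2.coeFn_toLp]
    have h3 := Lp.norm_fourier_eq (h2.toLp f)
    rw [Lp.norm_def, Lp.norm_def] at h3
    exact (ENNReal.toReal_eq_toReal_iff' (Lp.eLpNorm_ne_top _) (Lp.eLpNorm_ne_top _)).1 h3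
  have e : ∀ g : Rn n → ℂ, eLpNorm g 2 volume ^ 2 = ∫⁻ x, ‖g x‖ₑ ^ 2 := by
    intro g
    rw [eLpNorm_eq_lintegral_rpow_enorm_toReal (by norm_num) (by norm_num)]
    simp only [ENNReal.toReal_ofNat, ENNReal.rpow_ofNat]
    exact rpow_half_sq _
  rw [← e, ← e, key]

/-! ### The averaging operators and the square function -/

/-- The convolution of `f` with the truncated kernel at scale `t`. -/
def avgOp {n : ℕ} (k f : Rn n → ℂ) (t : ℝ) (x : Rn n) : ℂ := ∫ y, ker k t (x - y) * f y

/-- The linear Marcinkiewicz integral. -/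
def sqFn {n : ℕ} (k f : Rn n → ℂ) (x : Rn n) : ℝ≥0∞ := l2 dtt fun t => ‖avgOp k f t x‖ₑ

lemma avgOp_congr {n : ℕ} {k f g : Rn n → ℂ} (h : f =ᵐ[volume] g) (t : ℝ) (x : Rn n) :
    avgOp k f t x = avgOp k g t x :=
  integral_congr_ae (by filter_upwards [h] with y hy; rw [hy])

lemma sqFn_congr {n : ℕ} {k f g : Rn n → ℂ} (h : f =ᵐ[volume] g) : sqFn k f = sqFn k g := by
  funext x
  simp only [sqFn, avgOp_congr h]

lemma avgOp_eq_setIntegral {n : ℕ} (k f : Rn n → ℂ) (t : ℝ) (x : Rn n) :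
    avgOp k f t x = (t : ℂ)⁻¹ * ∫ y in closedBall (0 : Rn n) t, k y * f (x - y) := by
  rw [avgOp, ← integral_sub_left_eq_self (fun y => ker k t (x - y) * f y) volume x,
    ← integral_indicator measurableSet_closedBall, ← integral_const_mul]
  refine integral_congr_ae (Eventually.of_forall fun y => ?_)
  simp only [sub_sub_cancel, ker]
  by_cases hy : y ∈ closedBall (0 : Rn n) t
  · rw [indicator_of_mem hy, indicator_of_mem hy, mul_assoc]
  · rw [indicator_of_notMem hy, indicator_of_notMem hy]; simp

lemma truncated_eq_prod {n m : ℕ} (Om f : Fin m → Rn n → ℂ) (t : ℝ) (x : Rn n) :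
    truncated Om f t x =
      ∏ j, avgOp (fun y => Om j y / ((‖y‖ ^ (n - 1) : ℝ) : ℂ)) (f j) t x := by
  simp_rw [avgOp_eq_setIntegral, Finset.prod_mul_distrib, truncated]
  simp

lemma mu_eq_l2 {n m : ℕ} (Om f : Fin m → Rn n → ℂ) (x : Rn n)
    (h : Measurable fun t => ‖truncated Om f t x‖ₑ) :
    mu Om f x = l2 dtt fun t => ∏ j, ‖avgOp (fun y => Om j y / ((‖y‖ ^ (n - 1) : ℝ) : ℂ))
      (f j) t x‖ₑ := by
  rw [mu, l2]
  congr 1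
  have e : ∀ t, ∏ j, ‖avgOp (fun y => Om j y / ((‖y‖ ^ (n - 1) : ℝ) : ℂ)) (f j) t x‖ₑ =
      ‖truncated Om f t x‖ₑ := fun t => by
    rw [truncated_eq_prod]
    simp only [← ofReal_norm, norm_prod]
    exact (ENNReal.ofReal_prod_of_nonneg fun _ _ => norm_nonneg _).symm
  simp_rw [e]
  rw [lintegral_dtt (h.pow_const 2)]
  refine lintegral_congr fun t => ?_
  rw [mul_comm, div_eq_mul_inv]

lemma memLp_two_of_integrable_of_bound {n : ℕ} {g : Rn n → ℂ} {M : ℝ} (hg : Integrable g)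
    (hM : ∀ᵐ x, ‖g x‖ ≤ M) : MemLp g 2 volume := by
  rw [memLp_two_iff_integrable_sq_norm hg.1]
  refine (hg.norm.const_mul M).mono' (hg.1.norm.pow 2) ?_
  filter_upwards [hM] with x hx
  rw [Real.norm_of_nonneg (by positivity), sq]
  gcongr

/-! ### Measurability of the square function and its L² bound. -/

namespace RoughKernel

variable {n : ℕ} {β D : ℝ} {k : Rn n → ℂ}

lemma stronglyMeasurable_avgOp (hk : RoughKernel β D k) {f : Rn n → ℂ}
    (hf : AEStronglyMeasurable f volume) :
    StronglyMeasurable fun q : ℝ × Rn n => avgOp k f q.1 q.2 := by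
  have e : (fun q : ℝ × Rn n => avgOp k f q.1 q.2) = fun q => avgOp k (hf.mk f) q.1 q.2 := by
    funext q; exact avgOp_congr hf.ae_eq_mk _ _
  rw [e]
  refine StronglyMeasurable.integral_prod_right'
    (f := fun p : (ℝ × Rn n) × Rn n => ker k p.1.1 (p.1.2 - p.2) * hf.mk f p.2) ?_
  refine Measurable.stronglyMeasurable (Measurable.mul ?_ ?_)
  · exact hk.measurable_ker.comp
      (by fun_prop : Measurable fun p : (ℝ × Rn n) × Rn n => (p.1.1, p.1.2 - p.2))
  · exact hf.stronglyMeasurable_mk.measurable.comp measurable_snd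

lemma measurable_enorm_avgOp (hk : RoughKernel β D k) {f : Rn n → ℂ}
    (hf : AEStronglyMeasurable f volume) (x : Rn n) : Measurable fun t => ‖avgOp k f t x‖ₑ :=
  ((hk.stronglyMeasurable_avgOp hf).comp_measurable
    (by fun_prop : Measurable fun t : ℝ => (t, x))).measurable.enorm

lemma measurable_sqFn (hk : RoughKernel β D k) {f : Rn n → ℂ}
    (hf : AEStronglyMeasurable f volume) : Measurable (sqFn k f) := by
  refine Measurable.pow_const ?_ _
  exact Measurable.lintegral_prod_left' (f := fun q : ℝ × Rn n => ‖avgOp k f q.1 q.2‖ₑ ^ 2)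
    ((hk.stronglyMeasurable_avgOp hf).measurable.enorm.pow_const 2)

open scoped FourierTransform RealInnerProductSpace in
/-- Square-function bound for the Fourier transforms of the truncated kernels. -/
lemma lintegral_fourier_ker_sq_le [NeZero n] (hk : RoughKernel β D k) :
    ∃ C : ℝ≥0, 0 < C ∧ ∀ ξ : Rn n, ∫⁻ t, ‖𝓕 (ker k t) ξ‖ₑ ^ 2 ∂dtt ≤ C := by
  have hβ0 := hk.beta_pos
  obtain ⟨C1, hC1, h1⟩ := hk.lintegral_ker_le
  obtain ⟨C2, hC2, h2⟩ := hk.lintegral_ker_sub_le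
  refine ⟨((2 * Real.pi * C1) ^ 2 * (1 / 2) + (C2 : ℝ) ^ 2 * (1 / (2 * β))).toNNReal,
    Real.toNNReal_pos.2 (by positivity), fun ξ => ?_⟩
  rcases eq_or_ne ξ 0 with rfl | hξ
  · have : ∀ t, 𝓕 (ker k t) (0 : Rn n) = 0 := fun t => by
      rw [Real.fourier_eq]; simpa using hk.integral_ker t
    simp [this]
  have hξ0 : 0 < ‖ξ‖ := norm_pos_iff.2 hξ
  -- Low frequencies use cancellation: subtracting the zero integral replaces the character by its
  -- difference from 1, which is at most 2π|v||ξ| with |v| ≤ t on the support.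
  have hsmall : ∀ t : ℝ, 0 < t → ‖𝓕 (ker k t) ξ‖ₑ ≤ ENNReal.ofReal (2 * Real.pi * C1 * ‖ξ‖ * t) := by
    intro t ht
    have hint := hk.integrable_ker t ht
    have e : 𝓕 (ker k t) ξ = ∫ v, (Real.fourierChar (-⟪v, ξ⟫) • ker k t v - ker k t v) := by
      rw [integral_sub ((Real.fourierIntegral_convergent_iff ξ).2 hint) hint, hk.integral_ker,
        sub_zero, Real.fourier_eq]
    have hb : ∀ v, ‖Real.fourierChar (-⟪v, ξ⟫) • ker k t v - ker k t v‖ₑ ≤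
        ENNReal.ofReal (2 * Real.pi * ‖ξ‖ * t) * ‖ker k t v‖ₑ := by
      intro v
      rcases lt_or_ge t ‖v‖ with hv | hv
      · rw [ker_of_lt hv]; simp
      rw [← ofReal_norm, ← ofReal_norm, ← ENNReal.ofReal_mul (by positivity)]
      refine ENNReal.ofReal_le_ofReal ?_
      rw [Circle.smul_def, smul_eq_mul, ← sub_one_mul, norm_mul]
      gcongr
      rw [Real.fourierChar_apply]
      calc ‖Complex.exp (↑(2 * Real.pi * -⟪v, ξ⟫) * Complex.I) - 1‖
          ≤ ‖2 * Real.pi * -⟪v, ξ⟫‖ := by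
            rw [mul_comm]; exact Real.norm_exp_I_mul_ofReal_sub_one_le
        _ = 2 * Real.pi * |⟪v, ξ⟫| := by
            rw [Real.norm_eq_abs, abs_mul, abs_neg, abs_of_pos (by positivity)]
        _ ≤ 2 * Real.pi * (‖v‖ * ‖ξ‖) := by gcongr; exact abs_real_inner_le_norm v ξ
        _ ≤ 2 * Real.pi * ‖ξ‖ * t := by
            have := mul_le_mul_of_nonneg_right hv (norm_nonneg ξ)
            nlinarith [Real.pi_pos]
    calc ‖𝓕 (ker k t) ξ‖ₑ ≤ ∫⁻ v, ‖Real.fourierChar (-⟪v, ξ⟫) • ker k t v - ker k t v‖ₑ := by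
          rw [e]; exact enorm_integral_le_lintegral_enorm _
      _ ≤ ∫⁻ v, ENNReal.ofReal (2 * Real.pi * ‖ξ‖ * t) * ‖ker k t v‖ₑ := lintegral_mono hb
      _ ≤ ENNReal.ofReal (2 * Real.pi * ‖ξ‖ * t) * C1 := by
          rw [lintegral_const_mul' _ _ ENNReal.ofReal_ne_top]; gcongr; exact h1 t ht
      _ = _ := by
          rw [← ENNReal.ofReal_coe_nnreal, ← ENNReal.ofReal_mul (by positivity)]
          congr 1; ring
  have hlarge : ∀ t : ℝ, 0 < t → ‖𝓕 (ker k t) ξ‖ₑ ≤ ENNReal.ofReal (C2 * (‖ξ‖ * t) ^ (-β)) := by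
    intro t ht
    have hint := hk.integrable_ker t ht
    -- Translation by this h, half a period in the direction ξ, flips the sign of the character. The
    -- transform is thus half the transform of a difference, and the L¹ modulus applies with |h| =
    -- 1/(2|ξ|).
    set h : Rn n := (1 / (2 * ‖ξ‖ ^ 2) : ℝ) • ξ with hh
    have hnh : ‖h‖ = 1 / (2 * ‖ξ‖) := by
      rw [hh, norm_smul, Real.norm_of_nonneg (by positivity)]; field_simp
    have e := fourierIntegral_eq_half_sub_half_period_translate hξ hint
    have e2 : 𝓕 (ker k t) ξ = ∫ v, Real.fourierChar (-⟪v, ξ⟫) • ker k t v := Real.fourier_eq _ _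
    calc ‖𝓕 (ker k t) ξ‖ₑ ≤ ∫⁻ v, ‖ker k t (v + h) - ker k t v‖ₑ := by
          rw [e2, e, enorm_smul]
          calc _ ≤ 1 * ∫⁻ v, ‖Real.fourierChar (-⟪v, ξ⟫) • (ker k t v - ker k t (v + h))‖ₑ := by
                gcongr
                · rw [← ofReal_norm, ← ENNReal.ofReal_one]
                  apply ENNReal.ofReal_le_ofReal; norm_num
                · exact enorm_integral_le_lintegral_enorm _
            _ = _ := by
                rw [one_mul]
                refine lintegral_congr fun v => ?_
                rw [← ofReal_norm, ← ofReal_norm, Circle.norm_smul, norm_sub_rev]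
      _ ≤ C2 * ENNReal.ofReal ((‖h‖ / t) ^ β) := h2 t h ht
      _ ≤ _ := by
          rw [← ENNReal.ofReal_coe_nnreal, ← ENNReal.ofReal_mul (by positivity)]
          refine ENNReal.ofReal_le_ofReal ?_
          gcongr
          rw [Real.rpow_neg (by positivity), ← Real.inv_rpow (by positivity), hnh]
          gcongr
          rw [one_div, div_eq_mul_inv, ← mul_inv]
          apply inv_anti₀ (by positivity)
          nlinarith [mul_pos hξ0 ht]
  -- The two bounds cross at t|ξ| of order 1; on either side the dt/t integral of the square is
  -- independent of ξ.
  set r : ℝ := ‖ξ‖⁻¹ with hr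
  have hr0 : 0 < r := by positivity
  have hsplit : (univ : Set ℝ) ⊆ Iic 0 ∪ (Ioc 0 r ∪ Ici r) := by
    intro t _
    rcases le_or_gt t 0 with h | h
    · exact Or.inl h
    · rcases le_or_gt t r with h' | h'
      · exact Or.inr (Or.inl ⟨h, h'⟩)
      · exact Or.inr (Or.inr h'.le)
  have hnull : dtt (Iic 0) = 0 := by
    have := ae_dtt_pos
    rw [ae_iff] at this
    convert this using 2
    ext t; simp
  calc ∫⁻ t, ‖𝓕 (ker k t) ξ‖ₑ ^ 2 ∂dtt
      = ∫⁻ t in univ, ‖𝓕 (ker k t) ξ‖ₑ ^ 2 ∂dtt := by rw [Measure.restrict_univ]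
    _ ≤ ∫⁻ t in Iic 0 ∪ (Ioc 0 r ∪ Ici r), ‖𝓕 (ker k t) ξ‖ₑ ^ 2 ∂dtt := lintegral_mono_set hsplit
    _ ≤ (∫⁻ t in Iic 0, ‖𝓕 (ker k t) ξ‖ₑ ^ 2 ∂dtt) + ((∫⁻ t in Ioc 0 r, ‖𝓕 (ker k t) ξ‖ₑ ^ 2 ∂dtt) +
          ∫⁻ t in Ici r, ‖𝓕 (ker k t) ξ‖ₑ ^ 2 ∂dtt) :=
        (lintegral_union_le _ _ _).trans (add_le_add_right (lintegral_union_le _ _ _) _)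
    _ ≤ 0 + (ENNReal.ofReal ((2 * Real.pi * C1) ^ 2 * (1 / 2)) +
          ENNReal.ofReal ((C2 : ℝ) ^ 2 * (1 / (2 * β)))) := by
        refine add_le_add (le_of_eq ?_) (add_le_add ?_ ?_)
        · rw [Measure.restrict_eq_zero.2 hnull, lintegral_zero_measure]
        · calc _ ≤ ∫⁻ t in Ioc 0 r, ENNReal.ofReal ((2 * Real.pi * C1 * ‖ξ‖) ^ 2) *
                ENNReal.ofReal (t ^ (2 : ℝ)) ∂dtt := by
                refine setLIntegral_mono' measurableSet_Ioc fun t ht => ?_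
                refine (pow_le_pow_left' (hsmall t ht.1) 2).trans (le_of_eq ?_)
                have := ht.1
                rw [← ENNReal.ofReal_pow (by positivity), ← ENNReal.ofReal_mul (by positivity),
                  Real.rpow_ofNat]
                congr 1; ring
            _ = _ := by
                rw [lintegral_const_mul' _ _ ENNReal.ofReal_ne_top,
                  setLIntegral_Ioc_rpow_dtt (by norm_num) hr0, ← ENNReal.ofReal_mul (by positivity)]
                congr 1
                rw [hr, Real.rpow_ofNat]; field_simp
        · calc _ ≤ ∫⁻ t in Ici r, ENNReal.ofReal ((C2 : ℝ) ^ 2 * ‖ξ‖ ^ (-(2 * β))) *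
                ENNReal.ofReal (t ^ (-(2 * β))) ∂dtt := by
                refine setLIntegral_mono' measurableSet_Ici fun t ht => ?_
                have ht0 : 0 < t := hr0.trans_le ht
                refine (pow_le_pow_left' (hlarge t ht0) 2).trans (le_of_eq ?_)
                rw [← ENNReal.ofReal_pow (by positivity), ← ENNReal.ofReal_mul (by positivity)]
                congr 1
                rw [mul_pow, ← Real.rpow_natCast ((‖ξ‖ * t) ^ (-β)), ← Real.rpow_mul (by positivity),
                  mul_assoc, ← Real.mul_rpow hξ0.le ht0.le]
                congr 2; push_cast; ring
            _ = _ := by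
                rw [lintegral_const_mul' _ _ ENNReal.ofReal_ne_top,
                  setLIntegral_Ici_rpow_dtt (by positivity) hr0, ← ENNReal.ofReal_mul (by positivity)]
                congr 1
                have h1 : ‖ξ‖ ^ (-(2 * β)) * r ^ (-(2 * β)) = 1 := by
                  rw [← Real.mul_rpow hξ0.le hr0.le, hr, mul_inv_cancel₀ hξ0.ne', Real.one_rpow]
                rw [mul_assoc, ← mul_div_assoc, h1]
    _ = _ := by
        rw [zero_add, ← ENNReal.ofReal_add (by positivity) (by positivity)]; rfl

open scoped FourierTransform Convolution in
-- The average is a convolution with an integrable kernel, so it stays integrable and bounded.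
-- Plancherel applies to it, and its Fourier transform is a product.
lemma lintegral_avgOp_sq [NeZero n] (hk : RoughKernel β D k) {f : Rn n → ℂ} {M : ℝ}
    (hf : Integrable f) (hM : ∀ᵐ x, ‖f x‖ ≤ M) {t : ℝ} (ht : 0 < t) :
    (∫⁻ x, ‖avgOp k f t x‖ₑ ^ 2) = ∫⁻ ξ, ‖𝓕 f ξ‖ₑ ^ 2 * ‖𝓕 (ker k t) ξ‖ₑ ^ 2 := by
  have hint := hk.integrable_ker t ht
  have e : avgOp k f t = f ⋆[ContinuousLinearMap.mul ℂ ℂ] ker k t := by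
    funext x
    simp only [avgOp, convolution, ContinuousLinearMap.mul_apply', mul_comm]
  have hi : Integrable (avgOp k f t) := by
    rw [e]; exact hf.integrable_convolution _ hint
  have hbd : ∀ x, ‖avgOp k f t x‖ ≤ M * ∫ y, ‖ker k t y‖ := by
    intro x
    have hshift : Integrable fun y => ker k t (x - y) := hint.comp_sub_left x
    calc ‖avgOp k f t x‖ ≤ ∫ y, ‖ker k t (x - y) * f y‖ := norm_integral_le_integral_norm _
      _ ≤ ∫ y, M * ‖ker k t (x - y)‖ := by
          refine integral_mono_of_nonneg (Eventually.of_forall fun _ => norm_nonneg _)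
            (hshift.norm.const_mul M) ?_
          filter_upwards [hM] with y hy
          rw [norm_mul, mul_comm]; gcongr
      _ = M * ∫ y, ‖ker k t y‖ := by
          rw [integral_const_mul, integral_sub_left_eq_self (fun y => ‖ker k t y‖) volume x]
  rw [← lintegral_enorm_fourier_sq hi (memLp_two_of_integrable_of_bound hi
    (Eventually.of_forall hbd))]
  refine lintegral_congr fun ξ => ?_
  rw [e, Real.fourier_mul_convolution_eq hf hint, enorm_mul, mul_pow]

open scoped FourierTransform RealInnerProductSpace in
lemma measurable_enorm_fourier_ker (hk : RoughKernel β D k) :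
    Measurable fun q : ℝ × Rn n => ‖𝓕 (ker k q.1) q.2‖ₑ := by
  have : StronglyMeasurable fun q : ℝ × Rn n =>
      ∫ v, Real.fourierChar (-⟪v, q.2⟫) • ker k q.1 v := by
    refine StronglyMeasurable.integral_prod_right' (f := fun p : (ℝ × Rn n) × Rn n =>
      Real.fourierChar (-⟪p.2, p.1.2⟫) • ker k p.1.1 p.2) ?_
    simp only [Circle.smul_def, smul_eq_mul]
    refine Measurable.stronglyMeasurable (Measurable.mul ?_ ?_)
    · have hc : Continuous fun p : (ℝ × Rn n) × Rn n =>
          (Real.fourierChar (-⟪p.2, p.1.2⟫) : ℂ) :=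
        continuous_subtype_val.comp (Real.continuous_fourierChar.comp (by fun_prop))
      exact hc.measurable
    · exact hk.measurable_ker.comp
        (by fun_prop : Measurable fun p : (ℝ × Rn n) × Rn n => (p.1.1, p.2))
  simp_rw [Real.fourier_eq]
  exact this.measurable.enorm

open scoped FourierTransform RealInnerProductSpace in
/-- `L²` bound for the square function on bounded integrable functions. -/
lemma lintegral_sqFn_sq_le [NeZero n] (hk : RoughKernel β D k) :
    ∃ C : ℝ≥0, 0 < C ∧ ∀ (f : Rn n → ℂ) (M : ℝ), Integrable f → (∀ᵐ x, ‖f x‖ ≤ M) →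
      ∫⁻ x, sqFn k f x ^ 2 ≤ C * ∫⁻ x, ‖f x‖ₑ ^ 2 := by
  obtain ⟨C, hC, h⟩ := hk.lintegral_fourier_ker_sq_le
  refine ⟨C, hC, fun f M hf hM => ?_⟩
  have hmF := hk.measurable_enorm_fourier_ker
  have hconv := fun (t : ℝ) (ht : 0 < t) => hk.lintegral_avgOp_sq hf hM ht
  have hmf : Measurable (𝓕 f) :=
    (VectorFourier.fourierIntegral_continuous Real.continuous_fourierChar
      (by exact continuous_inner) hf).measurable
  calc ∫⁻ x, sqFn k f x ^ 2 = ∫⁻ x, (∫⁻ t, ‖avgOp k f t x‖ₑ ^ 2 ∂dtt) := by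
        refine lintegral_congr fun x => ?_
        rw [sqFn, l2_sq]
    _ = ∫⁻ t, (∫⁻ x, ‖avgOp k f t x‖ₑ ^ 2) ∂dtt := by
        have hm : Measurable fun q : Rn n × ℝ => ‖avgOp k f q.2 q.1‖ₑ ^ 2 :=
          Measurable.pow_const (((hk.stronglyMeasurable_avgOp hf.1).comp_measurable
            (by fun_prop : Measurable fun q : Rn n × ℝ => (q.2, q.1))).measurable.enorm) 2
        exact lintegral_lintegral_swap (f := fun x t => ‖avgOp k f t x‖ₑ ^ 2) hm.aemeasurable
    _ = ∫⁻ t, (∫⁻ ξ, ‖𝓕 f ξ‖ₑ ^ 2 * ‖𝓕 (ker k t) ξ‖ₑ ^ 2) ∂dtt :=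
        lintegral_congr_ae (ae_dtt_pos.mono fun t ht => hconv t ht)
    _ = ∫⁻ ξ, (∫⁻ t, ‖𝓕 f ξ‖ₑ ^ 2 * ‖𝓕 (ker k t) ξ‖ₑ ^ 2 ∂dtt) := by
        have hm : Measurable fun q : ℝ × Rn n => ‖𝓕 f q.2‖ₑ ^ 2 * ‖𝓕 (ker k q.1) q.2‖ₑ ^ 2 :=
          ((hmf.comp measurable_snd).enorm.pow_const 2).mul (hmF.pow_const 2)
        exact lintegral_lintegral_swap
          (f := fun t ξ => ‖𝓕 f ξ‖ₑ ^ 2 * ‖𝓕 (ker k t) ξ‖ₑ ^ 2) hm.aemeasurable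
    _ ≤ ∫⁻ ξ, ‖𝓕 f ξ‖ₑ ^ 2 * C := by
        refine lintegral_mono fun ξ => ?_
        rw [lintegral_const_mul' _ _ (by simp)]
        gcongr
        exact h ξ
    _ = C * ∫⁻ x, ‖f x‖ₑ ^ 2 := by
        rw [lintegral_mul_const' _ _ ENNReal.coe_ne_top,
          lintegral_enorm_fourier_sq hf (memLp_two_of_integrable_of_bound hf hM), mul_comm]

end RoughKernel

/-! ### The weak type `(1,1)` bound for the square function -/

/-- Enumerate the indices; Q i is A i together with the points of B i that lie in no A j and in no
earlier B j. With A the disjoint stopping balls and B their dilates, this replaces dyadic cubes: the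
pieces are disjoint and comparable in volume to balls. -/
lemma exists_disjoint_cover {α ι : Type*} [MeasurableSpace α] [Countable ι] (A B : ι → Set α)
    (hAB : ∀ i, A i ⊆ B i) (hA : ∀ i, MeasurableSet (A i)) (hB : ∀ i, MeasurableSet (B i))
    (hd : Pairwise fun i j => Disjoint (A i) (A j)) :
    ∃ Q : ι → Set α, (∀ i, MeasurableSet (Q i)) ∧ (Pairwise fun i j => Disjoint (Q i) (Q j)) ∧
      (∀ i, A i ⊆ Q i) ∧ (∀ i, Q i ⊆ B i) ∧ ⋃ i, Q i = ⋃ i, B i := by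
  obtain ⟨e, he⟩ := exists_injective_nat ι
  set Q : ι → Set α := fun i => A i ∪ (B i \ ((⋃ j, A j) ∪ ⋃ j ∈ {j | e j < e i}, B j)) with hQ
  refine ⟨Q, fun i => ?_, fun i j hij => ?_, fun i => subset_union_left, fun i => ?_, ?_⟩
  · exact (hA i).union ((hB i).diff ((MeasurableSet.iUnion hA).union
      (MeasurableSet.biUnion (to_countable _) fun j _ => hB j)))
  · refine Set.disjoint_left.2 ?_
    rintro x (hx | hx) (hy | hy)
    · exact Set.disjoint_left.1 (hd hij) hx hy
    · exact hy.2 (Or.inl (mem_iUnion.2 ⟨i, hx⟩))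
    · exact hx.2 (Or.inl (mem_iUnion.2 ⟨j, hy⟩))
    · rcases lt_trichotomy (e i) (e j) with h | h | h
      · exact hy.2 (Or.inr (mem_biUnion (x := i) h hx.1))
      · exact hij (he h)
      · exact hx.2 (Or.inr (mem_biUnion (x := j) h hy.1))
  · exact union_subset (hAB i) sdiff_subset
  · refine subset_antisymm (iUnion_mono fun i => union_subset (hAB i) sdiff_subset) fun x hx => ?_
    by_cases hxA : x ∈ ⋃ j, A j
    · obtain ⟨j, hj⟩ := mem_iUnion.1 hxA
      exact mem_iUnion.2 ⟨j, Or.inl hj⟩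
    · classical
      have hex : ∃ N, ∃ i, e i = N ∧ x ∈ B i := by
        obtain ⟨i, hi⟩ := mem_iUnion.1 hx
        exact ⟨_, i, rfl, hi⟩
      obtain ⟨i, hi, hxi⟩ := Nat.find_spec hex
      refine mem_iUnion.2 ⟨i, Or.inr ⟨hxi, ?_⟩⟩
      rintro (h | h)
      · exact hxA h
      · obtain ⟨j, hj, hxj⟩ := mem_iUnion₂.1 h
        have hj' : e j < e i := hj
        rw [hi] at hj'
        exact Nat.find_min hex hj' ⟨j, rfl, hxj⟩

namespace RoughKernel

variable {n : ℕ} {β D : ℝ} {k : Rn n → ℂ}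

/-- The vector-valued Hörmander condition. By `l2_ker_sub_le` the integrand is of order r^{β/2}|x -
z|^{-n-β/2}, whose integral over |x - z| ≥ 2r does not depend on r. -/
lemma lintegral_far_l2_ker_sub_le [NeZero n] (hk : RoughKernel β D k) :
    ∃ C : ℝ≥0, 0 < C ∧ ∀ (z h : Rn n) (r : ℝ), 0 < r → ‖h‖ ≤ r →
      ∫⁻ x in {x | 2 * r ≤ ‖z - x‖}, l2 dtt (fun t => ‖ker k t (x - z + h) - ker k t (x - z)‖ₑ) ≤
        C := by
  have hβ := hk.beta_pos
  obtain ⟨C1, hC1, h1⟩ := hk.l2_ker_sub_le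
  obtain ⟨C2, hC2, h2⟩ := lintegral_rpow_far (n := n) (a := n + β / 2) (σ := n)
    (by positivity) (by linarith)
  refine ⟨C1.toNNReal * (C2 * (unitVol n).toNNReal), by
    have := ENNReal.toNNReal_pos (unitVol_ne_zero n) (unitVol_ne_top n)
    have := Real.toNNReal_pos.2 hC1
    positivity, fun z h r hr hh => ?_⟩
  have h3 := h2 (fun _ => 1) z (unitVol n) (2 * r) (by positivity) fun s hs => by
    rw [setLIntegral_one, volume_closedBall_eq _ (by linarith), mul_comm, Real.rpow_natCast]
  calc ∫⁻ x in {x | 2 * r ≤ ‖z - x‖}, l2 dtt (fun t => ‖ker k t (x - z + h) - ker k t (x - z)‖ₑ)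
      ≤ ∫⁻ x in {x | 2 * r ≤ ‖z - x‖}, ENNReal.ofReal (C1 * r ^ (β / 2)) *
          (ENNReal.ofReal (‖z - x‖ ^ (-((n : ℝ) + β / 2))) * 1) := by
        refine setLIntegral_mono' (measurableSet_le (by fun_prop) (by fun_prop)) fun x hx => ?_
        have hx' : 2 * r ≤ ‖x - z‖ := by rw [norm_sub_rev]; exact hx
        have hx0 : 0 < ‖x - z‖ := by linarith
        refine (h1 (x - z) h (norm_pos_iff.1 hx0) (by linarith)).trans ?_
        rw [mul_one, ← ENNReal.ofReal_mul (by positivity), norm_sub_rev z x]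
        refine ENNReal.ofReal_le_ofReal ?_
        rw [mul_assoc, Real.div_rpow (norm_nonneg _) hx0.le, neg_add, Real.rpow_add hx0,
          Real.rpow_neg hx0.le (β / 2), mul_comm (‖x - z‖ ^ (-(n : ℝ))), ← mul_assoc (r ^ (β / 2)),
          ← div_eq_mul_inv]
        gcongr
    _ ≤ ENNReal.ofReal (C1 * r ^ (β / 2)) *
          (C2 * unitVol n * ENNReal.ofReal ((2 * r) ^ ((n : ℝ) - (n + β / 2)))) := by
        rw [lintegral_const_mul' _ _ ENNReal.ofReal_ne_top]; gcongr
    _ = (C1.toNNReal * (C2 * unitVol n)) *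
        (ENNReal.ofReal (r ^ (β / 2)) * ENNReal.ofReal ((2 * r) ^ ((n : ℝ) - (n + β / 2)))) := by
        rw [ENNReal.ofReal_mul hC1.le]
        change _ = (ENNReal.ofReal C1 * _) * _
        ring
    _ ≤ (C1.toNNReal * (C2 * unitVol n)) * 1 := by
        gcongr
        rw [← ENNReal.ofReal_mul (by positivity), ← ENNReal.ofReal_one]
        refine ENNReal.ofReal_le_ofReal ?_
        rw [show (n : ℝ) - (n + β / 2) = -(β / 2) by ring, Real.rpow_neg (by positivity),
          ← div_eq_mul_inv]
        refine div_le_one_of_le₀ ?_ (by positivity)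
        exact Real.rpow_le_rpow hr.le (by linarith) (by positivity)
    _ = _ := by
        push_cast
        rw [mul_one, ENNReal.coe_toNNReal (unitVol_ne_top n)]

/-- The square function of a function with integral zero is integrable away from its support. -/
lemma lintegral_far_sqFn_le [NeZero n] (hk : RoughKernel β D k) :
    ∃ C : ℝ≥0, 0 < C ∧ ∀ (z : Rn n) (r : ℝ) (b : Rn n → ℂ), 0 < r → Measurable b →
      (∀ y, y ∉ closedBall z r → b y = 0) → ∫ y, b y = 0 →
      ∫⁻ x in {x | 2 * r ≤ ‖z - x‖}, sqFn k b x ≤ C * ∫⁻ y, ‖b y‖ₑ := by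
  obtain ⟨C, hC, h⟩ := hk.lintegral_far_l2_ker_sub_le
  refine ⟨C, hC, fun z r b hr hb hsupp hzero => ?_⟩
  have hpt : ∀ t x, ‖avgOp k b t x‖ₑ ≤ ∫⁻ y, ‖ker k t (x - y) - ker k t (x - z)‖ₑ * ‖b y‖ₑ := by
    intro t x
    by_cases hi : Integrable fun y => ker k t (x - y) * b y
    · by_cases hib : Integrable b
      · have e : avgOp k b t x = ∫ y, (ker k t (x - y) - ker k t (x - z)) * b y := by
          simp_rw [sub_mul]
          rw [integral_sub hi (hib.const_mul _), integral_const_mul, hzero, mul_zero, sub_zero, avgOp]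
        rw [e]
        refine (enorm_integral_le_lintegral_enorm _).trans (le_of_eq ?_)
        simp_rw [enorm_mul]
      -- A vanishing Bochner integral does not give integrability of b. If b is not integrable,
      -- either the subtracted term is zero or the right-hand side is infinite.
      · by_cases hk0 : ker k t (x - z) = 0
        · simp_rw [hk0, sub_zero, ← enorm_mul]
          exact enorm_integral_le_lintegral_enorm _
        · have : ¬ Integrable fun y => (ker k t (x - y) - ker k t (x - z)) * b y := by
            intro hcon
            refine hib ?_
            have h2 := (hi.sub hcon).const_mul (ker k t (x - z))⁻¹
            refine h2.congr (Eventually.of_forall fun y => ?_)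
            simp only [Pi.sub_apply]
            rw [← sub_mul, sub_sub_cancel, ← mul_assoc, inv_mul_cancel₀ hk0, one_mul]
          have hm : AEStronglyMeasurable (fun y => (ker k t (x - y) - ker k t (x - z)) * b y)
              volume := by
            have := hk.measurable_ker_right t
            exact Measurable.aestronglyMeasurable (by fun_prop)
          have htop : ∫⁻ y, ‖(ker k t (x - y) - ker k t (x - z)) * b y‖ₑ = ∞ := by
            by_contra hne
            exact this ⟨hm, lt_top_iff_ne_top.2 hne⟩
          simp_rw [enorm_mul] at htop
          rw [htop]; exact le_top
    · rw [avgOp, integral_undef hi]; simp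
  have hΦ : ∀ x, Measurable (Function.uncurry fun (t : ℝ) (y : Rn n) =>
      ‖ker k t (x - y) - ker k t (x - z)‖ₑ * ‖b y‖ₑ) := by
    intro x
    have m1 : Measurable fun q : ℝ × Rn n => ker k q.1 (x - q.2) := hk.measurable_ker.comp
      (by fun_prop : Measurable fun q : ℝ × Rn n => (q.1, x - q.2))
    have m2 : Measurable fun q : ℝ × Rn n => ker k q.1 (x - z) := hk.measurable_ker.comp
      (by fun_prop : Measurable fun q : ℝ × Rn n => (q.1, x - z))
    exact (m1.sub m2).enorm.mul (hb.comp measurable_snd).enorm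
  have hpt2 : ∀ x, sqFn k b x ≤
      ∫⁻ y, ‖b y‖ₑ * l2 dtt (fun t => ‖ker k t (x - z + (z - y)) - ker k t (x - z)‖ₑ) := by
    intro x
    calc sqFn k b x ≤ l2 dtt fun t => ∫⁻ y, ‖ker k t (x - y) - ker k t (x - z)‖ₑ * ‖b y‖ₑ :=
          l2_mono_ae (Eventually.of_forall fun t => hpt t x)
      _ ≤ ∫⁻ y, l2 dtt fun t => ‖ker k t (x - y) - ker k t (x - z)‖ₑ * ‖b y‖ₑ := l2_lintegral_le (hΦ x)
      _ = _ := by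
          refine lintegral_congr fun y => ?_
          simp_rw [mul_comm _ ‖b y‖ₑ]
          rw [l2_const_mul enorm_ne_top, sub_add_sub_cancel]
  have hm : Measurable fun q : Rn n × Rn n =>
      ‖b q.2‖ₑ * l2 dtt (fun t => ‖ker k t (q.1 - z + (z - q.2)) - ker k t (q.1 - z)‖ₑ) := by
    refine (hb.comp measurable_snd).enorm.mul (Measurable.pow_const ?_ _)
    refine Measurable.lintegral_prod_right' (f := fun p : (Rn n × Rn n) × ℝ =>
      ‖ker k p.2 (p.1.1 - z + (z - p.1.2)) - ker k p.2 (p.1.1 - z)‖ₑ ^ 2) ?_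
    have m1 := hk.measurable_ker.comp (by fun_prop : Measurable fun p : (Rn n × Rn n) × ℝ =>
      (p.2, p.1.1 - z + (z - p.1.2)))
    have m2 := hk.measurable_ker.comp (by fun_prop : Measurable fun p : (Rn n × Rn n) × ℝ =>
      (p.2, p.1.1 - z))
    exact (m1.sub m2).enorm.pow_const 2
  calc ∫⁻ x in {x | 2 * r ≤ ‖z - x‖}, sqFn k b x
      ≤ ∫⁻ x in {x | 2 * r ≤ ‖z - x‖}, (∫⁻ y, ‖b y‖ₑ *
          l2 dtt (fun t => ‖ker k t (x - z + (z - y)) - ker k t (x - z)‖ₑ)) :=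
        lintegral_mono hpt2
    _ = ∫⁻ y, (∫⁻ x in {x | 2 * r ≤ ‖z - x‖}, ‖b y‖ₑ *
          l2 dtt (fun t => ‖ker k t (x - z + (z - y)) - ker k t (x - z)‖ₑ)) :=
        lintegral_lintegral_swap (f := fun x y => ‖b y‖ₑ *
          l2 dtt (fun t => ‖ker k t (x - z + (z - y)) - ker k t (x - z)‖ₑ)) hm.aemeasurable
    _ ≤ ∫⁻ y, ‖b y‖ₑ * C := by
        refine lintegral_mono fun y => ?_
        rw [lintegral_const_mul' _ _ enorm_ne_top]
        by_cases hy : y ∈ closedBall z r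
        · gcongr
          exact h z (z - y) r hr (by rwa [← dist_eq_norm, dist_comm])
        · simp [hsupp y hy]
    _ = _ := by rw [lintegral_mul_const' _ _ ENNReal.coe_ne_top, mul_comm]

/-- For a locally integrable function the averages converge absolutely at almost every point, for
all scales at once. -/
lemma ae_integrable_ker_mul [NeZero n] (hk : RoughKernel β D k) {f : Rn n → ℂ}
    (hf : LocallyIntegrable f) :
    ∀ᵐ x, ∀ t, 0 < t → Integrable fun y => ker k t (x - y) * f y := by
  obtain ⟨C, hC, h⟩ := hk.lintegral_ker_le
  have hfm := hf.aestronglyMeasurable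
  have key : ∀ N : ℕ, ∀ᵐ x, x ∈ closedBall (0 : Rn n) N → ∀ t : ℝ, 0 < t → t ≤ N →
      Integrable fun y => ker k t (x - y) * f y := by
    intro N
    rcases Nat.eq_zero_or_pos N with rfl | hN
    · refine Eventually.of_forall fun x _ t ht ht' => ?_
      simp at ht'; linarith
    have hN' : (0 : ℝ) < N := by exact_mod_cast hN
    set w : Rn n → ℝ≥0∞ := (closedBall (0 : Rn n) (2 * N)).indicator fun y => ‖hfm.mk f y‖ₑ with hw
    have hwm : Measurable w :=
      hfm.stronglyMeasurable_mk.measurable.enorm.indicator measurableSet_closedBall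
    have hwfin : ∫⁻ y, w y ≠ ∞ := by
      rw [hw, lintegral_indicator measurableSet_closedBall]
      have h1 : IntegrableOn f (closedBall (0 : Rn n) (2 * N)) :=
        hf.integrableOn_isCompact (isCompact_closedBall _ _)
      have h2 := h1.2
      rw [hasFiniteIntegral_iff_enorm] at h2
      rw [← lintegral_congr_ae (ae_restrict_of_ae (hfm.ae_eq_mk.mono fun y hy => by
        show ‖f y‖ₑ = ‖hfm.mk f y‖ₑ; rw [hy]))]
      exact h2.ne
    have hΦ : Measurable fun q : Rn n × Rn n => ‖ker k N (q.1 - q.2)‖ₑ * w q.2 :=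
      ((hk.measurable_ker_right N).comp (by fun_prop : Measurable fun q : Rn n × Rn n =>
        q.1 - q.2)).enorm.mul (hwm.comp measurable_snd)
    have hfin : ∫⁻ x, (∫⁻ y, ‖ker k N (x - y)‖ₑ * w y) ≠ ∞ := by
      have e := lintegral_lintegral_swap (μ := volume) (ν := volume)
        (f := fun x y : Rn n => ‖ker k N (x - y)‖ₑ * w y) hΦ.aemeasurable
      rw [e]
      refine ne_top_of_le_ne_top (ENNReal.mul_ne_top (ENNReal.coe_ne_top (r := C)) hwfin) ?_
      rw [← lintegral_const_mul' _ _ ENNReal.coe_ne_top]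
      refine lintegral_mono fun y => ?_
      have : Measurable fun x => ‖ker k N (x - y)‖ₑ := by
        have := hk.measurable_ker_right N
        fun_prop
      rw [lintegral_mul_const _ this, lintegral_sub_right_eq_self (fun x => ‖ker k N x‖ₑ) y]
      gcongr
      exact h N hN'
    filter_upwards [ae_lt_top hΦ.lintegral_prod_right' hfin] with x hx hxN t ht htN
    have hm : AEStronglyMeasurable (fun y => ker k t (x - y) * f y) volume := by
      have := hk.measurable_ker_right t
      exact AEStronglyMeasurable.mul (Measurable.aestronglyMeasurable (by fun_prop)) hfm
    refine ⟨hm, ?_⟩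
    rw [hasFiniteIntegral_iff_enorm]
    -- For t ≤ N the kernel at scale t is dominated by N/t times the one at scale N, so a single
    -- null set serves all scales.
    refine lt_of_le_of_lt ?_ (ENNReal.mul_lt_top (ENNReal.ofReal_lt_top (r := N / t)) hx)
    rw [← lintegral_const_mul' _ _ ENNReal.ofReal_ne_top]
    refine lintegral_mono_ae ?_
    filter_upwards [hfm.ae_eq_mk] with y hy
    rw [enorm_mul]
    rcases lt_or_ge t ‖x - y‖ with hlt | hle
    · rw [ker_of_lt hlt]; simp
    have hy2 : y ∈ closedBall (0 : Rn n) (2 * N) := by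
      rw [mem_closedBall_zero_iff]
      have h1 : ‖x‖ ≤ N := by simpa using hxN
      have : ‖y‖ ≤ ‖x‖ + ‖x - y‖ := by
        have := norm_sub_le x (x - y); simpa using this
      linarith
    rw [hw, indicator_of_mem hy2, ← hy, ← mul_assoc]
    gcongr
    rw [ker_of_le hle, ker_of_le (hle.trans htN), ← ofReal_norm, ← ofReal_norm,
      ← ENNReal.ofReal_mul (by positivity)]
    refine ENNReal.ofReal_le_ofReal (le_of_eq ?_)
    rw [norm_mul, norm_mul, norm_inv, norm_inv, Complex.norm_real, Complex.norm_real,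
      Real.norm_of_nonneg ht.le, Real.norm_of_nonneg hN'.le]
    field_simp
  have := ae_all_iff.2 key
  filter_upwards [this] with x hx t ht
  obtain ⟨N, hN⟩ := exists_nat_ge (max t ‖x‖)
  exact hx N (by simpa using (le_max_right _ _).trans hN) t ht ((le_max_left _ _).trans hN)

end RoughKernel

/-- The Calderón–Zygmund decomposition, with disjoint pieces inside the dilates of stopping balls. -/
lemma exists_calderon_zygmund {n : ℕ} [NeZero n] {f : Rn n → ℂ} (hfm : Measurable f)
    (hf : Integrable f) {l : ℝ≥0∞} (hl0 : l ≠ 0) (hltop : l ≠ ∞) :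
    ∃ (h : Rn n → ℂ) (u : Set (Rn n × ℝ)) (Q : u → Set (Rn n)), u.Countable ∧ Measurable h ∧
      (∀ᵐ x, ‖h x‖ₑ ≤ ENNReal.ofReal (5 ^ n) * l) ∧ (∫⁻ x, ‖h x‖ₑ) ≤ (∫⁻ x, ‖f x‖ₑ) ∧
      (∀ p : u, 0 < p.1.2) ∧
      l * ∑' p : u, volume (closedBall p.1.1 p.1.2) ≤ (∫⁻ x, ‖f x‖ₑ) ∧
      (∀ p, MeasurableSet (Q p)) ∧ (∀ p : u, Q p ⊆ closedBall p.1.1 (5 * p.1.2)) ∧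
      (Pairwise fun p q => Disjoint (Q p) (Q q)) ∧ (∀ p, ∫ y in Q p, (f y - h y) = 0) ∧
      ∀ x, x ∉ ⋃ p, Q p → h x = f x := by
  set ν : Measure (Rn n) := volume.withDensity fun y => ‖f y‖ₑ with hν
  have hfin : ∫⁻ y, ‖f y‖ₑ ≠ ∞ := (hasFiniteIntegral_iff_enorm.1 hf.2).ne
  have hνE : ν univ = ∫⁻ y, ‖f y‖ₑ := by
    rw [hν, withDensity_apply _ MeasurableSet.univ, Measure.restrict_univ]
  have hνs : ∀ x r, ν (closedBall x r) = ∫⁻ y in closedBall x r, ‖f y‖ₑ := fun x r => by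
    rw [hν, withDensity_apply _ measurableSet_closedBall]
  obtain ⟨u, hc, hu, hdisj, hcov⟩ := exists_stopping_balls ν (hνE ▸ hfin) hl0 hltop
    {x | ∃ r, 0 < r ∧ l * volume (closedBall x r) < ν (closedBall x r)} fun x hx => hx
  have := hc.to_subtype
  obtain ⟨Q, hQm, hQd, hQB, hQ5, hQU⟩ := exists_disjoint_cover
    (fun p : u => closedBall p.1.1 p.1.2) (fun p : u => closedBall p.1.1 (5 * p.1.2))
    (fun p => closedBall_subset_closedBall (by linarith [(hu p.1 p.2).2.1]))
    (fun p => measurableSet_closedBall) (fun p => measurableSet_closedBall)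
    (fun p q hpq => hdisj p.2 q.2 fun h => hpq (Subtype.ext h))
  -- The good part: the mean of f on each piece and f elsewhere; the index `none` stands for the
  -- complement of the pieces.
  obtain ⟨h, hm, hh⟩ := exists_measurable_piecewise (ι := Option u)
    (fun o => o.elim (⋃ p, Q p)ᶜ Q)
    (by rintro (_ | p); exacts [(MeasurableSet.iUnion hQm).compl, hQm p])
    (fun o => o.elim f fun p _ => ⨍ y in Q p, f y)
    (by rintro (_ | p); exacts [hfm, measurable_const])
    (by
      rintro (_ | p) (_ | q) hpq
      · exact fun x _ => rfl
      · exact fun x hx => absurd (mem_iUnion.2 ⟨q, hx.2⟩) hx.1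
      · exact fun x hx => absurd (mem_iUnion.2 ⟨p, hx.1⟩) hx.2
      · have : p ≠ q := fun h => hpq (by rw [h])
        exact fun x hx => absurd hx.2 (Set.disjoint_left.1 (hQd this) hx.1))
  have hhQ : ∀ p, ∀ x ∈ Q p, h x = ⨍ y in Q p, f y := fun p => hh (some p)
  have hhc : ∀ x, x ∉ ⋃ p, Q p → h x = f x := hh none
  have hQtop : ∀ p, volume (Q p) ≠ ∞ := fun p =>
    measure_ne_top_of_subset (hQ5 p) (volume_closedBall_ne_top _ _)
  have hQ0 : ∀ p, volume (Q p) ≠ 0 := fun p h0 =>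
    volume_closedBall_ne_zero p.1.1 (hu p.1 p.2).2.1 (measure_mono_null (hQB p) h0)
  have havg : ∀ p, volume (Q p) * ‖⨍ y in Q p, f y‖ₑ ≤ ∫⁻ y in Q p, ‖f y‖ₑ := by
    intro p
    refine le_trans (le_of_eq ?_) (enorm_integral_le_lintegral_enorm _)
    rw [← measure_smul_setAverage f (hQtop p), enorm_smul, Real.enorm_of_nonneg measureReal_nonneg,
      ofReal_measureReal (hQtop p)]
  refine ⟨h, u, Q, hc, hm, ?_, ?_, fun p => (hu p.1 p.2).2.1, ?_, hQm, hQ5, hQd, fun p => ?_, hhc⟩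
  -- On a piece, the stopping rule bounds the mass over the fivefold dilate, whose volume is at most
  -- 5ⁿ times that of the piece. Off the pieces no ball about x has density above l, and
  -- differentiation gives |f| ≤ l.
  · filter_upwards [ae_exists_closedBall_of_lt hfm.enorm hfin l] with x hx
    by_cases hxQ : x ∈ ⋃ p, Q p
    · obtain ⟨p, hp⟩ := mem_iUnion.1 hxQ
      rw [hhQ p x hp]
      have hp0 := (hu p.1 p.2).2.1
      have h1 : volume (Q p) * ‖⨍ y in Q p, f y‖ₑ ≤
          volume (Q p) * (ENNReal.ofReal (5 ^ n) * l) := by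
        calc _ ≤ ∫⁻ y in Q p, ‖f y‖ₑ := havg p
          _ ≤ ∫⁻ y in closedBall p.1.1 (5 * p.1.2), ‖f y‖ₑ := lintegral_mono_set (hQ5 p)
          _ ≤ l * volume (closedBall p.1.1 (5 * p.1.2)) := by
              rw [← hνs]; exact (hu p.1 p.2).2.2.2 _ (by linarith)
          _ = volume (closedBall p.1.1 p.1.2) * (ENNReal.ofReal (5 ^ n) * l) := by
              rw [volume_closedBall_mul p.1.1 p.1.1 hp0.le (by norm_num)]; ring
          _ ≤ _ := by gcongr; exact hQB p
      exact (ENNReal.mul_le_mul_iff_right (hQ0 p) (hQtop p)).1 h1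
    · rw [hhc x hxQ]
      have h1 : ¬ l < ‖f x‖ₑ := by
        intro hlt
        obtain ⟨r, hr, hr'⟩ := hx hlt
        refine hxQ ?_
        rw [hQU]
        have := hcov (show x ∈ _ from ⟨r, hr, by rw [hνs]; exact hr'⟩)
        obtain ⟨p, hp, hxp⟩ := mem_iUnion₂.1 this
        exact mem_iUnion.2 ⟨⟨p, hp⟩, hxp⟩
      refine (not_lt.1 h1).trans ?_
      calc l = 1 * l := (one_mul _).symm
        _ ≤ _ := by
          gcongr
          rw [← ENNReal.ofReal_one]
          exact ENNReal.ofReal_le_ofReal (one_le_pow₀ (by norm_num))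
  · rw [← lintegral_add_compl (fun x => ‖h x‖ₑ) (MeasurableSet.iUnion hQm),
      ← lintegral_add_compl (fun x => ‖f x‖ₑ) (MeasurableSet.iUnion hQm),
      lintegral_iUnion hQm hQd, lintegral_iUnion hQm hQd]
    refine add_le_add (ENNReal.tsum_le_tsum fun p => ?_) (le_of_eq ?_)
    · rw [setLIntegral_congr_fun (g := fun _ => ‖⨍ y in Q p, f y‖ₑ) (hQm p)
        fun x hx => by show ‖h x‖ₑ = _; rw [hhQ p x hx], setLIntegral_const, mul_comm]
      exact havg p
    · exact setLIntegral_congr_fun (MeasurableSet.iUnion hQm).compl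
        fun x hx => by show ‖h x‖ₑ = _; rw [hhc x hx]
  · rw [← hνE]
    exact tsum_volume_stopping_le hc (fun p hp => (hu p hp).2.2.1) hdisj
  · have e : ∫ y in Q p, (f y - h y) = ∫ y in Q p, (f y - ⨍ y in Q p, f y) :=
      setIntegral_congr_fun (hQm p) fun x hx => by show _ - h x = _; rw [hhQ p x hx]
    rw [e, integral_sub hf.integrableOn (integrableOn_const (hQtop p)), setIntegral_const,
      measure_smul_setAverage f (hQtop p), sub_self]

namespace RoughKernel

variable {n : ℕ} {β D : ℝ} {k : Rn n → ℂ}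

/-- The square function is of weak type `(1,1)`. -/
lemma sqFn_weak_type [NeZero n] (hk : RoughKernel β D k) :
    ∃ C : ℝ≥0, 0 < C ∧ ∀ f : Rn n → ℂ, Integrable f → ∀ l : ℝ≥0∞, l ≠ 0 → l ≠ ∞ →
      l * volume {x | l < sqFn k f x} ≤ C * ∫⁻ x, ‖f x‖ₑ := by
  obtain ⟨C1, hC1, h1⟩ := hk.lintegral_sqFn_sq_le
  obtain ⟨C2, hC2, h2⟩ := hk.lintegral_far_sqFn_le
  -- The three terms come from the exceptional set, the good part and the bad part; the outer 2 from
  -- working at height l'/2.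
  refine ⟨2 * (10 ^ n + C1 * 5 ^ n + C2 * 2), by positivity, fun f' hf' l' hl0' hltop' => ?_⟩
  obtain ⟨f, hfm, hff'⟩ : ∃ f, Measurable f ∧ f' =ᵐ[volume] f :=
    ⟨hf'.1.mk f', hf'.1.stronglyMeasurable_mk.measurable, hf'.1.ae_eq_mk⟩
  have hf : Integrable f := hf'.congr hff'
  rw [sqFn_congr hff', lintegral_congr_ae (hff'.mono fun x hx => by
    show ‖f' x‖ₑ = ‖f x‖ₑ; rw [hx])]
  set l : ℝ≥0∞ := l' / 2 with hl
  have hl0 : l ≠ 0 := by simp [hl, hl0']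
  have hltop : l ≠ ∞ := ENNReal.div_ne_top hltop' (by norm_num)
  have hll : l' = l + l := (ENNReal.add_halves l').symm
  have hfin : ∫⁻ y, ‖f y‖ₑ ≠ ∞ := (hasFiniteIntegral_iff_enorm.1 hf.2).ne
  obtain ⟨h, u, Q, hc, hm, hbd, hL1, hpos, hvol, hQm, hQ5, hQd, hQint, hQc⟩ :=
    exists_calderon_zygmund hfm hf hl0 hltop
  have := hc.to_subtype
  have hh : Integrable h := ⟨hm.aestronglyMeasurable, hL1.trans_lt (lt_top_iff_ne_top.2 hfin)⟩
  set b : Rn n → ℂ := fun y => f y - h y with hb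
  have hbm : Measurable b := hfm.sub hm
  have hbi : Integrable b := hf.sub hh
  set bp : u → Rn n → ℂ := fun p => (Q p).indicator b with hbp
  -- Tenfold dilates: each piece sits in a fivefold ball, and the far estimate starts at twice that
  -- radius.
  set E : Set (Rn n) := ⋃ p : u, closedBall p.1.1 (10 * p.1.2) with hE
  -- the pieces
  have hsum : ∀ᵐ x, sqFn k f x ≤ sqFn k h x + ∑' p, sqFn k (bp p) x := by
    filter_upwards [hk.ae_integrable_ker_mul hh.locallyIntegrable,
      hk.ae_integrable_ker_mul hbi.locallyIntegrable] with x hx hx'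
    have hpt : ∀ t, 0 < t → ‖avgOp k f t x‖ₑ ≤ ‖avgOp k h t x‖ₑ + ∑' p, ‖avgOp k (bp p) t x‖ₑ := by
      intro t ht
      have e1 : avgOp k f t x = avgOp k h t x + avgOp k b t x := by
        rw [avgOp, avgOp, avgOp, ← integral_add (hx t ht) (hx' t ht)]
        congr 1; funext y; simp only [hb]; ring
      have e2 : avgOp k b t x = ∑' p, avgOp k (bp p) t x := by
        have e3 : avgOp k b t x = ∫ y in ⋃ p, Q p, ker k t (x - y) * b y := by
          rw [avgOp, setIntegral_eq_integral_of_forall_compl_eq_zero]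
          intro y hy
          simp only [hb]
          rw [hQc y hy, sub_self, mul_zero]
        rw [e3, integral_iUnion hQm hQd (hx' t ht).integrableOn]
        refine tsum_congr fun p => ?_
        rw [avgOp, ← integral_indicator (hQm p)]
        congr 1; funext y
        by_cases hy : y ∈ Q p <;> simp [hbp, hy]
      rw [e1, e2]
      exact (enorm_add_le _ _).trans (add_le_add_right enorm_tsum_le_tsum_enorm _)
    have hmp : ∀ p, Measurable fun t => ‖avgOp k (bp p) t x‖ₑ := fun p =>
      hk.measurable_enorm_avgOp (hbm.indicator (hQm p)).aestronglyMeasurable x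
    calc sqFn k f x ≤ l2 dtt fun t => ‖avgOp k h t x‖ₑ + ∑' p, ‖avgOp k (bp p) t x‖ₑ :=
          l2_mono_ae (ae_dtt_pos.mono hpt)
      _ ≤ sqFn k h x + l2 dtt fun t => ∑' p, ‖avgOp k (bp p) t x‖ₑ :=
          l2_add_le (hk.measurable_enorm_avgOp hm.aestronglyMeasurable x).aemeasurable
            (Measurable.tsum hmp).aemeasurable
      _ ≤ _ := add_le_add_right (l2_tsum_le hmp) _
  set S : Rn n → ℝ≥0∞ := fun x => ∑' p, sqFn k (bp p) x with hS
  have hSm : Measurable S := Measurable.tsum fun p =>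
    hk.measurable_sqFn (hbm.indicator (hQm p)).aestronglyMeasurable
  have hsub : volume {x | l' < sqFn k f x} ≤
      volume E + (volume {x | l < sqFn k h x} + volume {x | x ∈ Eᶜ ∧ l < S x}) := by
    refine (measure_mono_ae (t := E ∪ ({x | l < sqFn k h x} ∪ {x | x ∈ Eᶜ ∧ l < S x})) ?_).trans
      ((measure_union_le _ _).trans (add_le_add_right (measure_union_le _ _) _))
    filter_upwards [hsum] with x hx hxl
    by_cases hxE : x ∈ E
    · exact Or.inl hxE
    by_cases hxh : l < sqFn k h x
    · exact Or.inr (Or.inl hxh)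
    refine Or.inr (Or.inr ⟨hxE, ?_⟩)
    by_contra hcon
    have hxl' : l' < sqFn k f x := hxl
    refine absurd hxl' (not_lt.2 (hx.trans ?_))
    rw [hll]
    exact add_le_add (not_lt.1 hxh) (not_lt.1 hcon)
  have hEv : l * volume E ≤ 10 ^ n * ∫⁻ y, ‖f y‖ₑ := by
    calc l * volume E ≤ l * ∑' p : u, volume (closedBall p.1.1 (10 * p.1.2)) := by
          gcongr; exact measure_iUnion_le _
      _ = 10 ^ n * (l * ∑' p : u, volume (closedBall p.1.1 p.1.2)) := by
          have : ∀ p : u, volume (closedBall p.1.1 (10 * p.1.2)) =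
              10 ^ n * volume (closedBall p.1.1 p.1.2) := fun p => by
            rw [volume_closedBall_mul p.1.1 p.1.1 (hpos p).le (by norm_num),
              ENNReal.ofReal_pow (by norm_num)]; simp
          simp_rw [this]
          rw [ENNReal.tsum_mul_left]; ring
      _ ≤ _ := by gcongr
  -- Chebyshev in L²; the bound |h|² ≤ 5ⁿ l |h| turns the L² norm back into l times an L¹ norm.
  have hhv : l * volume {x | l < sqFn k h x} ≤ C1 * 5 ^ n * ∫⁻ y, ‖f y‖ₑ := by
    have h5 : ENNReal.ofReal (5 ^ n) = 5 ^ n := by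
      rw [ENNReal.ofReal_pow (by norm_num)]; simp
    have hbd' : ∀ᵐ x, ‖h x‖ ≤ (5 ^ n * l).toReal := by
      filter_upwards [hbd] with x hx
      rw [h5] at hx
      rw [← toReal_enorm]
      exact ENNReal.toReal_mono (ENNReal.mul_ne_top (by simp) hltop) hx
    have e1 := mul_meas_ge_le_lintegral₀ (μ := volume)
      ((hk.measurable_sqFn hm.aestronglyMeasurable).pow_const 2).aemeasurable (l ^ 2)
    refine (ENNReal.mul_le_mul_iff_right hl0 hltop).1 ?_
    calc l * (l * volume {x | l < sqFn k h x})
        ≤ l ^ 2 * volume {x | l ^ 2 ≤ sqFn k h x ^ 2} := by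
          rw [sq, ← mul_assoc]
          gcongr with x
          intro hx
          have hx' : l < sqFn k h x := hx
          show l * l ≤ sqFn k h x ^ 2
          rw [← sq]; gcongr
      _ ≤ ∫⁻ x, sqFn k h x ^ 2 := e1
      _ ≤ C1 * ∫⁻ x, ‖h x‖ₑ ^ 2 := h1 h _ hh hbd'
      _ ≤ C1 * ∫⁻ x, 5 ^ n * l * ‖h x‖ₑ := by
          gcongr C1 * ?_
          refine lintegral_mono_ae ?_
          filter_upwards [hbd] with x hx
          rw [sq, ← h5]; gcongr
      _ ≤ C1 * (5 ^ n * l * ∫⁻ x, ‖f x‖ₑ) := by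
          rw [lintegral_const_mul _ hm.enorm]; gcongr
      _ = _ := by ring
  have hbv : l * volume {x | x ∈ Eᶜ ∧ l < S x} ≤ C2 * 2 * ∫⁻ y, ‖f y‖ₑ := by
    have hEm : MeasurableSet E := MeasurableSet.iUnion fun p => measurableSet_closedBall
    have e1 := mul_meas_ge_le_lintegral₀ (μ := volume.restrict Eᶜ) hSm.aemeasurable l
    calc l * volume {x | x ∈ Eᶜ ∧ l < S x}
        ≤ l * (volume.restrict Eᶜ) {x | l ≤ S x} := by
          rw [Measure.restrict_apply' hEm.compl]
          gcongr
          exact fun x hx => ⟨hx.2.le, hx.1⟩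
      _ ≤ ∫⁻ x in Eᶜ, S x := e1
      _ = ∑' p, ∫⁻ x in Eᶜ, sqFn k (bp p) x := lintegral_tsum fun p =>
          (hk.measurable_sqFn (hbm.indicator (hQm p)).aestronglyMeasurable).aemeasurable
      _ ≤ ∑' p, C2 * ∫⁻ y in Q p, ‖b y‖ₑ := by
          refine ENNReal.tsum_le_tsum fun p => ?_
          have e2 := h2 p.1.1 (5 * p.1.2) (bp p) (by linarith [hpos p]) (hbm.indicator (hQm p))
            (fun y hy => indicator_of_notMem (fun h => hy (hQ5 p h)) _)
            (by rw [hbp, integral_indicator (hQm p)]; exact hQint p)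
          refine (lintegral_mono_set ?_).trans (e2.trans (le_of_eq ?_))
          · intro x hx
            have hx' : x ∉ closedBall p.1.1 (10 * p.1.2) := fun hcon => hx (mem_iUnion.2 ⟨p, hcon⟩)
            rw [mem_closedBall, not_le, dist_comm, dist_eq_norm] at hx'
            show 2 * (5 * p.1.2) ≤ ‖p.1.1 - x‖
            linarith
          · congr 1
            rw [← lintegral_indicator (hQm p)]
            congr 1; funext y
            by_cases hy : y ∈ Q p <;> simp [hbp, hy]
      _ = C2 * ∫⁻ y in ⋃ p, Q p, ‖b y‖ₑ := by
          rw [ENNReal.tsum_mul_left, lintegral_iUnion hQm hQd]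
      _ ≤ C2 * ((∫⁻ y, ‖f y‖ₑ) + ∫⁻ y, ‖h y‖ₑ) := by
          gcongr
          rw [← lintegral_add_left hfm.enorm]
          exact (setLIntegral_le_lintegral _ _).trans (lintegral_mono fun y => enorm_sub_le)
      _ ≤ C2 * ((∫⁻ y, ‖f y‖ₑ) + ∫⁻ y, ‖f y‖ₑ) := by gcongr
      _ = _ := by ring
  calc l' * volume {x | l' < sqFn k f x}
      ≤ l' * (volume E + (volume {x | l < sqFn k h x} + volume {x | x ∈ Eᶜ ∧ l < S x})) := by gcongr
    _ = 2 * (l * volume E + (l * volume {x | l < sqFn k h x} +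
          l * volume {x | x ∈ Eᶜ ∧ l < S x})) := by rw [hll]; ring
    _ ≤ 2 * (10 ^ n * (∫⁻ y, ‖f y‖ₑ) + (C1 * 5 ^ n * (∫⁻ y, ‖f y‖ₑ) +
          C2 * 2 * ∫⁻ y, ‖f y‖ₑ)) := by gcongr
    _ = _ := by push_cast; ring

end RoughKernel

/-! ### The linear square function on Lebesgue spaces -/

namespace RoughKernel

variable {n : ℕ} {β D : ℝ} {k : Rn n → ℂ}

/-- Integration of a weight against the truncated kernel. -/
lemma lintegral_ker_mul_le [NeZero n] (hk : RoughKernel β D k) {σ : ℝ} (hσ : (n : ℝ) - 1 < σ) :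
    ∃ C : ℝ≥0, 0 < C ∧ ∀ (w : Rn n → ℝ≥0∞) (x : Rn n) (A : ℝ≥0∞) (t : ℝ), 0 < t →
      (∀ s, 0 < s → s ≤ t → ∫⁻ y in closedBall x s, w y ≤ A * ENNReal.ofReal (s ^ σ)) →
      ∫⁻ y, ‖ker k t (x - y)‖ₑ * w y ≤ C * A * ENNReal.ofReal (t ^ (σ - n)) := by
  have hn : (1 : ℝ) ≤ n := by exact_mod_cast Nat.one_le_iff_ne_zero.2 (NeZero.ne n)
  have hD := hk.pos
  obtain ⟨C, hC, h⟩ := lintegral_rpow_near (n := n) (a := (n : ℝ) - 1) (by linarith) hσ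
  refine ⟨D.toNNReal * C, mul_pos (Real.toNNReal_pos.2 hD) hC, fun w x A t ht hw => ?_⟩
  calc ∫⁻ y, ‖ker k t (x - y)‖ₑ * w y = ∫⁻ y in closedBall x t, ‖ker k t (x - y)‖ₑ * w y := by
        rw [← lintegral_indicator measurableSet_closedBall]
        refine lintegral_congr fun y => ?_
        by_cases hy : y ∈ closedBall x t
        · rw [indicator_of_mem hy]
        · rw [indicator_of_notMem hy, ker_of_lt, enorm_zero, zero_mul]
          rwa [mem_closedBall, dist_comm, dist_eq_norm, not_le] at hy
    _ ≤ ∫⁻ y in closedBall x t, ENNReal.ofReal (D * t⁻¹) *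
          (ENNReal.ofReal (‖x - y‖ ^ (-((n : ℝ) - 1))) * w y) := by
        refine lintegral_mono fun y => ?_
        rw [← mul_assoc, ← ENNReal.ofReal_mul (by positivity), mul_assoc D]
        gcongr
        exact enorm_le_ofReal (hk.norm_ker_le ht _)
    _ ≤ ENNReal.ofReal (D * t⁻¹) * (C * A * ENNReal.ofReal (t ^ (σ - ((n : ℝ) - 1)))) := by
        rw [lintegral_const_mul' _ _ ENNReal.ofReal_ne_top]
        gcongr
        exact h w x A t ht hw
    _ = ENNReal.ofReal D * C * A *
          (ENNReal.ofReal t⁻¹ * ENNReal.ofReal (t ^ (σ - ((n : ℝ) - 1)))) := by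
        rw [ENNReal.ofReal_mul hD.le]; ring
    _ = _ := by
        rw [← ENNReal.ofReal_mul (by positivity)]
        have : t⁻¹ * t ^ (σ - ((n : ℝ) - 1)) = t ^ (σ - n) := by
          rw [← Real.rpow_neg_one, ← Real.rpow_add ht]; congr 1; ring
        rw [this]
        push_cast
        rfl

lemma enorm_avgOp_le_lintegral (f : Rn n → ℂ) (t : ℝ) (x : Rn n) :
    ‖avgOp k f t x‖ₑ ≤ ∫⁻ y, ‖ker k t (x - y)‖ₑ * ‖f y‖ₑ := by
  refine (enorm_integral_le_lintegral_enorm _).trans (le_of_eq ?_)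
  simp_rw [enorm_mul]

/-- The maximal function bounds the mass of w in every ball about x by a multiple of sⁿ, and n
exceeds the order n - 1 of the singularity. -/
lemma lintegral_ker_mul_le_maxFn [NeZero n] (hk : RoughKernel β D k) :
    ∃ C : ℝ≥0, 0 < C ∧ ∀ (w : Rn n → ℝ≥0∞) (t : ℝ) (x : Rn n), 0 < t →
      ∫⁻ y, ‖ker k t (x - y)‖ₑ * w y ≤ C * maxFn w x := by
  obtain ⟨C, hC, h⟩ := hk.lintegral_ker_mul_le (σ := n) (by linarith)
  refine ⟨C * (2 ^ n * (unitVol n).toNNReal), mul_pos hC (mul_pos (by positivity)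
    (ENNReal.toNNReal_pos (unitVol_ne_zero n) (unitVol_ne_top n))), fun w t x ht => ?_⟩
  have h1 := h w x (2 ^ n * unitVol n * maxFn w x) t ht fun s hs _ => by
      refine (setLIntegral_closedBall_le_maxFn _ x hs).trans (le_of_eq ?_)
      rw [volume_closedBall_eq x hs.le, Real.rpow_natCast, ENNReal.ofReal_pow (by norm_num)]
      simp only [ENNReal.ofReal_ofNat]
      ring
  refine h1.trans (le_of_eq ?_)
  rw [sub_self, Real.rpow_zero, ENNReal.ofReal_one, mul_one]
  push_cast
  rw [ENNReal.coe_toNNReal (unitVol_ne_top n)]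
  ring

lemma enorm_avgOp_le_maxFn [NeZero n] (hk : RoughKernel β D k) :
    ∃ C : ℝ≥0, 0 < C ∧ ∀ (f : Rn n → ℂ) (t : ℝ) (x : Rn n), 0 < t →
      ‖avgOp k f t x‖ₑ ≤ C * maxFn (fun y => ‖f y‖ₑ) x := by
  obtain ⟨C, hC, h⟩ := hk.lintegral_ker_mul_le_maxFn
  exact ⟨C, hC, fun f t x ht => (enorm_avgOp_le_lintegral f t x).trans (h _ t x ht)⟩

/-- Oscillation of the square function of a function vanishing near the centre of a ball. -/
lemma sqFn_far_le_add [NeZero n] (hk : RoughKernel β D k) :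
    ∃ C : ℝ≥0, 0 < C ∧ ∀ (f : Rn n → ℂ) (z : Rn n) (r : ℝ), 0 < r → Integrable f → Measurable f →
      (∀ y ∈ closedBall z (2 * r), f y = 0) → ∀ x ∈ closedBall z r,
      sqFn k f x ≤ sqFn k f z + C * ENNReal.ofReal (r ^ (β / 2)) *
        (∫⁻ y in {y | 2 * r ≤ ‖z - y‖}, ENNReal.ofReal (‖z - y‖ ^ (-((n : ℝ) + β / 2))) * ‖f y‖ₑ) ∧
      sqFn k f z ≤ sqFn k f x + C * ENNReal.ofReal (r ^ (β / 2)) *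
        (∫⁻ y in {y | 2 * r ≤ ‖z - y‖}, ENNReal.ofReal (‖z - y‖ ^ (-((n : ℝ) + β / 2))) * ‖f y‖ₑ) := by
  have hβ := hk.beta_pos
  have hD := hk.pos
  have hn : (1 : ℝ) ≤ n := by exact_mod_cast Nat.one_le_iff_ne_zero.2 (NeZero.ne n)
  obtain ⟨C, hC, h⟩ := hk.l2_ker_sub_le
  refine ⟨C.toNNReal, Real.toNNReal_pos.2 hC, fun f z r hr hf hfm hf0 x hx => ?_⟩
  have hxz : ‖x - z‖ ≤ r := by rwa [← dist_eq_norm]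
  -- Since f vanishes on the double ball, the kernel is bounded where it meets f, and integrability
  -- of f gives convergence at every point, not merely almost everywhere.
  have hint : ∀ x' ∈ closedBall z r, ∀ t, 0 < t → Integrable fun y => ker k t (x' - y) * f y := by
    intro x' hx' t ht
    have hkm := hk.measurable_ker_right t
    refine (hf.norm.const_mul (D * (t⁻¹ * r ^ (-((n : ℝ) - 1))))).mono'
      (Measurable.aestronglyMeasurable (by fun_prop)) (Eventually.of_forall fun y => ?_)
    by_cases hy : y ∈ closedBall z (2 * r)
    · simp [hf0 y hy]
    · rw [norm_mul]
      gcongr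
      have h1 : r ≤ ‖x' - y‖ := by
        rw [mem_closedBall, not_le] at hy
        rw [mem_closedBall] at hx'
        have := dist_triangle_left y z x'
        rw [← dist_eq_norm]
        linarith
      refine (hk.norm_ker_le ht _).trans ?_
      gcongr D * (t⁻¹ * ?_)
      exact Real.rpow_le_rpow_of_nonpos hr h1 (by linarith)
  set S : Set (Rn n) := {y | 2 * r ≤ ‖z - y‖} with hS
  have hSm : MeasurableSet S := measurableSet_le (by fun_prop) (by fun_prop)
  have hΦ : Measurable (Function.uncurry fun (t : ℝ) (y : Rn n) =>
      ‖f y‖ₑ * ‖ker k t (z - y + (x - z)) - ker k t (z - y)‖ₑ) := by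
    have m1 : Measurable fun q : ℝ × Rn n => ker k q.1 (z - q.2 + (x - z)) :=
      hk.measurable_ker.comp (by fun_prop : Measurable fun q : ℝ × Rn n => (q.1, z - q.2 + (x - z)))
    have m2 : Measurable fun q : ℝ × Rn n => ker k q.1 (z - q.2) :=
      hk.measurable_ker.comp (by fun_prop : Measurable fun q : ℝ × Rn n => (q.1, z - q.2))
    exact (hfm.comp measurable_snd).enorm.mul (m1.sub m2).enorm
  set Ψ : ℝ → ℝ≥0∞ := fun t => ∫⁻ y in S,
    ‖f y‖ₑ * ‖ker k t (z - y + (x - z)) - ker k t (z - y)‖ₑ with hΨ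
  have hΨm : Measurable Ψ := hΦ.lintegral_prod_right'
  have hdiff : ∀ t, 0 < t → ‖avgOp k f t x - avgOp k f t z‖ₑ ≤ Ψ t := by
    intro t ht
    rw [avgOp, avgOp, ← integral_sub (hint x hx t ht) (hint z (mem_closedBall_self hr.le) t ht),
      hΨ]
    dsimp only
    rw [← lintegral_indicator hSm]
    refine (enorm_integral_le_lintegral_enorm _).trans (lintegral_mono fun y => ?_)
    by_cases hy : y ∈ S
    · rw [indicator_of_mem hy, ← sub_mul, enorm_mul, mul_comm, sub_add_sub_cancel']
    · have : y ∈ closedBall z (2 * r) := by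
        rw [mem_closedBall, dist_comm, dist_eq_norm]
        exact (not_le.1 hy).le
      simp [hf0 y this]
  have hl2 : l2 dtt Ψ ≤ C.toNNReal * ENNReal.ofReal (r ^ (β / 2)) *
      ∫⁻ y in S, ENNReal.ofReal (‖z - y‖ ^ (-((n : ℝ) + β / 2))) * ‖f y‖ₑ := by
    calc l2 dtt Ψ ≤ ∫⁻ y in S, l2 dtt fun t =>
          ‖f y‖ₑ * ‖ker k t (z - y + (x - z)) - ker k t (z - y)‖ₑ := l2_lintegral_le hΦ
      _ ≤ ∫⁻ y in S, (C.toNNReal * ENNReal.ofReal (r ^ (β / 2))) *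
            (ENNReal.ofReal (‖z - y‖ ^ (-((n : ℝ) + β / 2))) * ‖f y‖ₑ) := by
          refine setLIntegral_mono' hSm fun y hy => ?_
          have hy' : 2 * r ≤ ‖z - y‖ := hy
          have hy0 : 0 < ‖z - y‖ := by linarith
          rw [l2_const_mul enorm_ne_top, mul_comm ‖f y‖ₑ, ← mul_assoc]
          gcongr
          refine (h (z - y) (x - z) (norm_pos_iff.1 hy0) (by linarith)).trans ?_
          change _ ≤ ENNReal.ofReal C * _ * _
          rw [← ENNReal.ofReal_mul hC.le, ← ENNReal.ofReal_mul (by positivity)]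
          refine ENNReal.ofReal_le_ofReal ?_
          rw [mul_assoc, Real.div_rpow (norm_nonneg _) hy0.le, neg_add, Real.rpow_add hy0,
            Real.rpow_neg hy0.le (β / 2), mul_comm (‖z - y‖ ^ (-(n : ℝ))),
            ← mul_assoc (r ^ (β / 2)), ← div_eq_mul_inv]
          gcongr
      _ = _ := lintegral_const_mul' _ _ (by finiteness)
  have hmx := fun x => (hk.measurable_enorm_avgOp hfm.aestronglyMeasurable x).aemeasurable (μ := dtt)
  constructor
  · calc sqFn k f x ≤ l2 dtt fun t => ‖avgOp k f t z‖ₑ + Ψ t :=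
          l2_mono_ae (ae_dtt_pos.mono fun t ht => by
            calc ‖avgOp k f t x‖ₑ = ‖avgOp k f t z + (avgOp k f t x - avgOp k f t z)‖ₑ := by
                  rw [add_sub_cancel]
              _ ≤ _ := (enorm_add_le _ _).trans (add_le_add_right (hdiff t ht) _))
      _ ≤ sqFn k f z + l2 dtt Ψ := l2_add_le (hmx z) hΨm.aemeasurable
      _ ≤ _ := add_le_add_right hl2 _
  · calc sqFn k f z ≤ l2 dtt fun t => ‖avgOp k f t x‖ₑ + Ψ t :=
          l2_mono_ae (ae_dtt_pos.mono fun t ht => by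
            calc ‖avgOp k f t z‖ₑ = ‖avgOp k f t x - (avgOp k f t x - avgOp k f t z)‖ₑ := by
                  rw [sub_sub_cancel]
              _ ≤ _ := enorm_sub_le.trans (add_le_add_right (hdiff t ht) _))
      _ ≤ sqFn k f x + l2 dtt Ψ := l2_add_le (hmx x) hΨm.aemeasurable
      _ ≤ _ := add_le_add_right hl2 _

/-- Additivity of the averages requires both integrals to converge, which for locally integrable
functions holds off a null set common to all t. -/
lemma ae_sqFn_add_le [NeZero n] (hk : RoughKernel β D k) {f g : Rn n → ℂ}
    (hf : LocallyIntegrable f) (hg : LocallyIntegrable g) :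
    ∀ᵐ x, sqFn k (fun y => f y + g y) x ≤ sqFn k f x + sqFn k g x := by
  filter_upwards [hk.ae_integrable_ker_mul hf, hk.ae_integrable_ker_mul hg] with x hx hx'
  refine le_trans (l2_mono_ae (ae_dtt_pos.mono fun t ht => ?_))
    (l2_add_le (hk.measurable_enorm_avgOp hf.aestronglyMeasurable x).aemeasurable
      (hk.measurable_enorm_avgOp hg.aestronglyMeasurable x).aemeasurable)
  have : avgOp k (fun y => f y + g y) t x = avgOp k f t x + avgOp k g t x := by
    simp only [avgOp, mul_add]
    exact integral_add (hx t ht) (hx' t ht)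
  rw [this]
  exact enorm_add_le _ _

lemma sqFn_neg (f : Rn n → ℂ) (x : Rn n) : sqFn k (fun y => -f y) x = sqFn k f x := by
  simp only [sqFn, avgOp, mul_neg, integral_neg, enorm_neg]

/-- The oscillation of the square function is controlled by the maximal function. -/
lemma weakOscillation_sqFn [NeZero n] (hk : RoughKernel β D k) :
    ∃ A : ℝ≥0, ∀ f : Rn n → ℂ, Integrable f → Measurable f →
      WeakOscillation A (sqFn k f) (maxFn fun y => ‖f y‖ₑ) := by
  have hβ := hk.beta_pos
  obtain ⟨C1, hC1, h1⟩ := hk.sqFn_weak_type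
  obtain ⟨C2, hC2, h2⟩ := hk.sqFn_far_le_add
  obtain ⟨C3, hC3, h3⟩ := lintegral_rpow_far (n := n) (a := n + β / 2) (σ := n)
    (by positivity) (by linarith)
  set V : ℝ≥0 := (unitVol n).toNNReal with hV
  have hVe : (V : ℝ≥0∞) = unitVol n := ENNReal.coe_toNNReal (unitVol_ne_top n)
  refine ⟨2 * (C1 * (2 ^ n * 3 ^ n)) + 2 * (C2 * (C3 * (4 ^ n * V))),
    fun f hf hfm z r hr => ?_⟩
  -- The local part is handled by the weak type bound. The far part is nearly constant on the ball:
  -- its value at the centre is the constant, and K bounds its variation.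
  set B2 : Set (Rn n) := closedBall z (2 * r) with hB2
  set f1 : Rn n → ℂ := B2.indicator f with hf1
  set f2 : Rn n → ℂ := B2ᶜ.indicator f with hf2
  have hB2m : MeasurableSet B2 := measurableSet_closedBall
  have hf1i : Integrable f1 := hf.indicator hB2m
  have hf2i : Integrable f2 := hf.indicator hB2m.compl
  have hsum : ∀ y, f y = f1 y + f2 y := fun y => by
    rw [hf1, hf2, indicator_self_add_compl_apply]
  set I : ℝ≥0∞ := ∫⁻ y in {y | 2 * r ≤ ‖z - y‖},
    ENNReal.ofReal (‖z - y‖ ^ (-((n : ℝ) + β / 2))) * ‖f2 y‖ₑ with hI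
  set K : ℝ≥0∞ := C2 * ENNReal.ofReal (r ^ (β / 2)) * I with hK
  -- A ball of radius s ≥ 2r about z lies in the ball of radius 2s about any y of the given ball, so
  -- one maximal function value controls the whole tail; the powers of r cancel.
  have hKle : ∀ y ∈ closedBall z r, K ≤ C2 * (C3 * (4 ^ n * V)) * maxFn (fun y => ‖f y‖ₑ) y := by
    intro y hy
    set M := maxFn (fun y => ‖f y‖ₑ) y with hM
    have h4 := h3 (fun y => ‖f2 y‖ₑ) z (4 ^ n * V * M) (2 * r) (by positivity) fun s hs => by
      calc ∫⁻ y' in closedBall z s, ‖f2 y'‖ₑ ≤ ∫⁻ y' in closedBall y (2 * s), ‖f y'‖ₑ := by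
            refine (lintegral_mono fun y' => ?_).trans (lintegral_mono_set
              (closedBall_subset_closedBall' ?_))
            · exact enorm_indicator_le_enorm_self _ _
            · rw [dist_comm]; rw [mem_closedBall] at hy; linarith
        _ ≤ _ := setLIntegral_closedBall_le_maxFn _ y (by linarith)
        _ = _ := by
            rw [volume_closedBall_eq y (by linarith), Real.rpow_natCast, hVe, mul_pow,
              ENNReal.ofReal_mul (by positivity), ENNReal.ofReal_pow (by norm_num)]
            simp only [ENNReal.ofReal_ofNat]
            rw [show (4 : ℝ≥0∞) ^ n = 2 ^ n * 2 ^ n by rw [← mul_pow]; norm_num]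
            ring
    calc K ≤ C2 * ENNReal.ofReal (r ^ (β / 2)) * (C3 * (4 ^ n * V * M) *
          ENNReal.ofReal ((2 * r) ^ ((n : ℝ) - (n + β / 2)))) := by rw [hK]; gcongr
      _ = C2 * (C3 * (4 ^ n * V)) * M * (ENNReal.ofReal (r ^ (β / 2)) *
          ENNReal.ofReal ((2 * r) ^ ((n : ℝ) - (n + β / 2)))) := by ring
      _ ≤ C2 * (C3 * (4 ^ n * V)) * M * 1 := by
          gcongr
          rw [← ENNReal.ofReal_mul (by positivity), ← ENNReal.ofReal_one]
          refine ENNReal.ofReal_le_ofReal ?_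
          rw [show (n : ℝ) - (n + β / 2) = -(β / 2) by ring, Real.rpow_neg (by positivity),
            ← div_eq_mul_inv]
          refine div_le_one_of_le₀ ?_ (by positivity)
          exact Real.rpow_le_rpow hr.le (by linarith) (by positivity)
      _ = _ := mul_one _
  refine ⟨sqFn k f2 z, fun x => sqFn k f1 x + K, ?_, fun l hl0 hltop y hy => ?_⟩
  · have e1 : ∀ᵐ x, sqFn k f x ≤ sqFn k f1 x + sqFn k f2 x := by
      rw [funext hsum]
      exact hk.ae_sqFn_add_le hf1i.locallyIntegrable hf2i.locallyIntegrable
    have e2 : ∀ᵐ x, sqFn k f2 x ≤ sqFn k f x + sqFn k f1 x := by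
      have := hk.ae_sqFn_add_le hf.locallyIntegrable hf1i.neg.locallyIntegrable
      filter_upwards [this] with x hx
      have e3 : (fun y => f y + (-f1) y) = f2 := by
        funext y; rw [hsum y]; simp
      rw [e3] at hx
      exact hx.trans_eq (by rw [← sqFn_neg f1]; rfl)
    filter_upwards [e1, e2] with x hx1 hx2 hx
    obtain ⟨h5, h6⟩ := h2 f2 z r hr hf2i (hfm.indicator hB2m.compl)
      (fun y hy => indicator_of_notMem (not_not.2 hy) _) x hx
    refine ⟨hx1.trans ?_, h6.trans ?_⟩
    · calc sqFn k f1 x + sqFn k f2 x ≤ sqFn k f1 x + (sqFn k f2 z + K) := by gcongr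
        _ = _ := by ring
    · calc sqFn k f2 x + K ≤ (sqFn k f x + sqFn k f1 x) + K := by gcongr
        _ = _ := by ring
  · set M := maxFn (fun y => ‖f y‖ₑ) y with hM
    have hL1 : ∫⁻ x, ‖f1 x‖ₑ ≤ 2 ^ n * 3 ^ n * volume (closedBall z r) * M := by
      calc ∫⁻ x, ‖f1 x‖ₑ = ∫⁻ x in B2, ‖f x‖ₑ := by
            rw [← lintegral_indicator hB2m]
            congr 1; funext x
            by_cases hx : x ∈ B2 <;> simp [hf1, hx]
        _ ≤ ∫⁻ x in closedBall y (3 * r), ‖f x‖ₑ := lintegral_mono_set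
            (closedBall_subset_closedBall' (by
              rw [dist_comm]; rw [mem_closedBall] at hy; linarith))
        _ ≤ _ := setLIntegral_closedBall_le_maxFn _ y (by linarith)
        _ = _ := by
            rw [volume_closedBall_mul z y hr.le (by norm_num), ENNReal.ofReal_pow (by norm_num),
              ENNReal.ofReal_pow (by norm_num)]
            simp only [ENNReal.ofReal_ofNat]
            ring
    have hl2 : l = 2 * (l / 2) := (ENNReal.mul_div_cancel (by norm_num) (by norm_num)).symm
    push_cast
    -- If l is at most 2K the trivial volume bound suffices; otherwise the local part must exceed
    -- l/2.
    rcases le_or_gt (l / 2) K with hlK | hlK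
    · calc l * volume {x ∈ closedBall z r | l < sqFn k f1 x + K}
          ≤ 2 * K * volume (closedBall z r) := by
            rw [hl2]; gcongr
            exact fun x hx => hx.1
        _ ≤ 2 * (C2 * (C3 * (4 ^ n * V)) * M) * volume (closedBall z r) := by
            gcongr; exact hKle y hy
        _ = 2 * (C2 * (C3 * (4 ^ n * V))) * volume (closedBall z r) * M := by ring
        _ ≤ _ := by gcongr; exact le_add_self
    · have hl20 : l / 2 ≠ 0 := by simp [hl0]
      have hl2t : l / 2 ≠ ∞ := ENNReal.div_ne_top hltop (by norm_num)
      calc l * volume {x ∈ closedBall z r | l < sqFn k f1 x + K}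
          ≤ l * volume {x | l / 2 < sqFn k f1 x} := by
            refine mul_le_mul' le_rfl (measure_mono fun x hx => ?_)
            have hx' : l < sqFn k f1 x + K := hx.2
            show l / 2 < sqFn k f1 x
            by_contra hcon
            refine absurd hx' (not_lt.2 ?_)
            calc sqFn k f1 x + K ≤ l / 2 + l / 2 := add_le_add (not_lt.1 hcon) hlK.le
              _ = l := ENNReal.add_halves l
        _ = 2 * (l / 2 * volume {x | l / 2 < sqFn k f1 x}) := by
            rw [← mul_assoc, ← hl2]
        _ ≤ 2 * (C1 * (2 ^ n * 3 ^ n * volume (closedBall z r) * M)) := by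
            exact mul_le_mul' le_rfl ((h1 f1 hf1i _ hl20 hl2t).trans (mul_le_mul' le_rfl hL1))
        _ = 2 * (C1 * (2 ^ n * 3 ^ n)) * volume (closedBall z r) * M := by ring
        _ ≤ _ := by gcongr; exact le_self_add

/-- The good-λ inequality bounds the square function by the maximal function in L^p. Integrability
of f is used for the weak L¹ bound that makes the absorption legitimate. -/
lemma lintegral_sqFn_rpow_le_of_integrable [NeZero n] (hk : RoughKernel β D k) {p : ℝ}
    (hp : 1 < p) :
    ∃ C : ℝ≥0, 0 < C ∧ ∀ f : Rn n → ℂ, Integrable f →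
      ∫⁻ x, sqFn k f x ^ p ≤ C * ∫⁻ x, ‖f x‖ₑ ^ p := by
  obtain ⟨A, hA⟩ := hk.weakOscillation_sqFn
  obtain ⟨C1, hC1, h1⟩ := WeakOscillation.lintegral_rpow_le (n := n) A hp
  obtain ⟨C2, hC2, h2⟩ := maxFn_strong_type (n := n) hp
  obtain ⟨C3, hC3, h3⟩ := hk.sqFn_weak_type
  refine ⟨C1 * C2, mul_pos hC1 hC2, fun f' hf' => ?_⟩
  obtain ⟨f, hfm, hff'⟩ : ∃ f, Measurable f ∧ f' =ᵐ[volume] f :=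
    ⟨hf'.1.mk f', hf'.1.stronglyMeasurable_mk.measurable, hf'.1.ae_eq_mk⟩
  have hf : Integrable f := hf'.congr hff'
  have hnorm : ∫⁻ x, ‖f' x‖ₑ ^ p = ∫⁻ x, ‖f x‖ₑ ^ p :=
    lintegral_congr_ae (hff'.mono fun x hx => by dsimp only; rw [hx])
  rw [sqFn_congr hff', hnorm]
  have hfin : ∫⁻ y, ‖f y‖ₑ ≠ ∞ := (hasFiniteIntegral_iff_enorm.1 hf.2).ne
  refine (h1 (sqFn k f) (maxFn fun y => ‖f y‖ₑ) (hk.measurable_sqFn hfm.aestronglyMeasurable)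
    (measurable_maxFn hfm.enorm) (hA f hf hfm) ⟨C3 * ∫⁻ y, ‖f y‖ₑ, by finiteness, fun t ht =>
      h3 f hf _ (by simpa using ht) ENNReal.ofReal_ne_top⟩).trans ?_
  push_cast
  rw [mul_assoc]
  gcongr
  exact h2 _ hfm.enorm

/-- The linear Marcinkiewicz integral is bounded on `L^p`, `1 < p < ∞`. -/
lemma lintegral_sqFn_rpow_le [NeZero n] (hk : RoughKernel β D k) {p : ℝ} (hp : 1 < p) :
    ∃ C : ℝ≥0, 0 < C ∧ ∀ f : Rn n → ℂ, AEStronglyMeasurable f volume →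
      ∫⁻ x, sqFn k f x ^ p ≤ C * ∫⁻ x, ‖f x‖ₑ ^ p := by
  obtain ⟨C, hC, h⟩ := hk.lintegral_sqFn_rpow_le_of_integrable hp
  refine ⟨C, hC, fun f hf => ?_⟩
  have hp0 : 0 < p := by linarith
  rcases eq_or_ne (∫⁻ x, ‖f x‖ₑ ^ p) ∞ with htop | hfin
  · rw [htop, ENNReal.mul_top (by exact_mod_cast hC.ne')]; exact le_top
  set g : ℕ → Rn n → ℂ := fun N => (closedBall (0 : Rn n) N).indicator f with hg
  have hgm : ∀ N, AEStronglyMeasurable (g N) volume := fun N => hf.indicator measurableSet_closedBall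
  have hgi : ∀ N, Integrable (g N) := by
    intro N
    have hL : MemLp f (ENNReal.ofReal p) volume := by
      refine ⟨hf, ?_⟩
      rw [eLpNorm_lt_top_iff_lintegral_rpow_enorm_lt_top (by simpa using hp0) (by simp),
        ENNReal.toReal_ofReal hp0.le]
      exact lt_top_iff_ne_top.2 hfin
    have hfm : IsFiniteMeasure ((volume : Measure (Rn n)).restrict (closedBall (0 : Rn n) N)) :=
      ⟨by rw [Measure.restrict_apply_univ]; exact measure_closedBall_lt_top⟩
    exact (integrable_indicator_iff measurableSet_closedBall).2
      ((hL.restrict _).integrable (by simpa using hp.le))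
  -- The kernel at scale t has compact support, so truncating f to large balls eventually changes
  -- nothing at (x, t). Fatou is then applied twice, in t and in x.
  have hev : ∀ x t, ∀ᶠ N in atTop, avgOp k (g N) t x = avgOp k f t x := by
    intro x t
    obtain ⟨N0, hN0⟩ := exists_nat_ge (‖x‖ + t)
    filter_upwards [eventually_ge_atTop N0] with N hN
    have hN' : ‖x‖ + t ≤ N := hN0.trans (by exact_mod_cast hN)
    refine integral_congr_ae (Eventually.of_forall fun y => ?_)
    dsimp only
    rcases lt_or_ge t ‖x - y‖ with hlt | hle
    · rw [ker_of_lt hlt, zero_mul, zero_mul]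
    · rw [hg]
      dsimp only
      rw [indicator_of_mem]
      rw [mem_closedBall_zero_iff]
      have : ‖y‖ ≤ ‖x‖ + ‖x - y‖ := by
        have := norm_sub_le x (x - y); simpa using this
      linarith
  have hpt : ∀ x, sqFn k f x ^ p ≤ liminf (fun N => sqFn k (g N) x ^ p) atTop := by
    intro x
    have e1 : ∫⁻ t, ‖avgOp k f t x‖ₑ ^ 2 ∂dtt ≤
        liminf (fun N => ∫⁻ t, ‖avgOp k (g N) t x‖ₑ ^ 2 ∂dtt) atTop := by
      refine le_trans (le_of_eq (lintegral_congr fun t => ?_)) (lintegral_liminf_le fun N =>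
        (hk.measurable_enorm_avgOp (hgm N) x).pow_const 2)
      refine (Tendsto.liminf_eq (tendsto_const_nhds.congr' ?_)).symm
      filter_upwards [hev x t] with N hN
      rw [hN]
    have e2 : ∀ f, sqFn k f x ^ p = (∫⁻ t, ‖avgOp k f t x‖ₑ ^ 2 ∂dtt) ^ (p / 2) := by
      intro f
      rw [sqFn, l2, ← ENNReal.rpow_mul]; congr 1; ring
    simp_rw [e2]
    have hmono : Monotone fun a : ℝ≥0∞ => a ^ (p / 2) := ENNReal.monotone_rpow_of_nonneg (by linarith)
    have e3 := hmono.map_liminf_of_continuousAt (F := atTop)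
      (fun N => ∫⁻ t, ‖avgOp k (g N) t x‖ₑ ^ 2 ∂dtt) ENNReal.continuous_rpow_const.continuousAt
      (by isBoundedDefault) (by isBoundedDefault)
    exact (hmono e1).trans_eq e3
  calc ∫⁻ x, sqFn k f x ^ p ≤ ∫⁻ x, liminf (fun N => sqFn k (g N) x ^ p) atTop := lintegral_mono hpt
    _ ≤ liminf (fun N => ∫⁻ x, sqFn k (g N) x ^ p) atTop := lintegral_liminf_le fun N =>
        (hk.measurable_sqFn (hgm N)).pow_const p
    _ ≤ C * ∫⁻ x, ‖f x‖ₑ ^ p := by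
        refine liminf_le_of_le (by isBoundedDefault) fun b hb => ?_
        obtain ⟨N, hN⟩ := hb.exists
        refine hN.trans ((h (g N) (hgi N)).trans ?_)
        gcongr
        exact enorm_indicator_le_enorm_self _ _

end RoughKernel

/-! ### The multilinear square function -/

/-- The multilinear Marcinkiewicz integral, for general kernels. -/
def multSqFn {ι : Type*} [Fintype ι] {n : ℕ} (k f : ι → Rn n → ℂ) (x : Rn n) : ℝ≥0∞ :=
  l2 dtt fun t => ∏ j, ‖avgOp (k j) (f j) t x‖ₑ

/-- Here the constant may be infinite, as happens when it is a product of maximal functions;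
measurability replaces finiteness. -/
lemma l2_const_mul_of_measurable {α : Type*} [MeasurableSpace α] {ν : Measure α} {φ : α → ℝ≥0∞}
    (hφ : Measurable φ) (c : ℝ≥0∞) : l2 ν (fun t => c * φ t) = c * l2 ν φ := by
  simp only [l2, mul_pow]
  rw [lintegral_const_mul _ (hφ.pow_const 2), ENNReal.mul_rpow_of_nonneg _ _ (by norm_num),
    sq_rpow_half]

/-- Hölder's inequality for a finite product. -/
lemma lintegral_prod_rpow_le {ι α : Type*} [Fintype ι] [MeasurableSpace α] {ν : Measure α}
    {G : ι → α → ℝ≥0∞} (hG : ∀ j, AEMeasurable (G j) ν) {q : ι → ℝ} {p : ℝ} (hq : ∀ j, 0 < q j)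
    (hp : 0 < p) (hpq : 1 / p = ∑ j, 1 / q j) :
    ∫⁻ x, (∏ j, G j x) ^ p ∂ν ≤ ∏ j, (∫⁻ x, G j x ^ q j ∂ν) ^ (p / q j) := by
  have h := ENNReal.lintegral_prod_norm_pow_le (μ := ν) Finset.univ
    (f := fun j x => G j x ^ q j) (fun j _ => (hG j).pow_const _) (p := fun j => p / q j)
    (by
      have : ∀ j, p / q j = p * (1 / q j) := fun j => by ring
      simp_rw [this]
      rw [← Finset.mul_sum, ← hpq]; field_simp)
    (fun j _ => (div_pos hp (hq j)).le)
  refine le_trans (le_of_eq (lintegral_congr fun x => ?_)) h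
  rw [← ENNReal.prod_rpow_of_nonneg hp.le]
  refine Finset.prod_congr rfl fun j _ => ?_
  rw [← ENNReal.rpow_mul, mul_div_cancel₀ _ (hq j).ne']

section
variable {ι : Type*} [Fintype ι] {n : ℕ} {β : ℝ} {D : ι → ℝ} {k : ι → Rn n → ℂ}

lemma measurable_prod_enorm_avgOp (hk : ∀ j, RoughKernel β (D j) (k j)) {f : ι → Rn n → ℂ}
    (hf : ∀ j, AEStronglyMeasurable (f j) volume) (x : Rn n) :
    Measurable fun t => ∏ j, ‖avgOp (k j) (f j) t x‖ₑ :=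
  Finset.measurable_prod _ fun j _ => (hk j).measurable_enorm_avgOp (hf j) x

lemma measurable_multSqFn (hk : ∀ j, RoughKernel β (D j) (k j)) {f : ι → Rn n → ℂ}
    (hf : ∀ j, AEStronglyMeasurable (f j) volume) : Measurable (multSqFn k f) := by
  refine Measurable.pow_const ?_ _
  refine Measurable.lintegral_prod_left'
    (f := fun q : ℝ × Rn n => (∏ j, ‖avgOp (k j) (f j) q.1 q.2‖ₑ) ^ 2) (Measurable.pow_const ?_ _)
  exact Finset.measurable_prod _ fun j _ => ((hk j).stronglyMeasurable_avgOp (hf j)).measurable.enorm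

/-- Boundedness of the multilinear Marcinkiewicz integral on Lebesgue spaces. -/
lemma lintegral_multSqFn_rpow_le [NeZero n] [Nonempty ι] (hk : ∀ j, RoughKernel β (D j) (k j))
    {q : ι → ℝ} {p : ℝ} (hq : ∀ j, 1 < q j) (hp : 0 < p) (hpq : 1 / p = ∑ j, 1 / q j) :
    ∃ C : ℝ≥0, 0 < C ∧ ∀ f : ι → Rn n → ℂ, (∀ j, AEStronglyMeasurable (f j) volume) →
      ∫⁻ x, multSqFn k f x ^ p ≤ C * ∏ j, (∫⁻ x, ‖f j x‖ₑ ^ q j) ^ (p / q j) := by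
  classical
  obtain ⟨i⟩ := ‹Nonempty ι›
  have hq0 : ∀ j, 0 < q j := fun j => one_pos.trans (hq j)
  obtain ⟨C1, hC1, h1⟩ := (hk i).lintegral_sqFn_rpow_le (hq i)
  choose C2 hC2 h2 using fun j => (hk j).enorm_avgOp_le_maxFn
  choose C3 hC3 h3 using fun j => maxFn_strong_type (n := n) (hq j)
  set C4 : ι → ℝ≥0 := fun j => if j = i then C1 else C2 j ^ q j * C3 j with hC4
  have hC40 : ∀ j, 0 < C4 j := by
    intro j
    rw [hC4]; dsimp only
    split_ifs
    · exact hC1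
    · exact mul_pos (NNReal.rpow_pos (hC2 j)) (hC3 j)
  refine ⟨∏ j, C4 j ^ (p / q j), Finset.prod_pos fun j _ => NNReal.rpow_pos (hC40 j),
    fun f' hf' => ?_⟩
  obtain ⟨f, hfm, hff'⟩ : ∃ f : ι → Rn n → ℂ, (∀ j, Measurable (f j)) ∧ ∀ j, f' j =ᵐ[volume] f j :=
    ⟨fun j => (hf' j).mk (f' j), fun j => (hf' j).stronglyMeasurable_mk.measurable,
      fun j => (hf' j).ae_eq_mk⟩
  have e1 : multSqFn k f' = multSqFn k f := by
    funext x
    simp only [multSqFn, fun j => avgOp_congr (k := k j) (hff' j)]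
  have e2 : ∀ j, ∫⁻ x, ‖f' j x‖ₑ ^ q j = ∫⁻ x, ‖f j x‖ₑ ^ q j := fun j =>
    lintegral_congr_ae ((hff' j).mono fun x hx => by dsimp only; rw [hx])
  rw [e1]
  simp_rw [e2]
  -- One factor keeps its square function; the others are bounded uniformly in t and leave the
  -- L²(dt/t) norm.
  set G : ι → Rn n → ℝ≥0∞ := fun j x =>
    if j = i then sqFn (k i) (f i) x else C2 j * maxFn (fun y => ‖f j y‖ₑ) x with hG
  have hGm : ∀ j, Measurable (G j) := by
    intro j
    by_cases hj : j = i
    · simp only [hG, if_pos hj]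
      exact (hk i).measurable_sqFn (hfm i).aestronglyMeasurable
    · simp only [hG, if_neg hj]
      exact (measurable_maxFn (hfm j).enorm).const_mul _
  have hGq : ∀ j, ∫⁻ x, G j x ^ q j ≤ C4 j * ∫⁻ x, ‖f j x‖ₑ ^ q j := by
    intro j
    by_cases hj : j = i
    · subst hj
      simp only [hG, hC4, if_true]
      exact h1 _ (hfm j).aestronglyMeasurable
    · simp only [hG, hC4, if_neg hj]
      simp_rw [ENNReal.mul_rpow_of_nonneg _ _ (hq0 j).le]
      rw [lintegral_const_mul _ ((measurable_maxFn (hfm j).enorm).pow_const _)]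
      push_cast
      rw [ENNReal.coe_rpow_of_nonneg _ (hq0 j).le, mul_assoc]
      gcongr
      exact h3 j _ (hfm j).enorm
  have hpt : ∀ x, multSqFn k f x ≤ ∏ j, G j x := by
    intro x
    set c : ℝ≥0∞ := ∏ j ∈ Finset.univ.erase i, G j x with hc
    calc multSqFn k f x ≤ l2 dtt fun t => c * ‖avgOp (k i) (f i) t x‖ₑ := by
          refine l2_mono_ae (ae_dtt_pos.mono fun t ht => ?_)
          rw [← Finset.prod_erase_mul _ _ (Finset.mem_univ i)]
          refine mul_le_mul' (Finset.prod_le_prod' fun j hj => ?_) le_rfl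
          simp only [hG, if_neg (Finset.ne_of_mem_erase hj)]
          exact h2 j (f j) t x ht
      _ = c * sqFn (k i) (f i) x := l2_const_mul_of_measurable
          ((hk i).measurable_enorm_avgOp (hfm i).aestronglyMeasurable x) c
      _ = ∏ j, G j x := by
          rw [← Finset.prod_erase_mul _ _ (Finset.mem_univ i)]
          simp [hG, hc]
  calc ∫⁻ x, multSqFn k f x ^ p ≤ ∫⁻ x, (∏ j, G j x) ^ p := by
        gcongr with x; exact hpt x
    _ ≤ ∏ j, (∫⁻ x, G j x ^ q j) ^ (p / q j) :=
        lintegral_prod_rpow_le (fun j => (hGm j).aemeasurable) hq0 hp hpq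
    _ ≤ ∏ j, (C4 j * ∫⁻ x, ‖f j x‖ₑ ^ q j) ^ (p / q j) := by
        refine Finset.prod_le_prod' fun j _ => ?_
        exact ENNReal.rpow_le_rpow (hGq j) (div_pos hp (hq0 j)).le
    _ = _ := by
        have : ∀ j, 0 ≤ p / q j := fun j => (div_pos hp (hq0 j)).le
        simp_rw [ENNReal.mul_rpow_of_nonneg _ _ (this _)]
        rw [Finset.prod_mul_distrib]
        push_cast
        simp_rw [ENNReal.coe_rpow_of_nonneg _ (this _)]

end

/-- The multilinear Marcinkiewicz integral in terms of the truncated kernels. -/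
lemma mu_eq_multSqFn {n m : ℕ} {β : ℝ} {D : Fin m → ℝ} {Om f : Fin m → Rn n → ℂ}
    (hk : ∀ j, RoughKernel β (D j) (fun y => Om j y / ((‖y‖ ^ (n - 1) : ℝ) : ℂ)))
    (hf : ∀ j, AEStronglyMeasurable (f j) volume) :
    mu Om f = multSqFn (fun j y => Om j y / ((‖y‖ ^ (n - 1) : ℝ) : ℂ)) f := by
  funext x
  refine mu_eq_l2 Om f x ?_
  have e : (fun t => ‖truncated Om f t x‖ₑ) = fun t =>
      ‖∏ j, avgOp (fun y => Om j y / ((‖y‖ ^ (n - 1) : ℝ) : ℂ)) (f j) t x‖ₑ := by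
    funext t; rw [truncated_eq_prod]
  rw [e]
  refine Measurable.enorm (Finset.measurable_prod _ fun j _ => ?_)
  exact (((hk j).stronglyMeasurable_avgOp (hf j)).comp_measurable
    (by fun_prop : Measurable fun t : ℝ => (t, x))).measurable

lemma eLpNorm_mu_le {n m : ℕ} [NeZero n] [NeZero m] {β : ℝ} {D : Fin m → ℝ} {Om : Fin m → Rn n → ℂ}
    (hk : ∀ j, RoughKernel β (D j) (fun y => Om j y / ((‖y‖ ^ (n - 1) : ℝ) : ℂ)))
    {q : Fin m → ℝ} {p : ℝ} (hq : ∀ j, 1 < q j) (hpq : 1 / p = ∑ j, 1 / q j) :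
    ∃ C : ℝ≥0, 0 < C ∧ ∀ f : Fin m → Rn n → ℂ,
      (∀ j, MemLp (f j) (ENNReal.ofReal (q j)) volume) →
      eLpNorm (mu Om f) (ENNReal.ofReal p) volume ≤
        C * ∏ j, eLpNorm (f j) (ENNReal.ofReal (q j)) volume := by
  have hq0 : ∀ j, 0 < q j := fun j => one_pos.trans (hq j)
  have hp : 0 < p := by
    have : 0 < 1 / p := by
      rw [hpq]
      exact Finset.sum_pos (fun j _ => one_div_pos.2 (hq0 j)) Finset.univ_nonempty
    exact one_div_pos.1 this
  obtain ⟨C, hC, h⟩ := lintegral_multSqFn_rpow_le hk hq hp hpq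
  refine ⟨C ^ (1 / p), NNReal.rpow_pos hC, fun f hf => ?_⟩
  have key := h f fun j => (hf j).1
  rw [← mu_eq_multSqFn hk fun j => (hf j).1] at key
  rw [eLpNorm_eq_lintegral_rpow_enorm_toReal (by simpa using hp) (by simp),
    ENNReal.toReal_ofReal hp.le]
  simp only [enorm_eq_self]
  refine (ENNReal.rpow_le_rpow key (by positivity)).trans (le_of_eq ?_)
  rw [ENNReal.mul_rpow_of_nonneg _ _ (by positivity), ENNReal.coe_rpow_of_nonneg _ (by positivity),
    ← ENNReal.prod_rpow_of_nonneg (by positivity)]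
  congr 1
  refine Finset.prod_congr rfl fun j _ => ?_
  rw [eLpNorm_eq_lintegral_rpow_enorm_toReal (by simpa using hq0 j) (by simp),
    ENNReal.toReal_ofReal (hq0 j).le, ← ENNReal.rpow_mul]
  congr 1
  field_simp

/-! ### The John–Nirenberg inequality -/

/-- The difference is the mean of f - c. Used to compare means over different balls and to replace a
constant by the mean. -/
lemma volume_mul_enorm_setAverage_sub_le {n : ℕ} {V : Type*} [NormedAddCommGroup V]
    [NormedSpace ℝ V] [CompleteSpace V] {f : Rn n → V} (hf : LocallyIntegrable f)
    (z : Rn n) (r : ℝ) (c : V) :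
    volume (closedBall z r) * ‖(⨍ y in closedBall z r, f y) - c‖ₑ ≤
      ∫⁻ y in closedBall z r, ‖f y - c‖ₑ := by
  have htop := volume_closedBall_ne_top z r
  have hi : IntegrableOn f (closedBall z r) := hf.integrableOn_isCompact (isCompact_closedBall _ _)
  have e : (volume.real (closedBall z r)) • ((⨍ y in closedBall z r, f y) - c) =
      ∫ y in closedBall z r, (f y - c) := by
    rw [integral_sub hi (integrableOn_const htop), setIntegral_const, smul_sub,
      measure_smul_setAverage f htop]
  refine le_trans (le_of_eq ?_) (enorm_integral_le_lintegral_enorm _)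
  rw [← e, enorm_smul, Real.enorm_of_nonneg measureReal_nonneg, ofReal_measureReal htop]

lemma lintegral_closedBall_le_bmoSeminorm {n : ℕ} {V : Type*} [NormedAddCommGroup V]
    [NormedSpace ℝ V] (f : Rn n → V) (z : Rn n) {r : ℝ} (hr : 0 < r) :
    ∫⁻ x in closedBall z r, ‖f x - ⨍ y in closedBall z r, f y‖ₑ ≤
      volume (closedBall z r) * bmoSeminorm f := by
  have h : (volume (closedBall z r))⁻¹ *
      (∫⁻ x in closedBall z r, ‖f x - ⨍ y in closedBall z r, f y‖ₑ) ≤ bmoSeminorm f :=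
    le_iSup_of_le z (le_iSup_of_le r (le_iSup_of_le hr le_rfl))
  have h0 := volume_closedBall_ne_zero z hr
  have htop := volume_closedBall_ne_top z r
  calc _ = volume (closedBall z r) * ((volume (closedBall z r))⁻¹ *
      (∫⁻ x in closedBall z r, ‖f x - ⨍ y in closedBall z r, f y‖ₑ)) := by
        rw [← mul_assoc, ENNReal.mul_inv_cancel h0 htop, one_mul]
    _ ≤ _ := by gcongr

/-- Stopping balls for |f - f_B| on the double ball. Their fivefold dilates cover the set {|f - f_B|
> l} in B up to a null set, have total volume at most half of B, and have means within l of f_B.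
Exceeding s + l in B thus means exceeding s relative to the mean of some dilate, where the
assumption applies. -/
lemma john_nirenberg_step {n : ℕ} [NeZero n] {f : Rn n → ℂ} (hfm : Measurable f)
    (hf : LocallyIntegrable f) {N : ℝ≥0∞} (hN0 : N ≠ 0) (hNtop : N ≠ ∞)
    (hN : ∀ z r, 0 < r → ∫⁻ x in closedBall z r, ‖f x - ⨍ y in closedBall z r, f y‖ₑ ≤
      volume (closedBall z r) * N) {s θ : ℝ≥0∞}
    (h : ∀ z r, 0 < r → volume {x ∈ closedBall z r | s < ‖f x - ⨍ y in closedBall z r, f y‖ₑ} ≤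
      θ * volume (closedBall z r)) (z : Rn n) (r : ℝ) (hr : 0 < r) :
    volume {x ∈ closedBall z r | s + 4 * 40 ^ n * N < ‖f x - ⨍ y in closedBall z r, f y‖ₑ} ≤
      θ / 2 * volume (closedBall z r) := by
  set B := closedBall z r with hB
  set B2 := closedBall z (2 * r) with hB2
  set a : ℂ := ⨍ y in B, f y with ha
  -- The mass over the double ball is at most 2·4ⁿN|B|. In 40ⁿ = 4ⁿ·10ⁿ the factor 10ⁿ forces the
  -- stopping radii below r/10, and it more than pays for the 5ⁿ of the dilates.
  set l : ℝ≥0∞ := 4 * 40 ^ n * N with hl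
  have hl0 : l ≠ 0 := by simp [hl, hN0]
  have hltop : l ≠ ∞ := ENNReal.mul_ne_top (by finiteness) hNtop
  have hBB2 : B ⊆ B2 := closedBall_subset_closedBall (by linarith)
  have hvB2 : volume B2 = 2 ^ n * volume B := by
    rw [hB2, volume_closedBall_mul z z hr.le (by norm_num), ENNReal.ofReal_pow (by norm_num)]
    simp [hB]
  set w : Rn n → ℝ≥0∞ := B2.indicator fun x => ‖f x - a‖ₑ with hw
  have hwm : Measurable w := (hfm.sub_const a).enorm.indicator measurableSet_closedBall
  have hwint : ∫⁻ x, w x ≤ 2 * 4 ^ n * N * volume B := by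
    rw [hw, lintegral_indicator measurableSet_closedBall]
    have h1 : volume B * ‖a - ⨍ y in B2, f y‖ₑ ≤ 2 ^ n * volume B * N := by
      calc _ ≤ ∫⁻ x in B, ‖f x - ⨍ y in B2, f y‖ₑ := volume_mul_enorm_setAverage_sub_le hf z r _
        _ ≤ ∫⁻ x in B2, ‖f x - ⨍ y in B2, f y‖ₑ := lintegral_mono_set hBB2
        _ ≤ _ := by rw [← hvB2]; exact hN z _ (by linarith)
    calc ∫⁻ x in B2, ‖f x - a‖ₑ
        ≤ ∫⁻ x in B2, (‖f x - ⨍ y in B2, f y‖ₑ + ‖a - ⨍ y in B2, f y‖ₑ) := by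
          refine lintegral_mono fun x => ?_
          dsimp only
          rw [← sub_sub_sub_cancel_right (f x) a (⨍ y in B2, f y)]
          exact enorm_sub_le
      _ = (∫⁻ x in B2, ‖f x - ⨍ y in B2, f y‖ₑ) + ‖a - ⨍ y in B2, f y‖ₑ * volume B2 := by
          rw [lintegral_add_right _ measurable_const, setLIntegral_const]
      _ ≤ volume B2 * N + 2 ^ n * (volume B * ‖a - ⨍ y in B2, f y‖ₑ) := by
          refine add_le_add (hN z _ (by linarith)) (le_of_eq ?_)
          rw [hvB2]; ring
      _ ≤ 2 ^ n * volume B * N + 2 ^ n * (2 ^ n * volume B * N) := by rw [hvB2]; gcongr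
      _ ≤ 4 ^ n * volume B * N + 4 ^ n * volume B * N := by
          refine add_le_add (by gcongr; norm_num) (le_of_eq ?_)
          rw [show (4 : ℝ≥0∞) ^ n = 2 ^ n * 2 ^ n by rw [← mul_pow]; norm_num]
          ring
      _ = _ := by ring
  have hwfin : ∫⁻ x, w x ≠ ∞ := by
    refine ne_top_of_le_ne_top ?_ hwint
    have := volume_closedBall_ne_top z r
    finiteness
  set ν : Measure (Rn n) := volume.withDensity w with hν
  have hνE : ν univ = ∫⁻ y, w y := by
    rw [hν, withDensity_apply _ MeasurableSet.univ, Measure.restrict_univ]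
  have hνs : ∀ x r, ν (closedBall x r) = ∫⁻ y in closedBall x r, w y := fun x r => by
    rw [hν, withDensity_apply _ measurableSet_closedBall]
  obtain ⟨u, hc, hu, hdisj, hcov⟩ := exists_stopping_balls ν (hνE ▸ hwfin) hl0 hltop
    {x | x ∈ B ∧ ∃ r, 0 < r ∧ l * volume (closedBall x r) < ν (closedBall x r)} fun x hx => hx.2
  have hcount := hc.to_subtype
  have hrad : ∀ p ∈ u, 10 * p.2 ≤ r := by
    intro p hp
    obtain ⟨-, hp0, hp1, -⟩ := hu p hp
    by_contra hcon
    refine absurd hp1 (not_lt.2 ?_)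
    calc ν (closedBall p.1 p.2) ≤ 2 * 4 ^ n * N * volume B :=
          (measure_mono (subset_univ _)).trans (hνE ▸ hwint)
      _ ≤ 2 * 4 ^ n * N * (10 ^ n * volume (closedBall p.1 p.2)) := by
          gcongr
          rw [hB, volume_closedBall_eq z hr.le, volume_closedBall_eq p.1 hp0.le, ← mul_assoc,
            show (10 : ℝ≥0∞) ^ n = ENNReal.ofReal (10 ^ n) by
              rw [ENNReal.ofReal_pow (by norm_num)]; simp,
            ← ENNReal.ofReal_mul (by positivity), ← mul_pow]
          gcongr
          linarith
      _ = 2 * 40 ^ n * N * volume (closedBall p.1 p.2) := by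
          rw [show (40 : ℝ≥0∞) ^ n = 4 ^ n * 10 ^ n by rw [← mul_pow]; norm_num]; ring
      _ ≤ _ := by rw [hl]; gcongr; norm_num
  have hsub5 : ∀ p ∈ u, closedBall p.1 (5 * p.2) ⊆ B2 := by
    intro p hp
    refine closedBall_subset_closedBall' ?_
    have h1 := hrad p hp
    have h2 : dist p.1 z ≤ r := (hu p hp).1.1
    linarith
  have havg : ∀ p ∈ u, ‖(⨍ y in closedBall p.1 (5 * p.2), f y) - a‖ₑ ≤ l := by
    intro p hp
    obtain ⟨-, hp0, -, hp2⟩ := hu p hp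
    have h5 : 0 < 5 * p.2 := by linarith
    refine (ENNReal.mul_le_mul_iff_right (volume_closedBall_ne_zero p.1 h5)
      (volume_closedBall_ne_top p.1 (5 * p.2))).1 ?_
    calc _ ≤ ∫⁻ y in closedBall p.1 (5 * p.2), ‖f y - a‖ₑ :=
          volume_mul_enorm_setAverage_sub_le hf _ _ _
      _ = ∫⁻ y in closedBall p.1 (5 * p.2), w y := by
          refine setLIntegral_congr_fun measurableSet_closedBall fun y hy => ?_
          rw [hw, indicator_of_mem (hsub5 p hp hy)]
      _ ≤ l * volume (closedBall p.1 (5 * p.2)) := by rw [← hνs]; exact hp2 _ (by linarith)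
      _ = _ := mul_comm _ _
  have hvol : 5 ^ n * ∑' p : u, volume (closedBall p.1.1 p.1.2) ≤ 2⁻¹ * volume B := by
    refine (ENNReal.mul_le_mul_iff_right hl0 hltop).1 ?_
    calc l * (5 ^ n * ∑' p : u, volume (closedBall p.1.1 p.1.2))
        = 5 ^ n * (l * ∑' p : u, volume (closedBall p.1.1 p.1.2)) := by ring
      _ ≤ 5 ^ n * (2 * 4 ^ n * N * volume B) := by
          exact mul_le_mul' le_rfl ((tsum_volume_stopping_le hc (fun p hp => (hu p hp).2.2.1)
            hdisj).trans (hνE ▸ hwint))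
      _ = 2 * 20 ^ n * N * volume B := by
          rw [show (20 : ℝ≥0∞) ^ n = 5 ^ n * 4 ^ n by rw [← mul_pow]; norm_num]; ring
      _ ≤ 2 * 40 ^ n * N * volume B := by gcongr; norm_num
      _ = l * (2⁻¹ * volume B) := by
          rw [hl, show (4 : ℝ≥0∞) = 2 * 2 by norm_num]
          calc _ = (2 * 2⁻¹) * (2 * 40 ^ n * N * volume B) := by
                rw [ENNReal.mul_inv_cancel (by norm_num) (by norm_num), one_mul]
            _ = _ := by ring
  calc volume {x ∈ B | s + l < ‖f x - a‖ₑ}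
      ≤ volume (⋃ p : u, {x ∈ closedBall p.1.1 (5 * p.1.2) |
          s < ‖f x - ⨍ y in closedBall p.1.1 (5 * p.1.2), f y‖ₑ}) := by
        refine measure_mono_ae ?_
        filter_upwards [ae_exists_closedBall_of_lt hwm hwfin l] with x hx hxs
        obtain ⟨hxB, hxs⟩ : x ∈ B ∧ s + l < ‖f x - a‖ₑ := hxs
        have hxw : l < w x := by
          rw [hw, indicator_of_mem (hBB2 hxB)]
          exact lt_of_le_of_lt le_add_self hxs
        obtain ⟨ρ, hρ, hρ'⟩ := hx hxw
        obtain ⟨p, hp, hxp⟩ := mem_iUnion₂.1 (hcov ⟨hxB, ρ, hρ, by rw [hνs]; exact hρ'⟩)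
        refine mem_iUnion.2 ⟨⟨p, hp⟩, hxp, ?_⟩
        by_contra hcon
        refine absurd hxs (not_lt.2 ?_)
        rw [← sub_add_sub_cancel (f x) (⨍ y in closedBall p.1 (5 * p.2), f y) a]
        exact (enorm_add_le _ _).trans (add_le_add (not_lt.1 hcon) (havg p hp))
    _ ≤ ∑' p : u, θ * volume (closedBall p.1.1 (5 * p.1.2)) :=
        (measure_iUnion_le _).trans (ENNReal.tsum_le_tsum fun p =>
          h _ _ (by linarith [(hu p.1 p.2).2.1]))
    _ = θ * (5 ^ n * ∑' p : u, volume (closedBall p.1.1 p.1.2)) := by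
        have : ∀ p : u, volume (closedBall p.1.1 (5 * p.1.2)) =
            5 ^ n * volume (closedBall p.1.1 p.1.2) := fun p => by
          rw [volume_closedBall_mul p.1.1 p.1.1 (hu p.1 p.2).2.1.le (by norm_num),
            ENNReal.ofReal_pow (by norm_num)]; simp
        simp_rw [this]
        rw [ENNReal.tsum_mul_left, ENNReal.tsum_mul_left]
    _ ≤ θ * (2⁻¹ * volume B) := by gcongr
    _ = _ := by rw [ENNReal.div_eq_inv_mul]; ring

lemma bmoSeminorm_congr {n : ℕ} {f g : Rn n → ℂ} (h : f =ᵐ[volume] g) :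
    bmoSeminorm f = bmoSeminorm g := by
  have h1 : ∀ z r, (⨍ y in closedBall z r, f y) = ⨍ y in closedBall z r, g y := fun z r =>
    average_congr (ae_restrict_of_ae h)
  have h2 : ∀ z r, ∫⁻ x in closedBall z r, ‖f x - ⨍ y in closedBall z r, f y‖ₑ =
      ∫⁻ x in closedBall z r, ‖g x - ⨍ y in closedBall z r, g y‖ₑ := fun z r => by
    rw [h1]
    refine lintegral_congr_ae (ae_restrict_of_ae (h.mono fun x hx => ?_))
    dsimp only
    rw [hx]
  simp only [bmoSeminorm, h2]

/-- The John–Nirenberg inequality, in its integral form. -/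
lemma john_nirenberg (n : ℕ) [NeZero n] (Q : ℕ) (hQ : Q ≠ 0) :
    ∃ C : ℝ≥0, 0 < C ∧ ∀ f : Rn n → ℂ, MemBMO f → ∀ (z : Rn n) (r : ℝ), 0 < r →
      ∫⁻ x in closedBall z r, ‖f x - ⨍ y in closedBall z r, f y‖ₑ ^ Q ≤
        C * bmoSeminorm f ^ Q * volume (closedBall z r) := by
  have hsum : Summable fun j : ℕ => ((j : ℝ) + 1) ^ Q * (1 / 2) ^ j := by
    have h1 := (summable_nat_add_iff 1).2 (summable_pow_mul_geometric_of_norm_lt_one (R := ℝ) Q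
      (r := 1 / 2) (by norm_num))
    refine (h1.mul_left 2).congr fun j => ?_
    push_cast
    rw [pow_succ]; ring
  set S : ℝ := ∑' j : ℕ, ((j : ℝ) + 1) ^ Q * (1 / 2) ^ j with hS
  have hSpos : 0 < S := hsum.tsum_pos (fun j => by positivity) 0 (by norm_num)
  refine ⟨(4 * 40 ^ n) ^ Q * S.toNNReal, mul_pos (by positivity) (Real.toNNReal_pos.2 hSpos),
    fun f' hf' z r hr => ?_⟩
  obtain ⟨f, hfm, hff'⟩ : ∃ f, Measurable f ∧ f' =ᵐ[volume] f :=
    ⟨_, hf'.1.aestronglyMeasurable.stronglyMeasurable_mk.measurable,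
      hf'.1.aestronglyMeasurable.ae_eq_mk⟩
  have hf : LocallyIntegrable f := hf'.1.congr hff'
  have hNtop : bmoSeminorm f ≠ ∞ := by rw [← bmoSeminorm_congr hff']; exact hf'.2.ne
  have e1 : ∫⁻ x in closedBall z r, ‖f' x - ⨍ y in closedBall z r, f' y‖ₑ ^ Q =
      ∫⁻ x in closedBall z r, ‖f x - ⨍ y in closedBall z r, f y‖ₑ ^ Q := by
    have : (⨍ y in closedBall z r, f' y) = ⨍ y in closedBall z r, f y :=
      average_congr (ae_restrict_of_ae hff')
    rw [this]
    refine lintegral_congr_ae (ae_restrict_of_ae (hff'.mono fun x hx => ?_))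
    dsimp only
    rw [hx]
  rw [e1, bmoSeminorm_congr hff']
  set N := bmoSeminorm f with hN
  have hNb := fun z r (hr : 0 < r) => lintegral_closedBall_le_bmoSeminorm f z hr
  set a : ℂ := ⨍ y in closedBall z r, f y with ha
  have hv : Measurable fun x => ‖f x - a‖ₑ := (hfm.sub_const a).enorm
  -- The iteration needs a positive height, so functions of zero oscillation are treated apart.
  rcases eq_or_ne N 0 with hN0 | hN0
  · have h1 : ∫⁻ x in closedBall z r, ‖f x - a‖ₑ = 0 :=
      le_antisymm ((hNb z r hr).trans (by rw [← hN, hN0, mul_zero])) zero_le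
    rw [lintegral_eq_zero_iff hv] at h1
    have h2 : ∫⁻ x in closedBall z r, ‖f x - a‖ₑ ^ Q = 0 := by
      rw [lintegral_eq_zero_iff (hv.pow_const Q)]
      filter_upwards [h1] with x hx
      simp only [Pi.zero_apply] at hx ⊢
      rw [hx, zero_pow hQ]
    rw [h2]; exact zero_le
  set l : ℝ≥0∞ := 4 * 40 ^ n * N with hl
  have hl0 : l ≠ 0 := by simp [hl, hN0]
  have hltop : l ≠ ∞ := ENNReal.mul_ne_top (by finiteness) hNtop
  -- Iterating over all balls simultaneously halves the bound at each further height l.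
  have hdecay : ∀ j : ℕ, ∀ z r, 0 < r →
      volume {x ∈ closedBall z r | j * l < ‖f x - ⨍ y in closedBall z r, f y‖ₑ} ≤
      ENNReal.ofReal ((1 / 2) ^ j) * volume (closedBall z r) := by
    intro j
    induction j with
    | zero =>
      intro z r hr
      rw [pow_zero, ENNReal.ofReal_one, one_mul]
      exact measure_mono fun x hx => hx.1
    | succ j ih =>
      intro z r hr
      have h1 := john_nirenberg_step hfm hf hN0 hNtop hNb ih z r hr
      convert h1 using 2
      · push_cast
        simp only [add_mul, one_mul, hl]
      · rw [pow_succ, ENNReal.ofReal_mul (by positivity), div_eq_mul_inv (ENNReal.ofReal _),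
          one_div, ENNReal.ofReal_inv_of_pos (by norm_num), ENNReal.ofReal_ofNat]
  -- Each nonzero value lies in a unique layer (j l, (j+1) l], and the sum contains the term of that
  -- layer.
  have hpt : ∀ x, ‖f x - a‖ₑ ^ Q ≤ ∑' j : ℕ,
      {x | j * l < ‖f x - a‖ₑ}.indicator (fun _ => ((j + 1) * l) ^ Q) x := by
    intro x
    rcases eq_or_ne (‖f x - a‖ₑ) 0 with h0 | h0
    · rw [h0, zero_pow hQ]; exact zero_le
    classical
    have hex : ∃ N : ℕ, ‖f x - a‖ₑ ≤ N * l := by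
      obtain ⟨N, hN⟩ := ENNReal.exists_nat_mul_gt hl0 (enorm_ne_top (x := f x - a))
      exact ⟨N, hN.le⟩
    have h1 := Nat.find_spec hex
    obtain ⟨j, hj⟩ : ∃ j, Nat.find hex = j + 1 := by
      refine Nat.exists_eq_succ_of_ne_zero fun h2 => h0 ?_
      rw [h2] at h1
      simpa using h1
    have h3 : j * l < ‖f x - a‖ₑ := not_le.1 (Nat.find_min hex (by omega))
    refine le_trans ?_ (ENNReal.le_tsum j)
    rw [indicator_of_mem (show x ∈ {x | j * l < ‖f x - a‖ₑ} from h3)]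
    gcongr
    rw [hj] at h1
    exact_mod_cast h1
  have hms : ∀ j : ℕ, MeasurableSet {x | j * l < ‖f x - a‖ₑ} := fun j =>
    measurableSet_lt measurable_const hv
  calc ∫⁻ x in closedBall z r, ‖f x - a‖ₑ ^ Q
      ≤ ∫⁻ x in closedBall z r, ∑' j : ℕ,
          {x | j * l < ‖f x - a‖ₑ}.indicator (fun _ => ((j + 1) * l) ^ Q) x := lintegral_mono hpt
    _ = ∑' j : ℕ, ((j + 1) * l) ^ Q * volume {x ∈ closedBall z r | j * l < ‖f x - a‖ₑ} := by
        rw [lintegral_tsum fun j => (measurable_const.indicator (hms j)).aemeasurable]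
        refine tsum_congr fun j => ?_
        rw [lintegral_indicator_const (hms j), Measure.restrict_apply (hms j), inter_comm]
        rfl
    _ ≤ ∑' j : ℕ, ((j + 1) * l) ^ Q *
          (ENNReal.ofReal ((1 / 2) ^ j) * volume (closedBall z r)) :=
        ENNReal.tsum_le_tsum fun j => mul_le_mul' le_rfl (hdecay j z r hr)
    _ = ∑' j : ℕ, l ^ Q * volume (closedBall z r) *
          ENNReal.ofReal (((j : ℝ) + 1) ^ Q * (1 / 2) ^ j) := by
        refine tsum_congr fun j => ?_
        rw [ENNReal.ofReal_mul (by positivity), ENNReal.ofReal_pow (p := (j : ℝ) + 1) (by positivity),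
          ENNReal.ofReal_add (by positivity) (by positivity), ENNReal.ofReal_natCast,
          ENNReal.ofReal_one, mul_pow]
        ring
    _ = l ^ Q * volume (closedBall z r) * ENNReal.ofReal S := by
        rw [ENNReal.tsum_mul_left, ← ENNReal.ofReal_tsum_of_nonneg (fun j => by positivity) hsum]
    _ = _ := by
        rw [hl, mul_pow]
        push_cast
        change _ = _ * ENNReal.ofReal S * _ * _
        ring

/-! ### Mean oscillation of extended-real valued functions -/

lemma setLIntegral_le_rpow_mul {α : Type*} [MeasurableSpace α] {ν : Measure α} {S : Set α}
    {w : α → ℝ≥0∞} (hw : AEMeasurable w (ν.restrict S)) {p : ℝ} (hp : 1 ≤ p) :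
    ∫⁻ x in S, w x ∂ν ≤ (∫⁻ x in S, w x ^ p ∂ν) ^ (1 / p) * ν S ^ (1 - 1 / p) := by
  have h := eLpNorm'_le_eLpNorm'_mul_rpow_measure_univ one_pos hp hw.aestronglyMeasurable
  simpa [eLpNorm'_eq_lintegral_enorm] using h

lemma setLIntegral_le_of_rpow_le {n : ℕ} {w : Rn n → ℝ≥0∞} {z : Rn n} {r : ℝ} (hr : 0 < r)
    (hw : AEMeasurable w (volume.restrict (closedBall z r))) {p : ℝ} (hp : 1 ≤ p) {K : ℝ≥0∞}
    (h : ∫⁻ x in closedBall z r, w x ^ p ≤ K ^ p * volume (closedBall z r)) :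
    ∫⁻ x in closedBall z r, w x ≤ volume (closedBall z r) * K := by
  have hp0 : 0 < p := by linarith
  refine (setLIntegral_le_rpow_mul hw hp).trans ?_
  calc _ ≤ (K ^ p * volume (closedBall z r)) ^ (1 / p) * volume (closedBall z r) ^ (1 - 1 / p) := by
        gcongr
    _ = K * (volume (closedBall z r) ^ (1 / p) * volume (closedBall z r) ^ (1 - 1 / p)) := by
        rw [ENNReal.mul_rpow_of_nonneg _ _ (by positivity), ← ENNReal.rpow_mul,
          mul_one_div_cancel hp0.ne', ENNReal.rpow_one, mul_assoc]
    _ = _ := by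
        rw [← ENNReal.rpow_add _ _ (volume_closedBall_ne_zero z hr) (volume_closedBall_ne_top z r),
          add_sub_cancel, ENNReal.rpow_one, mul_comm]

/-- Closeness to some constant on each unit ball already yields integrability there, so local
integrability of the image is a conclusion of the oscillation bounds. -/
lemma locallyIntegrable_of_oscillation {n : ℕ} {V : Type*} [NormedAddCommGroup V]
    {G : Rn n → V} (hG : AEStronglyMeasurable G volume) {p : ℝ} (hp : 1 ≤ p) {K : ℝ → ℝ≥0∞}
    (hK : ∀ r, 0 < r → K r ≠ ∞)
    (h : ∀ z r, 0 < r → ∃ c : V, ∫⁻ x in closedBall z r, ‖G x - c‖ₑ ^ p ≤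
      K r ^ p * volume (closedBall z r)) : LocallyIntegrable G := by
  intro z
  refine ⟨closedBall z 1, closedBall_mem_nhds z one_pos, ?_⟩
  obtain ⟨c, hc⟩ := h z 1 one_pos
  have h1 := setLIntegral_le_of_rpow_le one_pos
    (hG.restrict.sub aestronglyMeasurable_const).enorm hp hc
  have h2 : IntegrableOn (fun x => G x - c) (closedBall z 1) := by
    refine ⟨hG.restrict.sub aestronglyMeasurable_const, ?_⟩
    rw [hasFiniteIntegral_iff_enorm]
    refine h1.trans_lt ?_
    have := hK 1 one_pos
    have := volume_closedBall_ne_top z 1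
    finiteness
  have h3 := h2.add (integrableOn_const (C := c) (volume_closedBall_ne_top z 1))
  refine h3.congr (Eventually.of_forall fun x => ?_)
  simp

lemma rpow_inv_mul_volume {p : ℝ} (hp : 0 < p) (K v : ℝ≥0∞) :
    (K ^ p * v) ^ (1 / p) = K * v ^ (1 / p) := by
  rw [ENNReal.mul_rpow_of_nonneg _ _ (by positivity), ← ENNReal.rpow_mul,
    mul_one_div_cancel hp.ne', ENNReal.rpow_one]

lemma setLIntegral_add_rpow_le {α : Type*} [MeasurableSpace α] {ν : Measure α} {S : Set α}
    {w v : α → ℝ≥0∞} (hw : AEMeasurable w (ν.restrict S)) (hv : AEMeasurable v (ν.restrict S))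
    {p : ℝ} (hp : 1 ≤ p) {K L : ℝ≥0∞} (h : ∫⁻ x in S, w x ^ p ∂ν ≤ K ^ p * ν S)
    (h' : ∫⁻ x in S, v x ^ p ∂ν ≤ L ^ p * ν S) :
    ∫⁻ x in S, (w x + v x) ^ p ∂ν ≤ (K + L) ^ p * ν S := by
  have hp0 : 0 < p := by linarith
  refine (ENNReal.rpow_le_rpow_iff (z := 1 / p) (by positivity)).1 ?_
  refine (ENNReal.lintegral_Lp_add_le hw hv hp).trans ?_
  rw [rpow_inv_mul_volume hp0, add_mul, ← rpow_inv_mul_volume hp0, ← rpow_inv_mul_volume hp0 L]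
  gcongr

lemma setLIntegral_enorm_sub_rpow_le {n : ℕ} {V : Type*} [NormedAddCommGroup V] {G : Rn n → V}
    (hG : AEStronglyMeasurable G volume) {p : ℝ} (hp : 1 ≤ p) {K L : ℝ≥0∞} {S : Set (Rn n)}
    {c c' : V} (h : ∫⁻ x in S, ‖G x - c‖ₑ ^ p ≤ K ^ p * volume S) (hc : ‖c' - c‖ₑ ≤ L) :
    ∫⁻ x in S, ‖G x - c'‖ₑ ^ p ≤ (K + L) ^ p * volume S := by
  refine le_trans (lintegral_mono fun x => ?_) (setLIntegral_add_rpow_le (v := fun _ => L)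
    (hG.restrict.sub aestronglyMeasurable_const).enorm aemeasurable_const hp h
    (setLIntegral_const _ _).le)
  dsimp only
  gcongr
  rw [← sub_sub_sub_cancel_right (G x) c' c]
  exact enorm_sub_le.trans (by gcongr; rfl)

/-- The mean is within K of any admissible constant, so replacing the constant by the mean at most
doubles the oscillation. -/
lemma oscillation_setAverage_le {n : ℕ} {V : Type*} [NormedAddCommGroup V] [NormedSpace ℝ V]
    [CompleteSpace V] {G : Rn n → V} (hG : LocallyIntegrable G) {p : ℝ} (hp : 1 ≤ p) {K : ℝ≥0∞}
    {z : Rn n} {r : ℝ} (hr : 0 < r) {c : V}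
    (h : ∫⁻ x in closedBall z r, ‖G x - c‖ₑ ^ p ≤ K ^ p * volume (closedBall z r)) :
    ((volume (closedBall z r))⁻¹ *
      ∫⁻ x in closedBall z r, ‖G x - ⨍ y in closedBall z r, G y‖ₑ ^ p) ^ (1 / p) ≤ 2 * K := by
  have hp0 : 0 < p := by linarith
  have hv0 := volume_closedBall_ne_zero z hr
  have hvtop := volume_closedBall_ne_top z r
  have h1 : ‖(⨍ y in closedBall z r, G y) - c‖ₑ ≤ K := by
    refine (ENNReal.mul_le_mul_iff_right hv0 hvtop).1 ?_
    exact (volume_mul_enorm_setAverage_sub_le hG z r c).trans (setLIntegral_le_of_rpow_le hr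
      (hG.aestronglyMeasurable.restrict.sub aestronglyMeasurable_const).enorm hp h)
  have h2 := setLIntegral_enorm_sub_rpow_le hG.aestronglyMeasurable hp h h1
  rw [one_div, ENNReal.rpow_inv_le_iff hp0, two_mul]
  calc _ ≤ (volume (closedBall z r))⁻¹ * ((K + K) ^ p * volume (closedBall z r)) := by gcongr
    _ = _ := by rw [mul_left_comm, ENNReal.inv_mul_cancel hv0 hvtop, mul_one]

lemma enorm_toReal_sub_le {a c e : ℝ≥0∞} (ha : a ≠ ∞) (hc : c ≠ ∞) (h1 : a ≤ c + e)
    (h2 : c ≤ a + e) : ‖a.toReal - c.toReal‖ₑ ≤ e := by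
  rcases eq_or_ne e ∞ with rfl | he
  · exact le_top
  rw [← ENNReal.ofReal_toReal he]
  refine enorm_le_ofReal ?_
  rw [Real.norm_eq_abs, abs_le]
  have h3 := ENNReal.toReal_mono (by finiteness) h1
  have h4 := ENNReal.toReal_mono (by finiteness) h2
  rw [ENNReal.toReal_add hc he] at h3
  rw [ENNReal.toReal_add ha he] at h4
  constructor <;> linarith

/-! ### Small and large scales -/

/-- Telescoping: exchanging one factor at a time costs δ times the product of all the bounds. -/
lemma enorm_prod_sub_prod_le {ι : Type*} (s : Finset ι) (a b : ι → ℂ) (U : ι → ℝ≥0∞) (δ : ℝ≥0∞)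
    (ha : ∀ j, ‖a j‖ₑ ≤ U j) (hb : ∀ j, ‖b j‖ₑ ≤ U j) (hab : ∀ j, ‖a j - b j‖ₑ ≤ U j * δ) :
    ‖∏ j ∈ s, a j - ∏ j ∈ s, b j‖ₑ ≤ s.card * (∏ j ∈ s, U j) * δ := by
  classical
  induction s using Finset.induction with
  | empty => simp
  | insert i s hi ih =>
    rw [Finset.prod_insert hi, Finset.prod_insert hi, Finset.prod_insert hi,
      Finset.card_insert_of_notMem hi]
    have e : a i * ∏ j ∈ s, a j - b i * ∏ j ∈ s, b j =
        a i * (∏ j ∈ s, a j - ∏ j ∈ s, b j) + (a i - b i) * ∏ j ∈ s, b j := by ring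
    have hprod : ‖∏ j ∈ s, b j‖ₑ ≤ ∏ j ∈ s, U j := by
      rw [← ofReal_norm, norm_prod, ENNReal.ofReal_prod_of_nonneg fun _ _ => norm_nonneg _]
      refine Finset.prod_le_prod' fun j _ => ?_
      rw [ofReal_norm]; exact hb j
    rw [e]
    refine (enorm_add_le _ _).trans ?_
    rw [enorm_mul, enorm_mul]
    calc ‖a i‖ₑ * ‖∏ j ∈ s, a j - ∏ j ∈ s, b j‖ₑ + ‖a i - b i‖ₑ * ‖∏ j ∈ s, b j‖ₑ
        ≤ U i * (s.card * (∏ j ∈ s, U j) * δ) + U i * δ * ∏ j ∈ s, U j := by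
          gcongr
          · exact ha i
          · exact hab i
      _ = _ := by push_cast; ring

lemma enorm_finset_prod {ι : Type*} (s : Finset ι) (a : ι → ℂ) : ‖∏ j ∈ s, a j‖ₑ = ∏ j ∈ s, ‖a j‖ₑ := by
  simp only [← ofReal_norm, norm_prod]
  exact ENNReal.ofReal_prod_of_nonneg fun _ _ => norm_nonneg _

lemma prod_rpow_eq_rpow_sum {ι : Type*} (s : Finset ι) {v : ℝ≥0∞} (h0 : v ≠ 0) (htop : v ≠ ∞)
    (a : ι → ℝ) : ∏ j ∈ s, v ^ a j = v ^ ∑ j ∈ s, a j := by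
  classical
  induction s using Finset.induction with
  | empty => simp
  | insert i s hi ih =>
    rw [Finset.prod_insert hi, Finset.sum_insert hi, ENNReal.rpow_add _ _ h0 htop, ih]

lemma l2_le_add_restrict {φ : ℝ → ℝ≥0∞} (r : ℝ) :
    l2 dtt φ ≤ l2 (dtt.restrict (Iic r)) φ + l2 (dtt.restrict (Ioi r)) φ := by
  rw [l2, ← lintegral_add_compl _ (measurableSet_Iic (a := r)), compl_Iic]
  exact ENNReal.rpow_add_le_add_rpow _ _ (by norm_num) (by norm_num)

lemma l2_Ioi_rpow_le {s r : ℝ} (hs : 0 < s) (hr : 0 < r) :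
    l2 (dtt.restrict (Ioi r)) (fun t => ENNReal.ofReal (t ^ (-s))) ≤
      ENNReal.ofReal ((1 / (2 * s)) ^ (1 / 2 : ℝ)) * ENNReal.ofReal (r ^ (-s)) := by
  rw [l2_le_iff]
  calc ∫⁻ t in Ioi r, ENNReal.ofReal (t ^ (-s)) ^ 2 ∂dtt
      ≤ ∫⁻ t in Ici r, ENNReal.ofReal (t ^ (-(2 * s))) ∂dtt := by
        refine (lintegral_mono_set Ioi_subset_Ici_self).trans (le_of_eq ?_)
        refine setLIntegral_congr_fun measurableSet_Ici fun t ht => ?_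
        have ht0 : 0 < t := hr.trans_le ht
        rw [← ENNReal.ofReal_pow (by positivity), ← Real.rpow_natCast, ← Real.rpow_mul ht0.le]
        congr 2; push_cast; ring
    _ = ENNReal.ofReal (r ^ (-(2 * s)) / (2 * s)) := setLIntegral_Ici_rpow_dtt (by positivity) hr
    _ = _ := by
        rw [← ENNReal.ofReal_mul (by positivity), ← ENNReal.ofReal_pow (by positivity)]
        congr 1
        have e1 : ((1 / (2 * s)) ^ (1 / 2 : ℝ)) ^ 2 = 1 / (2 * s) := by
          rw [← Real.rpow_natCast, ← Real.rpow_mul (by positivity)]; norm_num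
        have e2 : (r ^ (-s)) ^ 2 = r ^ (-(2 * s)) := by
          rw [← Real.rpow_natCast, ← Real.rpow_mul hr.le]; congr 1; push_cast; ring
        rw [mul_pow, e1, e2]; ring

lemma l2_Iic_rpow_le {s r : ℝ} (hs : 0 < s) (hr : 0 < r) :
    l2 (dtt.restrict (Iic r)) (fun t => ENNReal.ofReal (t ^ s)) ≤
      ENNReal.ofReal ((1 / (2 * s)) ^ (1 / 2 : ℝ)) * ENNReal.ofReal (r ^ s) := by
  rw [l2_le_iff]
  have hae : (Iic r : Set ℝ) =ᵐ[dtt] Ioc 0 r := by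
    filter_upwards [ae_dtt_pos] with t ht
    exact propext ⟨fun h => ⟨ht, h⟩, fun h => h.2⟩
  calc ∫⁻ t in Iic r, ENNReal.ofReal (t ^ s) ^ 2 ∂dtt
      = ∫⁻ t in Ioc 0 r, ENNReal.ofReal (t ^ (2 * s)) ∂dtt := by
        rw [setLIntegral_congr hae]
        refine setLIntegral_congr_fun measurableSet_Ioc fun t ht => ?_
        have ht0 : 0 < t := ht.1
        rw [← ENNReal.ofReal_pow (by positivity), ← Real.rpow_natCast, ← Real.rpow_mul ht0.le]
        congr 2; push_cast; ring
    _ = ENNReal.ofReal (r ^ (2 * s) / (2 * s)) := setLIntegral_Ioc_rpow_dtt (by positivity) hr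
    _ ≤ _ := by
        rw [← ENNReal.ofReal_mul (by positivity), ← ENNReal.ofReal_pow (by positivity)]
        refine ENNReal.ofReal_le_ofReal (le_of_eq ?_)
        have e1 : ((1 / (2 * s)) ^ (1 / 2 : ℝ)) ^ 2 = 1 / (2 * s) := by
          rw [← Real.rpow_natCast, ← Real.rpow_mul (by positivity)]; norm_num
        have e2 : (r ^ s) ^ 2 = r ^ (2 * s) := by
          rw [← Real.rpow_natCast, ← Real.rpow_mul hr.le]; congr 1; push_cast; ring
        rw [mul_pow, e1, e2]; ring

section
variable {n : ℕ} {β D : ℝ} {k : Rn n → ℂ}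

/-- The truncated kernel has integral zero. If the integral diverges with f, it also diverges with f
- c, and both sides take the default value 0. -/
lemma RoughKernel.avgOp_sub_const [NeZero n] (hk : RoughKernel β D k) (f : Rn n → ℂ) (c : ℂ)
    {t : ℝ} (ht : 0 < t) (x : Rn n) : avgOp k (fun y => f y - c) t x = avgOp k f t x := by
  have h1 : Integrable fun y => ker k t (x - y) := (hk.integrable_ker t ht).comp_sub_left x
  simp only [avgOp, mul_sub]
  by_cases hi : Integrable fun y => ker k t (x - y) * f y
  · rw [integral_sub hi (h1.mul_const c), integral_mul_const,
      integral_sub_left_eq_self (ker k t) volume x, hk.integral_ker, zero_mul, sub_zero]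
  · rw [integral_undef hi, integral_undef]
    intro hcon
    refine hi ((hcon.add (h1.mul_const c)).congr (Eventually.of_forall fun y => ?_))
    simp

/-- From a point of the ball, a scale t ≤ r cannot reach beyond the double ball. -/
lemma avgOp_indicator (f : Rn n → ℂ) {z x : Rn n} {r t : ℝ} (hx : x ∈ closedBall z r)
    (ht : t ≤ r) : avgOp k ((closedBall z (2 * r)).indicator f) t x = avgOp k f t x := by
  refine integral_congr_ae (Eventually.of_forall fun y => ?_)
  dsimp only
  rcases lt_or_ge t ‖x - y‖ with hlt | hle
  · rw [ker_of_lt hlt, zero_mul, zero_mul]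
  · rw [indicator_of_mem]
    rw [mem_closedBall] at hx ⊢
    rw [← dist_eq_norm] at hle
    linarith [dist_triangle_left y z x]

end

section
variable {ι : Type*} [Fintype ι] {n : ℕ} {β : ℝ} {D : ι → ℝ} {k : ι → Rn n → ℂ}

/-- The part of the multilinear Marcinkiewicz integral with scales at most `r`. -/
def multSqFnSmall (k f : ι → Rn n → ℂ) (r : ℝ) (x : Rn n) : ℝ≥0∞ :=
  l2 (dtt.restrict (Iic r)) fun t => ∏ j, ‖avgOp (k j) (f j) t x‖ₑ

/-- The part of the multilinear Marcinkiewicz integral with scales larger than `r`. -/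
def multSqFnLarge (k f : ι → Rn n → ℂ) (r : ℝ) (x : Rn n) : ℝ≥0∞ :=
  l2 (dtt.restrict (Ioi r)) fun t => ∏ j, ‖avgOp (k j) (f j) t x‖ₑ

lemma multSqFn_le_add (k f : ι → Rn n → ℂ) (r : ℝ) (x : Rn n) :
    multSqFn k f x ≤ multSqFnSmall k f r x + multSqFnLarge k f r x :=
  l2_le_add_restrict r

lemma multSqFnLarge_le (k f : ι → Rn n → ℂ) (r : ℝ) (x : Rn n) :
    multSqFnLarge k f r x ≤ multSqFn k f x :=
  l2_mono_measure Measure.restrict_le_self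

lemma ae_restrict_dtt_pos (S : Set ℝ) : ∀ᵐ t ∂(dtt.restrict S), 0 < t :=
  ae_restrict_of_ae ae_dtt_pos

/-- Locality and cancellation together: at small scales each function may be recentred by a constant
and cut off, so global Lebesgue bounds become local oscillation bounds. -/
lemma multSqFnSmall_le [NeZero n] (hk : ∀ j, RoughKernel β (D j) (k j)) (f : ι → Rn n → ℂ)
    (c : ι → ℂ) {z x : Rn n} {r : ℝ} (hx : x ∈ closedBall z r) :
    multSqFnSmall k f r x ≤
      multSqFn k (fun j => (closedBall z (2 * r)).indicator fun y => f j y - c j) x := by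
  refine le_trans ?_ (l2_mono_measure (Measure.restrict_le_self (s := Iic r)))
  refine (l2_congr_ae ?_).le
  filter_upwards [ae_restrict_dtt_pos (Iic r), ae_restrict_mem measurableSet_Iic] with t ht htr
  refine Finset.prod_congr rfl fun j _ => ?_
  rw [avgOp_indicator _ hx htr, (hk j).avgOp_sub_const _ _ ht]

/-- Local estimate for the small scales. -/
lemma lintegral_multSqFnSmall_le [NeZero n] [Nonempty ι] (hk : ∀ j, RoughKernel β (D j) (k j))
    {q : ι → ℝ} {p : ℝ} (hq : ∀ j, 1 < q j) (hp : 0 < p) (hpq : 1 / p = ∑ j, 1 / q j) :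
    ∃ C : ℝ≥0, 0 < C ∧ ∀ (f : ι → Rn n → ℂ) (c : ι → ℂ) (U : ι → ℝ≥0∞) (z : Rn n) (r : ℝ), 0 < r →
      (∀ j, AEStronglyMeasurable (f j) volume) →
      (∀ j, ∫⁻ x in closedBall z (2 * r), ‖f j x - c j‖ₑ ^ q j ≤
        U j ^ q j * volume (closedBall z r)) →
      ∫⁻ x in closedBall z r, multSqFnSmall k f r x ^ p ≤
        (C * ∏ j, U j) ^ p * volume (closedBall z r) := by
  have hq0 : ∀ j, 0 < q j := fun j => one_pos.trans (hq j)
  obtain ⟨C, hC, h⟩ := lintegral_multSqFn_rpow_le hk hq hp hpq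
  refine ⟨C ^ (1 / p), NNReal.rpow_pos hC, fun f c U z r hr hf hU => ?_⟩
  set v := volume (closedBall z r) with hv
  have hsum : ∑ j, p / q j = 1 := by
    have : ∀ j, p / q j = p * (1 / q j) := fun j => by ring
    simp_rw [this]
    rw [← Finset.mul_sum, ← hpq]; field_simp
  set g : ι → Rn n → ℂ := fun j => (closedBall z (2 * r)).indicator fun y => f j y - c j with hg
  calc ∫⁻ x in closedBall z r, multSqFnSmall k f r x ^ p
      ≤ ∫⁻ x in closedBall z r, multSqFn k g x ^ p := by
        refine setLIntegral_mono' measurableSet_closedBall fun x hx => ?_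
        gcongr
        exact multSqFnSmall_le hk f c hx
    _ ≤ ∫⁻ x, multSqFn k g x ^ p := setLIntegral_le_lintegral _ _
    _ ≤ C * ∏ j, (∫⁻ x, ‖g j x‖ₑ ^ q j) ^ (p / q j) := h g fun j =>
        ((hf j).sub aestronglyMeasurable_const).indicator measurableSet_closedBall
    _ ≤ C * ∏ j, (U j ^ p * v ^ (p / q j)) := by
        gcongr with j
        have e : ∫⁻ x, ‖g j x‖ₑ ^ q j = ∫⁻ x in closedBall z (2 * r), ‖f j x - c j‖ₑ ^ q j := by
          rw [← lintegral_indicator measurableSet_closedBall]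
          refine lintegral_congr fun x => ?_
          by_cases hx : x ∈ closedBall z (2 * r)
          · simp only [hg, indicator_of_mem hx]
          · simp only [hg, indicator_of_notMem hx, enorm_zero, ENNReal.zero_rpow_of_pos (hq0 j)]
        rw [e]
        refine (ENNReal.rpow_le_rpow (hU j) (div_pos hp (hq0 j)).le).trans (le_of_eq ?_)
        rw [ENNReal.mul_rpow_of_nonneg _ _ (div_pos hp (hq0 j)).le, ← ENNReal.rpow_mul,
          mul_div_cancel₀ _ (hq0 j).ne']
    _ = _ := by
        rw [Finset.prod_mul_distrib, ENNReal.prod_rpow_of_nonneg hp.le,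
          ENNReal.mul_rpow_of_nonneg _ _ hp.le, ← ENNReal.coe_rpow_of_nonneg _ hp.le,
          ← NNReal.rpow_mul, one_div_mul_cancel hp.ne', NNReal.rpow_one]
        rw [prod_rpow_eq_rpow_sum _ (volume_closedBall_ne_zero z hr) (volume_closedBall_ne_top z r),
          hsum, ENNReal.rpow_one, mul_assoc]

/-- Oscillation of the large scales. -/
lemma multSqFnLarge_le_add (hk : ∀ j, RoughKernel β (D j) (k j)) {α : ι → ℝ} {γ : ℝ}
    (hα : ∑ j, α j < γ) :
    ∃ C : ℝ≥0, 0 < C ∧ ∀ (f : ι → Rn n → ℂ) (U : ι → ℝ≥0∞) (x x' : Rn n) (r : ℝ), 0 < r →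
      (∀ j, AEStronglyMeasurable (f j) volume) →
      (∀ j t, r < t → ‖avgOp (k j) (f j) t x‖ₑ ≤ U j * ENNReal.ofReal (t ^ α j)) →
      (∀ j t, r < t → ‖avgOp (k j) (f j) t x'‖ₑ ≤ U j * ENNReal.ofReal (t ^ α j)) →
      (∀ j t, r < t → ‖avgOp (k j) (f j) t x - avgOp (k j) (f j) t x'‖ₑ ≤
        U j * ENNReal.ofReal (t ^ α j) * ENNReal.ofReal ((r / t) ^ γ)) →
      multSqFnLarge k f r x ≤ multSqFnLarge k f r x' +
        C * (∏ j, U j) * ENNReal.ofReal (r ^ ∑ j, α j) := by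
  set σ := ∑ j, α j with hσ
  have hγ : 0 < 2 * (γ - σ) := by linarith
  refine ⟨(Fintype.card ι + 1) * ((1 / (2 * (γ - σ))) ^ (1 / 2 : ℝ)).toNNReal,
    mul_pos (by positivity) (Real.toNNReal_pos.2 (by positivity)),
    fun f U x x' r hr hf h1 h2 h3 => ?_⟩
  -- Telescoping the product leaves a remainder of order t^σ(r/t)^γ, square integrable for dt/t on t
  -- > r because σ < γ.
  have hpt : ∀ t, r < t → ∏ j, ‖avgOp (k j) (f j) t x‖ₑ ≤ ∏ j, ‖avgOp (k j) (f j) t x'‖ₑ +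
      (Fintype.card ι * ∏ j, U j) * (ENNReal.ofReal (r ^ γ) * ENNReal.ofReal (t ^ (σ - γ))) := by
    intro t ht
    have ht0 : 0 < t := hr.trans ht
    have h4 := enorm_prod_sub_prod_le Finset.univ (fun j => avgOp (k j) (f j) t x)
      (fun j => avgOp (k j) (f j) t x') (fun j => U j * ENNReal.ofReal (t ^ α j)) _
      (fun j => h1 j t ht) (fun j => h2 j t ht) (fun j => h3 j t ht)
    rw [← enorm_finset_prod, ← enorm_finset_prod]
    have e : ∏ j, avgOp (k j) (f j) t x = ∏ j, avgOp (k j) (f j) t x' +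
        (∏ j, avgOp (k j) (f j) t x - ∏ j, avgOp (k j) (f j) t x') := by ring
    rw [e]
    refine (enorm_add_le _ _).trans (add_le_add_right (h4.trans (le_of_eq ?_)) _)
    rw [Finset.prod_mul_distrib, ← ENNReal.ofReal_prod_of_nonneg (fun j _ => by positivity),
      ← Real.rpow_sum_of_pos ht0, ← hσ, Finset.card_univ]
    have : ENNReal.ofReal (t ^ σ) * ENNReal.ofReal ((r / t) ^ γ) =
        ENNReal.ofReal (r ^ γ) * ENNReal.ofReal (t ^ (σ - γ)) := by
      rw [← ENNReal.ofReal_mul (by positivity), ← ENNReal.ofReal_mul (by positivity)]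
      congr 1
      rw [Real.div_rpow hr.le ht0.le, Real.rpow_sub ht0]; ring
    rw [← this]; ring
  have hl2 : l2 (dtt.restrict (Ioi r)) (fun t => ENNReal.ofReal (t ^ (σ - γ))) ≤
      ENNReal.ofReal ((1 / (2 * (γ - σ))) ^ (1 / 2 : ℝ)) * ENNReal.ofReal (r ^ (σ - γ)) := by
    rw [← neg_sub γ σ]
    exact l2_Ioi_rpow_le (by linarith) hr
  set P : ℝ≥0∞ := ∏ j, U j with hP
  calc multSqFnLarge k f r x
      ≤ l2 (dtt.restrict (Ioi r)) fun t => (∏ j, ‖avgOp (k j) (f j) t x'‖ₑ) +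
        (Fintype.card ι * P * ENNReal.ofReal (r ^ γ)) * ENNReal.ofReal (t ^ (σ - γ)) := by
        refine l2_mono_ae ?_
        filter_upwards [ae_restrict_mem measurableSet_Ioi] with t ht
        exact (hpt t ht).trans (le_of_eq (by ring))
    _ ≤ multSqFnLarge k f r x' + (Fintype.card ι * P * ENNReal.ofReal (r ^ γ)) *
          l2 (dtt.restrict (Ioi r)) (fun t => ENNReal.ofReal (t ^ (σ - γ))) := by
        refine (l2_add_le (measurable_prod_enorm_avgOp hk hf x').aemeasurable
          (Measurable.aemeasurable (by fun_prop))).trans ?_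
        rw [l2_const_mul_of_measurable (by fun_prop)]
        rfl
    _ ≤ multSqFnLarge k f r x' + ((Fintype.card ι + 1) * P * ENNReal.ofReal (r ^ γ)) *
          (ENNReal.ofReal ((1 / (2 * (γ - σ))) ^ (1 / 2 : ℝ)) * ENNReal.ofReal (r ^ (σ - γ))) := by
        gcongr
        exact le_self_add
    _ = multSqFnLarge k f r x' + ((Fintype.card ι + 1) *
          ENNReal.ofReal ((1 / (2 * (γ - σ))) ^ (1 / 2 : ℝ))) * P *
          (ENNReal.ofReal (r ^ γ) * ENNReal.ofReal (r ^ (σ - γ))) := by ring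
    _ = _ := by
        rw [← ENNReal.ofReal_mul (by positivity), ← Real.rpow_add hr, add_sub_cancel]
        push_cast
        rfl

end

/-! ### Oscillation of the averages of Lipschitz and `BMO` functions -/

/-- Cauchy–Schwarz with the weight split as a product of square roots. With φ a kernel difference,
half of its L¹ smoothness is kept while the weight carries a square of f - c. -/
lemma lintegral_mul_le_sqrt {α : Type*} [MeasurableSpace α] {ν : Measure α} {φ ψ : α → ℝ≥0∞}
    (hφ : AEMeasurable φ ν) (hψ : AEMeasurable ψ ν) :
    ∫⁻ x, φ x * ψ x ∂ν ≤ (∫⁻ x, φ x ∂ν) ^ (1 / 2 : ℝ) * (∫⁻ x, φ x * ψ x ^ 2 ∂ν) ^ (1 / 2 : ℝ) := by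
  have h := lintegral_mul_le_l2 (ν := ν) (hφ.pow_const (1 / 2 : ℝ))
    ((hφ.pow_const (1 / 2 : ℝ)).mul hψ)
  simp only [l2, mul_pow, rpow_half_sq, Pi.mul_apply] at h
  refine le_trans (le_of_eq (lintegral_congr fun x => ?_)) h
  rw [← mul_assoc, ← sq, rpow_half_sq]

section
variable {n : ℕ} {β D : ℝ} {k : Rn n → ℂ}

namespace RoughKernel

lemma lintegral_ker_sub_left_le [NeZero n] (hk : RoughKernel β D k) :
    ∃ C : ℝ≥0, 0 < C ∧ ∀ (t : ℝ) (x x' : Rn n), 0 < t →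
      ∫⁻ y, ‖ker k t (x - y) - ker k t (x' - y)‖ₑ ≤ C * ENNReal.ofReal ((‖x - x'‖ / t) ^ β) := by
  obtain ⟨C, hC, h⟩ := hk.lintegral_ker_sub_le
  refine ⟨C, hC, fun t x x' ht => ?_⟩
  refine le_trans (le_of_eq ?_) (h t (x - x') ht)
  rw [← lintegral_sub_left_eq_self (fun u => ‖ker k t (u + (x - x')) - ker k t u‖ₑ) x']
  refine lintegral_congr fun y => ?_
  rw [show x' - y + (x - x') = x - y by abel]

/-- A common constant is subtracted at both points before the kernels are compared, so only the
oscillation of f enters. -/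
lemma enorm_avgOp_sub_le [NeZero n] (hk : RoughKernel β D k) {f : Rn n → ℂ} {c : ℂ} {t : ℝ}
    (ht : 0 < t) {x x' : Rn n} (hx : Integrable fun y => ker k t (x - y) * (f y - c))
    (hx' : Integrable fun y => ker k t (x' - y) * (f y - c)) :
    ‖avgOp k f t x - avgOp k f t x'‖ₑ ≤
      ∫⁻ y, ‖ker k t (x - y) - ker k t (x' - y)‖ₑ * ‖f y - c‖ₑ := by
  rw [← hk.avgOp_sub_const f c ht x, ← hk.avgOp_sub_const f c ht x', avgOp, avgOp,
    ← integral_sub hx hx']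
  refine (enorm_integral_le_lintegral_enorm _).trans (le_of_eq (lintegral_congr fun y => ?_))
  rw [← sub_mul, enorm_mul]

lemma aestronglyMeasurable_ker_mul (hk : RoughKernel β D k) {f : Rn n → ℂ}
    (hf : AEStronglyMeasurable f volume) (t : ℝ) (x : Rn n) (c : ℂ) :
    AEStronglyMeasurable (fun y => ker k t (x - y) * (f y - c)) volume := by
  have := hk.measurable_ker_right t
  exact AEStronglyMeasurable.mul (Measurable.aestronglyMeasurable (by fun_prop))
    (hf.sub aestronglyMeasurable_const)

/-- Size and smoothness of the averages of a Lipschitz function. -/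
lemma enorm_avgOp_lipschitz [NeZero n] (hk : RoughKernel β D k) {a : ℝ} (ha : 0 < a) :
    ∃ C : ℝ≥0, 0 < C ∧ ∀ (f : Rn n → ℂ) (A : ℝ≥0∞), A ≠ ∞ → AEStronglyMeasurable f volume →
      (∀ x y, ‖f x - f y‖ₑ ≤ A * ENNReal.ofReal (‖x - y‖ ^ a)) →
      (∀ (t : ℝ) (x : Rn n), 0 < t → ‖avgOp k f t x‖ₑ ≤ C * A * ENNReal.ofReal (t ^ a)) ∧
      ∀ (t : ℝ) (x x' : Rn n), 0 < t → ‖x - x'‖ ≤ t →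
        ‖avgOp k f t x - avgOp k f t x'‖ₑ ≤
          C * A * ENNReal.ofReal (t ^ a) * ENNReal.ofReal ((‖x - x'‖ / t) ^ β) := by
  obtain ⟨C1, hC1, h1⟩ := hk.lintegral_ker_le
  obtain ⟨C2, hC2, h2⟩ := hk.lintegral_ker_sub_left_le
  have h1' : ∀ t x, 0 < t → ∫⁻ y, ‖ker k t (x - y)‖ₑ ≤ C1 := fun t x ht => by
    rw [lintegral_sub_left_eq_self (fun u => ‖ker k t u‖ₑ) x]; exact h1 t ht
  refine ⟨C1 + C2 * Real.toNNReal (2 ^ a), by positivity, fun f A hA hfm hf => ⟨?_, ?_⟩⟩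
  · intro t x ht
    rw [← hk.avgOp_sub_const f (f x) ht x]
    calc ‖avgOp k (fun y => f y - f x) t x‖ₑ
        ≤ ∫⁻ y, ‖ker k t (x - y)‖ₑ * ‖f y - f x‖ₑ := enorm_avgOp_le_lintegral _ t x
      _ ≤ ∫⁻ y, ‖ker k t (x - y)‖ₑ * (A * ENNReal.ofReal (t ^ a)) := by
          refine lintegral_mono fun y => ?_
          dsimp only
          rcases lt_or_ge t ‖x - y‖ with hlt | hle
          · rw [ker_of_lt hlt]; simp
          · gcongr
            refine (hf y x).trans ?_
            rw [norm_sub_rev]; gcongr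
      _ ≤ C1 * (A * ENNReal.ofReal (t ^ a)) := by
          rw [lintegral_mul_const' _ _ (by finiteness)]
          gcongr; exact h1' t x ht
      _ ≤ _ := by
          rw [mul_assoc]; gcongr; exact_mod_cast le_self_add
  · intro t x x' ht hxx'
    -- Both kernels are supported within 2t of x, where f differs from f(x) by at most this amount.
    set M : ℝ≥0∞ := A * ENNReal.ofReal ((2 * t) ^ a) with hM
    have hMtop : M ≠ ∞ := by finiteness
    have hb : ∀ y, ‖x - y‖ ≤ 2 * t → ‖f y - f x‖ₑ ≤ M := by
      intro y hy
      refine (hf y x).trans ?_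
      rw [hM, norm_sub_rev]; gcongr
    have hint : ∀ w : Rn n, ‖x - w‖ ≤ t → Integrable fun y => ker k t (w - y) * (f y - f x) := by
      intro w hw
      refine ⟨hk.aestronglyMeasurable_ker_mul hfm t w _, ?_⟩
      rw [hasFiniteIntegral_iff_enorm]
      refine lt_of_le_of_lt (b := ∫⁻ y, ‖ker k t (w - y)‖ₑ * M) (lintegral_mono fun y => ?_) ?_
      · dsimp only
        rw [enorm_mul]
        rcases lt_or_ge t ‖w - y‖ with hlt | hle
        · rw [ker_of_lt hlt]; simp
        · gcongr
          refine hb y ?_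
          calc ‖x - y‖ ≤ ‖x - w‖ + ‖w - y‖ := by
                rw [← sub_add_sub_cancel x w y]; exact norm_add_le _ _
            _ ≤ 2 * t := by linarith
      · rw [lintegral_mul_const' _ _ hMtop]
        exact ENNReal.mul_lt_top ((h1' t w ht).trans_lt ENNReal.coe_lt_top)
          (lt_top_iff_ne_top.2 hMtop)
    calc ‖avgOp k f t x - avgOp k f t x'‖ₑ
        ≤ ∫⁻ y, ‖ker k t (x - y) - ker k t (x' - y)‖ₑ * ‖f y - f x‖ₑ :=
          hk.enorm_avgOp_sub_le ht (hint x (by simpa using ht.le)) (hint x' hxx')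
      _ ≤ ∫⁻ y, ‖ker k t (x - y) - ker k t (x' - y)‖ₑ * M := by
          refine lintegral_mono fun y => ?_
          dsimp only
          rcases lt_or_ge (2 * t) ‖x - y‖ with hlt | hle
          · have h3 : t < ‖x' - y‖ := by
              have : ‖x - y‖ ≤ ‖x - x'‖ + ‖x' - y‖ := by
                rw [← sub_add_sub_cancel x x' y]; exact norm_add_le _ _
              linarith
            rw [ker_of_lt h3, ker_of_lt (by linarith)]; simp
          · gcongr; exact hb y hle
      _ ≤ C2 * ENNReal.ofReal ((‖x - x'‖ / t) ^ β) * M := by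
          rw [lintegral_mul_const' _ _ hMtop]; gcongr; exact h2 t x x' ht
      _ = C2 * ENNReal.ofReal (2 ^ a) * A * ENNReal.ofReal (t ^ a) *
            ENNReal.ofReal ((‖x - x'‖ / t) ^ β) := by
          rw [hM, Real.mul_rpow (by norm_num) ht.le, ENNReal.ofReal_mul (by positivity)]; ring
      _ ≤ _ := by
          gcongr
          push_cast
          exact le_add_self

/-- A weighted quadratic estimate for functions of bounded mean oscillation. -/
lemma lintegral_ker_mul_bmo_sq_le [NeZero n] (hk : RoughKernel β D k) :
    ∃ C : ℝ≥0, 0 < C ∧ ∀ f : Rn n → ℂ, MemBMO f → ∀ (t : ℝ) (x x' : Rn n), 0 < t → ‖x - x'‖ ≤ t →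
      ∫⁻ y, ‖ker k t (x' - y)‖ₑ * ‖f y - ⨍ u in closedBall x (2 * t), f u‖ₑ ^ 2 ≤
        C * bmoSeminorm f ^ 2 := by
  have hn : n ≠ 0 := NeZero.ne n
  have hn1 : (1 : ℝ) ≤ n := by exact_mod_cast Nat.one_le_iff_ne_zero.2 hn
  obtain ⟨C1, hC1, h1⟩ := john_nirenberg n (4 * n) (by omega)
  obtain ⟨C2, hC2, h2⟩ := hk.lintegral_ker_mul_le (σ := n - 1 / 2) (by linarith)
  set V : ℝ≥0 := (unitVol n).toNNReal with hV
  have hVe : (V : ℝ≥0∞) = unitVol n := ENNReal.coe_toNNReal (unitVol_ne_top n)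
  have hV0 : 0 < V := ENNReal.toNNReal_pos (unitVol_ne_zero n) (unitVol_ne_top n)
  -- Hölder with exponent 2n, paired with John–Nirenberg at exponent 4n, bounds the mass of |f - c|²
  -- in a ball of radius s by a multiple of t^{1/2}s^{n-1/2}. The order n - 1/2 still exceeds the
  -- singularity n - 1.
  set P : ℝ := 2 * n with hP
  have hP0 : 0 < P := by positivity
  have hP1 : 1 ≤ P := by linarith
  have hP2 : 0 ≤ 1 - 1 / P := by
    rw [sub_nonneg, div_le_one hP0]; exact hP1
  refine ⟨C2 * (C1 ^ (1 / P) * V * 2), by positivity, fun f hf t x x' ht hxx' => ?_⟩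
  set c : ℂ := ⨍ u in closedBall x (2 * t), f u with hc
  set N := bmoSeminorm f with hN
  have hmain : ∀ s, 0 < s → s ≤ t → ∫⁻ y in closedBall x' s, ‖f y - c‖ₑ ^ 2 ≤
      C1 ^ (1 / P) * N ^ 2 * V * ENNReal.ofReal ((2 * t) ^ (1 / 2 : ℝ)) *
        ENNReal.ofReal (s ^ ((n : ℝ) - 1 / 2)) := by
    intro s hs hst
    have hm : AEMeasurable (fun y => ‖f y - c‖ₑ ^ 2) (volume.restrict (closedBall x' s)) :=
      ((hf.1.aestronglyMeasurable.sub aestronglyMeasurable_const).enorm.pow_const 2).restrict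
    calc ∫⁻ y in closedBall x' s, ‖f y - c‖ₑ ^ 2
        ≤ (∫⁻ y in closedBall x' s, (‖f y - c‖ₑ ^ 2) ^ P) ^ (1 / P) *
            volume (closedBall x' s) ^ (1 - 1 / P) := setLIntegral_le_rpow_mul hm hP1
      _ ≤ (C1 * N ^ (4 * n) * volume (closedBall x (2 * t))) ^ (1 / P) *
            volume (closedBall x' s) ^ (1 - 1 / P) := by
          gcongr
          refine le_trans ?_ (h1 f hf x (2 * t) (by linarith))
          refine (lintegral_mono_set (closedBall_subset_closedBall' ?_)).trans
            (le_of_eq (lintegral_congr fun y => ?_))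
          · rw [dist_comm, dist_eq_norm]; linarith
          · rw [← ENNReal.rpow_natCast, ← ENNReal.rpow_natCast, ← ENNReal.rpow_mul]
            congr 1
            rw [hP]; push_cast; ring
      _ = C1 ^ (1 / P) * (N ^ (4 * n)) ^ (1 / P) * (unitVol n ^ (1 / P) * unitVol n ^ (1 - 1 / P)) *
            ENNReal.ofReal ((2 * t) ^ n) ^ (1 / P) * ENNReal.ofReal (s ^ n) ^ (1 - 1 / P) := by
          rw [volume_closedBall_eq x (by linarith), volume_closedBall_eq x' hs.le,
            ENNReal.mul_rpow_of_nonneg _ _ (by positivity),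
            ENNReal.mul_rpow_of_nonneg _ _ (by positivity),
            ENNReal.mul_rpow_of_nonneg _ _ (by positivity), ENNReal.mul_rpow_of_nonneg _ _ hP2]
          ring
      _ = _ := by
          rw [← ENNReal.rpow_add _ _ (unitVol_ne_zero n) (unitVol_ne_top n), add_sub_cancel,
            ENNReal.rpow_one, ENNReal.ofReal_rpow_of_nonneg (by positivity) (by positivity),
            ENNReal.ofReal_rpow_of_nonneg (by positivity) hP2, hVe]
          have e1 : (N ^ (4 * n)) ^ (1 / P) = N ^ 2 := by
            rw [← ENNReal.rpow_natCast, ← ENNReal.rpow_natCast, ← ENNReal.rpow_mul]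
            congr 1
            rw [hP]; push_cast; field_simp; norm_num
          have e2 : ((2 * t) ^ n) ^ (1 / P) = (2 * t) ^ (1 / 2 : ℝ) := by
            rw [← Real.rpow_natCast, ← Real.rpow_mul (by positivity)]
            congr 1
            rw [hP]; field_simp
          have e3 : (s ^ n) ^ (1 - 1 / P) = s ^ ((n : ℝ) - 1 / 2) := by
            rw [← Real.rpow_natCast, ← Real.rpow_mul (by positivity)]
            congr 1
            rw [hP]; field_simp
          rw [e1, e2, e3]
  refine (h2 _ x' _ t ht hmain).trans ?_
  have e4 : ENNReal.ofReal ((2 * t) ^ (1 / 2 : ℝ)) * ENNReal.ofReal (t ^ ((n : ℝ) - 1 / 2 - n)) ≤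
      2 := by
    rw [← ENNReal.ofReal_mul (by positivity), ← ENNReal.ofReal_ofNat]
    refine ENNReal.ofReal_le_ofReal ?_
    rw [show (n : ℝ) - 1 / 2 - n = -(1 / 2) by ring, Real.mul_rpow (by norm_num) ht.le, mul_assoc,
      ← Real.rpow_add ht, add_neg_cancel, Real.rpow_zero, mul_one]
    calc (2 : ℝ) ^ (1 / 2 : ℝ) ≤ 2 ^ (1 : ℝ) :=
          Real.rpow_le_rpow_of_exponent_le (by norm_num) (by norm_num)
      _ = 2 := Real.rpow_one 2
  calc _ = C2 * (C1 ^ (1 / P) * V * (ENNReal.ofReal ((2 * t) ^ (1 / 2 : ℝ)) *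
        ENNReal.ofReal (t ^ ((n : ℝ) - 1 / 2 - n)))) * N ^ 2 := by ring
    _ ≤ C2 * (C1 ^ (1 / P) * V * 2) * N ^ 2 := by gcongr
    _ = _ := by
        push_cast
        rw [ENNReal.coe_rpow_of_nonneg _ (by positivity)]

/-- Size and smoothness of the averages of a function of bounded mean oscillation. -/
lemma enorm_avgOp_bmo [NeZero n] (hk : RoughKernel β D k) :
    ∃ C : ℝ≥0, 0 < C ∧ ∀ f : Rn n → ℂ, MemBMO f →
      (∀ (t : ℝ) (x : Rn n), 0 < t → ‖avgOp k f t x‖ₑ ≤ C * bmoSeminorm f) ∧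
      ∀ (t : ℝ) (x x' : Rn n), 0 < t → ‖x - x'‖ ≤ t → ‖avgOp k f t x - avgOp k f t x'‖ₑ ≤
        C * bmoSeminorm f * ENNReal.ofReal ((‖x - x'‖ / t) ^ (β / 2)) := by
  obtain ⟨C1, hC1, h1⟩ := hk.lintegral_ker_le
  obtain ⟨C2, hC2, h2⟩ := hk.lintegral_ker_sub_left_le
  obtain ⟨C3, hC3, h3⟩ := hk.lintegral_ker_mul_bmo_sq_le
  have h1' : ∀ t x, 0 < t → ∫⁻ y, ‖ker k t (x - y)‖ₑ ≤ C1 := fun t x ht => by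
    rw [lintegral_sub_left_eq_self (fun u => ‖ker k t u‖ₑ) x]; exact h1 t ht
  have hkm : ∀ t (x : Rn n), Measurable fun y => ker k t (x - y) := fun t x => by
    have := hk.measurable_ker_right t
    fun_prop
  refine ⟨C1 ^ (1 / 2 : ℝ) * C3 ^ (1 / 2 : ℝ) + C2 ^ (1 / 2 : ℝ) * (2 * C3) ^ (1 / 2 : ℝ),
    by positivity, fun f hf => ?_⟩
  set N := bmoSeminorm f with hN
  have hNtop : N ≠ ∞ := hf.2.ne
  have hgm : ∀ c : ℂ, AEMeasurable (fun y => ‖f y - c‖ₑ) volume := fun c =>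
    (hf.1.aestronglyMeasurable.sub aestronglyMeasurable_const).enorm
  have hL1 : ∀ t (x x' : Rn n), 0 < t → ‖x - x'‖ ≤ t →
      ∫⁻ y, ‖ker k t (x' - y)‖ₑ * ‖f y - ⨍ u in closedBall x (2 * t), f u‖ₑ ≤
        (C1 : ℝ≥0∞) ^ (1 / 2 : ℝ) * (C3 : ℝ≥0∞) ^ (1 / 2 : ℝ) * N := by
    intro t x x' ht hxx'
    refine (lintegral_mul_le_sqrt (hkm t x').enorm.aemeasurable (hgm _)).trans ?_
    calc _ ≤ (C1 : ℝ≥0∞) ^ (1 / 2 : ℝ) * (C3 * N ^ 2) ^ (1 / 2 : ℝ) := by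
          gcongr
          · exact h1' t x' ht
          · exact h3 f hf t x x' ht hxx'
      _ = _ := by rw [ENNReal.mul_rpow_of_nonneg _ _ (by norm_num), sq_rpow_half, mul_assoc]
  have e0 : ((C1 ^ (1 / 2 : ℝ) * C3 ^ (1 / 2 : ℝ) + C2 ^ (1 / 2 : ℝ) * (2 * C3) ^ (1 / 2 : ℝ) :
      ℝ≥0) : ℝ≥0∞) = (C1 : ℝ≥0∞) ^ (1 / 2 : ℝ) * (C3 : ℝ≥0∞) ^ (1 / 2 : ℝ) +
      (C2 : ℝ≥0∞) ^ (1 / 2 : ℝ) * (2 * (C3 : ℝ≥0∞)) ^ (1 / 2 : ℝ) := by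
    push_cast
    simp only [ENNReal.coe_rpow_of_nonneg _ (by norm_num : (0 : ℝ) ≤ 1 / 2), ENNReal.coe_mul,
      ENNReal.coe_ofNat]
  rw [e0]
  constructor
  · intro t x ht
    rw [← hk.avgOp_sub_const f (⨍ u in closedBall x (2 * t), f u) ht x]
    refine (enorm_avgOp_le_lintegral _ t x).trans ((hL1 t x x ht (by simpa using ht.le)).trans ?_)
    gcongr
    exact le_self_add
  · intro t x x' ht hxx'
    set c : ℂ := ⨍ u in closedBall x (2 * t), f u with hc
    have hint : ∀ w : Rn n, ‖x - w‖ ≤ t → Integrable fun y => ker k t (w - y) * (f y - c) := by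
      intro w hw
      refine ⟨hk.aestronglyMeasurable_ker_mul hf.1.aestronglyMeasurable t w _, ?_⟩
      rw [hasFiniteIntegral_iff_enorm]
      simp_rw [enorm_mul]
      refine (hL1 t x w ht hw).trans_lt ?_
      finiteness
    have hΔm : Measurable fun y => ‖ker k t (x - y) - ker k t (x' - y)‖ₑ :=
      ((hkm t x).sub (hkm t x')).enorm
    -- The first root carries the modulus (|x - x'|/t)^β, the second the size of f; this halves the
    -- exponent.
    calc ‖avgOp k f t x - avgOp k f t x'‖ₑ
        ≤ ∫⁻ y, ‖ker k t (x - y) - ker k t (x' - y)‖ₑ * ‖f y - c‖ₑ :=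
          hk.enorm_avgOp_sub_le ht (hint x (by simpa using ht.le)) (hint x' hxx')
      _ ≤ (∫⁻ y, ‖ker k t (x - y) - ker k t (x' - y)‖ₑ) ^ (1 / 2 : ℝ) *
            (∫⁻ y, ‖ker k t (x - y) - ker k t (x' - y)‖ₑ * ‖f y - c‖ₑ ^ 2) ^ (1 / 2 : ℝ) :=
          lintegral_mul_le_sqrt hΔm.aemeasurable (hgm c)
      _ ≤ (C2 * ENNReal.ofReal ((‖x - x'‖ / t) ^ β)) ^ (1 / 2 : ℝ) *
            (2 * C3 * N ^ 2) ^ (1 / 2 : ℝ) := by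
          gcongr
          · exact h2 t x x' ht
          · calc _ ≤ ∫⁻ y, (‖ker k t (x - y)‖ₑ * ‖f y - c‖ₑ ^ 2 +
                  ‖ker k t (x' - y)‖ₑ * ‖f y - c‖ₑ ^ 2) := by
                  refine lintegral_mono fun y => ?_
                  dsimp only
                  rw [← add_mul]
                  gcongr
                  exact enorm_sub_le
              _ = (∫⁻ y, ‖ker k t (x - y)‖ₑ * ‖f y - c‖ₑ ^ 2) +
                  ∫⁻ y, ‖ker k t (x' - y)‖ₑ * ‖f y - c‖ₑ ^ 2 :=
                  lintegral_add_left' ((hkm t x).enorm.aemeasurable.mul ((hgm c).pow_const 2)) _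
              _ ≤ C3 * N ^ 2 + C3 * N ^ 2 := add_le_add
                  (h3 f hf t x x ht (by simpa using ht.le)) (h3 f hf t x x' ht hxx')
              _ = _ := by ring
      _ = (C2 : ℝ≥0∞) ^ (1 / 2 : ℝ) * (2 * (C3 : ℝ≥0∞)) ^ (1 / 2 : ℝ) * N *
            ENNReal.ofReal ((‖x - x'‖ / t) ^ (β / 2)) := by
          rw [ENNReal.mul_rpow_of_nonneg _ _ (by norm_num),
            ENNReal.mul_rpow_of_nonneg (2 * (C3 : ℝ≥0∞)) _ (by norm_num), sq_rpow_half,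
            ENNReal.ofReal_rpow_of_nonneg (by positivity) (by norm_num),
            ← Real.rpow_mul (by positivity), mul_one_div]
          ring
      _ ≤ _ := by
          gcongr
          exact le_add_self

end RoughKernel
end

/-! ### Lipschitz spaces -/

lemma enorm_sub_le_lipSeminorm {n : ℕ} {V : Type*} [NormedAddCommGroup V] {a : ℝ}
    (f : Rn n → V) (x y : Rn n) :
    ‖f x - f y‖ₑ ≤ lipSeminorm a f * ENNReal.ofReal (‖x - y‖ ^ a) := by
  rcases eq_or_ne x y with rfl | hxy
  · simp
  have h0 : 0 < ‖x - y‖ := norm_pos_iff.2 (sub_ne_zero.2 hxy)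
  have h : ‖f x - f y‖ₑ / ‖x - y‖ₑ ^ a ≤ lipSeminorm a f :=
    le_iSup_of_le x (le_iSup_of_le y (le_iSup_of_le hxy le_rfl))
  have e : ‖x - y‖ₑ ^ a = ENNReal.ofReal (‖x - y‖ ^ a) := by
    rw [← ofReal_norm, ENNReal.ofReal_rpow_of_pos h0]
  rw [e] at h
  exact (ENNReal.div_le_iff (by simpa using Real.rpow_pos_of_pos h0 a) (by finiteness)).1 h

lemma lipSeminorm_le {n : ℕ} {V : Type*} [NormedAddCommGroup V] {a : ℝ} {f : Rn n → V} {C : ℝ≥0∞}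
    (h : ∀ x y, ‖f x - f y‖ₑ ≤ C * ENNReal.ofReal (‖x - y‖ ^ a)) : lipSeminorm a f ≤ C := by
  refine iSup_le fun x => iSup_le fun y => iSup_le fun hxy => ?_
  have h0 : 0 < ‖x - y‖ := norm_pos_iff.2 (sub_ne_zero.2 hxy)
  have e : ‖x - y‖ₑ ^ a = ENNReal.ofReal (‖x - y‖ ^ a) := by
    rw [← ofReal_norm, ENNReal.ofReal_rpow_of_pos h0]
  rw [e]
  exact (ENNReal.div_le_iff (by simpa using Real.rpow_pos_of_pos h0 a) (by finiteness)).2 (h x y)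

lemma continuous_of_lipSeminorm {n : ℕ} {a : ℝ} (ha : 0 < a) {f : Rn n → ℂ}
    (hf : lipSeminorm a f < ∞) : Continuous f := by
  have h : HolderWith (lipSeminorm a f).toNNReal ⟨a, ha.le⟩ f := by
    intro x y
    rw [edist_eq_enorm_sub, edist_eq_enorm_sub, ENNReal.coe_toNNReal hf.ne]
    refine (enorm_sub_le_lipSeminorm (a := a) f x y).trans (le_of_eq ?_)
    rw [← ofReal_norm (x - y), ENNReal.ofReal_rpow_of_nonneg (norm_nonneg _)]
    · rfl
    · exact ha.le
  exact h.continuous ha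

section
variable {ι : Type*} [Fintype ι] {n : ℕ} {β : ℝ} {D : ι → ℝ} {k : ι → Rn n → ℂ}

/-- Split at r = |x - x'|. Up to r the product at x is at most a multiple of t^σ, square integrable
near 0 since σ > 0; beyond r the points are compared, which needs σ < β. The one-sided form makes
sense with infinite values and yields the dichotomy. -/
lemma multSqFn_le_add_lip [NeZero n] [Nonempty ι] (hk : ∀ j, RoughKernel β (D j) (k j)) {a : ι → ℝ}
    (ha : ∀ j, 0 < a j) (haβ : ∑ j, a j < β) :
    ∃ C : ℝ≥0, 0 < C ∧ ∀ f : ι → Rn n → ℂ, (∀ j, lipSeminorm (a j) (f j) < ∞) → ∀ x x',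
      multSqFn k f x ≤ multSqFn k f x' + C * (∏ j, lipSeminorm (a j) (f j)) *
        ENNReal.ofReal (‖x - x'‖ ^ ∑ j, a j) := by
  set σ := ∑ j, a j with hσ
  have hσ0 : 0 < σ := Finset.sum_pos (fun j _ => ha j) Finset.univ_nonempty
  choose C1 hC1 h1 using fun j => (hk j).enorm_avgOp_lipschitz (ha j)
  obtain ⟨C2, hC2, h2⟩ := multSqFnLarge_le_add hk haβ
  set c3 : ℝ := (1 / (2 * σ)) ^ (1 / 2 : ℝ) with hc3
  have hc30 : 0 < c3 := by positivity
  refine ⟨(c3.toNNReal + C2) * ∏ j, C1 j, mul_pos (add_pos (Real.toNNReal_pos.2 hc30) hC2)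
    (Finset.prod_pos fun j _ => hC1 j), fun f hf x x' => ?_⟩
  rcases eq_or_ne x x' with rfl | hxx'
  · exact le_self_add
  set r : ℝ := ‖x - x'‖ with hr
  have hr0 : 0 < r := norm_pos_iff.2 (sub_ne_zero.2 hxx')
  have hfm : ∀ j, AEStronglyMeasurable (f j) volume := fun j =>
    (continuous_of_lipSeminorm (ha j) (hf j)).aestronglyMeasurable
  have h3 := fun j => h1 j (f j) _ (hf j).ne (hfm j) (enorm_sub_le_lipSeminorm (f j))
  set U : ι → ℝ≥0∞ := fun j => C1 j * lipSeminorm (a j) (f j) with hU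
  have hUtop : ∏ j, U j ≠ ∞ := ENNReal.prod_ne_top fun j _ =>
    ENNReal.mul_ne_top ENNReal.coe_ne_top (hf j).ne
  have hsmall : multSqFnSmall k f r x ≤ (∏ j, U j) * (ENNReal.ofReal c3 * ENNReal.ofReal (r ^ σ)) := by
    calc multSqFnSmall k f r x
        ≤ l2 (dtt.restrict (Iic r)) fun t => (∏ j, U j) * ENNReal.ofReal (t ^ σ) := by
          refine l2_mono_ae ?_
          filter_upwards [ae_restrict_dtt_pos (Iic r)] with t ht
          calc ∏ j, ‖avgOp (k j) (f j) t x‖ₑ ≤ ∏ j, U j * ENNReal.ofReal (t ^ a j) :=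
                Finset.prod_le_prod' fun j _ => (h3 j).1 t x ht
            _ = _ := by
                rw [Finset.prod_mul_distrib,
                  ← ENNReal.ofReal_prod_of_nonneg (fun j _ => by positivity),
                  ← Real.rpow_sum_of_pos ht]
      _ = (∏ j, U j) * l2 (dtt.restrict (Iic r)) fun t => ENNReal.ofReal (t ^ σ) :=
          l2_const_mul hUtop
      _ ≤ _ := by gcongr; exact l2_Iic_rpow_le hσ0 hr0
  have hlarge := h2 f U x x' r hr0 hfm (fun j t ht => (h3 j).1 t x (hr0.trans ht))
    (fun j t ht => (h3 j).1 t x' (hr0.trans ht)) (fun j t ht => (h3 j).2 t x x' (hr0.trans ht) ht.le)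
  calc multSqFn k f x ≤ multSqFnSmall k f r x + multSqFnLarge k f r x := multSqFn_le_add k f r x
    _ ≤ (∏ j, U j) * (ENNReal.ofReal c3 * ENNReal.ofReal (r ^ σ)) +
          (multSqFn k f x' + C2 * (∏ j, U j) * ENNReal.ofReal (r ^ σ)) := by
        gcongr
        exact hlarge.trans (by gcongr; exact multSqFnLarge_le k f r x')
    _ = multSqFn k f x' + (ENNReal.ofReal c3 + C2) * (∏ j, U j) * ENNReal.ofReal (r ^ σ) := by ring
    _ = _ := by
        rw [hU, Finset.prod_mul_distrib]
        push_cast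
        change _ = _ + (ENNReal.ofReal c3 + C2) * _ * _ * _
        ring

end

section
variable {ι : Type*} [Fintype ι] {n : ℕ} {β : ℝ} {D : ι → ℝ} {k : ι → Rn n → ℂ}

/-- Dichotomy and boundedness on Lipschitz spaces. -/
lemma multSqFn_lipschitz [NeZero n] [Nonempty ι] (hk : ∀ j, RoughKernel β (D j) (k j)) {a : ι → ℝ}
    (ha : ∀ j, 0 < a j) (haβ : ∑ j, a j < β) :
    ∃ C : ℝ≥0, 0 < C ∧ ∀ f : ι → Rn n → ℂ, (∀ j, lipSeminorm (a j) (f j) < ∞) →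
      (∀ x, multSqFn k f x = ∞) ∨ ((∀ x, multSqFn k f x < ∞) ∧
        lipSeminorm (∑ j, a j) (fun x => (multSqFn k f x).toReal) ≤
          C * ∏ j, lipSeminorm (a j) (f j)) := by
  obtain ⟨C, hC, h⟩ := multSqFn_le_add_lip hk ha haβ
  refine ⟨C, hC, fun f hf => ?_⟩
  by_cases hfin : ∃ x₀, multSqFn k f x₀ ≠ ∞
  · obtain ⟨x₀, hx₀⟩ := hfin
    have hprod : ∏ j, lipSeminorm (a j) (f j) ≠ ∞ := ENNReal.prod_ne_top fun j _ => (hf j).ne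
    have hall : ∀ x, multSqFn k f x < ∞ := fun x =>
      (h f hf x x₀).trans_lt (by finiteness)
    refine Or.inr ⟨hall, lipSeminorm_le fun x y => ?_⟩
    refine enorm_toReal_sub_le (hall x).ne (hall y).ne (h f hf x y) ?_
    rw [norm_sub_rev]
    exact h f hf y x
  · push Not at hfin
    exact Or.inl hfin

/-! ### Measurability of the split operators and boundedness on BMO. -/

lemma measurable_multSqFnSmall (hk : ∀ j, RoughKernel β (D j) (k j)) {f : ι → Rn n → ℂ}
    (hf : ∀ j, AEStronglyMeasurable (f j) volume) (r : ℝ) : Measurable (multSqFnSmall k f r) := by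
  refine Measurable.pow_const ?_ _
  refine Measurable.lintegral_prod_left'
    (f := fun q : ℝ × Rn n => (∏ j, ‖avgOp (k j) (f j) q.1 q.2‖ₑ) ^ 2) (Measurable.pow_const ?_ _)
  exact Finset.measurable_prod _ fun j _ => ((hk j).stronglyMeasurable_avgOp (hf j)).measurable.enorm

lemma measurable_multSqFnLarge (hk : ∀ j, RoughKernel β (D j) (k j)) {f : ι → Rn n → ℂ}
    (hf : ∀ j, AEStronglyMeasurable (f j) volume) (r : ℝ) : Measurable (multSqFnLarge k f r) := by
  refine Measurable.pow_const ?_ _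
  refine Measurable.lintegral_prod_left'
    (f := fun q : ℝ × Rn n => (∏ j, ‖avgOp (k j) (f j) q.1 q.2‖ₑ) ^ 2) (Measurable.pow_const ?_ _)
  exact Finset.measurable_prod _ fun j _ => ((hk j).stronglyMeasurable_avgOp (hf j)).measurable.enorm

lemma ae_lt_top_of_forall_closedBall {g : Rn n → ℝ≥0∞} (x₀ : Rn n)
    (h : ∀ r, 0 < r → ∀ᵐ x ∂(volume.restrict (closedBall x₀ r)), g x < ∞) : ∀ᵐ x, g x < ∞ := by
  have h1 : ∀ N : ℕ, ∀ᵐ x, x ∈ closedBall x₀ (N + 1 : ℝ) → g x < ∞ := fun N =>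
    (ae_restrict_iff' measurableSet_closedBall).1 (h _ (by positivity))
  filter_upwards [ae_all_iff.2 h1] with x hx
  obtain ⟨N, hN⟩ := exists_nat_ge (dist x x₀)
  exact hx N (by rw [mem_closedBall]; linarith)

/-- Estimate of the small scales for functions of bounded mean oscillation. -/
lemma lintegral_multSqFnSmall_bmo_le [NeZero n] [Nonempty ι]
    (hk : ∀ j, RoughKernel β (D j) (k j)) :
    ∃ C : ℝ≥0, 0 < C ∧ ∀ f : ι → Rn n → ℂ, (∀ j, MemBMO (f j)) → ∀ (z : Rn n) (r : ℝ), 0 < r →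
      ∫⁻ x in closedBall z r, multSqFnSmall k f r x ≤
        volume (closedBall z r) * (C * ∏ j, bmoSeminorm (f j)) := by
  set m : ℕ := Fintype.card ι with hm
  have hm0 : 0 < m := Fintype.card_pos
  have hm1 : (1 : ℝ) ≤ m := by exact_mod_cast hm0
  -- Equal exponents 2m give p = 2, which dominates the mean oscillation; John–Nirenberg supplies
  -- the exponent 2m.
  obtain ⟨C1, hC1, h1⟩ := lintegral_multSqFnSmall_le hk (q := fun _ => ((2 * m : ℕ) : ℝ)) (p := 2)
    (fun _ => by push_cast; linarith) (by norm_num) (by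
      rw [Finset.sum_const, Finset.card_univ, nsmul_eq_mul, ← hm]; push_cast; field_simp)
  obtain ⟨C2, hC2, h2⟩ := john_nirenberg n (2 * m) (by omega)
  set s : ℝ := 1 / ((2 * m : ℕ) : ℝ) with hs
  have hs0 : 0 ≤ s := by positivity
  -- Chosen so that κ^{2m} absorbs both the John–Nirenberg constant and the doubling factor 2ⁿ.
  set κ : ℝ≥0 := (C2 * 2 ^ n) ^ s with hκ
  have hκ0 : 0 < κ := NNReal.rpow_pos (by positivity)
  have hκm : κ ^ (2 * m) = C2 * 2 ^ n := by
    rw [hκ, ← NNReal.rpow_natCast, ← NNReal.rpow_mul, hs, one_div_mul_cancel (by positivity),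
      NNReal.rpow_one]
  refine ⟨C1 * κ ^ m, by positivity, fun f hf z r hr => ?_⟩
  have h3 := h1 f (fun j => ⨍ u in closedBall z (2 * r), f j u)
    (fun j => κ * bmoSeminorm (f j)) z r hr (fun j => (hf j).1.aestronglyMeasurable) fun j => by
      simp_rw [ENNReal.rpow_natCast]
      refine (h2 (f j) (hf j) z (2 * r) (by linarith)).trans (le_of_eq ?_)
      rw [volume_closedBall_mul z z hr.le (by norm_num), mul_pow, ← ENNReal.coe_pow, hκm,
        ENNReal.ofReal_pow (by norm_num)]
      push_cast
      rw [ENNReal.ofReal_ofNat]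
      ring
  have h4 := setLIntegral_le_of_rpow_le hr (measurable_multSqFnSmall hk
    (fun j => (hf j).1.aestronglyMeasurable) r).aemeasurable (by norm_num) h3
  refine h4.trans (le_of_eq ?_)
  rw [Finset.prod_mul_distrib, Finset.prod_const, Finset.card_univ, ← hm]
  push_cast
  ring

/-- Boundedness on `BMO`. -/
lemma multSqFn_bmo [NeZero n] [Nonempty ι] (hk : ∀ j, RoughKernel β (D j) (k j)) :
    ∃ C : ℝ≥0, 0 < C ∧ ∀ f : ι → Rn n → ℂ, (∀ j, MemBMO (f j)) →
      (∃ x₀, multSqFn k f x₀ < ∞) → (∀ᵐ x, multSqFn k f x < ∞) ∧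
      MemBMO (fun x => (multSqFn k f x).toReal) ∧
      bmoSeminorm (fun x => (multSqFn k f x).toReal) ≤ C * ∏ j, bmoSeminorm (f j) := by
  have hβ : 0 < β := (hk (Classical.arbitrary ι)).beta_pos
  obtain ⟨C1, hC1, h1⟩ := lintegral_multSqFnSmall_bmo_le hk
  choose C2 hC2 h2 using fun j => (hk j).enorm_avgOp_bmo
  -- Averages of BMO functions do not grow with t, so all orders are 0 and any positive gain, here
  -- β/2, suffices.
  obtain ⟨C3, hC3, h3⟩ := multSqFnLarge_le_add hk (α := fun _ => 0) (γ := β / 2)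
    (by rw [Finset.sum_const_zero]; positivity)
  refine ⟨2 * (C1 + C3 * ∏ j, C2 j), by positivity, fun f hf ⟨x₀, hx₀⟩ => ?_⟩
  have hfm : ∀ j, AEStronglyMeasurable (f j) volume := fun j => (hf j).1.aestronglyMeasurable
  set P : ℝ≥0∞ := ∏ j, bmoSeminorm (f j) with hP
  have hPtop : P ≠ ∞ := ENNReal.prod_ne_top fun j _ => (hf j).2.ne
  set E : ℝ≥0∞ := C3 * (∏ j, (C2 j : ℝ≥0∞)) * P with hE
  have hEtop : E ≠ ∞ := by
    have : ∏ j, (C2 j : ℝ≥0∞) ≠ ∞ := ENNReal.prod_ne_top fun j _ => ENNReal.coe_ne_top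
    finiteness
  have hlarge : ∀ (x x' : Rn n) (r : ℝ), 0 < r → ‖x - x'‖ ≤ r →
      multSqFnLarge k f r x ≤ multSqFnLarge k f r x' + E := by
    intro x x' r hr hxx'
    have h4 := h3 f (fun j => C2 j * bmoSeminorm (f j)) x x' r hr hfm
      (fun j t ht => by
        rw [Real.rpow_zero, ENNReal.ofReal_one, mul_one]
        exact (h2 j (f j) (hf j)).1 t x (hr.trans ht))
      (fun j t ht => by
        rw [Real.rpow_zero, ENNReal.ofReal_one, mul_one]
        exact (h2 j (f j) (hf j)).1 t x' (hr.trans ht))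
      (fun j t ht => by
        have ht0 : 0 < t := hr.trans ht
        rw [Real.rpow_zero, ENNReal.ofReal_one, mul_one]
        refine ((h2 j (f j) (hf j)).2 t x x' ht0 (hxx'.trans ht.le)).trans ?_
        gcongr)
    refine h4.trans (le_of_eq ?_)
    rw [Finset.sum_const_zero, Real.rpow_zero, ENNReal.ofReal_one, mul_one,
      Finset.prod_mul_distrib, hE]
    ring
  have hae : ∀ᵐ x, multSqFn k f x < ∞ := by
    -- On any ball about x₀ the large scales are within E of their finite value at x₀, and the small
    -- scales are integrable.
    refine ae_lt_top_of_forall_closedBall x₀ fun r hr => ?_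
    have h5 : ∫⁻ x in closedBall x₀ r, multSqFnSmall k f r x ≠ ∞ := by
      refine ne_top_of_le_ne_top ?_ (h1 f hf x₀ r hr)
      have := volume_closedBall_ne_top x₀ r
      finiteness
    filter_upwards [ae_lt_top (measurable_multSqFnSmall hk hfm r) h5,
      ae_restrict_mem measurableSet_closedBall] with x hx hxr
    refine (multSqFn_le_add k f r x).trans_lt (ENNReal.add_lt_top.2 ⟨hx, ?_⟩)
    refine (hlarge x x₀ r hr (by rwa [← dist_eq_norm])).trans_lt ?_
    have := (multSqFnLarge_le k f r x₀).trans_lt hx₀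
    finiteness
  set G : Rn n → ℝ := fun x => (multSqFn k f x).toReal with hG
  have hGm : AEStronglyMeasurable G volume :=
    (measurable_multSqFn hk hfm).ennreal_toReal.aestronglyMeasurable
  set K : ℝ≥0∞ := C1 * P + E with hK
  have hKtop : K ≠ ∞ := by finiteness
  have hosc : ∀ z r, 0 < r → ∃ c : ℝ, ∫⁻ x in closedBall z r, ‖G x - c‖ₑ ^ (1 : ℝ) ≤
      K ^ (1 : ℝ) * volume (closedBall z r) := by
    intro z r hr
    have hne : NeBot (ae (volume.restrict (closedBall z r))) := by
      rw [ae_neBot, Ne, Measure.restrict_eq_zero]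
      exact volume_closedBall_ne_zero z hr
    -- The comparison constant is the large-scale part at the centre z. It is finite because the
    -- ball contains a point where the full operator is finite.
    obtain ⟨x₁, hx₁, hx₁r⟩ := ((ae_restrict_of_ae (s := closedBall z r) hae).and
      (ae_restrict_mem measurableSet_closedBall)).exists
    have hc : multSqFnLarge k f r z ≠ ∞ := by
      refine ne_top_of_le_ne_top ?_ (hlarge z x₁ r hr (by
        rwa [norm_sub_rev, ← dist_eq_norm]))
      have := (multSqFnLarge_le k f r x₁).trans_lt hx₁
      finiteness
    refine ⟨(multSqFnLarge k f r z).toReal, ?_⟩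
    simp only [ENNReal.rpow_one]
    calc ∫⁻ x in closedBall z r, ‖G x - (multSqFnLarge k f r z).toReal‖ₑ
        ≤ ∫⁻ x in closedBall z r, (multSqFnSmall k f r x + E) := by
          refine lintegral_mono_ae ?_
          filter_upwards [ae_restrict_of_ae hae, ae_restrict_mem measurableSet_closedBall]
            with x hx hxr
          refine enorm_toReal_sub_le hx.ne hc ?_ ?_
          · calc multSqFn k f x ≤ multSqFnSmall k f r x + (multSqFnLarge k f r z + E) :=
                  (multSqFn_le_add k f r x).trans
                    (add_le_add_right (hlarge x z r hr (by rwa [← dist_eq_norm])) _)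
              _ = _ := by ring
          · calc multSqFnLarge k f r z ≤ multSqFnLarge k f r x + E :=
                  hlarge z x r hr (by rwa [norm_sub_rev, ← dist_eq_norm])
              _ ≤ _ := add_le_add (multSqFnLarge_le k f r x) le_add_self
      _ = (∫⁻ x in closedBall z r, multSqFnSmall k f r x) + E * volume (closedBall z r) := by
          rw [lintegral_add_right _ measurable_const, setLIntegral_const]
      _ ≤ volume (closedBall z r) * (C1 * P) + E * volume (closedBall z r) := by
          gcongr; exact h1 f hf z r hr
      _ = _ := by rw [hK]; ring
  have hloc : LocallyIntegrable G :=
    locallyIntegrable_of_oscillation hGm le_rfl (K := fun _ => K) (fun _ _ => hKtop) hosc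
  have hbound : bmoSeminorm G ≤ 2 * K := by
    refine iSup_le fun z => iSup_le fun r => iSup_le fun hr => ?_
    obtain ⟨c, hc⟩ := hosc z r hr
    have h6 := oscillation_setAverage_le hloc le_rfl hr hc
    simpa only [ENNReal.rpow_one, one_div, inv_one] using h6
  refine ⟨hae, ⟨hloc, hbound.trans_lt (by finiteness)⟩, hbound.trans (le_of_eq ?_)⟩
  rw [hK, hE]
  push_cast
  ring

end

/-! ### Campanato spaces of negative order -/

section
variable {n : ℕ}

lemma volume_closedBall_rpow [NeZero n] (z : Rn n) {r : ℝ} (hr : 0 < r) (s : ℝ) :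
    volume (closedBall z r) ^ (s / n) = unitVol n ^ (s / n) * ENNReal.ofReal (r ^ s) := by
  have hn : (n : ℝ) ≠ 0 := by exact_mod_cast NeZero.ne n
  rw [volume_closedBall_eq z hr.le, ENNReal.mul_rpow_of_ne_top ENNReal.ofReal_ne_top
    (unitVol_ne_top n), ENNReal.ofReal_rpow_of_pos (by positivity), ← Real.rpow_natCast,
    ← Real.rpow_mul hr.le, mul_div_cancel₀ _ hn, mul_comm]

lemma unitVol_rpow_ne_top (s : ℝ) : unitVol n ^ s ≠ ∞ :=
  ENNReal.rpow_ne_top_of_ne_zero (unitVol_ne_zero n) (unitVol_ne_top n)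

/-- Trades powers of the volume for powers of the radius, the factor C being a power of the volume
of the unit ball. -/
lemma setLIntegral_le_campanatoSeminorm [NeZero n] {V : Type*} [NormedAddCommGroup V]
    [NormedSpace ℝ V] (a : ℝ) {q : ℝ} (hq : 0 < q) :
    ∃ C : ℝ≥0, 0 < C ∧ ∀ (f : Rn n → V) (z : Rn n) (r : ℝ), 0 < r →
      ∫⁻ x in closedBall z r, ‖f x - ⨍ y in closedBall z r, f y‖ₑ ^ q ≤
        (C * campanatoSeminorm a q f * ENNReal.ofReal (r ^ a)) ^ q * volume (closedBall z r) := by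
  refine ⟨(unitVol n ^ (a / n)).toNNReal, ENNReal.toNNReal_pos (by
    simp [ENNReal.rpow_eq_zero_iff, unitVol_ne_zero, unitVol_ne_top]) (unitVol_rpow_ne_top _),
    fun f z r hr => ?_⟩
  have hv0 := volume_closedBall_ne_zero z hr
  have hvtop := volume_closedBall_ne_top z r
  have h : volume (closedBall z r) ^ (-(a / n)) * ((volume (closedBall z r))⁻¹ *
      ∫⁻ x in closedBall z r, ‖f x - ⨍ y in closedBall z r, f y‖ₑ ^ q) ^ (1 / q) ≤
      campanatoSeminorm a q f :=
    le_iSup_of_le z (le_iSup_of_le r (le_iSup_of_le hr le_rfl))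
  set I := ∫⁻ x in closedBall z r, ‖f x - ⨍ y in closedBall z r, f y‖ₑ ^ q with hI
  set v := volume (closedBall z r) with hv
  have h1 : (v⁻¹ * I) ^ (1 / q) ≤ v ^ (a / n) * campanatoSeminorm a q f := by
    calc (v⁻¹ * I) ^ (1 / q) = v ^ (a / n) * (v ^ (-(a / n)) * (v⁻¹ * I) ^ (1 / q)) := by
          rw [← mul_assoc, ← ENNReal.rpow_add _ _ hv0 hvtop, add_neg_cancel, ENNReal.rpow_zero,
            one_mul]
      _ ≤ _ := by gcongr
  rw [hv, volume_closedBall_rpow z hr, ← hv, one_div, ENNReal.rpow_inv_le_iff hq] at h1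
  rw [ENNReal.coe_toNNReal (unitVol_rpow_ne_top _), mul_right_comm]
  calc I = v⁻¹ * I * v := by rw [mul_right_comm, ENNReal.inv_mul_cancel hv0 hvtop, one_mul]
    _ ≤ _ := by gcongr

lemma campanatoSeminorm_le [NeZero n] {V : Type*} [NormedAddCommGroup V] [NormedSpace ℝ V]
    {α p : ℝ} {G : Rn n → V} {L : ℝ≥0∞}
    (h : ∀ z r, 0 < r → ((volume (closedBall z r))⁻¹ *
      ∫⁻ x in closedBall z r, ‖G x - ⨍ y in closedBall z r, G y‖ₑ ^ p) ^ (1 / p) ≤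
        L * ENNReal.ofReal (r ^ α)) :
    campanatoSeminorm α p G ≤ unitVol n ^ (-(α / n)) * L := by
  refine iSup_le fun z => iSup_le fun r => iSup_le fun hr => ?_
  refine (mul_le_mul' le_rfl (h z r hr)).trans (le_of_eq ?_)
  rw [← neg_div, volume_closedBall_rpow z hr]
  calc _ = unitVol n ^ (-α / n) * L * (ENNReal.ofReal (r ^ (-α)) * ENNReal.ofReal (r ^ α)) := by
        ring
    _ = _ := by
        rw [← ENNReal.ofReal_mul (by positivity), ← Real.rpow_add hr, neg_add_cancel,
          Real.rpow_zero, ENNReal.ofReal_one, mul_one]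

/-- Modulo constants, a Campanato function of negative order is a Morrey function. -/
lemma exists_const_morrey [NeZero n] {V : Type*} [NormedAddCommGroup V] [NormedSpace ℝ V]
    [CompleteSpace V] {a q : ℝ} (ha : a < 0) (hq : 1 ≤ q) :
    ∃ C : ℝ≥0, 0 < C ∧ ∀ f : Rn n → V, MemCampanato a q f → ∃ c : V, ∀ (z : Rn n) (r : ℝ),
      0 < r → ∫⁻ x in closedBall z r, ‖f x - c‖ₑ ^ q ≤
        (C * campanatoSeminorm a q f * ENNReal.ofReal (r ^ a)) ^ q * volume (closedBall z r) := by
  obtain ⟨C, hC, h⟩ := setLIntegral_le_campanatoSeminorm (n := n) (V := V) a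
    (one_pos.trans_le hq)
  set ρ : ℝ := (2 : ℝ) ^ a with hρ
  have hρ0 : 0 < ρ := by positivity
  have hρ1 : ρ < 1 := Real.rpow_lt_one_of_one_lt_of_neg (by norm_num) ha
  have hρ2 : 0 < 1 - ρ := by linarith
  set E : ℝ := 2 ^ n / (1 - ρ) with hE
  have hE0 : 0 < E := by positivity
  refine ⟨C * (1 + E.toNNReal), by positivity, fun f hf => ?_⟩
  set N : ℝ := (C * campanatoSeminorm a q f).toReal with hN
  have hNe : ENNReal.ofReal N = C * campanatoSeminorm a q f :=
    ENNReal.ofReal_toReal (ENNReal.mul_ne_top ENNReal.coe_ne_top hf.2.ne)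
  have hN0 : 0 ≤ N := ENNReal.toReal_nonneg
  set F : Rn n → ℝ → V := fun z r => ⨍ y in closedBall z r, f y with hF
  -- Means over nested balls differ by at most the oscillation on the larger one times the volume
  -- ratio cⁿ. Along dyadic dilates this is geometric, since 2^a < 1, so the means converge.
  have hmean : ∀ (z z' : Rn n) (r c : ℝ), 0 < r → 0 < c →
      closedBall z' r ⊆ closedBall z (c * r) →
      dist (F z' r) (F z (c * r)) ≤ c ^ n * N * (c * r) ^ a := by
    intro z z' r c hr hc hsub
    have h1 := setLIntegral_le_of_rpow_le (mul_pos hc hr)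
      (hf.1.aestronglyMeasurable.restrict.sub aestronglyMeasurable_const).enorm hq
      (h f z (c * r) (mul_pos hc hr))
    rw [dist_eq_norm, ← ENNReal.ofReal_le_ofReal_iff (by positivity), ofReal_norm]
    refine (ENNReal.mul_le_mul_iff_right (volume_closedBall_ne_zero z' hr)
      (volume_closedBall_ne_top z' r)).1 ?_
    calc _ ≤ ∫⁻ x in closedBall z' r, ‖f x - F z (c * r)‖ₑ :=
          volume_mul_enorm_setAverage_sub_le hf.1 z' r _
      _ ≤ ∫⁻ x in closedBall z (c * r), ‖f x - F z (c * r)‖ₑ := lintegral_mono_set hsub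
      _ ≤ _ := h1
      _ = _ := by
          rw [volume_closedBall_mul z' z hr.le hc.le, ENNReal.ofReal_mul (by positivity),
            ENNReal.ofReal_mul (by positivity), hNe]
          ring
  have hpow : ∀ (J : ℕ) (r : ℝ), 0 < r → ((2 : ℝ) ^ J * r) ^ a = ρ ^ J * r ^ a := by
    intro J r hr
    rw [Real.mul_rpow (by positivity) hr.le, ← Real.rpow_natCast, ← Real.rpow_mul (by norm_num),
      mul_comm, mul_comm (J : ℝ), Real.rpow_mul (by norm_num), Real.rpow_natCast, mul_comm]
  have hstep : ∀ (z : Rn n) (r : ℝ), 0 < r → ∀ J : ℕ,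
      dist (F z (2 ^ J * r)) (F z (2 ^ (J + 1) * r)) ≤ 2 ^ n * N * r ^ a * ρ ^ J := by
    intro z r hr J
    have e : (2 : ℝ) ^ (J + 1) * r = 2 * (2 ^ J * r) := by ring
    have hJ : 0 < (2 : ℝ) ^ J * r := by positivity
    have h1 := hmean z z (2 ^ J * r) 2 hJ two_pos (closedBall_subset_closedBall (by linarith))
    rw [← e, hpow (J + 1) r hr] at h1
    refine h1.trans ?_
    calc (2 : ℝ) ^ n * N * (ρ ^ (J + 1) * r ^ a) = 2 ^ n * N * r ^ a * ρ ^ J * ρ := by ring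
      _ ≤ 2 ^ n * N * r ^ a * ρ ^ J * 1 := by gcongr
      _ = _ := mul_one _
  have hlim : ∀ (z : Rn n) (r : ℝ), 0 < r → ∃ L, Tendsto (fun J : ℕ => F z (2 ^ J * r)) atTop (𝓝 L)
      ∧ dist (F z r) L ≤ E * N * r ^ a := by
    intro z r hr
    obtain ⟨L, hL⟩ := cauchySeq_tendsto_of_complete
      (cauchySeq_of_le_geometric _ _ hρ1 (hstep z r hr))
    refine ⟨L, hL, ?_⟩
    have h1 := dist_le_of_le_geometric_of_tendsto₀ _ _ hρ1 (hstep z r hr) hL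
    rw [pow_zero, one_mul] at h1
    refine h1.trans (le_of_eq ?_)
    rw [hE]; ring
  choose! L hL1 hL2 using hlim
  -- Dilates of a large ball about 0 contain the corresponding dilates about z, with a fixed volume
  -- ratio, and the oscillation tends to 0. Hence the limit depends on neither centre nor radius.
  have hagree : ∀ (z : Rn n) (r R : ℝ), 0 < r → r + ‖z‖ ≤ R → L z r = L 0 R := by
    intro z r R hr hR
    have hR0 : 0 < R := by linarith [norm_nonneg z]
    refine tendsto_nhds_unique (hL1 z r hr) ((hL1 0 R hR0).congr_dist ?_)
    have hb : ∀ J : ℕ, dist (F 0 (2 ^ J * R)) (F z (2 ^ J * r)) ≤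
        (R / r) ^ n * N * R ^ a * ρ ^ J := by
      intro J
      have e : (2 : ℝ) ^ J * R = R / r * (2 ^ J * r) := by field_simp
      have h1 := hmean 0 z (2 ^ J * r) (R / r) (by positivity) (by positivity) (by
        rw [← e]
        refine closedBall_subset_closedBall' ?_
        rw [dist_zero_right]
        have : ‖z‖ ≤ 2 ^ J * ‖z‖ := le_mul_of_one_le_left (norm_nonneg _)
          (one_le_pow₀ (by norm_num))
        nlinarith [pow_pos (two_pos (α := ℝ)) J])
      rw [dist_comm]
      rw [← e, hpow J R hR0] at h1
      refine h1.trans (le_of_eq ?_)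
      ring
    refine squeeze_zero (fun _ => dist_nonneg) hb ?_
    simpa using (tendsto_pow_atTop_nhds_zero_of_lt_one hρ0.le hρ1).const_mul
      ((R / r) ^ n * N * R ^ a)
  refine ⟨L 0 1, fun z r hr => ?_⟩
  have hLz : L z r = L 0 1 := by
    rw [hagree z r (r + ‖z‖ + 1) hr (by linarith),
      hagree 0 1 (r + ‖z‖ + 1) one_pos (by rw [norm_zero]; linarith [norm_nonneg z])]
  have h2 : ‖L 0 1 - F z r‖ₑ ≤ ENNReal.ofReal E * (C * campanatoSeminorm a q f *
      ENNReal.ofReal (r ^ a)) := by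
    rw [← ofReal_norm, ← dist_eq_norm, dist_comm, ← hLz, ← hNe, ← ENNReal.ofReal_mul hN0,
      ← ENNReal.ofReal_mul hE0.le, ← mul_assoc]
    exact ENNReal.ofReal_le_ofReal (hL2 z r hr)
  have h3 := setLIntegral_enorm_sub_rpow_le hf.1.aestronglyMeasurable hq (h f z r hr) h2
  refine h3.trans (le_of_eq ?_)
  congr 2
  push_cast
  simp only [ENNReal.ofReal]
  ring

end

/-! ### Averages and the multilinear operator on Morrey functions. -/

section
variable {n : ℕ} {β D : ℝ} {k : Rn n → ℂ}

/-- Averages at large scales of a function of Morrey type. -/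
lemma RoughKernel.enorm_avgOp_morrey_le [NeZero n] (hk : RoughKernel β D k) {a ε : ℝ}
    (hε : 0 < ε) (hε1 : ε ≤ 1 / 2) (hεa : 2 * ε ≤ -a) :
    ∃ C : ℝ≥0, 0 < C ∧ ∀ (g : Rn n → ℂ) (K : ℝ≥0∞) (z x : Rn n) (r t : ℝ), 0 < r → r < t →
      Measurable g → x ∈ closedBall z r →
      (∀ s, 0 < s → ∫⁻ y in closedBall x s, ‖g y‖ₑ ≤
        volume (closedBall x s) * (K * ENNReal.ofReal (s ^ a))) →
      ‖avgOp k g t x‖ₑ ≤ C * ENNReal.ofReal ((r / t) ^ ε) * (K * ENNReal.ofReal (r ^ a) +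
        maxFn (fun y => ‖(closedBall z (2 * r)).indicator g y‖ₑ) x) := by
  have hD := hk.pos
  have hn : (1 : ℝ) ≤ n := by exact_mod_cast Nat.one_le_iff_ne_zero.2 (NeZero.ne n)
  obtain ⟨C1, hC1, h1⟩ := lintegral_rpow_far (n := n) (a := n - ε) (σ := n - 2 * ε)
    (by linarith) (by linarith)
  obtain ⟨C2, hC2, h2⟩ := hk.lintegral_ker_mul_le_maxFn
  refine ⟨C2 + D.toNNReal * C1 * (unitVol n).toNNReal, by positivity,
    fun g K z x r t hr hrt hg hx hK => ?_⟩
  have ht : 0 < t := hr.trans hrt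
  set w : Rn n → ℝ≥0∞ := fun y => ‖(closedBall z (2 * r)).indicator g y‖ₑ with hw
  set S : Set (Rn n) := {y | r ≤ ‖x - y‖} with hS
  have hSm : MeasurableSet S := measurableSet_le measurable_const (by fun_prop)
  set φ : Rn n → ℝ≥0∞ := fun y => ENNReal.ofReal (‖x - y‖ ^ (-((n : ℝ) - ε))) * ‖g y‖ₑ with hφ
  have hφm : Measurable φ := by fun_prop
  -- Within distance r the kernel at scale t is r/t times the one at scale r. The Morrey bound alone
  -- may not control its singularity, so a maximal function takes over. Farther out, t^{-1}|u|^{1-n}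
  -- ≤ t^{-ε}|u|^{ε-n} trades part of the decay in t for integrability at infinity.
  have hpt : ∀ y, ‖ker k t (x - y)‖ₑ * ‖g y‖ₑ ≤
      ENNReal.ofReal (r / t) * (‖ker k r (x - y)‖ₑ * w y) +
        ENNReal.ofReal (D * t ^ (-ε)) * S.indicator φ y := by
    intro y
    rcases lt_or_ge t ‖x - y‖ with hlt | hle
    · rw [ker_of_lt hlt, enorm_zero, zero_mul]
      exact zero_le
    rcases le_or_gt ‖x - y‖ r with hyr | hyr
    · refine le_add_right (le_of_eq ?_)
      have hy : y ∈ closedBall z (2 * r) := by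
        rw [mem_closedBall] at hx ⊢
        rw [← dist_eq_norm] at hyr
        linarith [dist_triangle_left y z x]
      rw [hw]; dsimp only
      rw [indicator_of_mem hy, ker_of_le hle, ker_of_le hyr, ← mul_assoc]
      congr 1
      rw [← ofReal_norm, ← ofReal_norm, ← ENNReal.ofReal_mul (by positivity), norm_mul, norm_mul,
        norm_inv, norm_inv, Complex.norm_real, Complex.norm_real, Real.norm_of_nonneg ht.le,
        Real.norm_of_nonneg hr.le]
      congr 1
      field_simp
    · refine le_add_left ?_
      have hu : 0 < ‖x - y‖ := hr.trans hyr
      rw [indicator_of_mem (show y ∈ S from hyr.le), hφ]; dsimp only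
      rw [← mul_assoc, ← ENNReal.ofReal_mul (by positivity)]
      refine mul_le_mul' (enorm_le_ofReal ((hk.norm_ker_le ht _).trans ?_)) le_rfl
      rw [mul_assoc]
      refine mul_le_mul_of_nonneg_left ?_ hD.le
      have e1 : ‖x - y‖ ^ (-((n : ℝ) - 1)) = ‖x - y‖ ^ (-((n : ℝ) - ε)) * ‖x - y‖ ^ (1 - ε) := by
        rw [← Real.rpow_add hu]; congr 1; ring
      have e2 : t ^ (-ε) = t⁻¹ * t ^ (1 - ε) := by
        rw [← Real.rpow_neg_one, ← Real.rpow_add ht]; congr 1; ring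
      have e3 : ‖x - y‖ ^ (1 - ε) ≤ t ^ (1 - ε) :=
        Real.rpow_le_rpow hu.le hle (by linarith)
      rw [e1, e2]
      calc t⁻¹ * (‖x - y‖ ^ (-((n : ℝ) - ε)) * ‖x - y‖ ^ (1 - ε))
          ≤ t⁻¹ * (‖x - y‖ ^ (-((n : ℝ) - ε)) * t ^ (1 - ε)) := by gcongr
        _ = _ := by ring
  have hfar := h1 (fun y => ‖g y‖ₑ) x (unitVol n * K * ENNReal.ofReal (r ^ (a + 2 * ε))) r hr (by
    intro s hs
    have hs0 : 0 < s := hr.trans_le hs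
    refine (hK s hs0).trans ?_
    rw [volume_closedBall_eq x hs0.le]
    -- As a + 2ε ≤ 0 and s ≥ r, the surplus power of s is bounded by the same power of r, leaving
    -- mass of order s^{n-2ε}.
    have e : s ^ n * s ^ a = s ^ (a + 2 * ε) * s ^ ((n : ℝ) - 2 * ε) := by
      rw [← Real.rpow_natCast, ← Real.rpow_add hs0, ← Real.rpow_add hs0]; congr 1; ring
    calc _ = unitVol n * K * ENNReal.ofReal (s ^ n * s ^ a) := by
          rw [ENNReal.ofReal_mul (by positivity)]; ring
      _ ≤ unitVol n * K * ENNReal.ofReal (r ^ (a + 2 * ε) * s ^ ((n : ℝ) - 2 * ε)) := by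
          rw [e]
          refine mul_le_mul' le_rfl (ENNReal.ofReal_le_ofReal ?_)
          refine mul_le_mul_of_nonneg_right ?_ (by positivity)
          exact Real.rpow_le_rpow_of_nonpos hr hs (by linarith)
      _ = _ := by rw [ENNReal.ofReal_mul (by positivity), ← mul_assoc])
  have hrt1 : r / t ≤ 1 := (div_le_one ht).2 hrt.le
  calc ‖avgOp k g t x‖ₑ ≤ ∫⁻ y, ‖ker k t (x - y)‖ₑ * ‖g y‖ₑ := enorm_avgOp_le_lintegral g t x
    _ ≤ ∫⁻ y, (ENNReal.ofReal (r / t) * (‖ker k r (x - y)‖ₑ * w y) +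
        ENNReal.ofReal (D * t ^ (-ε)) * S.indicator φ y) := lintegral_mono hpt
    _ = ENNReal.ofReal (r / t) * (∫⁻ y, ‖ker k r (x - y)‖ₑ * w y) +
        ENNReal.ofReal (D * t ^ (-ε)) * ∫⁻ y in S, φ y := by
        rw [lintegral_add_right _ ((hφm.indicator hSm).const_mul _),
          lintegral_const_mul' _ _ ENNReal.ofReal_ne_top,
          lintegral_const_mul' _ _ ENNReal.ofReal_ne_top, lintegral_indicator hSm]
    _ ≤ ENNReal.ofReal ((r / t) ^ ε) * (C2 * maxFn w x) + ENNReal.ofReal (D * t ^ (-ε)) *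
        (C1 * (unitVol n * K * ENNReal.ofReal (r ^ (a + 2 * ε))) *
          ENNReal.ofReal (r ^ ((n : ℝ) - 2 * ε - (n - ε)))) := by
        refine add_le_add (mul_le_mul' (ENNReal.ofReal_le_ofReal ?_) (h2 w r x hr))
          (mul_le_mul' le_rfl hfar)
        calc r / t = (r / t) ^ (1 : ℝ) := (Real.rpow_one _).symm
          _ ≤ _ := Real.rpow_le_rpow_of_exponent_ge (by positivity) hrt1 (by linarith)
    _ = C2 * ENNReal.ofReal ((r / t) ^ ε) * maxFn w x + ENNReal.ofReal D * C1 * unitVol n *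
          ENNReal.ofReal ((r / t) ^ ε) * (K * ENNReal.ofReal (r ^ a)) := by
        have e : t ^ (-ε) * r ^ (a + 2 * ε) * r ^ ((n : ℝ) - 2 * ε - (n - ε)) =
            (r / t) ^ ε * r ^ a := by
          rw [mul_assoc, ← Real.rpow_add hr, Real.div_rpow hr.le ht.le, Real.rpow_neg ht.le,
            show a + 2 * ε + ((n : ℝ) - 2 * ε - (n - ε)) = ε + a by ring, Real.rpow_add hr]
          field_simp
        have e' : ENNReal.ofReal (t ^ (-ε)) * ENNReal.ofReal (r ^ (a + 2 * ε)) *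
            ENNReal.ofReal (r ^ ((n : ℝ) - 2 * ε - (n - ε))) =
            ENNReal.ofReal ((r / t) ^ ε) * ENNReal.ofReal (r ^ a) := by
          rw [← ENNReal.ofReal_mul (by positivity), ← ENNReal.ofReal_mul (by positivity),
            ← ENNReal.ofReal_mul (by positivity), e]
        rw [ENNReal.ofReal_mul hD.le]
        calc _ = C2 * ENNReal.ofReal ((r / t) ^ ε) * maxFn w x + ENNReal.ofReal D * C1 *
              unitVol n * K * (ENNReal.ofReal (t ^ (-ε)) * ENNReal.ofReal (r ^ (a + 2 * ε)) *
                ENNReal.ofReal (r ^ ((n : ℝ) - 2 * ε - (n - ε)))) := by ring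
          _ = _ := by rw [e']; ring
    _ ≤ (C2 + ENNReal.ofReal D * C1 * unitVol n) * ENNReal.ofReal ((r / t) ^ ε) *
        (K * ENNReal.ofReal (r ^ a) + maxFn w x) := by
        set T := ENNReal.ofReal ((r / t) ^ ε)
        calc _ ≤ C2 * T * (K * ENNReal.ofReal (r ^ a) + maxFn w x) +
              ENNReal.ofReal D * C1 * unitVol n * T * (K * ENNReal.ofReal (r ^ a) + maxFn w x) :=
              add_le_add (mul_le_mul' le_rfl le_add_self) (mul_le_mul' le_rfl le_self_add)
          _ = _ := by ring
    _ = _ := by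
        push_cast
        rw [ENNReal.coe_toNNReal (unitVol_ne_top n)]
        rfl

end

section
variable {ι : Type*} [Fintype ι] {n : ℕ} {β : ℝ} {D : ι → ℝ} {k : ι → Rn n → ℂ}

/-- Each factor decays like (r/t)^{ε_j} beyond scale r, and the product is square integrable for
dt/t. The large scales are therefore bounded outright, with no comparison of points. -/
lemma multSqFnLarge_morrey_le [NeZero n] [Nonempty ι] (hk : ∀ j, RoughKernel β (D j) (k j))
    {a : ι → ℝ} (ha : ∀ j, a j < 0) :
    ∃ C : ℝ≥0, 0 < C ∧ ∀ (g : ι → Rn n → ℂ) (K : ι → ℝ≥0∞) (z x : Rn n) (r : ℝ), 0 < r →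
      (∀ j, Measurable (g j)) → x ∈ closedBall z r →
      (∀ j s, 0 < s → ∫⁻ y in closedBall x s, ‖g j y‖ₑ ≤
        volume (closedBall x s) * (K j * ENNReal.ofReal (s ^ a j))) →
      multSqFnLarge k g r x ≤ C * ∏ j, (K j * ENNReal.ofReal (r ^ a j) +
        maxFn (fun y => ‖(closedBall z (2 * r)).indicator (g j) y‖ₑ) x) := by
  set ε : ι → ℝ := fun j => min (-(a j) / 2) (1 / 2) with hε
  have hε0 : ∀ j, 0 < ε j := fun j => lt_min (by linarith [ha j]) (by norm_num)
  choose C hC h using fun j => (hk j).enorm_avgOp_morrey_le (a := a j) (hε0 j) (min_le_right _ _)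
    (by linarith [min_le_left (-(a j) / 2) (1 / 2)])
  set s : ℝ := ∑ j, ε j with hs
  have hs0 : 0 < s := Finset.sum_pos (fun j _ => hε0 j) Finset.univ_nonempty
  set c : ℝ := (1 / (2 * s)) ^ (1 / 2 : ℝ) with hc
  have hc0 : 0 < c := by positivity
  refine ⟨(∏ j, C j) * c.toNNReal, mul_pos (Finset.prod_pos fun j _ => hC j)
    (Real.toNNReal_pos.2 hc0), fun g K z x r hr hg hx hK => ?_⟩
  set W : ι → ℝ≥0∞ := fun j => K j * ENNReal.ofReal (r ^ a j) +
    maxFn (fun y => ‖(closedBall z (2 * r)).indicator (g j) y‖ₑ) x with hW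
  calc multSqFnLarge k g r x
      ≤ l2 (dtt.restrict (Ioi r)) fun t => (∏ j, (C j : ℝ≥0∞)) * (∏ j, W j) *
          ENNReal.ofReal (r ^ s) * ENNReal.ofReal (t ^ (-s)) := by
        refine l2_mono_ae ?_
        filter_upwards [ae_restrict_mem measurableSet_Ioi] with t ht
        have ht' : r < t := ht
        have ht0 : 0 < t := hr.trans ht'
        calc ∏ j, ‖avgOp (k j) (g j) t x‖ₑ
            ≤ ∏ j, (C j * ENNReal.ofReal ((r / t) ^ ε j) * W j) :=
              Finset.prod_le_prod' fun j _ =>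
                h j (g j) (K j) z x r t hr ht' (hg j) hx (hK j)
          _ = (∏ j, (C j : ℝ≥0∞)) * (∏ j, W j) * ENNReal.ofReal ((r / t) ^ s) := by
              rw [hs, Real.rpow_sum_of_pos (by positivity), ENNReal.ofReal_prod_of_nonneg
                (fun j _ => by positivity), Finset.prod_mul_distrib, Finset.prod_mul_distrib]
              ring
          _ = _ := by
              rw [Real.div_rpow hr.le ht0.le, div_eq_mul_inv, ← Real.rpow_neg ht0.le,
                ENNReal.ofReal_mul (by positivity), mul_assoc, mul_assoc, mul_assoc]
    _ = (∏ j, (C j : ℝ≥0∞)) * (∏ j, W j) * ENNReal.ofReal (r ^ s) *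
          l2 (dtt.restrict (Ioi r)) fun t => ENNReal.ofReal (t ^ (-s)) :=
        l2_const_mul_of_measurable (by fun_prop) _
    _ ≤ (∏ j, (C j : ℝ≥0∞)) * (∏ j, W j) * ENNReal.ofReal (r ^ s) *
          (ENNReal.ofReal c * ENNReal.ofReal (r ^ (-s))) :=
        mul_le_mul' le_rfl (l2_Ioi_rpow_le hs0 hr)
    _ = (∏ j, (C j : ℝ≥0∞)) * ENNReal.ofReal c * (∏ j, W j) *
          (ENNReal.ofReal (r ^ s) * ENNReal.ofReal (r ^ (-s))) := by ring
    _ = _ := by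
        rw [← ENNReal.ofReal_mul (by positivity), ← Real.rpow_add hr, add_neg_cancel,
          Real.rpow_zero, ENNReal.ofReal_one, mul_one]
        push_cast
        rfl

end

section
variable {ι : Type*} [Fintype ι] {n : ℕ} {β : ℝ} {D : ι → ℝ} {k : ι → Rn n → ℂ}

lemma lintegral_maxFn_indicator_rpow_le [NeZero n] {q : ℝ} (hq : 1 < q) :
    ∃ C : ℝ≥0, 0 < C ∧ ∀ (g : Rn n → ℂ) (U : ℝ≥0∞) (z : Rn n) (r : ℝ), Measurable g →
      ∫⁻ x in closedBall z (2 * r), ‖g x‖ₑ ^ q ≤ U ^ q * volume (closedBall z r) →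
      ∫⁻ x in closedBall z r,
        maxFn (fun y => ‖(closedBall z (2 * r)).indicator g y‖ₑ) x ^ q ≤
          (C * U) ^ q * volume (closedBall z r) := by
  have hq0 : 0 < q := one_pos.trans hq
  obtain ⟨C, hC, h⟩ := maxFn_strong_type (n := n) hq
  refine ⟨C ^ (1 / q), NNReal.rpow_pos hC, fun g U z r hg hU => ?_⟩
  calc _ ≤ ∫⁻ x, maxFn (fun y => ‖(closedBall z (2 * r)).indicator g y‖ₑ) x ^ q :=
        setLIntegral_le_lintegral _ _
    _ ≤ C * ∫⁻ x, ‖(closedBall z (2 * r)).indicator g x‖ₑ ^ q :=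
        h _ (hg.indicator measurableSet_closedBall).enorm
    _ = C * ∫⁻ x in closedBall z (2 * r), ‖g x‖ₑ ^ q := by
        rw [← lintegral_indicator measurableSet_closedBall]
        congr 2 with x
        by_cases hx : x ∈ closedBall z (2 * r)
        · simp only [indicator_of_mem hx]
        · simp only [indicator_of_notMem hx, enorm_zero, ENNReal.zero_rpow_of_pos hq0]
    _ ≤ C * (U ^ q * volume (closedBall z r)) := by gcongr
    _ = _ := by
        rw [ENNReal.mul_rpow_of_nonneg _ _ hq0.le, ← ENNReal.coe_rpow_of_nonneg _ hq0.le,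
          ← NNReal.rpow_mul, one_div_mul_cancel hq0.ne', NNReal.rpow_one, mul_assoc]

/-- Hölder's inequality for normalized integrals. -/
lemma setLIntegral_prod_rpow_le_volume {G : ι → Rn n → ℝ≥0∞} {z : Rn n} {r : ℝ} (hr : 0 < r)
    (hG : ∀ j, AEMeasurable (G j) (volume.restrict (closedBall z r))) {q : ι → ℝ} {p : ℝ}
    (hq : ∀ j, 0 < q j) (hp : 0 < p) (hpq : 1 / p = ∑ j, 1 / q j) {T : ι → ℝ≥0∞}
    (h : ∀ j, ∫⁻ x in closedBall z r, G j x ^ q j ≤ T j ^ q j * volume (closedBall z r)) :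
    ∫⁻ x in closedBall z r, (∏ j, G j x) ^ p ≤ (∏ j, T j) ^ p * volume (closedBall z r) := by
  set v := volume (closedBall z r) with hv
  have hsum : ∑ j, p / q j = 1 := by
    have : ∀ j, p / q j = p * (1 / q j) := fun j => by ring
    simp_rw [this]
    rw [← Finset.mul_sum, ← hpq]; field_simp
  calc _ ≤ ∏ j, (∫⁻ x in closedBall z r, G j x ^ q j) ^ (p / q j) :=
        lintegral_prod_rpow_le hG hq hp hpq
    _ ≤ ∏ j, (T j ^ p * v ^ (p / q j)) := by
        refine Finset.prod_le_prod' fun j _ => ?_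
        have hpq0 : 0 ≤ p / q j := div_nonneg hp.le (hq j).le
        refine (ENNReal.rpow_le_rpow (h j) hpq0).trans (le_of_eq ?_)
        rw [ENNReal.mul_rpow_of_nonneg _ _ hpq0, ← ENNReal.rpow_mul, mul_div_cancel₀ _ (hq j).ne']
    _ = _ := by
        rw [Finset.prod_mul_distrib, ENNReal.prod_rpow_of_nonneg hp.le,
          prod_rpow_eq_rpow_sum _ (volume_closedBall_ne_zero z hr) (volume_closedBall_ne_top z r),
          hsum, ENNReal.rpow_one]

/-- Boundedness on Morrey spaces. -/
lemma lintegral_multSqFn_morrey_le [NeZero n] [Nonempty ι]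
    (hk : ∀ j, RoughKernel β (D j) (k j)) {a q : ι → ℝ} {p : ℝ} (ha : ∀ j, a j < 0)
    (hq : ∀ j, 1 < q j) (hp : 1 ≤ p) (hpq : 1 / p = ∑ j, 1 / q j) :
    ∃ C : ℝ≥0, 0 < C ∧ ∀ (g : ι → Rn n → ℂ) (K : ι → ℝ≥0∞), (∀ j, Measurable (g j)) →
      (∀ j z r, 0 < r → ∫⁻ x in closedBall z r, ‖g j x‖ₑ ^ q j ≤
        (K j * ENNReal.ofReal (r ^ a j)) ^ q j * volume (closedBall z r)) →
      ∀ (z : Rn n) (r : ℝ), 0 < r → ∫⁻ x in closedBall z r, multSqFn k g x ^ p ≤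
        (C * (∏ j, K j) * ENNReal.ofReal (r ^ ∑ j, a j)) ^ p * volume (closedBall z r) := by
  have hp0 : 0 < p := one_pos.trans_le hp
  have hq0 : ∀ j, 0 < q j := fun j => one_pos.trans (hq j)
  obtain ⟨C1, hC1, h1⟩ := lintegral_multSqFnSmall_le hk hq hp0 hpq
  obtain ⟨C2, hC2, h2⟩ := multSqFnLarge_morrey_le hk ha
  choose C3 hC3 h3 using fun j => lintegral_maxFn_indicator_rpow_le (n := n) (hq j)
  refine ⟨C1 * ∏ _j : ι, 2 ^ n + C2 * ∏ j, ((1 + C3 j) * 2 ^ n), by positivity,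
    fun g K hg hK z r hr => ?_⟩
  set v := volume (closedBall z r) with hv
  set R : ι → ℝ≥0∞ := fun j => K j * ENNReal.ofReal (r ^ a j) with hR
  -- Passing from the double ball to the ball costs a volume factor 2ⁿ ≤ (2ⁿ)^{q_j}; the radius
  -- power only improves, since a_j < 0.
  set U : ι → ℝ≥0∞ := fun j => 2 ^ n * R j with hU
  have hRU : ∀ j, R j ≤ U j := fun j => le_mul_of_one_le_left zero_le (one_le_pow₀ (by norm_num))
  have hgU : ∀ j, ∫⁻ x in closedBall z (2 * r), ‖g j x‖ₑ ^ q j ≤ U j ^ q j * v := by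
    intro j
    refine (hK j z (2 * r) (by positivity)).trans ?_
    rw [volume_closedBall_mul z z hr.le (by norm_num), ← hv, ← mul_assoc]
    refine mul_le_mul' ?_ le_rfl
    rw [hU]; dsimp only
    rw [ENNReal.mul_rpow_of_nonneg (2 ^ n) (R j) (hq0 j).le, mul_comm, ENNReal.ofReal_pow (by norm_num),
      ENNReal.ofReal_ofNat]
    refine mul_le_mul' ?_ (ENNReal.rpow_le_rpow (mul_le_mul' le_rfl
      (ENNReal.ofReal_le_ofReal ?_)) (hq0 j).le)
    · calc (2 : ℝ≥0∞) ^ n = (2 ^ n) ^ (1 : ℝ) := (ENNReal.rpow_one _).symm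
        _ ≤ _ := ENNReal.rpow_le_rpow_of_exponent_le (one_le_pow₀ (by norm_num)) (hq j).le
    · exact Real.rpow_le_rpow_of_nonpos hr (by linarith) (ha j).le
  have havg : ∀ x j s, 0 < s → ∫⁻ y in closedBall x s, ‖g j y‖ₑ ≤
      volume (closedBall x s) * (K j * ENNReal.ofReal (s ^ a j)) := fun x j s hs =>
    setLIntegral_le_of_rpow_le hs (hg j).enorm.aemeasurable (hq j).le (hK j x s hs)
  have hgm : ∀ j, AEStronglyMeasurable (g j) volume := fun j => (hg j).aestronglyMeasurable
  have hsmall := h1 g (fun _ => 0) U z r hr hgm fun j => by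
    simp only [sub_zero]; exact hgU j
  set W : ι → Rn n → ℝ≥0∞ := fun j x => R j +
    maxFn (fun y => ‖(closedBall z (2 * r)).indicator (g j) y‖ₑ) x with hW
  have hMm : ∀ j, Measurable (maxFn fun y => ‖(closedBall z (2 * r)).indicator (g j) y‖ₑ) :=
    fun j => measurable_maxFn ((hg j).indicator measurableSet_closedBall).enorm
  have hWle : ∀ j, ∫⁻ x in closedBall z r, W j x ^ q j ≤ ((1 + C3 j) * U j) ^ q j * v := by
    intro j
    rw [add_mul, one_mul]
    refine setLIntegral_add_rpow_le (w := fun _ => R j) aemeasurable_const (hMm j).aemeasurable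
      (hq j).le ?_ (h3 j (g j) (U j) z r (hg j) (hgU j))
    rw [setLIntegral_const]
    exact mul_le_mul' (ENNReal.rpow_le_rpow (hRU j) (hq0 j).le) le_rfl
  have hprod := setLIntegral_prod_rpow_le_volume hr
    (fun j => ((hMm j).const_add (R j)).aemeasurable) hq0 hp0 hpq hWle
  have hlarge : ∫⁻ x in closedBall z r, multSqFnLarge k g r x ^ p ≤
      (C2 * ∏ j, ((1 + C3 j) * U j)) ^ p * v := by
    calc _ ≤ ∫⁻ x in closedBall z r, (C2 : ℝ≥0∞) ^ p * (∏ j, W j x) ^ p := by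
          refine setLIntegral_mono' measurableSet_closedBall fun x hx => ?_
          rw [← ENNReal.mul_rpow_of_nonneg _ _ hp0.le]
          exact ENNReal.rpow_le_rpow (h2 g K z x r hr hg hx (havg x)) hp0.le
      _ = (C2 : ℝ≥0∞) ^ p * ∫⁻ x in closedBall z r, (∏ j, W j x) ^ p :=
          lintegral_const_mul' _ _ (by finiteness)
      _ ≤ (C2 : ℝ≥0∞) ^ p * ((∏ j, ((1 + C3 j) * U j)) ^ p * v) := mul_le_mul' le_rfl hprod
      _ = _ := by rw [ENNReal.mul_rpow_of_nonneg _ _ hp0.le, mul_assoc]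
  calc ∫⁻ x in closedBall z r, multSqFn k g x ^ p
      ≤ ∫⁻ x in closedBall z r, (multSqFnSmall k g r x + multSqFnLarge k g r x) ^ p :=
        lintegral_mono fun x => ENNReal.rpow_le_rpow (multSqFn_le_add k g r x) hp0.le
    _ ≤ (C1 * ∏ j, U j + C2 * ∏ j, ((1 + C3 j) * U j)) ^ p * v :=
        setLIntegral_add_rpow_le (measurable_multSqFnSmall hk hgm r).aemeasurable
          (measurable_multSqFnLarge hk hgm r).aemeasurable hp hsmall hlarge
    _ = _ := by
        congr 2
        rw [Real.rpow_sum_of_pos hr, ENNReal.ofReal_prod_of_nonneg fun j _ => by positivity]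
        simp only [hU, hR, Finset.prod_mul_distrib]
        push_cast
        ring

/-- Boundedness on Campanato spaces of negative order. -/
lemma multSqFn_campanato [NeZero n] [Nonempty ι] (hk : ∀ j, RoughKernel β (D j) (k j))
    {a q : ι → ℝ} {p : ℝ} (ha : ∀ j, a j < 0) (hq : ∀ j, 1 < q j) (hp : 1 ≤ p)
    (hpq : 1 / p = ∑ j, 1 / q j) :
    ∃ C : ℝ≥0, 0 < C ∧ ∀ f : ι → Rn n → ℂ, (∀ j, MemCampanato (a j) (q j) (f j)) →
      (∀ᵐ x, multSqFn k f x < ∞) ∧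
      MemCampanato (∑ j, a j) p (fun x => (multSqFn k f x).toReal) ∧
      campanatoSeminorm (∑ j, a j) p (fun x => (multSqFn k f x).toReal) ≤
        C * ∏ j, campanatoSeminorm (a j) (q j) (f j) := by
  have hp0 : 0 < p := one_pos.trans_le hp
  obtain ⟨C1, hC1, h1⟩ := lintegral_multSqFn_morrey_le hk ha hq hp hpq
  choose C2 hC2 h2 using fun j => exists_const_morrey (n := n) (V := ℂ) (ha j) (hq j).le
  set α : ℝ := ∑ j, a j with hα
  set E : ℝ≥0 := (unitVol n ^ (-(α / n))).toNNReal with hE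
  have hE0 : 0 < E := ENNReal.toNNReal_pos (by
    simp [ENNReal.rpow_eq_zero_iff, unitVol_ne_zero, unitVol_ne_top]) (unitVol_rpow_ne_top _)
  have hC20 : 0 < ∏ j, C2 j := Finset.prod_pos fun j _ => hC2 j
  refine ⟨E * (2 * (C1 * ∏ j, C2 j)), by positivity, fun f hf => ?_⟩
  have hfm : ∀ j, AEStronglyMeasurable (f j) volume := fun j => (hf j).1.aestronglyMeasurable
  choose c hc using fun j => h2 j (f j) (hf j)
  -- Measurable Morrey representatives; neither the subtracted constants nor the null sets affect
  -- the averages.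
  set g : ι → Rn n → ℂ := fun j y => (hfm j).mk (f j) y - c j with hg
  have hgm : ∀ j, Measurable (g j) := fun j =>
    (hfm j).stronglyMeasurable_mk.measurable.sub_const _
  have hfg : multSqFn k f = multSqFn k g := by
    funext x
    refine l2_congr_ae (ae_dtt_pos.mono fun t ht => Finset.prod_congr rfl fun j _ => ?_)
    rw [(hk j).avgOp_sub_const _ _ ht, avgOp_congr (hfm j).ae_eq_mk]
  set P : ℝ≥0∞ := ∏ j, campanatoSeminorm (a j) (q j) (f j) with hP
  have hPtop : P ≠ ∞ := ENNReal.prod_ne_top fun j _ => (hf j).2.ne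
  set L : ℝ≥0∞ := C1 * ∏ j, (C2 j * campanatoSeminorm (a j) (q j) (f j)) with hL
  have hLP : L = C1 * (∏ j, (C2 j : ℝ≥0∞)) * P := by
    rw [hL, Finset.prod_mul_distrib, mul_assoc]
  have hLtop : L ≠ ∞ := by
    have : ∏ j, (C2 j : ℝ≥0∞) ≠ ∞ := ENNReal.prod_ne_top fun j _ => ENNReal.coe_ne_top
    rw [hLP]; finiteness
  have key : ∀ (z : Rn n) (r : ℝ), 0 < r → ∫⁻ x in closedBall z r, multSqFn k f x ^ p ≤
      (L * ENNReal.ofReal (r ^ α)) ^ p * volume (closedBall z r) := by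
    intro z r hr
    rw [hfg]
    refine h1 g (fun j => C2 j * campanatoSeminorm (a j) (q j) (f j)) hgm (fun j z r hr => ?_) z r hr
    refine le_trans (le_of_eq ?_) (hc j z r hr)
    refine lintegral_congr_ae (ae_restrict_of_ae ?_)
    filter_upwards [(hfm j).ae_eq_mk] with x hx
    rw [hg, hx]
  have hae : ∀ᵐ x, multSqFn k f x < ∞ := by
    refine ae_lt_top_of_forall_closedBall 0 fun r hr => ?_
    have h3 : ∫⁻ x in closedBall (0 : Rn n) r, multSqFn k f x ^ p ≠ ∞ := by
      refine ne_top_of_le_ne_top ?_ (key 0 r hr)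
      have := volume_closedBall_ne_top (0 : Rn n) r
      finiteness
    filter_upwards [ae_lt_top ((measurable_multSqFn hk hfm).pow_const p) h3] with x hx
    exact (ENNReal.rpow_lt_top_iff_of_pos hp0).1 hx
  set G : Rn n → ℝ := fun x => (multSqFn k f x).toReal with hG
  have hGm : AEStronglyMeasurable G volume :=
    (measurable_multSqFn hk hfm).ennreal_toReal.aestronglyMeasurable
  -- The image is itself of Morrey type, so 0 serves as the comparison constant on every ball.
  have hosc : ∀ (z : Rn n) (r : ℝ), 0 < r → ∫⁻ x in closedBall z r, ‖G x - 0‖ₑ ^ p ≤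
      (L * ENNReal.ofReal (r ^ α)) ^ p * volume (closedBall z r) := by
    intro z r hr
    refine (lintegral_mono fun x => ?_).trans (key z r hr)
    refine ENNReal.rpow_le_rpow ?_ hp0.le
    rw [sub_zero, hG]
    dsimp only
    rw [Real.enorm_of_nonneg ENNReal.toReal_nonneg]
    exact ENNReal.ofReal_toReal_le
  have hloc : LocallyIntegrable G :=
    locallyIntegrable_of_oscillation hGm hp (K := fun r => L * ENNReal.ofReal (r ^ α))
      (fun r _ => by finiteness) fun z r hr => ⟨0, hosc z r hr⟩
  have hbound : campanatoSeminorm α p G ≤ E * (2 * L) := by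
    rw [hE, ENNReal.coe_toNNReal (unitVol_rpow_ne_top _)]
    refine campanatoSeminorm_le fun z r hr => ?_
    rw [mul_assoc]
    exact oscillation_setAverage_le hloc hp hr (hosc z r hr)
  refine ⟨hae, ⟨hloc, hbound.trans_lt (by finiteness)⟩, hbound.trans (le_of_eq ?_)⟩
  rw [hLP]
  push_cast
  ring

end

end Marcinkiewicz

end

/-! ### The four boundedness statements. -/

theorem theorem5p1 {n m : ℕ} (hn : 1 ≤ n) (hm : 1 ≤ m) (β : ℝ) (hβ0 : 0 < β) (hβ1 : β < 1)
    (Om : Fin m → Marcinkiewicz.Rn n → ℂ) (hOm : ∀ j, Marcinkiewicz.IsKernel β (Om j)) :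
    -- boundedness on Lebesgue spaces
    (∀ (q : Fin m → ℝ) (p : ℝ), (∀ j, 1 < q j) → 1 / p = ∑ j, 1 / q j →
      ∃ C : ℝ≥0, 0 < C ∧ ∀ f : Fin m → Marcinkiewicz.Rn n → ℂ,
        (∀ j, MemLp (f j) (ENNReal.ofReal (q j)) volume) →
        eLpNorm (Marcinkiewicz.mu Om f) (ENNReal.ofReal p) volume ≤
          C * ∏ j, eLpNorm (f j) (ENNReal.ofReal (q j)) volume) ∧
    -- BMO
    (∃ C : ℝ≥0, 0 < C ∧ ∀ f : Fin m → Marcinkiewicz.Rn n → ℂ,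
      (∀ j, Marcinkiewicz.MemBMO (f j)) →
      (∃ x₀, Marcinkiewicz.mu Om f x₀ < ∞) →
      (∀ᵐ x, Marcinkiewicz.mu Om f x < ∞) ∧
      Marcinkiewicz.MemBMO (fun x => (Marcinkiewicz.mu Om f x).toReal) ∧
      Marcinkiewicz.bmoSeminorm (fun x => (Marcinkiewicz.mu Om f x).toReal) ≤
        C * ∏ j, Marcinkiewicz.bmoSeminorm (f j)) ∧
    -- Campanato spaces of negative order
    (∀ (a q : Fin m → ℝ) (α p : ℝ), (∀ j, a j < 0) → α = ∑ j, a j →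
      (∀ j, 1 < q j) → 1 / p = ∑ j, 1 / q j →
      ((n : ℝ) < p ∨ (-(m : ℝ) < α ∧ 1 < p)) →
      ∃ C : ℝ≥0, 0 < C ∧ ∀ f : Fin m → Marcinkiewicz.Rn n → ℂ,
        (∀ j, Marcinkiewicz.MemCampanato (a j) (q j) (f j)) →
        (∀ x, Marcinkiewicz.mu Om f x = ∞) ∨
        ((∀ᵐ x, Marcinkiewicz.mu Om f x < ∞) ∧
          Marcinkiewicz.MemCampanato α p (fun x => (Marcinkiewicz.mu Om f x).toReal) ∧
          Marcinkiewicz.campanatoSeminorm α p (fun x => (Marcinkiewicz.mu Om f x).toReal) ≤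
            C * ∏ j, Marcinkiewicz.campanatoSeminorm (a j) (q j) (f j))) ∧
    -- Lipschitz spaces
    (∀ (a : Fin m → ℝ) (α : ℝ), (∀ j, 0 < a j ∧ a j < 1 / m) → α = ∑ j, a j → α < β / 2 →
      ∃ C : ℝ≥0, 0 < C ∧ ∀ f : Fin m → Marcinkiewicz.Rn n → ℂ,
        (∀ j, Marcinkiewicz.lipSeminorm (a j) (f j) < ∞) →
        (∀ x, Marcinkiewicz.mu Om f x = ∞) ∨
        ((∀ x, Marcinkiewicz.mu Om f x < ∞) ∧
          Marcinkiewicz.lipSeminorm α (fun x => (Marcinkiewicz.mu Om f x).toReal) ≤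
            C * ∏ j, Marcinkiewicz.lipSeminorm (a j) (f j))) := by
  have : NeZero n := ⟨by omega⟩
  have : NeZero m := ⟨by omega⟩
  choose D hk using fun j => (hOm j).exists_roughKernel hβ0 hβ1
  refine ⟨fun q p hq hpq => Marcinkiewicz.eLpNorm_mu_le hk hq hpq, ?_, ?_, ?_⟩
  · obtain ⟨C, hC, h⟩ := Marcinkiewicz.multSqFn_bmo hk
    refine ⟨C, hC, fun f hf hx => ?_⟩
    rw [Marcinkiewicz.mu_eq_multSqFn hk fun j => (hf j).1.aestronglyMeasurable] at hx ⊢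
    exact h f hf hx
  · rintro a q α p ha rfl hq hpq hcond
    have hn' : (1 : ℝ) ≤ n := by exact_mod_cast hn
    -- Either alternative gives p ≥ 1, as n ≥ 1; this is what Minkowski's inequality in L^p
    -- requires.
    have hp : 1 ≤ p := by
      rcases hcond with h | h
      · linarith
      · exact h.2.le
    obtain ⟨C, hC, h⟩ := Marcinkiewicz.multSqFn_campanato hk ha hq hp hpq
    -- For negative orders finiteness almost everywhere is automatic.
    refine ⟨C, hC, fun f hf => Or.inr ?_⟩
    rw [Marcinkiewicz.mu_eq_multSqFn hk fun j => (hf j).1.aestronglyMeasurable]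
    exact h f hf
  · rintro a α ha rfl hα
    -- The pointwise Lipschitz argument gains the full exponent β, and β/2 < β.
    obtain ⟨C, hC, h⟩ := Marcinkiewicz.multSqFn_lipschitz hk (fun j => (ha j).1)
      (by linarith : ∑ j, a j < β)
    refine ⟨C, hC, fun f hf => ?_⟩
    rw [Marcinkiewicz.mu_eq_multSqFn hk fun j =>
      (Marcinkiewicz.continuous_of_lipSeminorm (ha j).1 (hf j)).aestronglyMeasurable]
    exact h f hf
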